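/- Let $d\ge 3$, let $\eta=\mathrm{diag}(\pm1,\dots,\pm1)$ be a flat metric of any signature on $\mathbb R^d$, $\Box=\eta^{mn}\partial_m\partial_n$, $p^2=\eta^{mn}p_mp_n$, $\nu=\frac{d-3}{2}$, and let $\hbar\neq0$ be real. A symbol is a finite sum $f(x,p)=\sum_k f^{m_1\dots m_k}(x)p_{m_1}\cdots p_{m_k}$ with smooth complex coefficients, $*$ is the Weyl–Moyal product and $\dagger$ is complex conjugation. A *field* is a real symbol with compactly supported coefficients; $f_s$ denotes the rank-$s$ component of $f$. Let $\mathcal A[H]$ be a real action functional defined for $H=-p^2+h$, $h$ a field, twice continuously differentiable at $-p^2$ along finite-dimensional families of fields, and invariant, to all orders in $h$, under $$\delta H=\omega^\dagger*H+H*\omega$$ for all symbols $\omega$ with compactly supported coefficients. Suppose that $H=-p^2$ is a vacuum (the first variation of $\mathcal A$ vanishes there), and that the quadratic part $\mathcal A_2[h]$ of $\mathcal A[-p^2+h]$ is a Poincaré-invariant quadratic action $$\mathcal A_2[h]=\int d^dx\,\{h(x,p)\,P(\overleftarrow{\partial_p},\overrightarrow{\partial_{p'}},\partial)\,h(x,p')\}_{p=p'=0},$$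 where $P(q,q',\partial)$ is a power series in $q^2,q'^2,qq',q\partial,q'\partial$ whose coefficients are real (pseudodifferential) functions of $\Box$ with tempered locally integrable Fourier multipliers. Put $\rho^2=\Box q^2-(q\partial)^2$, $\rho'^2=\Box q'^2-(q'\partial)^2$, $\tau=\Box\,qq'-(q\partial)(q'\partial)$, $U_\nu(z)=z^{-\nu}J_\nu(z)$, $\mu^2=-\frac{\hbar^2}{4}\Box$ (so $(\mu/\sqrt\Box)^2=-\hbar^2/4$), and, with $C_s^\nu$ the Gegenbauer polynomial, $$\mathcal P^{(s)}=\tfrac{\Gamma(\nu)}{\Gamma(s+\nu)}(\rho\rho')^sC_s^{\nu}\!\left(\tfrac{\tau}{\rho\rho'}\right),\qquad P^{(s)}_\mu=U_{s+\nu}\!\left(\tfrac{\mu}{\sqrt\Box}\rho\right)U_{s+\nu}\!\left(\tfrac{\mu}{\sqrt\Box}\rho'\right)\mathcal P^{(s)}$$ (for $d=3$ read as the limit $\nu\to0$). Then: 1. The gauge variation of the vacuum with $\omega=a+\frac i\hbar\epsilon$ is the deformed gauge transformation $\delta h=-2(p^2+\mu^2)a-2p\,\partial_x\epsilon$, $\mu^2=-\frac{\hbar^2}{4}\Box$.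 2. There are real tempered functions $f_s(\Box)$, $s=0,1,2,\dots$ (polynomials in $\Box$ if all coefficients of $P$ are), such that for every field $h$ the quadratic part is the (finite) sum $\mathcal A_2[h]=\sum_s A_s[h]$ of the deformed theories with wave operators $f_s(\Box)P^{(s)}_\mu$; each $A_s$ is invariant under the deformed gauge transformations. 3. The undressing map $h\mapsto\phi$, $$\phi_s=\Big[U_{s+\nu}\big(\tfrac{\mu}{\sqrt\Box}\rho\big)h\Big]_s\quad(q\to\partial/\partial p \text{ in }\rho),$$ and the reconstruction map $\phi\mapsto h$, $$\sum_{s}\tfrac{i^s}{s!}h_s=2^\nu\Gamma(\nu)\sum_s i^s(s+\nu)\big(\tfrac{\mu}{\sqrt\Box}\rho\big)^sC_s^\nu\big(\tfrac{\sqrt\Box}{\mu\rho}\big)\phi_s,$$ are local, map fields to fields, and are inverse to each other. They exchange the deformed gauge transformations with the undeformed ones $-2p^2a-2p\,\partial_x\epsilon$, and $A_s[h]=\mathcal A_s[\phi_s]$ with $\mathcal A_s[\phi_s]=\int\phi_s\,f_s(\Box)\mathcal P^{(s)}(\partial)\,\phi_s$. 4. Each $\mathcal A_s$ is a conformal higher-spin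 theory of spin $s$: $\mathcal P^{(s)}$ is a non-zero Lorentz-invariant differential operator of order $2s$ on tensors of rank $s$, symmetric ($\mathcal P_{a(s)b(s)}=\mathcal P_{b(s)a(s)}$), traceless (${\mathcal P^c}_{c\,a(s-2)b(s)}=0$) and transverse ($\mathcal P_{a(s-1)c\,b(s)}\partial^c=0$); $\mathcal A_s[\phi_s]$ depends only on the traceless part $\varphi_s$ of $\phi_s$; and $\mathcal A_s[\varphi_s]$ is invariant under $\delta\varphi_s=$ traceless part of $\partial\varepsilon_{s-1}$ with $\varepsilon_{s-1}$ traceless. Hence $\mathcal A_2[h]=\sum_{s}\mathcal A_s[\varphi_s]$. -/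

import Mathlib

open MeasureTheory Filter Topology Asymptotics
open scoped ContDiff FourierTransform

noncomputable section

namespace ConformalHS

/-! ## Symbols: power series in momenta with finitely many terms and smooth coefficients -/

/-- Space-time `ℝ^d`.  The norm is only used for analysis; the metric is a separate `η`. -/
abbrev Pt (d : ℕ) := EuclideanSpace ℝ (Fin d)

/-- The algebra of smooth complex functions on space-time. -/
def smoothFn (d : ℕ) : Subalgebra ℂ (Pt d → ℂ) where
  carrier := {f | ContDiff ℝ ∞ f}
  mul_mem' := fun {f g} (hf : ContDiff ℝ ∞ f) (hg : ContDiff ℝ ∞ g) => hf.mul hg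
  add_mem' := fun {f g} (hf : ContDiff ℝ ∞ f) (hg : ContDiff ℝ ∞ g) => hf.add hg
  algebraMap_mem' := fun c => (contDiff_const : ContDiff ℝ ∞ fun _ : Pt d => c)

/-- The value of a smooth function at a point. -/
def val {d : ℕ} (f : smoothFn d) (x : Pt d) : ℂ := (f : Pt d → ℂ) x

/-- The partial derivative `∂_i` of a smooth function. -/
def pd {d : ℕ} (i : Fin d) (f : smoothFn d) : smoothFn d :=
  ⟨fun x => fderiv ℝ (f : Pt d → ℂ) x (EuclideanSpace.single i 1),
    ((show ContDiff ℝ ∞ (f : Pt d → ℂ) from f.2).fderiv_right (m := ∞) le_rfl).clm_apply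
      contDiff_const⟩

/-- Complex conjugation of smooth functions. -/
def conjFn {d : ℕ} (f : smoothFn d) : smoothFn d :=
  ⟨fun x => (starRingEnd ℂ) ((f : Pt d → ℂ) x),
    Complex.conjCLE.contDiff.comp (show ContDiff ℝ ∞ (f : Pt d → ℂ) from f.2)⟩

/-- Symbols `f(x,p) = ∑ f^{m₁…m_k}(x) p_{m₁}…p_{m_k}`. -/
abbrev Symb (d : ℕ) := MvPolynomial (Fin d) (smoothFn d)

/-- `∂/∂x^i` of a symbol. -/
def dX {d : ℕ} (i : Fin d) (f : Symb d) : Symb d :=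
  ∑ α ∈ f.support, MvPolynomial.monomial α (pd i (f.coeff α))

/-- `∂/∂p_i` of a symbol. -/
def dP {d : ℕ} (i : Fin d) (f : Symb d) : Symb d := MvPolynomial.pderiv i f

/-- Hermitian conjugation, which for Weyl symbols is complex conjugation. -/
def dagger {d : ℕ} (f : Symb d) : Symb d :=
  ∑ α ∈ f.support, MvPolynomial.monomial α (conjFn (f.coeff α))

/-- All the coefficients have compact support in `x`-space. -/
def IsCompSupp {d : ℕ} (f : Symb d) : Prop :=
  ∀ α, HasCompactSupport (val (f.coeff α))

/-- A hermitian symbol with compactly supported coefficients: a fluctuation, or a real gauge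
parameter. -/
def IsRealField {d : ℕ} (f : Symb d) : Prop := dagger f = f ∧ IsCompSupp f

/-! ## The Weyl–Moyal product and the gauge transformations -/

/-- `f ∇ⁿ g`, where `f ∇ g = ∑ (∂f/∂xⁱ ∂g/∂pᵢ - ∂f/∂pᵢ ∂g/∂xⁱ)`. -/
def nablaPow {d : ℕ} : ℕ → Symb d → Symb d → Symb d
  | 0, f, g => f * g
  | n + 1, f, g => ∑ i, (nablaPow n (dX i f) (dP i g) - nablaPow n (dP i f) (dX i g))

/-- `f * g = f exp((iħ/2)∇) g`.  Terms with `n` above the sum of the degrees in `p` vanish. -/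
def moyal {d : ℕ} (ħ : ℝ) (f g : Symb d) : Symb d :=
  ∑ n ∈ Finset.range (f.totalDegree + g.totalDegree + 1),
    ((Complex.I * ħ / 2) ^ n / (n.factorial : ℂ)) • nablaPow n f g

/-- `δH = ω† * H + H * ω`, with the gauge parameter `ω = w`. -/
def gaugeVar {d : ℕ} (ħ : ℝ) (w H : Symb d) : Symb d :=
  moyal ħ (dagger w) H + moyal ħ H w

/-- `p² = η^{mn} p_m p_n`, for the diagonal metric with entries `η i`. -/
def pSq {d : ℕ} (η : Fin d → ℝ) : Symb d :=
  ∑ i, (η i : ℂ) • (MvPolynomial.X i * MvPolynomial.X i)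

/-- The vacuum `H = -p²`. -/
def vac {d : ℕ} (η : Fin d → ℝ) : Symb d := - pSq η

/-! ## Actions around the vacuum -/

/-- `A` has a second order expansion at the vacuum: it is `C²` there on every finite-dimensional
family of compactly supported fluctuations. -/
def HasExpansion {d : ℕ} (η : Fin d → ℝ) (A : Symb d → ℝ) : Prop :=
  ∀ (n : ℕ) (h : Fin n → Symb d), (∀ i, IsRealField (h i)) →
    ContDiffAt ℝ 2 (fun t : Fin n → ℝ => A (vac η + ∑ i, (t i : ℂ) • h i)) 0

/-- The first variation of `A` at `H` along `gaugeVar ħ w H`. -/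
def gaugeVariation {d : ℕ} (ħ : ℝ) (A : Symb d → ℝ) (w H : Symb d) : ℝ :=
  deriv (fun u : ℝ => A (H + (u : ℂ) • gaugeVar ħ w H)) 0

/-- Gauge invariance, to all orders of the perturbative expansion in the fluctuation: the gauge
variation of `A` at `-p² + t h` vanishes to all orders in `t`.  It is implied by
`gaugeVariation ħ A w H = 0` for all `w` and `H`. -/
def IsGaugeInvariant {d : ℕ} (ħ : ℝ) (η : Fin d → ℝ) (A : Symb d → ℝ) : Prop :=
  ∀ w h : Symb d, IsCompSupp w → IsRealField h → ∀ n : ℕ,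
    (fun t : ℝ => gaugeVariation ħ A w (vac η + (t : ℂ) • h)) =O[𝓝 0] fun t => t ^ n

/-- `H = -p²` solves the equations of motion of `A`. -/
def IsVacuum {d : ℕ} (η : Fin d → ℝ) (A : Symb d → ℝ) : Prop :=
  ∀ h : Symb d, IsRealField h → HasDerivAt (fun t : ℝ => A (vac η + (t : ℂ) • h)) 0 0

/-- The quadratic part of the expansion of `A` around the vacuum. -/
def quadPart {d : ℕ} (η : Fin d → ℝ) (A : Symb d → ℝ) (h : Symb d) : ℝ :=
  iteratedDeriv 2 (fun t : ℝ => A (vac η + (t : ℂ) • h)) 0 / 2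

/-! ## Quadratic actions with translation invariant wave operators -/

/-- A wave operator `P(q, q', ∂)`: a power series in `q` (the `Sum.inl` variables) and `q'` (the
`Sum.inr` variables) whose coefficients are Fourier multipliers, functions of the frequency `ξ`
with `∂ = 2πiξ`. -/
abbrev WaveOp (d : ℕ) := Pt d → MvPowerSeries (Fin d ⊕ Fin d) ℂ

/-- `α! = ∏ α_i!`. -/
def multiFact {d : ℕ} (α : Fin d →₀ ℕ) : ℂ := ∏ i, ((α i).factorial : ℂ)

/-- The action `∫ d^dx {h(x,p) P(∂/∂p (acting to the left), ∂/∂p', ∂) h(x,p')}` at `p = p' = 0`. -/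
def quadAction {d : ℕ} (P : WaveOp d) (h : Symb d) : ℂ :=
  ∑ α ∈ h.support, ∑ β ∈ h.support, multiFact α * multiFact β *
    ∫ x, val (h.coeff α) x *
      𝓕⁻ (fun ξ : Pt d => MvPowerSeries.coeff (Finsupp.sumElim α β) (P ξ) *
        𝓕 (val (h.coeff β)) ξ) x

/-- The symbol `2πiξ` of `∂`. -/
def dSym {d : ℕ} (ξ : Pt d) : Fin d → ℂ := fun i => 2 * Real.pi * Complex.I * (ξ i : ℂ)

/-- The symbol of `□ = η^{mn} ∂_m ∂_n`. -/
def boxSym {d : ℕ} (η : Fin d → ℝ) (ξ : Pt d) : ℝ :=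
  -(4 * Real.pi ^ 2 * ∑ i, η i * ξ i ^ 2)

/-- `F(□)` is a pseudodifferential operator: its multiplier is locally integrable, with at most
polynomial growth in the mean. -/
def IsTempered {d : ℕ} (η : Fin d → ℝ) (F : ℝ → ℝ) : Prop :=
  ∃ N : ℕ, Integrable fun ξ : Pt d => F (boxSym η ξ) / (1 + ‖ξ‖) ^ N

/-- Polynomials in `q` and `q'`. -/
abbrev QPoly (d : ℕ) := MvPolynomial (Fin d ⊕ Fin d) ℂ

/-- `q²`, `q'²`, `qq'`, `q∂`, `q'∂` and `□`, with `κ` in place of `∂`. -/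
def qq {d : ℕ} (η : Fin d → ℝ) : QPoly d :=
  ∑ i, MvPolynomial.C (η i : ℂ) * MvPolynomial.X (Sum.inl i) ^ 2
def qq2 {d : ℕ} (η : Fin d → ℝ) : QPoly d :=
  ∑ i, MvPolynomial.C (η i : ℂ) * MvPolynomial.X (Sum.inr i) ^ 2
def qq12 {d : ℕ} (η : Fin d → ℝ) : QPoly d :=
  ∑ i, MvPolynomial.C (η i : ℂ) * (MvPolynomial.X (Sum.inl i) * MvPolynomial.X (Sum.inr i))
def qd {d : ℕ} (κ : Fin d → ℂ) : QPoly d :=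
  ∑ i, MvPolynomial.C (κ i) * MvPolynomial.X (Sum.inl i)
def qd2 {d : ℕ} (κ : Fin d → ℂ) : QPoly d :=
  ∑ i, MvPolynomial.C (κ i) * MvPolynomial.X (Sum.inr i)
def bx {d : ℕ} (η : Fin d → ℝ) (κ : Fin d → ℂ) : QPoly d :=
  MvPolynomial.C (∑ i, (η i : ℂ) * κ i ^ 2)

/-- The general Poincaré-invariant wave operator, built from `∂`, the metric and functions of `□`:
`P = ∑ W_t(□) (q²)^{t₀} (q'²)^{t₁} (qq')^{t₂} (q∂)^{t₃} (q'∂)^{t₄}`, the sum being over all `t`.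
Only `t` with entries bounded by the degree of a monomial contribute to its coefficient. -/
def invariantOp {d : ℕ} (η : Fin d → ℝ) (W : (Fin 5 → ℕ) → ℝ → ℝ) : WaveOp d := fun ξ m =>
  MvPolynomial.coeff m (∑ t ∈ Fintype.piFinset fun _ : Fin 5 => Finset.range (m.degree + 1),
    MvPolynomial.C (W t (boxSym η ξ) : ℂ) * qq η ^ t 0 * qq2 η ^ t 1 * qq12 η ^ t 2 *
      qd (dSym ξ) ^ t 3 * qd2 (dSym ξ) ^ t 4)

/-- The wave operator `f(□) P`. -/
def scaleOp {d : ℕ} (η : Fin d → ℝ) (f : ℝ → ℝ) (P : WaveOp d) : WaveOp d := fun ξ =>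
  (f (boxSym η ξ) : ℂ) • P ξ

/-! ## Conformal and deformed conformal higher spin theories -/

/-- `ρ² = □ q² - (q∂)²`, `ρ'² = □ q'² - (q'∂)²`, `τ = □ (qq') - (q∂)(q'∂)`. -/
def rho {d : ℕ} (η : Fin d → ℝ) (κ : Fin d → ℂ) : QPoly d := bx η κ * qq η - qd κ ^ 2
def rho2 {d : ℕ} (η : Fin d → ℝ) (κ : Fin d → ℂ) : QPoly d :=
  bx η κ * qq2 η - qd2 κ ^ 2
def tau {d : ℕ} (η : Fin d → ℝ) (κ : Fin d → ℂ) : QPoly d :=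
  bx η κ * qq12 η - qd κ * qd2 κ

/-- The index `ν = (d-3)/2`. -/
def nu (d : ℕ) : ℝ := ((d : ℝ) - 3) / 2

/-- The coefficient of `t^{s-2r}` in `Γ(ν)/Γ(s+ν) C_s^ν(t)`, for the Gegenbauer polynomial `C_s^ν`
and `2r ≤ s`, written so that it also covers the limit `ν → 0`. -/
def gegenbauerCoeff (ν : ℝ) (s r : ℕ) : ℝ :=
  (-1) ^ r * 2 ^ (s - 2 * r) /
    (r.factorial * (s - 2 * r).factorial * ∏ j ∈ Finset.range r, ((s : ℝ) - 1 - j + ν))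

/-- `𝒫^{(s)} = Γ(ν)/Γ(s+ν) (ρρ')^s C_s^ν(τ/(ρρ'))`, a polynomial in `ρ²`, `ρ'²` and `τ`. -/
def confKernel {d : ℕ} (η : Fin d → ℝ) (s : ℕ) (κ : Fin d → ℂ) : QPoly d :=
  ∑ r ∈ Finset.range (s / 2 + 1), MvPolynomial.C (gegenbauerCoeff (nu d) s r : ℂ) *
    tau η κ ^ (s - 2 * r) * rho η κ ^ r * rho2 η κ ^ r

/-- The wave operator `𝒫^{(s)}(∂)`. -/
def confOp {d : ℕ} (η : Fin d → ℝ) (s : ℕ) : WaveOp d := fun ξ =>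
  (confKernel η s (dSym ξ) : MvPowerSeries (Fin d ⊕ Fin d) ℂ)

/-- The coefficient of `z^{2r}` in `U_ν(z) = z^{-ν} J_ν(z)`, for the Bessel function `J_ν`. -/
def besselCoeff (ν : ℝ) (r : ℕ) : ℝ :=
  (-1) ^ r / ((2 : ℝ) ^ (ν + 2 * r) * r.factorial * Real.Gamma (ν + r + 1))

/-- The value `(μ/√□)² = -ħ²/4` for `μ² = -(ħ²/4)□`. -/
def muRatioSq (ħ : ℝ) : ℝ := -(ħ ^ 2 / 4)

/-- The deformed spin-`s` wave operator
`P^{(s)}_μ = U_{s+ν}((μ/√□)ρ) U_{s+ν}((μ/√□)ρ') 𝒫^{(s)}` for `μ² = -(ħ²/4)□`.  Only terms of the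
Bessel series up to the degree of a monomial contribute to its coefficient. -/
def deformedOp {d : ℕ} (ħ : ℝ) (η : Fin d → ℝ) (s : ℕ) : WaveOp d := fun ξ m =>
  MvPolynomial.coeff m
    ((∑ r ∈ Finset.range (m.degree + 1),
        MvPolynomial.C (besselCoeff (s + nu d) r * muRatioSq ħ ^ r : ℂ) * rho η (dSym ξ) ^ r) *
      (∑ r ∈ Finset.range (m.degree + 1),
        MvPolynomial.C (besselCoeff (s + nu d) r * muRatioSq ħ ^ r : ℂ) * rho2 η (dSym ξ) ^ r) *
      confKernel η s (dSym ξ))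

/-! ## Differential operators on symbols -/

/-- `□ = η^{mn} ∂_m ∂_n`. -/
def boxX {d : ℕ} (η : Fin d → ℝ) (f : Symb d) : Symb d := ∑ i, (η i : ℂ) • dX i (dX i f)

/-- `p∂_x = η^{mn} p_m ∂_n`. -/
def pGrad {d : ℕ} (η : Fin d → ℝ) (f : Symb d) : Symb d :=
  ∑ i, (η i : ℂ) • (MvPolynomial.X i * dX i f)

/-- The trace `∂_p² = η_{mn} ∂/∂p_m ∂/∂p_n` (the inverse of `η` is `η`). -/
def trP {d : ℕ} (η : Fin d → ℝ) (f : Symb d) : Symb d := ∑ i, (η i : ℂ) • dP i (dP i f)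

/-- The divergence `∂_p ∂_x = ∂/∂p_m ∂/∂x^m`. -/
def divP {d : ℕ} (f : Symb d) : Symb d := ∑ i, dX i (dP i f)

/-- The operator `ρ²` with `q` replaced by `∂/∂p`, acting on symbols. -/
def rhoSq {d : ℕ} (η : Fin d → ℝ) (f : Symb d) : Symb d := boxX η (trP η f) - divP (divP f)

/-- The component of rank `s`. -/
def rank {d : ℕ} (s : ℕ) (f : Symb d) : Symb d := MvPolynomial.homogeneousComponent s f

/-- The gauge transformation `δh = -2 (p² + μ²) a - 2 p∂_x ε` of deformed theories, for
`μ² = -(ħ²/4)□`. -/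
def deformedGauge {d : ℕ} (ħ : ℝ) (η : Fin d → ℝ) (a ε : Symb d) : Symb d :=
  (-2 : ℂ) • (pSq η * a + (-(ħ ^ 2 / 4) : ℂ) • boxX η a) - (2 : ℂ) • pGrad η ε

/-- The gauge transformation `δh = -2 p² a - 2 p∂_x ε` of undeformed theories. -/
def plainGauge {d : ℕ} (η : Fin d → ℝ) (a ε : Symb d) : Symb d :=
  (-2 : ℂ) • (pSq η * a) - (2 : ℂ) • pGrad η ε

/-- `g` is the traceless part of `f`. -/
def IsTracelessPart {d : ℕ} (η : Fin d → ℝ) (f g : Symb d) : Prop :=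
  trP η g = 0 ∧ ∃ χ : Symb d, f = g + pSq η * χ

/-- The undressing map: the component of rank `s` of the result is the component of rank `s` of
`U_{s+ν}((μ/√□)ρ) h`, where `ρ²` acts by `rhoSq`, which lowers the rank by two. -/
def undress {d : ℕ} (ħ : ℝ) (η : Fin d → ℝ) (h : Symb d) : Symb d :=
  ∑ s ∈ Finset.range (h.totalDegree + 1), rank s
    (∑ r ∈ Finset.range (h.totalDegree + 1),
      (besselCoeff (s + nu d) r * muRatioSq ħ ^ r : ℂ) • (rhoSq η)^[r] h)

/-- The coefficient of `z^{2r}` in `2^ν Γ(ν) (s+ν) z^s C_s^ν(1/z)`, for `2r ≤ s`, with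
`(s+ν) Γ(s-r+ν)` written as `Γ(s-r+ν+1) + r Γ(s-r+ν)`, which also covers the limit `ν → 0`. -/
def reconstructCoeff (ν : ℝ) (s r : ℕ) : ℝ :=
  (2 : ℝ) ^ ν * (-1) ^ r * 2 ^ (s - 2 * r) *
      (Real.Gamma ((s : ℝ) - r + ν + 1) + r * Real.Gamma ((s : ℝ) - r + ν)) /
    (r.factorial * (s - 2 * r).factorial)

/-- The reconstruction map `φ ↦ h`:
`∑ (i^k/k!) h_k = 2^ν Γ(ν) ∑ i^s (s+ν) ((μ/√□)ρ)^s C_s^ν(√□/(μρ)) φ_s`, the component of rank `k`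
receiving `(ρ²)^r φ_{k+2r}` for all `r`. -/
def reconstruct {d : ℕ} (ħ : ℝ) (η : Fin d → ℝ) (φ : Symb d) : Symb d :=
  ∑ k ∈ Finset.range (φ.totalDegree + 1), ∑ r ∈ Finset.range (φ.totalDegree + 1),
    ((k.factorial : ℂ) / Complex.I ^ k * Complex.I ^ (k + 2 * r) *
        reconstructCoeff (nu d) (k + 2 * r) r * muRatioSq ħ ^ r) •
      (rhoSq η)^[r] (rank (k + 2 * r) φ)

/-- A map of symbols is local: its value on an open set depends on its argument there only. -/
def IsLocal {d : ℕ} (T : Symb d → Symb d) : Prop :=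
  ∀ (f g : Symb d) (O : Set (Pt d)), IsOpen O →
    (∀ x ∈ O, ∀ α, val (f.coeff α) x = val (g.coeff α) x) →
    ∀ x ∈ O, ∀ α, val ((T f).coeff α) x = val ((T g).coeff α) x

/-- The conditions on the wave operator `P_{a(s)b(s)}(∂)` of a spin-`s` conformal theory. -/
structure IsConformalKernel {d : ℕ} (η : Fin d → ℝ) (s : ℕ) (P : (Fin d → ℂ) → QPoly d) :
    Prop where
  rank_left : ∀ κ, (P κ).IsWeightedHomogeneous (Sum.elim (fun _ => 1) fun _ => 0) s
  rank_right : ∀ κ, (P κ).IsWeightedHomogeneous (Sum.elim (fun _ => 0) fun _ => 1) s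
  /-- It is a differential operator, -/
  differential : ∀ m, ∃ p : MvPolynomial (Fin d) ℂ, ∀ κ, (P κ).coeff m = MvPolynomial.eval κ p
  /-- of order `2s`, -/
  order : ∀ (c : ℂ) κ, P (c • κ) = c ^ (2 * s) • P κ
  nonzero : ∀ κ, κ ≠ 0 → P κ ≠ 0
  /-- Lorentz-invariant, -/
  invariant : ∀ (Λ : Matrix (Fin d) (Fin d) ℝ),
    Λ.transpose * Matrix.diagonal η * Λ = Matrix.diagonal η → ∀ κ,
    MvPolynomial.aeval (Sum.elim
        (fun i => ∑ j, MvPolynomial.C (Λ i j : ℂ) * MvPolynomial.X (Sum.inl j))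
        (fun i => ∑ j, MvPolynomial.C (Λ i j : ℂ) * MvPolynomial.X (Sum.inr j)) :
          Fin d ⊕ Fin d → QPoly d) (P κ) =
      P (fun j => ∑ i, κ i * (Λ i j : ℂ))
  /-- symmetric, `P_{a(s)b(s)}(∂) = P_{b(s)a(s)}(∂) = P_{b(s)a(s)}(-∂)`, -/
  symm : ∀ κ, MvPolynomial.rename Sum.swap (P κ) = P κ
  symm_neg : ∀ κ, MvPolynomial.rename Sum.swap (P κ) = P (-κ)
  /-- traceless -/
  traceless : ∀ κ, ∑ i, MvPolynomial.C (η i : ℂ) *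
    MvPolynomial.pderiv (Sum.inl i) (MvPolynomial.pderiv (Sum.inl i) (P κ)) = 0
  /-- and transverse, `P_{a(s-1)c b(s)} ∂^c = 0`. -/
  transverse : ∀ κ, ∑ i, MvPolynomial.C ((η i : ℂ) * κ i) *
    MvPolynomial.pderiv (Sum.inl i) (P κ) = 0

/-- The action `𝒜_s[φ] = ∫ φ_s f(□) 𝒫^{(s)} φ_s` of a spin-`s` conformal theory. -/
def confAction {d : ℕ} (η : Fin d → ℝ) (s : ℕ) (f : ℝ → ℝ) (φ : Symb d) : ℂ :=
  quadAction (scaleOp η f (confOp η s)) φ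

/-- The action of the deformed spin-`s` theory with `μ² = -(ħ²/4)□`. -/
def deformedAction {d : ℕ} (ħ : ℝ) (η : Fin d → ℝ) (s : ℕ) (f : ℝ → ℝ) (h : Symb d) : ℂ :=
  quadAction (scaleOp η f (deformedOp ħ η s)) h

/-- A functional of symmetric tensors of rank `s` that is a conformal spin-`s` action: it has the
required wave operator, it depends on the traceless part only, and on traceless tensors it is
invariant under `δφ = traceless part of ∂ε` with `ε` traceless of rank `s - 1`. -/
structure IsConformalTheory {d : ℕ} (η : Fin d → ℝ) (s : ℕ) (S : Symb d → ℂ) : Prop where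
  action : ∃ (P : (Fin d → ℂ) → QPoly d) (f : ℝ → ℝ), IsConformalKernel η s P ∧ IsTempered η f ∧
    S = quadAction (scaleOp η f fun ξ => (P (dSym ξ) : MvPowerSeries (Fin d ⊕ Fin d) ℂ))
  traceless : ∀ φ g, IsRealField φ → IsRealField g → φ.IsHomogeneous s → g.IsHomogeneous s →
    IsTracelessPart η φ g → S φ = S g
  gauge : 1 ≤ s → ∀ φ ε g, IsRealField φ → IsRealField ε → IsRealField g →
    φ.IsHomogeneous s → ε.IsHomogeneous (s - 1) → trP η φ = 0 → trP η ε = 0 →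
    IsTracelessPart η (pGrad η ε) g → S (φ + g) = S φ

end ConformalHS

end

open ConformalHS

noncomputable section

namespace ConformalHS

section

/-! ## Linear operators on symbols -/

variable {d : ℕ}

/-! The first order of gauge invariance in the fluctuation, together with the vanishing of the first
variation at the vacuum, says that the linearized gauge variations -2(p² + μ²)a - 2p∂ε lie in the
kernel of the symmetric bilinear form of the quadratic part (`quadPart_add_gaugeVar`,
`bilin_symW_gaugeVar`). Their shape comes from a Moyal expansion that stops at second order, because
p² is quadratic in p and independent of x (`gaugeVar_vac`). A Fourier multiplier is determined
almost everywhere by its matrix elements between test functions (`IsMultiplier.ae_eq_zero`), so the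
problem becomes algebra at almost every frequency κ. Multiplication of fields by p∂ and by p² is
adjoint to the derivation ∂^m ∂/∂q^m and to the Laplacian ∂_q² acting on kernels. If K_{ij} is the
part of the symmetrized kernel of degree i in q and j in q', every K_{ij} is transverse and ∂_q²
K_{i+2,j} = -μ² K_{ij}.

At a generic κ these equations have few solutions. A kernel that is transverse in both arguments
does not change when q and q' are projected to the hyperplane orthogonal to κ, so it is a polynomial
in ρ², ρ'² and τ (`eq_sum_transvTerm`). Among such polynomials of degree (j + 2k, j), the harmonic
ones vanish for k > 0 and are multiples of the Gegenbauer kernel for k = 0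
(`radial_harmonic_eq_zero`, `radial_harmonic_eq_confKernel`). Conversely, ∂_q² lowers the power of
ρ² in (ρ²)^n 𝒫^{(s)} with the factor 4n(n+s+ν)□, and this is the factor in the recursion of the
Bessel coefficients, so P^{(s)}_μ solves the equations (`lap_rho_pow_confKernel`, `lap_dressedSum`).

Induction on i + j then identifies the kernel with a sum of f_s P^{(s)}_μ (`invSum_eq_dressedSum`):
the difference of the two sides is harmonic, and its only free constant is tested at q = q' null.
There only the term (q∂)^j (q'∂)^j of the original operator survives. Hence the f_s solve a
triangular system with constant real coefficients, whose diagonal is non-zero because the Gegenbauer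
polynomial does not vanish at 1 (`gegenbauerSum_ne_zero`). They are finite real combinations of the
given functions of □ and inherit temperedness or polynomiality from them (`waveFactor_mem`).

The variable ρ² of the kernel is adjoint to the operator ρ² on fields, so the two Bessel factors of
P^{(s)}_μ can be moved onto the two fields; this is the undressing (`density_deformed_eq`).
Undressing and reconstruction are series in ρ² with rank-dependent coefficients, and they are
mutually inverse by two telescoping sums (`inverse_bessel_sum`, `bessel_inverse_sum`). They exchange
the gauge transformations because ρ² commutes with p∂, while its commutator with p² consists of □
terms, which the Bessel recursion cancels against μ²a for 2ν = d - 3, and of a gradient, which is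
absorbed in ε (`ladder_bessel_weyl`). -/

theorem val_ext {f g : smoothFn d} (h : ∀ x, val f x = val g x) : f = g :=
  Subtype.ext (funext h)

@[simp] theorem val_add (f g : smoothFn d) (x : Pt d) : val (f + g) x = val f x + val g x := rfl
@[simp] theorem val_mul (f g : smoothFn d) (x : Pt d) : val (f * g) x = val f x * val g x := rfl
@[simp] theorem val_smul (c : ℂ) (f : smoothFn d) (x : Pt d) : val (c • f) x = c * val f x := rfl
@[simp] theorem val_zero (x : Pt d) : val (0 : smoothFn d) x = 0 := rfl

theorem val_contDiff (f : smoothFn d) : ContDiff ℝ ∞ (val f) := f.2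

theorem val_differentiable (f : smoothFn d) : Differentiable ℝ (val f) :=
  (val_contDiff f).differentiable (by simp)

theorem val_pd (i : Fin d) (f : smoothFn d) (x : Pt d) :
    val (pd i f) x = fderiv ℝ (val f) x (EuclideanSpace.single i 1) := rfl

theorem pd_add (i : Fin d) (f g : smoothFn d) : pd i (f + g) = pd i f + pd i g := by
  apply val_ext
  intro x
  have h : val (f + g) = val f + val g := rfl
  rw [val_pd, h, fderiv_add (val_differentiable f x) (val_differentiable g x)]
  rfl

theorem pd_smul (i : Fin d) (c : ℂ) (f : smoothFn d) : pd i (c • f) = c • pd i f := by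
  apply val_ext
  intro x
  have h : val (c • f) = c • val f := rfl
  rw [val_pd, h, fderiv_const_smul (val_differentiable f x) c]
  rfl

/-- `∂_i` as a linear map on smooth functions. -/
def pdL (i : Fin d) : smoothFn d →ₗ[ℂ] smoothFn d where
  toFun := pd i
  map_add' := pd_add i
  map_smul' := pd_smul i

@[simp] theorem pd_zero (i : Fin d) : pd i (0 : smoothFn d) = 0 := (pdL i).map_zero

theorem pd_comm (i j : Fin d) (f : smoothFn d) : pd i (pd j f) = pd j (pd i f) := by
  apply val_ext
  intro x
  have hs : IsSymmSndFDerivAt ℝ (val f) x :=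
    (val_contDiff f).contDiffAt.isSymmSndFDerivAt (by
      simp only [minSmoothness_of_isRCLikeNormedField]
      exact WithTop.coe_le_coe.mpr (le_top : (2 : ℕ∞) ≤ ⊤))
  have hd : DifferentiableAt ℝ (fderiv ℝ (val f)) x :=
    ((val_contDiff f).fderiv_right (m := ∞) le_rfl).differentiable (by simp) x
  have key : ∀ k l : Fin d, val (pd k (pd l f)) x =
      fderiv ℝ (fderiv ℝ (val f)) x (EuclideanSpace.single k 1) (EuclideanSpace.single l 1) := by
    intro k l
    have : val (pd l f) = fun y => fderiv ℝ (val f) y (EuclideanSpace.single l 1) := rfl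
    rw [val_pd, this, fderiv_clm_apply hd (by fun_prop)]
    simp
  rw [key, key]
  exact hs.eq _ _

/-- Serves for maps of coefficients that are not ring homomorphisms: ∂_i, conjugation, and the value
of the Fourier transform at a frequency. The condition at 0 accounts for the monomials outside the
support. -/
theorem coeff_sum_monomial {R S : Type*} [CommSemiring R] [CommSemiring S] (F : R → S)
    (hF : F 0 = 0) (f : MvPolynomial (Fin d) R) (α : Fin d →₀ ℕ) :
    (∑ β ∈ f.support, MvPolynomial.monomial β (F (f.coeff β))).coeff α = F (f.coeff α) := by
  classical
  rw [MvPolynomial.coeff_sum]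
  simp only [MvPolynomial.coeff_monomial]
  rw [Finset.sum_ite_eq' f.support α fun β => F (f.coeff β)]
  split_ifs with h
  · rfl
  · rw [MvPolynomial.notMem_support_iff.mp h, hF]

@[simp] theorem coeff_dX (i : Fin d) (f : Symb d) (α : Fin d →₀ ℕ) :
    (dX i f).coeff α = pd i (f.coeff α) :=
  coeff_sum_monomial (pd i) (pd_zero i) f α

theorem conjFn_zero : conjFn (0 : smoothFn d) = 0 := val_ext fun _ => map_zero (starRingEnd ℂ)

@[simp] theorem coeff_dagger (f : Symb d) (α : Fin d →₀ ℕ) :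
    (dagger f).coeff α = conjFn (f.coeff α) :=
  coeff_sum_monomial conjFn conjFn_zero f α

theorem coeff_dP (i : Fin d) (f : Symb d) (α : Fin d →₀ ℕ) :
    (dP i f).coeff α = f.coeff (α + Finsupp.single i 1) * (α i + 1) :=
  MvPolynomial.coeff_pderiv f α

theorem coeff_csmul (c : ℂ) (f : Symb d) (α : Fin d →₀ ℕ) :
    (c • f).coeff α = c • f.coeff α := MvPolynomial.coeff_smul ..

/-- `∂/∂x^i` as a linear map on symbols. -/
def dXL (i : Fin d) : Symb d →ₗ[ℂ] Symb d where
  toFun := dX i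
  map_add' f g := by ext1 α; simp [pd_add]
  map_smul' c f := by ext1 α; simp only [coeff_dX, coeff_csmul, pd_smul, RingHom.id_apply]

/-- `∂/∂p_i` as a linear map on symbols. -/
def dPL (i : Fin d) : Symb d →ₗ[ℂ] Symb d := (MvPolynomial.pderiv i).toLinearMap.restrictScalars ℂ

/-- Multiplication by a symbol as a linear map. -/
def mulL (g : Symb d) : Symb d →ₗ[ℂ] Symb d := LinearMap.mulLeft ℂ g

theorem dXL_apply (i : Fin d) (f : Symb d) : dXL i f = dX i f := rfl
theorem dPL_apply (i : Fin d) (f : Symb d) : dPL i f = dP i f := rfl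
theorem mulL_apply (g f : Symb d) : mulL g f = g * f := rfl

theorem dX_add (i : Fin d) (f g : Symb d) : dX i (f + g) = dX i f + dX i g := (dXL i).map_add f g
theorem dX_smul (i : Fin d) (c : ℂ) (f : Symb d) : dX i (c • f) = c • dX i f :=
  (dXL i).map_smul c f
theorem dX_sum {ι : Type*} (i : Fin d) (s : Finset ι) (f : ι → Symb d) :
    dX i (∑ j ∈ s, f j) = ∑ j ∈ s, dX i (f j) := map_sum (dXL i) f s
@[simp] theorem dX_zero (i : Fin d) : dX i (0 : Symb d) = 0 := (dXL i).map_zero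

theorem dP_add (i : Fin d) (f g : Symb d) : dP i (f + g) = dP i f + dP i g := (dPL i).map_add f g
theorem dP_smul (i : Fin d) (c : ℂ) (f : Symb d) : dP i (c • f) = c • dP i f :=
  (dPL i).map_smul c f
theorem dP_sum {ι : Type*} (i : Fin d) (s : Finset ι) (f : ι → Symb d) :
    dP i (∑ j ∈ s, f j) = ∑ j ∈ s, dP i (f j) := map_sum (dPL i) f s
@[simp] theorem dP_zero (i : Fin d) : dP i (0 : Symb d) = 0 := (dPL i).map_zero

theorem dX_dX_comm (i j : Fin d) (f : Symb d) : dX i (dX j f) = dX j (dX i f) := by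
  ext1 α
  simp only [coeff_dX]
  exact pd_comm i j _

theorem pd_nat_mul (i : Fin d) (n : ℕ) (f : smoothFn d) :
    pd i (f * n) = pd i f * n := by
  have := map_nsmul (pdL i) n f
  simp only [nsmul_eq_mul] at this
  rw [mul_comm, mul_comm (pd i f)]
  exact this

theorem dX_dP_comm (i j : Fin d) (f : Symb d) : dX i (dP j f) = dP j (dX i f) := by
  ext1 α
  rw [coeff_dX, coeff_dP, coeff_dP, coeff_dX]
  exact_mod_cast pd_nat_mul i (α j + 1) _

theorem dP_dP_comm (i j : Fin d) (f : Symb d) : dP i (dP j f) = dP j (dP i f) := by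
  ext1 α
  simp only [coeff_dP]
  rw [add_right_comm]
  by_cases h : i = j
  · subst h; ring
  · simp [h, Ne.symm h]; ring

theorem dX_X_mul (i j : Fin d) (f : Symb d) :
    dX i (MvPolynomial.X j * f) = MvPolynomial.X j * dX i f := by
  classical
  ext1 α
  rw [coeff_dX, MvPolynomial.coeff_X_mul', MvPolynomial.coeff_X_mul']
  split_ifs <;> simp

theorem dP_mul (i : Fin d) (f g : Symb d) : dP i (f * g) = dP i f * g + f * dP i g :=
  (MvPolynomial.pderiv_mul (i := i) (f := f) (g := g))

theorem dP_X (i j : Fin d) : dP i (MvPolynomial.X j : Symb d) = if i = j then 1 else 0 := by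
  classical
  unfold dP
  rw [MvPolynomial.pderiv_X, Pi.single_apply]
  simp [eq_comm]

theorem dP_X_mul (i j : Fin d) (f : Symb d) :
    dP i (MvPolynomial.X j * f) = MvPolynomial.X j * dP i f + if i = j then f else 0 := by
  rw [dP_mul, dP_X]
  split_ifs <;> ring

/-! ### Linear maps for the composite operators -/

/-- `□` as a linear map. -/
def boxL (η : Fin d → ℝ) : Symb d →ₗ[ℂ] Symb d := ∑ i, (η i : ℂ) • (dXL i * dXL i)
/-- `∂_p²` as a linear map. -/
def trL (η : Fin d → ℝ) : Symb d →ₗ[ℂ] Symb d := ∑ i, (η i : ℂ) • (dPL i * dPL i)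
/-- `∂_p∂_x` as a linear map. -/
def divL : Symb d →ₗ[ℂ] Symb d := ∑ i, dXL i * dPL i
/-- `p∂_x` as a linear map. -/
def gradL (η : Fin d → ℝ) : Symb d →ₗ[ℂ] Symb d :=
  ∑ i, (η i : ℂ) • (mulL (MvPolynomial.X i) * dXL i)
/-- `ρ²` as a linear map. -/
def rhoL (η : Fin d → ℝ) : Symb d →ₗ[ℂ] Symb d := boxL η * trL η + (-1 : ℂ) • (divL (d := d) * divL (d := d))

theorem boxL_apply (η : Fin d → ℝ) (f : Symb d) : boxL η f = boxX η f := by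
  simp [boxL, boxX, dXL_apply]
theorem trL_apply (η : Fin d → ℝ) (f : Symb d) : trL η f = trP η f := by
  simp [trL, trP, dPL_apply]
theorem divL_apply (f : Symb d) : divL f = divP f := by
  simp [divL, divP, dPL_apply, dXL_apply]
theorem gradL_apply (η : Fin d → ℝ) (f : Symb d) : gradL η f = pGrad η f := by
  simp [gradL, pGrad, mulL_apply, dXL_apply]
theorem rhoL_apply (η : Fin d → ℝ) (f : Symb d) : rhoL η f = rhoSq η f := by
  simp [rhoL, rhoSq, boxL_apply, trL_apply, divL_apply, sub_eq_add_neg]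
  module

theorem rhoL_pow_apply (η : Fin d → ℝ) (r : ℕ) (f : Symb d) :
    (rhoL η ^ r) f = (rhoSq η)^[r] f := by
  induction r generalizing f with
  | zero => rfl
  | succ n ih => rw [pow_succ, Module.End.mul_apply, ih, rhoL_apply, Function.iterate_succ_apply]

/-! ### Commutators -/

theorem comm_dX_dX (i j : Fin d) : Commute (dXL i) (dXL j) := LinearMap.ext (dX_dX_comm i j)
theorem comm_dX_dP (i j : Fin d) : Commute (dXL i) (dPL j) := LinearMap.ext (dX_dP_comm i j)
theorem comm_dP_dP (i j : Fin d) : Commute (dPL i) (dPL j) := LinearMap.ext (dP_dP_comm i j)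
theorem comm_dX_X (i j : Fin d) : Commute (dXL i) (mulL (MvPolynomial.X j)) :=
  LinearMap.ext (dX_X_mul i j)

theorem comm_box_of {η : Fin d → ℝ} {T : Symb d →ₗ[ℂ] Symb d} (h : ∀ i, Commute (dXL i) T) :
    Commute (boxL η) T :=
  Commute.sum_left _ _ _ fun i _ => ((h i).mul_left (h i)).smul_left _

theorem comm_box_tr (η : Fin d → ℝ) : Commute (boxL η) (trL η) :=
  comm_box_of fun i => Commute.sum_right _ _ _ fun j _ =>
    ((comm_dX_dP i j).mul_right (comm_dX_dP i j)).smul_right _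

theorem comm_box_div (η : Fin d → ℝ) : Commute (boxL η) (divL (d := d)) :=
  comm_box_of fun i => Commute.sum_right _ _ _ fun j _ =>
    (comm_dX_dX i j).mul_right (comm_dX_dP i j)

theorem comm_box_grad (η : Fin d → ℝ) : Commute (boxL η) (gradL η) :=
  comm_box_of fun i => Commute.sum_right _ _ _ fun j _ =>
    ((comm_dX_X i j).mul_right (comm_dX_dX i j)).smul_right _

theorem comm_tr_div (η : Fin d → ℝ) : Commute (trL η) (divL (d := d)) :=
  Commute.sum_left _ _ _ fun i _ => Commute.smul_left (Commute.sum_right _ _ _ fun j _ =>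
    (((comm_dX_dP j i).symm.mul_right (comm_dP_dP i j))).mul_left
      (((comm_dX_dP j i).symm.mul_right (comm_dP_dP i j)))) _

theorem comm_box_rho (η : Fin d → ℝ) : Commute (boxL η) (rhoL η) :=
  ((Commute.refl _).mul_right (comm_box_tr η)).add_right
    (((comm_box_div η).mul_right (comm_box_div η)).smul_right _)

theorem comm_div_rho (η : Fin d → ℝ) : Commute (divL (d := d)) (rhoL η) :=
  ((comm_box_div η).symm.mul_right (comm_tr_div η).symm).add_right
    (((Commute.refl _).mul_right (Commute.refl _)).smul_right _)

theorem dP_pGrad (η : Fin d → ℝ) (i : Fin d) (f : Symb d) :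
    dP i (pGrad η f) = pGrad η (dP i f) + (η i : ℂ) • dX i f := by
  simp only [pGrad, dP_sum, dP_smul, dP_X_mul, ← dX_dP_comm, smul_add, Finset.sum_add_distrib]
  simp

theorem dX_pGrad (η : Fin d → ℝ) (i : Fin d) (f : Symb d) :
    dX i (pGrad η f) = pGrad η (dX i f) := by
  simp only [pGrad, dX_sum, dX_smul, dX_X_mul]
  exact Finset.sum_congr rfl fun j _ => by rw [dX_dX_comm]

theorem pGrad_sum {ι : Type*} (η : Fin d → ℝ) (s : Finset ι) (f : ι → Symb d) :
    pGrad η (∑ j ∈ s, f j) = ∑ j ∈ s, pGrad η (f j) := by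
  simp only [← gradL_apply, map_sum]

theorem pGrad_smul (η : Fin d → ℝ) (c : ℂ) (f : Symb d) : pGrad η (c • f) = c • pGrad η f := by
  simp only [← gradL_apply, map_smul]

theorem pGrad_add (η : Fin d → ℝ) (f g : Symb d) : pGrad η (f + g) = pGrad η f + pGrad η g := by
  simp only [← gradL_apply, map_add]

theorem divP_pGrad (η : Fin d → ℝ) (f : Symb d) :
    divP (pGrad η f) = pGrad η (divP f) + boxX η f := by
  simp only [divP, dP_pGrad, dX_add, dX_smul, dX_pGrad, Finset.sum_add_distrib, pGrad_sum, boxX]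

/-- A diagonal metric with entries ±1 is its own inverse, which is why no inverse metric appears in
the commutators. -/
theorem eta_sq {η : Fin d → ℝ} (hη : ∀ i, η i = 1 ∨ η i = -1) (i : Fin d) :
    (η i : ℂ) * (η i : ℂ) = 1 := by
  rcases hη i with h | h <;> simp [h]

theorem trP_pGrad {η : Fin d → ℝ} (hη : ∀ i, η i = 1 ∨ η i = -1) (f : Symb d) :
    trP η (pGrad η f) = pGrad η (trP η f) + (2 : ℂ) • divP f := by
  simp only [trP, dP_pGrad, dP_add, dP_smul, Finset.sum_add_distrib, pGrad_sum, pGrad_smul,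
    divP, smul_add, smul_smul, eta_sq hη, one_smul, Finset.smul_sum, add_assoc, dX_dP_comm]
  rw [← Finset.sum_add_distrib (f := fun i => dP i (dX i f))]
  simp only [two_smul]

/-- With [∂_p², p∂] = 2 ∂_p∂_x and [∂_p∂_x, p∂] = □, the commutators of □∂_p² and of (∂_p∂_x)² with
p∂ are both 2□∂_p∂_x and cancel in ρ². -/
theorem rho_grad {η : Fin d → ℝ} (hη : ∀ i, η i = 1 ∨ η i = -1) (f : Symb d) :
    rhoSq η (pGrad η f) = pGrad η (rhoSq η f) := by
  have h1 : ∀ g, boxX η (pGrad η g) = pGrad η (boxX η g) := fun g => by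
    simp only [← boxL_apply, ← gradL_apply]
    exact LinearMap.congr_fun (comm_box_grad η).eq g
  have h2 : ∀ g, divP (boxX η g) = boxX η (divP g) := fun g => by
    simp only [← boxL_apply, ← divL_apply]
    exact LinearMap.congr_fun (comm_box_div η).eq.symm g
  have h3 : ∀ g g' : Symb d, boxX η (g + g') = boxX η g + boxX η g' := fun g g' => by
    simp only [← boxL_apply, map_add]
  have h4 : ∀ (c : ℂ) (g : Symb d), boxX η (c • g) = c • boxX η g := fun c g => by
    simp only [← boxL_apply, map_smul]
  have h5 : ∀ g g' : Symb d, divP (g + g') = divP g + divP g' := fun g g' => by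
    simp only [← divL_apply, map_add]
  have h6 : ∀ g g' : Symb d, pGrad η (g - g') = pGrad η g - pGrad η g' := fun g g' => by
    simp only [← gradL_apply, map_sub]
  simp only [rhoSq, trP_pGrad hη, divP_pGrad, h1, h2, h3, h4, h5, h6]
  module

theorem pSq_eq_C_mul (η : Fin d → ℝ) (f : Symb d) :
    pSq η * f = ∑ i, (η i : ℂ) • (MvPolynomial.X i * (MvPolynomial.X i * f)) := by
  simp only [pSq, Finset.sum_mul, smul_mul_assoc, mul_assoc]

/-- The Euler operator `p ∂_p`. -/
def euler (f : Symb d) : Symb d := ∑ i, MvPolynomial.X i * dP i f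

theorem dP_pSq_mul (η : Fin d → ℝ) (i : Fin d) (f : Symb d) :
    dP i (pSq η * f) = pSq η * dP i f + (2 * η i : ℂ) • (MvPolynomial.X i * f) := by
  simp only [pSq_eq_C_mul, dP_sum, dP_smul, dP_X_mul, mul_add, smul_add, Finset.sum_add_distrib]
  simp only [mul_ite, mul_zero, smul_ite, smul_zero, Finset.sum_ite_eq, Finset.mem_univ, if_true]
  module

theorem dX_pSq_mul (η : Fin d → ℝ) (i : Fin d) (f : Symb d) :
    dX i (pSq η * f) = pSq η * dX i f := by
  simp only [pSq_eq_C_mul, dX_sum, dX_smul, dX_X_mul]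

theorem boxX_pSq_mul (η : Fin d → ℝ) (f : Symb d) :
    boxX η (pSq η * f) = pSq η * boxX η f := by
  simp only [boxX, dX_pSq_mul, Finset.mul_sum, mul_smul_comm]

theorem divP_pSq_mul (η : Fin d → ℝ) (f : Symb d) :
    divP (pSq η * f) = pSq η * divP f + (2 : ℂ) • pGrad η f := by
  simp only [divP, dP_pSq_mul, dX_add, dX_smul, dX_X_mul, dX_pSq_mul, Finset.mul_sum,
    Finset.sum_add_distrib, pGrad, Finset.smul_sum, smul_smul]

theorem trP_pSq_mul {η : Fin d → ℝ} (hη : ∀ i, η i = 1 ∨ η i = -1) (f : Symb d) :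
    trP η (pSq η * f) = pSq η * trP η f + (4 : ℂ) • euler f + (2 * d : ℂ) • f := by
  simp only [trP, dP_pSq_mul, dP_add, dP_smul, dP_X_mul, if_true, smul_add, smul_smul,
    Finset.sum_add_distrib, Finset.mul_sum, mul_smul_comm, euler, Finset.smul_sum]
  have h : ∀ i, (η i : ℂ) * (2 * η i) = 2 := fun i => by linear_combination 2 * eta_sq hη i
  simp only [h, Finset.sum_const, Finset.card_univ, Fintype.card_fin, ← Nat.cast_smul_eq_nsmul ℂ,
    smul_smul, add_assoc]
  rw [mul_comm (d : ℂ) 2, ← add_assoc, ← add_assoc, ← add_assoc, add_assoc _ (∑ i, _) (∑ i, _),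
    ← Finset.sum_add_distrib]
  simp only [← add_smul]
  norm_num

/-- Follows from [∂_p², p²] = 4 p∂_p + 2d and [∂_p∂_x, p²] = 2 p∂, with -2□ coming from reordering
∂_p∂_x past p∂. The □ terms are what the μ² part of the deformed transformation compensates; the
last term is a vector gauge transformation. -/
theorem rho_pSq {η : Fin d → ℝ} (hη : ∀ i, η i = 1 ∨ η i = -1) (f : Symb d) :
    rhoSq η (pSq η * f) = pSq η * rhoSq η f + (4 : ℂ) • boxX η (euler f) +
      (2 * d - 2 : ℂ) • boxX η f - (4 : ℂ) • pGrad η (divP f) := by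
  have h3 : ∀ g g' : Symb d, boxX η (g + g') = boxX η g + boxX η g' := fun g g' => by
    simp only [← boxL_apply, map_add]
  have h4 : ∀ (c : ℂ) (g : Symb d), boxX η (c • g) = c • boxX η g := fun c g => by
    simp only [← boxL_apply, map_smul]
  have h5 : ∀ g g' : Symb d, divP (g + g') = divP g + divP g' := fun g g' => by
    simp only [← divL_apply, map_add]
  have h7 : ∀ (c : ℂ) (g : Symb d), divP (c • g) = c • divP g := fun c g => by
    simp only [← divL_apply, map_smul]
  simp only [rhoSq, trP_pSq_mul hη, divP_pSq_mul, boxX_pSq_mul, h3, h4, h5, h7, divP_pGrad]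
  rw [show pSq η * (boxX η (trP η f) - divP (divP f)) =
    pSq η * boxX η (trP η f) - pSq η * divP (divP f) from
    mul_sub (pSq η) (boxX η (trP η f)) (divP (divP f))]
  module

end

section

variable {d : ℕ}

theorem neg_one_csmul (f : Symb d) : (-1 : ℂ) • f = -f := by module

/-! ## Components of definite rank -/

theorem coeff_rank (s : ℕ) (f : Symb d) (α : Fin d →₀ ℕ) :
    (rank s f).coeff α = if α.degree = s then f.coeff α else 0 := by
  unfold rank
  rw [MvPolynomial.coeff_homogeneousComponent]

theorem rank_ext {f g : Symb d} (h : ∀ s, rank s f = rank s g) : f = g := by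
  ext1 α
  have := congrArg (fun p : Symb d => p.coeff α) (h α.degree)
  simpa [coeff_rank] using this

theorem rank_add (s : ℕ) (f g : Symb d) : rank s (f + g) = rank s f + rank s g := map_add _ f g
theorem rank_sub (s : ℕ) (f g : Symb d) : rank s (f - g) = rank s f - rank s g :=
  map_sub (MvPolynomial.homogeneousComponent s) f g
theorem rank_smul (s : ℕ) (c : ℂ) (f : Symb d) : rank s (c • f) = c • rank s f := by
  ext1 α
  simp only [coeff_rank, coeff_csmul]
  split_ifs <;> simp
theorem rank_sum {ι : Type*} (s : ℕ) (t : Finset ι) (f : ι → Symb d) :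
    rank s (∑ j ∈ t, f j) = ∑ j ∈ t, rank s (f j) := map_sum _ f t
@[simp] theorem rank_zero (s : ℕ) : rank s (0 : Symb d) = 0 := map_zero _

theorem rank_rank (s t : ℕ) (f : Symb d) : rank s (rank t f) = if s = t then rank s f else 0 := by
  ext1 α
  simp only [coeff_rank]
  split_ifs <;> simp_all [coeff_rank]

theorem rank_eq_zero {s : ℕ} {f : Symb d} (h : f.totalDegree < s) : rank s f = 0 :=
  MvPolynomial.homogeneousComponent_eq_zero s f h

theorem rank_isHomogeneous (s : ℕ) (f : Symb d) : (rank s f).IsHomogeneous s :=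
  MvPolynomial.homogeneousComponent_isHomogeneous s f

theorem rank_dX (s : ℕ) (i : Fin d) (f : Symb d) : rank s (dX i f) = dX i (rank s f) := by
  ext1 α
  simp only [coeff_rank, coeff_dX]
  split_ifs <;> simp

theorem rank_dP (s : ℕ) (i : Fin d) (f : Symb d) : rank s (dP i f) = dP i (rank (s + 1) f) := by
  ext1 α
  simp only [coeff_rank, coeff_dP, map_add, Finsupp.degree_single, add_left_inj]
  split_ifs <;> simp

theorem degree_sub_single {α : Fin d →₀ ℕ} {i : Fin d} (h : i ∈ α.support) :
    (α - Finsupp.single i 1).degree + 1 = α.degree := by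
  have h1 : α - Finsupp.single i 1 + Finsupp.single i 1 = α := by
    ext j
    by_cases hj : i = j
    · subst hj
      simp at h
      simp; omega
    · simp [hj]
  conv_rhs => rw [← h1]
  simp

theorem rank_X_mul (s : ℕ) (i : Fin d) (f : Symb d) :
    rank (s + 1) (MvPolynomial.X i * f) = MvPolynomial.X i * rank s f := by
  ext1 α
  rw [coeff_rank, MvPolynomial.coeff_X_mul', MvPolynomial.coeff_X_mul', coeff_rank]
  by_cases h : i ∈ α.support
  · have := degree_sub_single h
    simp only [h, if_true]
    congr 1
    simp only [eq_iff_iff]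
    omega
  · simp [h]

theorem rank_zero_X_mul (i : Fin d) (f : Symb d) : rank 0 (MvPolynomial.X i * f) = 0 := by
  ext1 α
  rw [coeff_rank, MvPolynomial.coeff_X_mul']
  split_ifs with h h'
  · have := degree_sub_single h'
    omega
  · rfl
  · rfl

theorem rank_boxX (s : ℕ) (η : Fin d → ℝ) (f : Symb d) :
    rank s (boxX η f) = boxX η (rank s f) := by
  simp only [boxX, rank_sum, rank_smul, rank_dX]

theorem rank_trP (s : ℕ) (η : Fin d → ℝ) (f : Symb d) :
    rank s (trP η f) = trP η (rank (s + 2) f) := by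
  simp only [trP, rank_sum, rank_smul, rank_dP]

theorem rank_divP (s : ℕ) (f : Symb d) : rank s (divP f) = divP (rank (s + 1) f) := by
  simp only [divP, rank_sum, rank_dP, rank_dX]

theorem rank_rhoSq (s : ℕ) (η : Fin d → ℝ) (f : Symb d) :
    rank s (rhoSq η f) = rhoSq η (rank (s + 2) f) := by
  simp only [rhoSq, rank_sub, rank_boxX, rank_trP, rank_divP]

theorem rank_rhoSq_iter (s r : ℕ) (η : Fin d → ℝ) (f : Symb d) :
    rank s ((rhoSq η)^[r] f) = (rhoSq η)^[r] (rank (s + 2 * r) f) := by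
  induction r generalizing f with
  | zero => rfl
  | succ n ih =>
    rw [Function.iterate_succ_apply, ih, rank_rhoSq, Function.iterate_succ_apply]
    ring_nf

theorem rank_pGrad (s : ℕ) (η : Fin d → ℝ) (f : Symb d) :
    rank (s + 1) (pGrad η f) = pGrad η (rank s f) := by
  simp only [pGrad, rank_sum, rank_smul, rank_X_mul, rank_dX]

theorem rank_zero_pGrad (η : Fin d → ℝ) (f : Symb d) : rank 0 (pGrad η f) = 0 := by
  simp only [pGrad, rank_sum, rank_smul, rank_zero_X_mul, smul_zero, Finset.sum_const_zero]

theorem rank_pSq_mul (s : ℕ) (η : Fin d → ℝ) (f : Symb d) :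
    rank (s + 2) (pSq η * f) = pSq η * rank s f := by
  simp only [pSq_eq_C_mul, rank_sum, rank_smul, rank_X_mul]

theorem rank_zero_pSq_mul (η : Fin d → ℝ) (f : Symb d) : rank 0 (pSq η * f) = 0 := by
  simp only [pSq_eq_C_mul, rank_sum, rank_smul, rank_zero_X_mul, smul_zero, Finset.sum_const_zero]

theorem rank_one_pSq_mul (η : Fin d → ℝ) (f : Symb d) : rank 1 (pSq η * f) = 0 := by
  simp only [pSq_eq_C_mul, rank_sum, rank_smul, rank_X_mul _ _ (_ * _),
    rank_zero_X_mul, mul_zero, smul_zero, Finset.sum_const_zero]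

theorem rhoSq_iter_smul (η : Fin d → ℝ) (r : ℕ) (c : ℂ) (f : Symb d) :
    (rhoSq η)^[r] (c • f) = c • (rhoSq η)^[r] f := by
  simp only [← rhoL_pow_apply, map_smul]
theorem rhoSq_iter_add (η : Fin d → ℝ) (r : ℕ) (f g : Symb d) :
    (rhoSq η)^[r] (f + g) = (rhoSq η)^[r] f + (rhoSq η)^[r] g := by
  simp only [← rhoL_pow_apply, map_add]
theorem rhoSq_iter_sum {ι : Type*} (η : Fin d → ℝ) (r : ℕ) (t : Finset ι) (f : ι → Symb d) :
    (rhoSq η)^[r] (∑ j ∈ t, f j) = ∑ j ∈ t, (rhoSq η)^[r] (f j) := by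
  simp only [← rhoL_pow_apply, map_sum]
@[simp] theorem rhoSq_iter_zero (η : Fin d → ℝ) (r : ℕ) : (rhoSq η)^[r] (0 : Symb d) = 0 := by
  simp only [← rhoL_pow_apply, map_zero]

/-! ## Ladders: sums over powers of `ρ²` with rank-dependent real coefficients -/

/-- The map of symbols whose component of rank `k` is `∑_r c(k,r) (ρ²)^r f_{k+2r}`. -/
def ladder (η : Fin d → ℝ) (c : ℕ → ℕ → ℝ) (f : Symb d) : Symb d :=
  ∑ k ∈ Finset.range (f.totalDegree + 1), ∑ r ∈ Finset.range (f.totalDegree + 1),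
    (c k r : ℂ) • (rhoSq η)^[r] (rank (k + 2 * r) f)

theorem rank_iter_rank (η : Fin d → ℝ) (s k r : ℕ) (f : Symb d) :
    rank s ((rhoSq η)^[r] (rank (k + 2 * r) f)) =
      if s = k then (rhoSq η)^[r] (rank (k + 2 * r) f) else 0 := by
  rw [rank_rhoSq_iter, rank_rank]
  by_cases h : s = k
  · subst h; simp
  · have : ¬ (s + 2 * r = k + 2 * r) := by omega
    simp [h]

theorem sum_range_rank_extend (F : ℕ → Symb d →ₗ[ℂ] Symb d) (k : ℕ) (f : Symb d) {M N : ℕ}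
    (hM : f.totalDegree < k + 2 * (M + 1)) (hN : f.totalDegree < k + 2 * (N + 1)) :
    ∑ r ∈ Finset.range (M + 1), F r (rank (k + 2 * r) f) =
      ∑ r ∈ Finset.range (N + 1), F r (rank (k + 2 * r) f) := by
  wlog h : M ≤ N generalizing M N
  · exact (this hN hM (by omega)).symm
  refine Finset.sum_subset (fun x hx => by simp at hx ⊢; omega) fun r _ hr => ?_
  rw [rank_eq_zero, map_zero]
  simp at hr
  omega

/-- A ladder is truncated at the total degree of its argument, which is not additive. The freedom in
`M` allows symbols of different degrees to be compared with a common truncation. -/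
theorem rank_ladder (η : Fin d → ℝ) (c : ℕ → ℕ → ℝ) (f : Symb d) (k M : ℕ)
    (hM : f.totalDegree < k + 2 * (M + 1)) :
    rank k (ladder η c f) =
      ∑ r ∈ Finset.range (M + 1), (c k r : ℂ) • (rhoSq η)^[r] (rank (k + 2 * r) f) := by
  have key := sum_range_rank_extend (fun r => (c k r : ℂ) • rhoL η ^ r) k f hM
    (N := f.totalDegree) (by omega)
  simp only [LinearMap.smul_apply, rhoL_pow_apply] at key
  rw [key]
  simp only [ladder, rank_sum, rank_smul, rank_iter_rank]
  by_cases hk : k ∈ Finset.range (f.totalDegree + 1)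
  · rw [Finset.sum_eq_single k]
    · simp
    · intro b _ hb
      simp [Ne.symm hb]
    · exact fun h => (h hk).elim
  · rw [Finset.sum_eq_zero, Finset.sum_eq_zero]
    · intro r _
      rw [rank_eq_zero (by simp at hk; omega)]
      simp
    · intro b hb
      have : k ≠ b := by rintro rfl; exact hk hb
      simp [this]

theorem totalDegree_le_of_rank {f : Symb d} {n : ℕ} (h : ∀ k, n < k → rank k f = 0) :
    f.totalDegree ≤ n := by
  refine Finset.sup_le fun α hα => ?_
  change α.degree ≤ n
  by_contra hlt
  push Not at hlt
  have := congrArg (fun p : Symb d => p.coeff α) (h α.degree hlt)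
  simp [coeff_rank] at this
  exact MvPolynomial.mem_support_iff.mp hα this

theorem totalDegree_ladder (η : Fin d → ℝ) (c : ℕ → ℕ → ℝ) (f : Symb d) :
    (ladder η c f).totalDegree ≤ f.totalDegree := by
  refine totalDegree_le_of_rank fun k hk => ?_
  rw [rank_ladder η c f k 0 (by omega)]
  simp [rank_eq_zero hk]

/-- Each power of ρ² lowers the rank by two, so the second ladder is read at the shifted rank k +
2r; collecting equal powers of ρ² gives this twisted convolution. -/
theorem ladder_comp (η : Fin d → ℝ) (c c' c'' : ℕ → ℕ → ℝ)
    (h : ∀ k n, ∑ r ∈ Finset.range (n + 1), c k r * c' (k + 2 * r) (n - r) = c'' k n)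
    (f : Symb d) : ladder η c (ladder η c' f) = ladder η c'' f := by
  refine rank_ext fun k => ?_
  set M := f.totalDegree
  have hd := totalDegree_ladder η c' f
  rw [rank_ladder η c _ k M (by omega), rank_ladder η c'' f k M (by omega)]
  have h1 : ∀ r ∈ Finset.range (M + 1),
      (c k r : ℂ) • (rhoSq η)^[r] (rank (k + 2 * r) (ladder η c' f)) =
      ∑ j ∈ Finset.range (M + 1 - r), (c k r * c' (k + 2 * r) j : ℂ) •
        (rhoSq η)^[r + j] (rank (k + 2 * (r + j)) f) := by
    intro r hr
    simp only [Finset.mem_range] at hr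
    rw [rank_ladder η c' f (k + 2 * r) (M - r) (by omega), rhoSq_iter_sum, Finset.smul_sum,
      show M + 1 - r = M - r + 1 by omega]
    refine Finset.sum_congr rfl fun j _ => ?_
    rw [rhoSq_iter_smul, smul_smul, ← Function.iterate_add_apply]
    ring_nf
  rw [Finset.sum_congr rfl h1, ← Finset.sum_range_diag_flip (M + 1) fun r j =>
    (c k r * c' (k + 2 * r) j : ℂ) • (rhoSq η)^[r + j] (rank (k + 2 * (r + j)) f)]
  refine Finset.sum_congr rfl fun n _ => ?_
  rw [← h k n]
  push_cast
  rw [Finset.sum_smul]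
  refine Finset.sum_congr rfl fun r hr => ?_
  simp only [Finset.mem_range] at hr
  rw [show r + (n - r) = n by omega]

/-- The coefficients of the identity ladder. -/
def idCoeff (_ n : ℕ) : ℝ := if n = 0 then 1 else 0

theorem ladder_id (η : Fin d → ℝ) (f : Symb d) : ladder η idCoeff f = f := by
  refine rank_ext fun k => ?_
  rw [rank_ladder η _ f k f.totalDegree (by omega), Finset.sum_eq_single 0]
  · simp [idCoeff]
  · intro r _ hr
    simp [idCoeff, hr]
  · simp

theorem ladder_smul (η : Fin d → ℝ) (c : ℕ → ℕ → ℝ) (z : ℂ) (f : Symb d) :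
    ladder η c (z • f) = z • ladder η c f := by
  refine rank_ext fun k => ?_
  have h : (z • f).totalDegree ≤ f.totalDegree :=
    totalDegree_le_of_rank fun k hk => by rw [rank_smul, rank_eq_zero hk, smul_zero]
  rw [rank_smul, rank_ladder η c _ k f.totalDegree (by omega),
    rank_ladder η c f k f.totalDegree (by omega), Finset.smul_sum]
  simp only [rank_smul, rhoSq_iter_smul]
  exact Finset.sum_congr rfl fun r _ => smul_comm _ _ _

theorem ladder_add (η : Fin d → ℝ) (c : ℕ → ℕ → ℝ) (f g : Symb d) :
    ladder η c (f + g) = ladder η c f + ladder η c g := by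
  refine rank_ext fun k => ?_
  have h := MvPolynomial.totalDegree_add f g
  have h1 : f.totalDegree ≤ max f.totalDegree g.totalDegree := le_max_left _ _
  have h2 : g.totalDegree ≤ max f.totalDegree g.totalDegree := le_max_right _ _
  set M := max f.totalDegree g.totalDegree
  rw [rank_add, rank_ladder η c _ k M (by omega), rank_ladder η c f k M (by omega),
    rank_ladder η c g k M (by omega), ← Finset.sum_add_distrib]
  simp only [rank_add, rhoSq_iter_add, smul_add]

theorem ladder_neg (η : Fin d → ℝ) (c : ℕ → ℕ → ℝ) (f : Symb d) :
    ladder η c (-f) = -ladder η c f := by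
  have := ladder_smul η c (-1) f
  rwa [neg_one_csmul, neg_one_csmul] at this

/-! ### Locality and reality -/

/-- A local linear operator which maps fields to fields. -/
structure IsNice (T : Symb d → Symb d) : Prop where
  isLocal : IsLocal T
  dag : ∀ f, dagger (T f) = T (dagger f)

theorem IsNice.comp {T T' : Symb d → Symb d} (h : IsNice T) (h' : IsNice T') :
    IsNice fun f => T (T' f) where
  isLocal f g O hO hfg := h.isLocal _ _ O hO (h'.isLocal f g O hO hfg)
  dag f := by rw [h.dag, h'.dag]

theorem dagger_add (f g : Symb d) : dagger (f + g) = dagger f + dagger g := by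
  ext1 α
  simp only [coeff_dagger, MvPolynomial.coeff_add]
  exact val_ext fun x => map_add (starRingEnd ℂ) _ _

theorem dagger_smul (c : ℂ) (f : Symb d) : dagger (c • f) = (starRingEnd ℂ c) • dagger f := by
  ext1 α
  simp only [coeff_dagger, coeff_csmul]
  exact val_ext fun x => map_mul (starRingEnd ℂ) _ _

theorem dagger_zero : dagger (0 : Symb d) = 0 := by
  ext1 α
  rw [coeff_dagger]
  exact conjFn_zero

theorem dagger_sum {ι : Type*} (t : Finset ι) (f : ι → Symb d) :
    dagger (∑ j ∈ t, f j) = ∑ j ∈ t, dagger (f j) :=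
  map_sum (⟨⟨dagger, dagger_zero⟩, dagger_add⟩ : Symb d →+ Symb d) f t

theorem IsNice.add {T T' : Symb d → Symb d} (h : IsNice T) (h' : IsNice T') :
    IsNice fun f => T f + T' f where
  isLocal f g O hO hfg x hx α := by
    simp only [MvPolynomial.coeff_add, val_add, h.isLocal f g O hO hfg x hx α,
      h'.isLocal f g O hO hfg x hx α]
  dag f := by rw [dagger_add, h.dag, h'.dag]

theorem IsNice.zero : IsNice fun _ : Symb d => (0 : Symb d) where
  isLocal _ _ _ _ _ _ _ _ := rfl
  dag _ := dagger_zero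

theorem IsNice.smul {T : Symb d → Symb d} (h : IsNice T) (c : ℝ) : IsNice fun f => (c : ℂ) • T f where
  isLocal f g O hO hfg x hx α := by
    simp only [coeff_csmul, val_smul, h.isLocal f g O hO hfg x hx α]
  dag f := by rw [dagger_smul, h.dag, Complex.conj_ofReal]

theorem IsNice.sum {ι : Type*} (t : Finset ι) {T : ι → Symb d → Symb d} (h : ∀ j, IsNice (T j)) :
    IsNice fun f => ∑ j ∈ t, T j f := by
  classical
  induction t using Finset.induction_on with
  | empty => simpa using IsNice.zero
  | insert a s ha ih => simpa [Finset.sum_insert ha] using (h a).add ih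

theorem IsNice.congr {T T' : Symb d → Symb d} (h : IsNice T) (e : ∀ f, T f = T' f) : IsNice T' := by
  rwa [← funext e]

theorem conjFn_pd (i : Fin d) (f : smoothFn d) : conjFn (pd i f) = pd i (conjFn f) := by
  apply val_ext
  intro x
  have h : val (conjFn f) = fun y => Complex.conjCLE (val f y) := rfl
  rw [val_pd, h]
  have := (Complex.conjCLE.toContinuousLinearMap.hasFDerivAt.comp x
    (val_differentiable f x).hasFDerivAt).fderiv
  rw [show (fun y => Complex.conjCLE (val f y)) =
    (Complex.conjCLE.toContinuousLinearMap : ℂ → ℂ) ∘ val f from rfl, this]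
  rfl

theorem isNice_dX (i : Fin d) : IsNice (dX (d := d) i) where
  isLocal f g O hO hfg x hx α := by
    rw [coeff_dX, coeff_dX, val_pd, val_pd]
    congr 1
    refine Filter.EventuallyEq.fderiv_eq ?_
    filter_upwards [hO.mem_nhds hx] with y hy using hfg y hy α
  dag f := by
    ext1 α
    rw [coeff_dagger, coeff_dX, coeff_dX, coeff_dagger, conjFn_pd]

theorem isNice_dP (i : Fin d) : IsNice (dP (d := d) i) where
  isLocal f g O hO hfg x hx α := by
    rw [coeff_dP, coeff_dP, val_mul, val_mul, hfg x hx]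
  dag f := by
    ext1 α
    rw [coeff_dagger, coeff_dP, coeff_dP, coeff_dagger]
    refine val_ext fun x => ?_
    change (starRingEnd ℂ) (val _ x * ((α i : ℂ) + 1)) = (starRingEnd ℂ) (val _ x) * ((α i : ℂ) + 1)
    simp

theorem isNice_X (i : Fin d) : IsNice fun f : Symb d => MvPolynomial.X i * f where
  isLocal f g O hO hfg x hx α := by
    rw [MvPolynomial.coeff_X_mul', MvPolynomial.coeff_X_mul']
    split_ifs
    · exact hfg x hx _
    · rfl
  dag f := by
    ext1 α
    rw [coeff_dagger, MvPolynomial.coeff_X_mul', MvPolynomial.coeff_X_mul']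
    split_ifs
    · rw [coeff_dagger]
    · exact conjFn_zero

theorem isNice_rank (s : ℕ) : IsNice (rank (d := d) s) where
  isLocal f g O hO hfg x hx α := by
    rw [coeff_rank, coeff_rank]
    split_ifs
    · exact hfg x hx _
    · rfl
  dag f := by
    ext1 α
    rw [coeff_dagger, coeff_rank, coeff_rank, coeff_dagger]
    split_ifs
    · rfl
    · exact conjFn_zero

theorem isNice_boxX (η : Fin d → ℝ) : IsNice (boxX η) :=
  IsNice.sum _ fun i => ((isNice_dX i).comp (isNice_dX i)).smul _
theorem isNice_trP (η : Fin d → ℝ) : IsNice (trP η) :=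
  IsNice.sum _ fun i => ((isNice_dP i).comp (isNice_dP i)).smul _
theorem isNice_divP : IsNice (divP (d := d)) :=
  IsNice.sum _ fun i => (isNice_dX i).comp (isNice_dP i)
theorem isNice_pGrad (η : Fin d → ℝ) : IsNice (pGrad η) :=
  IsNice.sum _ fun i => ((isNice_X i).comp (isNice_dX i)).smul _
theorem isNice_pSq (η : Fin d → ℝ) : IsNice fun f : Symb d => pSq η * f :=
  (IsNice.sum _ fun i => ((isNice_X i).comp (isNice_X i)).smul _).congr
    fun f => (pSq_eq_C_mul η f).symm
theorem isNice_rhoSq (η : Fin d → ℝ) : IsNice (rhoSq η) :=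
  (((isNice_boxX η).comp (isNice_trP η)).add ((isNice_divP.comp isNice_divP).smul (-1))).congr
    fun f => by simp [rhoSq, sub_eq_add_neg]; module

theorem isNice_rhoSq_iter (η : Fin d → ℝ) (r : ℕ) : IsNice (rhoSq (d := d) η)^[r] := by
  induction r with
  | zero => exact ⟨fun f g O hO hfg => hfg, fun f => rfl⟩
  | succ n ih => exact (ih.comp (isNice_rhoSq η)).congr fun f => rfl

theorem totalDegree_dagger (f : Symb d) : (dagger f).totalDegree ≤ f.totalDegree := by
  refine totalDegree_le_of_rank fun k hk => ?_
  rw [← (isNice_rank k).dag, rank_eq_zero hk, dagger_zero]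

theorem isNice_ladder (η : Fin d → ℝ) (c : ℕ → ℕ → ℝ) : IsNice (ladder η c) := by
  -- The truncation inside `ladder` depends on the argument. For a fixed truncation `N` and rank `k`
  -- one has a finite combination of local real operators, and every component of the ladder agrees
  -- with such a combination once `N` bounds the degrees involved.
  let T : ℕ → ℕ → Symb d → Symb d := fun N k f => ∑ r ∈ Finset.range (N + 1),
    (c k r : ℂ) • (rhoSq η)^[r] (rank (k + 2 * r) f)
  have hT : ∀ N k, IsNice (T N k) := fun N k =>
    IsNice.sum _ fun r => ((isNice_rhoSq_iter η r).comp (isNice_rank _)).smul _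
  have hl : ∀ N k f, f.totalDegree ≤ N → rank k (ladder η c f) = T N k f := fun N k f hf =>
    rank_ladder η c f k N (by omega)
  refine ⟨fun f g O hO hfg x hx α => ?_, fun f => rank_ext fun k => ?_⟩
  · have h := (hT (max f.totalDegree g.totalDegree) α.degree).isLocal f g O hO hfg x hx α
    rw [← hl _ _ f (le_max_left _ _), ← hl _ _ g (le_max_right _ _), coeff_rank, coeff_rank,
      if_pos rfl, if_pos rfl] at h
    exact h
  · rw [← (isNice_rank k).dag, hl _ k f le_rfl, (hT _ _).dag, hl _ k _ (totalDegree_dagger f)]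

/-- Outside the compact union of the supports of its coefficients, `f` agrees with 0 on an open set,
so by locality `T f` agrees there with `T 0`. -/
theorem IsNice.compSupp {T : Symb d → Symb d} (h : IsNice T) (h0 : T 0 = 0) {f : Symb d}
    (hf : IsCompSupp f) : IsCompSupp (T f) := by
  intro α
  let K : Set (Pt d) := ⋃ β ∈ f.support, tsupport (val (f.coeff β))
  have hK : IsCompact K := f.support.isCompact_biUnion fun β _ => hf β
  refine HasCompactSupport.intro hK fun x hx => ?_
  have hz : ∀ y ∈ Kᶜ, ∀ β, val (f.coeff β) y = val ((0 : Symb d).coeff β) y := by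
    intro y hy β
    change _ = (0 : ℂ)
    by_cases hβ : β ∈ f.support
    · refine image_eq_zero_of_notMem_tsupport fun hmem => hy ?_
      exact Set.mem_biUnion hβ hmem
    · rw [MvPolynomial.notMem_support_iff.mp hβ]
      rfl
  rw [h.isLocal f 0 Kᶜ hK.isClosed.isOpen_compl hz x hx α, h0]
  rfl

theorem IsNice.realField {T : Symb d → Symb d} (h : IsNice T) (h0 : T 0 = 0) {f : Symb d}
    (hf : IsRealField f) : IsRealField (T f) :=
  ⟨by rw [h.dag, hf.1], h.compSupp h0 hf.2⟩

theorem IsCompSupp.add {f g : Symb d} (hf : IsCompSupp f) (hg : IsCompSupp g) :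
    IsCompSupp (f + g) := fun α => by
  rw [MvPolynomial.coeff_add]
  exact (hf α).add (hg α)

theorem IsCompSupp.smul {f : Symb d} (hf : IsCompSupp f) (c : ℂ) : IsCompSupp (c • f) := fun α => by
  rw [coeff_csmul]
  exact (hf α).mul_left (f := fun _ => c)

theorem IsCompSupp.zero : IsCompSupp (0 : Symb d) := fun _ => HasCompactSupport.zero

theorem IsCompSupp.sum {ι : Type*} (t : Finset ι) {f : ι → Symb d} (h : ∀ j ∈ t, IsCompSupp (f j)) :
    IsCompSupp (∑ j ∈ t, f j) :=
  Finset.sum_induction _ IsCompSupp (fun _ _ => IsCompSupp.add) IsCompSupp.zero h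

theorem IsRealField.add {f g : Symb d} (hf : IsRealField f) (hg : IsRealField g) :
    IsRealField (f + g) := ⟨by rw [dagger_add, hf.1, hg.1], hf.2.add hg.2⟩

theorem IsRealField.smul {f : Symb d} (hf : IsRealField f) (c : ℝ) :
    IsRealField ((c : ℂ) • f) := ⟨by rw [dagger_smul, hf.1, Complex.conj_ofReal], hf.2.smul c⟩

theorem IsRealField.neg {f : Symb d} (hf : IsRealField f) : IsRealField (-f) := by
  have := hf.smul (-1)
  push_cast at this
  rwa [neg_one_csmul] at this

theorem IsRealField.sub {f g : Symb d} (hf : IsRealField f) (hg : IsRealField g) :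
    IsRealField (f - g) := by
  rw [sub_eq_add_neg]
  exact hf.add hg.neg

theorem ladder_zero (η : Fin d → ℝ) (c : ℕ → ℕ → ℝ) : ladder η c 0 = 0 := by
  have := ladder_smul η c 0 0
  simpa using this

theorem IsRealField.ladder {f : Symb d} (hf : IsRealField f) (η : Fin d → ℝ) (c : ℕ → ℕ → ℝ) :
    IsRealField (ladder η c f) := (isNice_ladder η c).realField (ladder_zero η c) hf

end

section

variable {d : ℕ}

/-! ## Orthogonality relations between the Bessel and the reconstruction coefficients -/

theorem two_rpow_add (x : ℝ) (n : ℕ) : (2 : ℝ) ^ (x + 2 * n) = 2 ^ x * 4 ^ n := by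
  rw [Real.rpow_add two_pos, Real.rpow_mul two_pos.le, Real.rpow_natCast]
  norm_num

theorem besselCoeff_eq (σ : ℝ) (r : ℕ) :
    besselCoeff σ r = (-1) ^ r / (2 ^ σ * 4 ^ r * r.factorial * Real.Gamma (σ + r + 1)) := by
  rw [besselCoeff, two_rpow_add]

/-- The ladder coefficients of `U_{k+ν}((μ/√□)ρ)`, with `m` in place of `(μ/√□)²`. -/
def besselLadder (ν m : ℝ) (k r : ℕ) : ℝ := besselCoeff (k + ν) r * m ^ r

/-- The ladder coefficients of the inverse of `besselLadder`. -/
def inverseLadder (ν m : ℝ) (k r : ℕ) : ℝ :=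
  k.factorial * (-1) ^ r * reconstructCoeff ν (k + 2 * r) r * m ^ r

theorem reconstructCoeff_eq (ν : ℝ) (k r : ℕ) : reconstructCoeff ν (k + 2 * r) r =
    2 ^ ν * (-1) ^ r * 2 ^ k * (Real.Gamma (k + ν + r + 1) + r * Real.Gamma (k + ν + r)) /
      (r.factorial * k.factorial) := by
  unfold reconstructCoeff
  rw [show k + 2 * r - 2 * r = k by omega]
  push_cast
  congr 5 <;> ring_nf

theorem besselLadder_shift (ν m : ℝ) (k j r : ℕ) : besselLadder ν m (k + 2 * j) r =
    (-1) ^ r * m ^ r / (2 ^ ν * 2 ^ k * 4 ^ j * 4 ^ r * r.factorial *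
      Real.Gamma (k + ν + (2 * j + r) + 1)) := by
  unfold besselLadder
  rw [besselCoeff_eq]
  have h1 : ((k + 2 * j : ℕ) : ℝ) + ν = (ν + k) + 2 * j := by push_cast; ring
  have h2 : ((k + 2 * j : ℕ) : ℝ) + ν + r + 1 = k + ν + (2 * j + r) + 1 := by push_cast; ring
  rw [h2, h1, two_rpow_add, Real.rpow_add two_pos, Real.rpow_natCast]
  ring

/-- This is the vanishing of the off-diagonal coefficients of reconstruction after undressing,
proved by an explicit antidifference. -/
theorem inverse_bessel_sum {a : ℝ} (ha : 0 ≤ a) (n : ℕ) (hn : 0 < n) :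
    ∑ r ∈ Finset.range (n + 1), (-1 : ℝ) ^ (n - r) *
      (Real.Gamma (a + r + 1) + r * Real.Gamma (a + r)) /
        (r.factorial * (n - r).factorial * Real.Gamma (a + n + r + 1)) = 0 := by
  have hG : ∀ x : ℝ, 0 < x → Real.Gamma x ≠ 0 := fun x hx => (Real.Gamma_pos_of_pos hx).ne'
  have hn0 : (n : ℝ) ≠ 0 := by positivity
  -- The antidifference of the summand. The factor r gives H 0 = 0, and the last term of the sum,
  -- kept apart because n - (r + 1) would truncate there, equals -H n.
  let H : ℕ → ℝ := fun r => -(-1) ^ (n - r) * r * Real.Gamma (a + r) /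
    (n * r.factorial * (n - r).factorial * Real.Gamma (a + n + r))
  have key : ∀ r ∈ Finset.range n, (-1 : ℝ) ^ (n - r) *
      (Real.Gamma (a + r + 1) + r * Real.Gamma (a + r)) /
        (r.factorial * (n - r).factorial * Real.Gamma (a + n + r + 1)) = H (r + 1) - H r := by
    intro r hr
    obtain ⟨t, rfl⟩ := Nat.exists_eq_add_of_lt (Finset.mem_range.mp hr)
    have e1 : r + t + 1 - r = t + 1 := by omega
    have e2 : r + t + 1 - (r + 1) = t := by omega
    simp only [H, e1, e2]
    -- For a = r = 0, which occurs when d = 3 and k = 0, the functional equation of Γ is not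
    -- available at the pole; the factor r makes the identity hold there too.
    have h1 : r * Real.Gamma (a + r + 1) = r * ((a + r) * Real.Gamma (a + r)) := by
      rcases Nat.eq_zero_or_pos r with h | h
      · simp [h]
      · rw [Real.Gamma_add_one]
        positivity
    have h2 : Real.Gamma (a + (r + t + 1 : ℕ) + r + 1) =
        (a + (r + t + 1 : ℕ) + r) * Real.Gamma (a + (r + t + 1 : ℕ) + r) := by
      rw [Real.Gamma_add_one]; positivity
    have h3 := hG (a + (r + t + 1 : ℕ) + r) (by positivity)
    have h4 : a + (r + t + 1 : ℕ) + r ≠ 0 := by positivity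
    have e3 : a + ((r + t + 1 : ℕ) : ℝ) + ((r + 1 : ℕ) : ℝ) = a + (r + t + 1 : ℕ) + r + 1 := by
      push_cast; ring
    have e4 : a + ((r + 1 : ℕ) : ℝ) = a + r + 1 := by push_cast; ring
    rw [e3, e4, h2, Nat.factorial_succ, Nat.factorial_succ]
    generalize Real.Gamma (a + (r + t + 1 : ℕ) + r) = Γ₁ at *
    generalize Real.Gamma (a + r + 1) = Γ₂ at *
    generalize Real.Gamma (a + r) = Γ₃ at *
    push_cast at *
    field_simp
    linear_combination (-(-1) ^ t) * h1
  rw [Finset.sum_range_succ, Finset.sum_congr rfl key, Finset.sum_range_sub]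
  have h2 : Real.Gamma (a + n + n + 1) = (a + n + n) * Real.Gamma (a + n + n) := by
    rw [Real.Gamma_add_one]; positivity
  have h3 := hG (a + n + n) (by positivity)
  have h4 : Real.Gamma (a + n + 1) = (a + n) * Real.Gamma (a + n) := by
    rw [Real.Gamma_add_one]; positivity
  have h5 : a + n + n ≠ 0 := by positivity
  simp only [H, Nat.sub_self, h2, h4]
  push_cast
  field_simp
  ring

/-- The composition in the opposite order gives a different sum, since the rank shift now sits in
the argument of the inverse coefficients; it telescopes with its own antidifference, which again
vanishes at 0 and equals minus the last term at n. -/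
theorem bessel_inverse_sum {a : ℝ} (ha : 0 ≤ a) (n : ℕ) (hn : 0 < n) :
    ∑ j ∈ Finset.range (n + 1), (-1 : ℝ) ^ j *
      (Real.Gamma (a + n + j + 1) + ((n - j : ℕ) : ℝ) * Real.Gamma (a + n + j)) /
        (j.factorial * (n - j).factorial * Real.Gamma (a + j + 1)) = 0 := by
  have hG : ∀ x : ℝ, 0 < x → Real.Gamma x ≠ 0 := fun x hx => (Real.Gamma_pos_of_pos hx).ne'
  have hn0 : (n : ℝ) ≠ 0 := by positivity
  let H : ℕ → ℝ := fun j => -(-1) ^ j * (a + 2 * n) * (j * (a + j)) * Real.Gamma (a + n + j) /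
    ((a + n) * n * j.factorial * (n - j).factorial * Real.Gamma (a + j + 1))
  have key : ∀ j ∈ Finset.range n, (-1 : ℝ) ^ j *
      (Real.Gamma (a + n + j + 1) + ((n - j : ℕ) : ℝ) * Real.Gamma (a + n + j)) /
        (j.factorial * (n - j).factorial * Real.Gamma (a + j + 1)) = H (j + 1) - H j := by
    intro r hr
    obtain ⟨t, rfl⟩ := Nat.exists_eq_add_of_lt (Finset.mem_range.mp hr)
    have e1 : r + t + 1 - r = t + 1 := by omega
    have e2 : r + t + 1 - (r + 1) = t := by omega
    simp only [H, e1, e2]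
    have h1 : Real.Gamma (a + r + 1 + 1) = (a + r + 1) * Real.Gamma (a + r + 1) := by
      rw [Real.Gamma_add_one]; positivity
    have h2 : Real.Gamma (a + (r + t + 1 : ℕ) + r + 1) =
        (a + (r + t + 1 : ℕ) + r) * Real.Gamma (a + (r + t + 1 : ℕ) + r) := by
      rw [Real.Gamma_add_one]; positivity
    have h3 := hG (a + r + 1) (by positivity)
    have h4 : a + (r + t + 1 : ℕ) ≠ 0 := by positivity
    have h5 : a + r + 1 ≠ 0 := by positivity
    have e3 : a + ((r + t + 1 : ℕ) : ℝ) + ((r + 1 : ℕ) : ℝ) = a + (r + t + 1 : ℕ) + r + 1 := by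
      push_cast; ring
    have e4 : a + ((r + 1 : ℕ) : ℝ) = a + r + 1 := by push_cast; ring
    rw [e3, e4, h2, h1, Nat.factorial_succ, Nat.factorial_succ]
    generalize Real.Gamma (a + (r + t + 1 : ℕ) + r) = Γ₁ at *
    generalize Real.Gamma (a + r + 1) = Γ₂ at *
    push_cast at *
    field_simp
    ring
  rw [Finset.sum_range_succ, Finset.sum_congr rfl key, Finset.sum_range_sub]
  have h2 : Real.Gamma (a + n + n + 1) = (a + n + n) * Real.Gamma (a + n + n) := by
    rw [Real.Gamma_add_one]; positivity
  have h3 := hG (a + n + 1) (by positivity)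
  have h5 : a + n ≠ 0 := by positivity
  simp only [H, Nat.sub_self, h2]
  push_cast
  field_simp
  ring

theorem inverse_bessel {ν : ℝ} (hν : 0 ≤ ν) (m : ℝ) (k n : ℕ) :
    ∑ r ∈ Finset.range (n + 1), inverseLadder ν m k r * besselLadder ν m (k + 2 * r) (n - r) =
      idCoeff k n := by
  have ha : 0 ≤ (k : ℝ) + ν := by positivity
  have h2 : (2 : ℝ) ^ ν ≠ 0 := (Real.rpow_pos_of_pos two_pos ν).ne'
  have key : ∀ r ∈ Finset.range (n + 1),
      inverseLadder ν m k r * besselLadder ν m (k + 2 * r) (n - r) =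
      m ^ n / 4 ^ n * ((-1 : ℝ) ^ (n - r) *
        (Real.Gamma (k + ν + r + 1) + r * Real.Gamma (k + ν + r)) /
        (r.factorial * (n - r).factorial * Real.Gamma (k + ν + n + r + 1))) := by
    intro r hr
    obtain ⟨t, rfl⟩ := Nat.exists_eq_add_of_le (Nat.lt_succ_iff.mp (Finset.mem_range.mp hr))
    rw [show r + t - r = t by omega, besselLadder_shift, inverseLadder, reconstructCoeff_eq]
    have e : (k : ℝ) + ν + (2 * r + t) + 1 = k + ν + (r + t : ℕ) + r + 1 := by push_cast; ring
    have h3 : Real.Gamma (k + ν + (r + t : ℕ) + r + 1) ≠ 0 :=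
      (Real.Gamma_pos_of_pos (by positivity)).ne'
    have h4 : ((-1 : ℝ) ^ r) ^ 2 = 1 := by rw [← pow_mul, mul_comm, pow_mul]; norm_num
    rw [e]
    generalize Real.Gamma (k + ν + (r + t : ℕ) + r + 1) = Γ₁ at *
    generalize Real.Gamma (k + ν + r + 1) = Γ₂ at *
    generalize Real.Gamma (k + ν + r) = Γ₃ at *
    rw [pow_add, pow_add]
    field_simp
    linear_combination (m ^ r * m ^ t * (Γ₂ + r * Γ₃)) * h4
  rw [Finset.sum_congr rfl key, ← Finset.mul_sum]
  rcases Nat.eq_zero_or_pos n with rfl | hn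
  · have : Real.Gamma (k + ν + 1) ≠ 0 := (Real.Gamma_pos_of_pos (by positivity)).ne'
    simp [idCoeff, this]
  · rw [inverse_bessel_sum ha n hn, mul_zero, idCoeff, if_neg hn.ne']

theorem bessel_inverse {ν : ℝ} (hν : 0 ≤ ν) (m : ℝ) (k n : ℕ) :
    ∑ r ∈ Finset.range (n + 1), besselLadder ν m k r * inverseLadder ν m (k + 2 * r) (n - r) =
      idCoeff k n := by
  have ha : 0 ≤ (k : ℝ) + ν := by positivity
  have h2 : (2 : ℝ) ^ ν ≠ 0 := (Real.rpow_pos_of_pos two_pos ν).ne'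
  have key : ∀ r ∈ Finset.range (n + 1),
      besselLadder ν m k r * inverseLadder ν m (k + 2 * r) (n - r) =
      m ^ n * ((-1 : ℝ) ^ r *
      (Real.Gamma (k + ν + n + r + 1) + ((n - r : ℕ) : ℝ) * Real.Gamma (k + ν + n + r)) /
        (r.factorial * (n - r).factorial * Real.Gamma (k + ν + r + 1))) := by
    intro r hr
    obtain ⟨t, rfl⟩ := Nat.exists_eq_add_of_le (Nat.lt_succ_iff.mp (Finset.mem_range.mp hr))
    have hb := besselLadder_shift ν m k 0 r
    simp only [mul_zero, add_zero, pow_zero, mul_one, Nat.cast_zero, zero_add] at hb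
    rw [show r + t - r = t by omega, hb, inverseLadder, reconstructCoeff_eq]
    have e : ((k + 2 * r : ℕ) : ℝ) + ν + t = k + ν + (r + t : ℕ) + r := by push_cast; ring
    have h3 : Real.Gamma (k + ν + r + 1) ≠ 0 := (Real.Gamma_pos_of_pos (by positivity)).ne'
    have h4 : ((-1 : ℝ) ^ t) ^ 2 = 1 := by rw [← pow_mul, mul_comm, pow_mul]; norm_num
    have h5 : (2 : ℝ) ^ (k + 2 * r) = 2 ^ k * 4 ^ r := by rw [pow_add, pow_mul]; norm_num
    rw [e, h5]
    generalize Real.Gamma (k + ν + (r + t : ℕ) + r + 1) = Γ₁ at *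
    generalize Real.Gamma (k + ν + r + 1) = Γ₂ at *
    generalize Real.Gamma (k + ν + (r + t : ℕ) + r) = Γ₃ at *
    rw [pow_add]
    field_simp
    linear_combination (m ^ r * m ^ t * (Γ₁ + t * Γ₃)) * h4
  rw [Finset.sum_congr rfl key, ← Finset.mul_sum]
  rcases Nat.eq_zero_or_pos n with rfl | hn
  · have : Real.Gamma (k + ν + 1) ≠ 0 := (Real.Gamma_pos_of_pos (by positivity)).ne'
    simp [idCoeff, this]
  · rw [bessel_inverse_sum ha n hn, mul_zero, idCoeff, if_neg hn.ne']

theorem ladder_inverse_bessel (η : Fin d → ℝ) {ν : ℝ} (hν : 0 ≤ ν) (m : ℝ) (f : Symb d) :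
    ladder η (inverseLadder ν m) (ladder η (besselLadder ν m) f) = f := by
  rw [ladder_comp η _ _ _ (inverse_bessel hν m), ladder_id]

theorem ladder_bessel_inverse (η : Fin d → ℝ) {ν : ℝ} (hν : 0 ≤ ν) (m : ℝ) (f : Symb d) :
    ladder η (besselLadder ν m) (ladder η (inverseLadder ν m) f) = f := by
  rw [ladder_comp η _ _ _ (bessel_inverse hν m), ladder_id]

/-! ## The undressing and reconstruction maps are ladders -/

theorem undress_eq (ħ : ℝ) (η : Fin d → ℝ) (h : Symb d) :
    undress ħ η h = ladder η (besselLadder (nu d) (muRatioSq ħ)) h := by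
  unfold undress ladder
  refine Finset.sum_congr rfl fun s _ => ?_
  rw [rank_sum]
  refine Finset.sum_congr rfl fun r _ => ?_
  rw [rank_smul, rank_rhoSq_iter]
  simp [besselLadder]

/-- The phases combine to i^(k+2r)/i^k = (-1)^r, so the coefficients are real; this is why the map
preserves real fields. -/
theorem reconstruct_eq (ħ : ℝ) (η : Fin d → ℝ) (φ : Symb d) :
    reconstruct ħ η φ = ladder η (inverseLadder (nu d) (muRatioSq ħ)) φ := by
  unfold reconstruct ladder
  refine Finset.sum_congr rfl fun k _ => Finset.sum_congr rfl fun r _ => ?_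
  congr 1
  have h1 : Complex.I ^ (k + 2 * r) = Complex.I ^ k * (-1) ^ r := by
    rw [pow_add, pow_mul, Complex.I_sq]
  have h2 : Complex.I ^ k ≠ 0 := pow_ne_zero _ Complex.I_ne_zero
  rw [h1]
  simp only [inverseLadder]
  push_cast
  field_simp

theorem nu_nonneg (hd : 3 ≤ d) : 0 ≤ nu d := by
  have : (3 : ℝ) ≤ d := by exact_mod_cast hd
  unfold nu
  linarith

/-! ## Exchange of the deformed and the plain gauge transformations -/

/-- The Bessel equation for the series, in product form. It is used twice: to cancel μ²a in the
gauge transformations of fields, and to show that the deformed kernels solve the mass-shell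
equation. -/
theorem besselCoeff_succ {σ : ℝ} (hσ : 0 ≤ σ) (r : ℕ) :
    besselCoeff σ (r + 1) * (4 * (r + 1) * (σ + (r + 1))) = -besselCoeff σ r := by
  rw [besselCoeff_eq, besselCoeff_eq]
  have h1 : Real.Gamma (σ + (r + 1 : ℕ) + 1) = (σ + (r + 1)) * Real.Gamma (σ + r + 1) := by
    have : σ + (r + 1 : ℕ) + 1 = (σ + r + 1) + 1 := by push_cast; ring
    rw [this, Real.Gamma_add_one (by positivity), add_assoc]
  have h2 : Real.Gamma (σ + r + 1) ≠ 0 := (Real.Gamma_pos_of_pos (by positivity)).ne'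
  have h3 : σ + (r + 1) ≠ 0 := by positivity
  have h4 : (2 : ℝ) ^ σ ≠ 0 := (Real.rpow_pos_of_pos two_pos σ).ne'
  rw [h1, Nat.factorial_succ]
  push_cast
  field_simp
  ring

theorem rho_grad_iter {η : Fin d → ℝ} (hη : ∀ i, η i = 1 ∨ η i = -1) (r : ℕ) (f : Symb d) :
    (rhoSq η)^[r] (pGrad η f) = pGrad η ((rhoSq η)^[r] f) := by
  induction r generalizing f with
  | zero => rfl
  | succ n ih => rw [Function.iterate_succ_apply, rho_grad hη, ih, Function.iterate_succ_apply]

theorem euler_of_isHomogeneous {f : Symb d} {n : ℕ} (h : f.IsHomogeneous n) :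
    euler f = (n : ℂ) • f := by
  have : euler f = n • f := by
    rw [← h.sum_X_mul_pderiv]
    rfl
  rw [this, Nat.cast_smul_eq_nsmul]

theorem isHomogeneous_iff_rank {f : Symb d} {n : ℕ} : f.IsHomogeneous n ↔ rank n f = f := by
  constructor
  · intro h
    ext1 α
    rw [coeff_rank]
    split_ifs with h'
    · rfl
    · exact (h.coeff_eq_zero h').symm
  · intro h
    rw [← h]
    exact rank_isHomogeneous n f

/-- Moving p² through the factors ρ² one at a time, the Euler operator takes the values t + 2r, …, t
+ 2, t. The arithmetic progression of the resulting □ coefficients sums to the stated product, and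
the r + 1 gradient terms are equal because ρ² commutes with p∂ and with the divergence. -/
theorem rhoSq_iter_succ_pSq {η : Fin d → ℝ} (hη : ∀ i, η i = 1 ∨ η i = -1) (t r : ℕ) (f : Symb d) :
    (rhoSq η)^[r + 1] (pSq η * rank (t + 2 * r) f) =
      pSq η * (rhoSq η)^[r + 1] (rank (t + 2 * r) f) +
      ((r + 1 : ℂ) * (4 * t + 4 * r + 2 * d - 2)) •
        boxX η ((rhoSq η)^[r] (rank (t + 2 * r) f)) -
      (4 * (r + 1) : ℂ) • pGrad η (divP ((rhoSq η)^[r] (rank (t + 2 * r) f))) := by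
  have hb : ∀ (c : ℂ) (g : Symb d), boxX η (c • g) = c • boxX η g := fun c g => by
    simp only [← boxL_apply, map_smul]
  have hrb : ∀ g : Symb d, rhoSq η (boxX η g) = boxX η (rhoSq η g) := fun g => by
    simp only [← boxL_apply, ← rhoL_apply]
    exact LinearMap.congr_fun (comm_box_rho η).eq.symm g
  have hrd : ∀ g : Symb d, rhoSq η (divP g) = divP (rhoSq η g) := fun g => by
    simp only [← divL_apply, ← rhoL_apply]
    exact LinearMap.congr_fun (comm_div_rho η).eq.symm g
  have hra : ∀ g g' : Symb d, rhoSq η (g + g') = rhoSq η g + rhoSq η g' := fun g g' => by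
    simp only [← rhoL_apply, map_add]
  have hrs : ∀ g g' : Symb d, rhoSq η (g - g') = rhoSq η g - rhoSq η g' := fun g g' => by
    simp only [← rhoL_apply, map_sub]
  have hrm : ∀ (c : ℂ) (g : Symb d), rhoSq η (c • g) = c • rhoSq η g := fun c g => by
    simp only [← rhoL_apply, map_smul]
  induction r generalizing t with
  | zero =>
    simp only [zero_add, Function.iterate_one, Function.iterate_zero, id]
    rw [rho_pSq hη, euler_of_isHomogeneous (rank_isHomogeneous (t + 2 * 0) f), hb]
    push_cast
    module
  | succ n ih =>
    have e : t + 2 * (n + 1) = (t + 2) + 2 * n := by ring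
    have ihn := ih (t + 2)
    rw [← e] at ihn
    have hh : euler ((rhoSq η)^[n + 1] (rank (t + 2 * (n + 1)) f)) =
        (t : ℂ) • (rhoSq η)^[n + 1] (rank (t + 2 * (n + 1)) f) := by
      apply euler_of_isHomogeneous
      rw [isHomogeneous_iff_rank, rank_iter_rank, if_pos rfl]
    rw [Function.iterate_succ_apply', ihn, hrs, hra, rho_pSq hη, hh, hrm, hrm, hrb, rho_grad hη,
      hrd, hb]
    rw [← Function.iterate_succ_apply' (rhoSq η) n, ← Function.iterate_succ_apply' (rhoSq η) (n + 1)]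
    push_cast
    module

theorem totalDegree_boxX (η : Fin d → ℝ) (f : Symb d) :
    (boxX η f).totalDegree ≤ f.totalDegree :=
  totalDegree_le_of_rank fun k hk => by
    rw [rank_boxX, rank_eq_zero hk, ← boxL_apply, map_zero]

theorem totalDegree_pGrad (η : Fin d → ℝ) (f : Symb d) :
    (pGrad η f).totalDegree ≤ f.totalDegree + 1 :=
  totalDegree_le_of_rank fun k hk => by
    obtain ⟨j, rfl⟩ := Nat.exists_eq_add_of_lt hk
    rw [rank_pGrad, rank_eq_zero (by omega), ← gradL_apply, map_zero]

theorem totalDegree_pSq_mul (η : Fin d → ℝ) (f : Symb d) :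
    (pSq η * f).totalDegree ≤ f.totalDegree + 2 :=
  totalDegree_le_of_rank fun k hk => by
    obtain ⟨j, rfl⟩ := Nat.exists_eq_add_of_lt hk
    rw [show f.totalDegree + 2 + j + 1 = f.totalDegree + j + 1 + 2 by ring, rank_pSq_mul,
      rank_eq_zero (by omega), mul_zero]

theorem totalDegree_divP (f : Symb d) : (divP f).totalDegree ≤ f.totalDegree :=
  totalDegree_le_of_rank fun k hk => by
    rw [rank_divP, rank_eq_zero (by omega), ← divL_apply, map_zero]

/-- ρ² commutes with p∂, but p∂ raises the rank by one and the Bessel index is tied to the rank;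
hence the shift of ν by one. In rank 0 both sides vanish: the remaining terms would need (ρ²)^(r+1)
on a tensor of rank 2r + 1. -/
theorem ladder_bessel_grad {η : Fin d → ℝ} (hη : ∀ i, η i = 1 ∨ η i = -1) (ν m : ℝ) (f : Symb d) :
    ladder η (besselLadder ν m) (pGrad η f) = pGrad η (ladder η (besselLadder (ν + 1) m) f) := by
  have hd := totalDegree_pGrad η f
  refine rank_ext fun k => ?_
  rw [rank_ladder η _ _ k f.totalDegree (by omega)]
  cases k with
  | zero =>
    rw [rank_zero_pGrad]
    refine Finset.sum_eq_zero fun r _ => ?_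
    rcases r with _ | r
    · rw [mul_zero, add_zero, rank_zero_pGrad, rhoSq_iter_zero, smul_zero]
    · rw [show 0 + 2 * (r + 1) = (2 * r + 1) + 1 by ring, rank_pGrad, rho_grad_iter hη,
        ← pGrad_smul]
      have hz : (rhoSq η)^[r + 1] (rank (2 * r + 1) f) = 0 := by
        refine rank_ext fun s => ?_
        rw [rank_rhoSq_iter, rank_rank, if_neg (by omega), rhoSq_iter_zero, rank_zero]
      rw [hz, smul_zero, ← gradL_apply, map_zero]
  | succ k =>
    rw [rank_pGrad, rank_ladder η _ f k f.totalDegree (by omega), pGrad_sum]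
    refine Finset.sum_congr rfl fun r _ => ?_
    rw [show k + 1 + 2 * r = (k + 2 * r) + 1 by ring, rank_pGrad, rho_grad_iter hη, ← pGrad_smul]
    unfold besselLadder
    congr 5
    push_cast
    ring_nf

/-- The coefficients of the compensating part of the vector gauge parameter. -/
def shiftLadder (ν m : ℝ) (k r : ℕ) : ℝ :=
  -4 * (r + 1) * besselCoeff (k + 1 + ν) (r + 1) * m ^ (r + 1)

/-- Of the three terms of the commutator of (ρ²)^(r+1) with p², the □ term cancels against μ²a, p²
itself shifts ν by two because it raises the rank by two, and the gradient is a vector gauge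
transformation. The cancellation fixes ν. -/
theorem ladder_bessel_weyl {η : Fin d → ℝ} (hη : ∀ i, η i = 1 ∨ η i = -1) {ν m : ℝ}
    (hν : 0 ≤ ν) (hdν : 2 * ν = d - 3) (f : Symb d) :
    ladder η (besselLadder ν m) (pSq η * f + (m : ℂ) • boxX η f) =
      pSq η * ladder η (besselLadder (ν + 2) m) f +
        pGrad η (ladder η (shiftLadder ν m) (divP f)) := by
  have hdC : 2 * (ν : ℂ) = d - 3 := by exact_mod_cast congrArg Complex.ofReal hdν
  have h1 := totalDegree_pSq_mul η f
  have h2 := totalDegree_boxX η f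
  have h3 := totalDegree_divP f
  set M := f.totalDegree with hM
  have hb : ∀ (c : ℂ) (g : Symb d), boxX η (c • g) = c • boxX η g := fun c g => by
    simp only [← boxL_apply, map_smul]
  have hrbi : ∀ (r : ℕ) (g : Symb d), (rhoSq η)^[r] (boxX η g) = boxX η ((rhoSq η)^[r] g) := by
    intro r g
    simp only [← boxL_apply, ← rhoL_pow_apply]
    exact LinearMap.congr_fun ((comm_box_rho η).pow_right r).eq.symm g
  have hrdi : ∀ (r : ℕ) (g : Symb d), (rhoSq η)^[r] (divP g) = divP ((rhoSq η)^[r] g) := by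
    intro r g
    simp only [← divL_apply, ← rhoL_pow_apply]
    exact LinearMap.congr_fun ((comm_div_rho η).pow_right r).eq.symm g
  have hz : ∀ r : ℕ, M < r → (rhoSq η)^[r] f = 0 := by
    intro r hr
    refine rank_ext fun s => ?_
    rw [rank_rhoSq_iter, rank_eq_zero (by omega), rhoSq_iter_zero, rank_zero]
  refine rank_ext fun k => ?_
  rw [ladder_add, ladder_smul, rank_add, rank_add, rank_smul,
    rank_ladder η _ _ k (M + 1) (by omega), rank_ladder η _ _ k M (by omega)]
  -- the component of the variation along `p²`
  have key : ∀ r : ℕ, (besselLadder ν m k (r + 1) : ℂ) •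
      (rhoSq η)^[r + 1] (rank (k + 2 * (r + 1)) (pSq η * f)) =
      (besselLadder ν m k (r + 1) : ℂ) • (pSq η * (rhoSq η)^[r + 1] (rank (k + 2 * r) f)) +
      (-(besselLadder ν m k r * m) : ℂ) • boxX η ((rhoSq η)^[r] (rank (k + 2 * r) f)) +
      pGrad η ((-4 * (r + 1) * besselLadder ν m k (r + 1) : ℂ) •
        divP ((rhoSq η)^[r] (rank (k + 2 * r) f))) := by
    intro r
    have hs := besselCoeff_succ (σ := k + ν) (by positivity) r
    have hs' := congrArg Complex.ofReal hs
    push_cast at hs'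
    rw [show k + 2 * (r + 1) = (k + 2 * r) + 2 by ring, rank_pSq_mul, rhoSq_iter_succ_pSq hη,
      pGrad_smul]
    -- The condition 2ν = d - 3 turns 4k + 4r + 2d - 2 into 4(k + ν + r + 1), which is the factor of
    -- the Bessel recursion at index k + ν.
    have e : (besselLadder ν m k (r + 1) : ℂ) * ((r + 1 : ℂ) * (4 * k + 4 * r + 2 * d - 2)) =
        -(besselLadder ν m k r * m) := by
      simp only [besselLadder]
      push_cast
      rw [show (d : ℂ) = 2 * ν + 3 by linear_combination -hdC]
      linear_combination (m : ℂ) ^ (r + 1) * hs'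
    rw [smul_sub, smul_add, smul_smul, e]
    module
  rw [Finset.sum_range_succ' _ (M + 1), Finset.sum_congr rfl fun r _ => key r]
  simp only [Finset.sum_add_distrib, Finset.smul_sum, rank_boxX, hrbi]
  have hbox : ∑ r ∈ Finset.range (M + 1), (-(besselLadder ν m k r * m) : ℂ) •
        boxX η ((rhoSq η)^[r] (rank (k + 2 * r) f)) +
      ∑ r ∈ Finset.range (M + 1), (m : ℂ) • (besselLadder ν m k r : ℂ) •
        boxX η ((rhoSq η)^[r] (rank (k + 2 * r) f)) = 0 := by
    rw [← Finset.sum_add_distrib]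
    exact Finset.sum_eq_zero fun r _ => by module
  have hgrad : ∑ r ∈ Finset.range (M + 1), pGrad η
        ((-4 * (r + 1) * besselLadder ν m k (r + 1) : ℂ) •
          divP ((rhoSq η)^[r] (rank (k + 2 * r) f))) =
      rank k (pGrad η (ladder η (shiftLadder ν m) (divP f))) := by
    rw [← pGrad_sum]
    cases k with
    | zero =>
      rw [rank_zero_pGrad, Finset.sum_eq_zero, ← gradL_apply, map_zero]
      intro r _
      have : divP ((rhoSq η)^[r] (rank (0 + 2 * r) f)) = 0 := by
        refine rank_ext fun s => ?_
        rw [rank_divP, rank_iter_rank, if_neg (by omega), ← divL_apply, map_zero, rank_zero]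
      rw [this, smul_zero]
    | succ k =>
      rw [rank_pGrad, rank_ladder η _ _ k M (by omega)]
      congr 1
      refine Finset.sum_congr rfl fun r _ => ?_
      rw [rank_divP, hrdi, show k + 2 * r + 1 = k + 1 + 2 * r by ring]
      congr 1
      simp only [shiftLadder, besselLadder]
      push_cast
      ring
  have hsq : ∑ r ∈ Finset.range (M + 1), (besselLadder ν m k (r + 1) : ℂ) •
        (pSq η * (rhoSq η)^[r + 1] (rank (k + 2 * r) f)) +
      (besselLadder ν m k 0 : ℂ) • rank k (pSq η * f) =
      rank k (pSq η * ladder η (besselLadder (ν + 2) m) f) := by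
    -- In ranks 0 and 1 there is no component of p² times a symbol, and the corresponding sum
    -- vanishes because r + 1 applications of ρ² need rank at least 2r + 2.
    have hlow : ∀ l r : ℕ, l < 2 → (rhoSq η)^[r + 1] (rank (l + 2 * r) f) = 0 := by
      intro l r hl
      refine rank_ext fun s => ?_
      rw [rank_rhoSq_iter, rank_rank, if_neg (by omega), rhoSq_iter_zero, rank_zero]
    rcases k with _ | _ | k
    · rw [rank_zero_pSq_mul, rank_zero_pSq_mul, smul_zero, add_zero]
      exact Finset.sum_eq_zero fun r _ => by rw [hlow 0 r (by omega), mul_zero, smul_zero]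
    · rw [rank_one_pSq_mul, rank_one_pSq_mul, smul_zero, add_zero]
      exact Finset.sum_eq_zero fun r _ => by rw [hlow 1 r (by omega), mul_zero, smul_zero]
    · rw [show k + 1 + 1 = k + 2 by ring, rank_pSq_mul, rank_pSq_mul,
        rank_ladder η _ _ k M (by omega), Finset.mul_sum, Finset.sum_range_succ, Finset.sum_range_succ',
        rank_eq_zero (s := k + 2 + 2 * M) (by omega), rhoSq_iter_zero, mul_zero, smul_zero,
        add_zero]
      have hc : ∀ r, besselLadder ν m (k + 2) r = besselLadder (ν + 2) m k r := fun r => by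
        unfold besselLadder
        congr 2
        push_cast
        ring
      congr 1
      · refine Finset.sum_congr rfl fun r _ => ?_
        rw [hc, mul_smul_comm, show k + 2 + 2 * r = k + 2 * (r + 1) by ring]
      · rw [hc, mul_smul_comm]
        simp
  have e0 : (rhoSq η)^[0] (rank (k + 2 * 0) (pSq η * f)) = rank k (pSq η * f) := rfl
  rw [hgrad, ← hsq, e0]
  linear_combination hbox

end

/-! ### Gauge transformations of the undressed field -/

section

variable {d : ℕ}

theorem ladder_sub (η : Fin d → ℝ) (c : ℕ → ℕ → ℝ) (f g : Symb d) :
    ladder η c (f - g) = ladder η c f - ladder η c g := by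
  rw [sub_eq_add_neg, ladder_add, ladder_neg, ← sub_eq_add_neg]

/-- The vector gauge parameter of the undressed field. -/
def undressedVector (ħ : ℝ) (η : Fin d → ℝ) (a ε : Symb d) : Symb d :=
  ladder η (besselLadder (nu d + 1) (muRatioSq ħ)) ε +
    ladder η (shiftLadder (nu d) (muRatioSq ħ)) (divP a)

theorem undress_deformedGauge (hd : 3 ≤ d) {η : Fin d → ℝ} (hη : ∀ i, η i = 1 ∨ η i = -1) (ħ : ℝ)
    (a ε : Symb d) : undress ħ η (deformedGauge ħ η a ε) =
      plainGauge η (ladder η (besselLadder (nu d + 2) (muRatioSq ħ)) a)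
        (undressedVector ħ η a ε) := by
  have hm : (-(ħ ^ 2 / 4) : ℂ) = (muRatioSq ħ : ℂ) := by simp [muRatioSq]
  rw [undress_eq, deformedGauge, hm, ladder_sub, ladder_smul, ladder_smul,
    ladder_bessel_weyl hη (nu_nonneg hd) (by unfold nu; ring), ladder_bessel_grad hη, plainGauge,
    undressedVector, pGrad_add]
  module

theorem IsRealField.undressedVector {a ε : Symb d} (ha : IsRealField a) (hε : IsRealField ε)
    (ħ : ℝ) (η : Fin d → ℝ) : IsRealField (undressedVector ħ η a ε) :=
  (hε.ladder _ _).add ((isNice_divP.realField (by simp [divP]) ha).ladder _ _)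

theorem reconstruct_undress (hd : 3 ≤ d) (ħ : ℝ) (η : Fin d → ℝ) (h : Symb d) :
    reconstruct ħ η (undress ħ η h) = h := by
  rw [undress_eq, reconstruct_eq, ladder_inverse_bessel η (nu_nonneg hd)]

theorem undress_reconstruct (hd : 3 ≤ d) (ħ : ℝ) (η : Fin d → ℝ) (φ : Symb d) :
    undress ħ η (reconstruct ħ η φ) = φ := by
  rw [undress_eq, reconstruct_eq, ladder_bessel_inverse η (nu_nonneg hd)]

/-- The change of gauge parameters is triangular, since the new vector parameter also receives a
contribution of `a`. It is inverted by solving for `a` with the inverse ladder at ν + 2, then for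
`ε` at ν + 1 after subtracting that contribution. -/
theorem exists_reconstruct_plainGauge (hd : 3 ≤ d) {η : Fin d → ℝ} (hη : ∀ i, η i = 1 ∨ η i = -1)
    (ħ : ℝ) {a' ε' : Symb d} (ha : IsRealField a') (hε : IsRealField ε') :
    ∃ a ε, IsRealField a ∧ IsRealField ε ∧
      reconstruct ħ η (plainGauge η a' ε') = deformedGauge ħ η a ε := by
  set m := muRatioSq ħ with hm
  have hν := nu_nonneg hd
  set a := ladder η (inverseLadder (nu d + 2) m) a' with ha_def
  have haR : IsRealField a := ha.ladder _ _
  set b := ladder η (shiftLadder (nu d) m) (divP a)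
  have hbR : IsRealField b := (isNice_divP.realField (by simp [divP]) haR).ladder _ _
  set ε := ladder η (inverseLadder (nu d + 1) m) (ε' - b) with hε_def
  refine ⟨a, ε, haR, (hε.sub hbR).ladder _ _, ?_⟩
  rw [← reconstruct_undress hd ħ η (deformedGauge ħ η a ε), undress_deformedGauge hd hη, ← hm,
    ha_def, ladder_bessel_inverse η (by linarith)]
  congr 2
  rw [undressedVector, ← hm, hε_def, ladder_bessel_inverse η (by linarith)]
  exact (sub_add_cancel ε' b).symm

/-! ## The traceless part -/

theorem trP_add (η : Fin d → ℝ) (f g : Symb d) : trP η (f + g) = trP η f + trP η g := by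
  simp only [← trL_apply, map_add]
theorem trP_smul (η : Fin d → ℝ) (c : ℂ) (f : Symb d) : trP η (c • f) = c • trP η f := by
  simp only [← trL_apply, map_smul]
@[simp] theorem trP_zero (η : Fin d → ℝ) : trP η (0 : Symb d) = 0 := by
  simp only [← trL_apply, map_zero]

theorem rank_trP_iter (s j : ℕ) (η : Fin d → ℝ) (f : Symb d) :
    rank s ((trP η)^[j] f) = (trP η)^[j] (rank (s + 2 * j) f) := by
  induction j generalizing f with
  | zero => rfl
  | succ n ih =>
    rw [Function.iterate_succ_apply, ih, rank_trP, Function.iterate_succ_apply]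
    ring_nf

theorem trP_iter_zero (η : Fin d → ℝ) (j : ℕ) : (trP η)^[j] (0 : Symb d) = 0 := by
  induction j with
  | zero => rfl
  | succ n ih => rw [Function.iterate_succ_apply, trP_zero, ih]

theorem rank_pSq_pow_mul (s j : ℕ) (η : Fin d → ℝ) (f : Symb d) :
    rank (s + 2 * j) (pSq η ^ j * f) = pSq η ^ j * rank s f := by
  induction j generalizing s with
  | zero => simp
  | succ n ih => rw [show s + 2 * (n + 1) = (s + 2 * n) + 2 by ring, pow_succ', mul_assoc,
      rank_pSq_mul, ih, mul_assoc]

theorem trP_pSq_pow_mul {η : Fin d → ℝ} (hη : ∀ i, η i = 1 ∨ η i = -1) (t j : ℕ) {f : Symb d}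
    (hf : rank t f = f) : trP η (pSq η ^ (j + 1) * f) = pSq η ^ (j + 1) * trP η f +
      (2 * (j + 1) * (2 * j + 2 * t + d) : ℂ) • (pSq η ^ j * f) := by
  induction j with
  | zero =>
    rw [zero_add, pow_one, pow_zero, one_mul, trP_pSq_mul hη,
      euler_of_isHomogeneous (isHomogeneous_iff_rank.mpr hf)]
    push_cast
    module
  | succ n ih =>
    have hh : rank (t + 2 * (n + 1)) (pSq η ^ (n + 1) * f) = pSq η ^ (n + 1) * f := by
      rw [rank_pSq_pow_mul, hf]
    rw [pow_succ', mul_assoc, trP_pSq_mul hη, ih,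
      euler_of_isHomogeneous (isHomogeneous_iff_rank.mpr hh), mul_add, ← mul_assoc,
      mul_smul_comm, ← mul_assoc, ← pow_succ', pow_succ' _ n]
    push_cast
    module

/-- Coefficients of the projection on the traceless part of a tensor of rank `s`. -/
def tracelessCoeff (d s : ℕ) : ℕ → ℝ
  | 0 => 1
  | j + 1 => -tracelessCoeff d s j / (2 * (j + 1) * (2 * s - 2 * j - 4 + d))

/-- The traceless part of the component of rank `s`. -/
def tracelessPart (η : Fin d → ℝ) (s : ℕ) (f : Symb d) : Symb d :=
  ∑ j ∈ Finset.range (s / 2 + 1),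
    (tracelessCoeff d s j : ℂ) • (pSq η ^ j * (trP η)^[j] (rank s f))

theorem isNice_tracelessPart (η : Fin d → ℝ) (s : ℕ) : IsNice (tracelessPart η s) := by
  have h1 : ∀ j, IsNice fun f : Symb d => pSq η ^ j * f := by
    intro j
    induction j with
    | zero => exact ⟨fun f g O hO hfg => by simpa using hfg, fun f => by simp⟩
    | succ n ih => exact ((isNice_pSq η).comp ih).congr fun f => by rw [pow_succ', mul_assoc]
  have h2 : ∀ j, IsNice (trP (d := d) η)^[j] := by
    intro j
    induction j with
    | zero => exact ⟨fun f g O hO hfg => hfg, fun f => rfl⟩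
    | succ n ih => exact (ih.comp (isNice_trP η)).congr fun f => rfl
  exact IsNice.sum _ fun j => (((h1 j).comp (h2 j)).comp (isNice_rank s)).smul _

theorem rank_tracelessPart (η : Fin d → ℝ) (s : ℕ) (f : Symb d) :
    rank s (tracelessPart η s f) = tracelessPart η s f := by
  unfold tracelessPart
  rw [rank_sum]
  refine Finset.sum_congr rfl fun j hj => ?_
  obtain ⟨t, rfl⟩ : ∃ t, s = t + 2 * j := ⟨s - 2 * j, by
    simp only [Finset.mem_range] at hj; omega⟩
  rw [rank_smul, rank_pSq_pow_mul, rank_trP_iter, rank_rank, if_pos rfl]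

/-- The coefficients are chosen so that the trace of the term with p² to the power j + 1 removes
what is left by the terms before it. The denominators 2j + 2t + d, with t the rank after j + 1
traces, do not vanish because d ≥ 3. -/
theorem isTracelessPart_tracelessPart (hd : 3 ≤ d) {η : Fin d → ℝ}
    (hη : ∀ i, η i = 1 ∨ η i = -1) (s : ℕ) (f : Symb d) :
    IsTracelessPart η (rank s f) (tracelessPart η s f) := by
  constructor
  · have hterm : ∀ j, 2 * (j + 1) ≤ s →
        trP η ((tracelessCoeff d s (j + 1) : ℂ) •
          (pSq η ^ (j + 1) * (trP η)^[j + 1] (rank s f))) =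
        (tracelessCoeff d s (j + 1) : ℂ) • (pSq η ^ (j + 1) * (trP η)^[j + 2] (rank s f)) -
        (tracelessCoeff d s j : ℂ) • (pSq η ^ j * (trP η)^[j + 1] (rank s f)) := by
      intro j hj
      obtain ⟨t, rfl⟩ := Nat.exists_eq_add_of_le' hj
      have hr : rank t ((trP η)^[j + 1] (rank (t + 2 * (j + 1)) f)) =
          (trP η)^[j + 1] (rank (t + 2 * (j + 1)) f) := by
        rw [rank_trP_iter, rank_rank, if_pos rfl]
      rw [trP_smul, trP_pSq_pow_mul hη t j hr, ← Function.iterate_succ_apply' (trP η), smul_add,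
        smul_smul]
      have hc : (tracelessCoeff d (t + 2 * (j + 1)) (j + 1) : ℂ) *
          (2 * (j + 1) * (2 * j + 2 * t + d)) = -tracelessCoeff d (t + 2 * (j + 1)) j := by
        rw [tracelessCoeff]
        push_cast
        have h1 : (2 * (t + 2 * (j + 1)) - 2 * j - 4 + d : ℂ) = 2 * j + 2 * t + d := by ring
        have h2 : (2 * j + 2 * t + d : ℂ) ≠ 0 := by norm_cast; omega
        have h3 : (j + 1 : ℂ) ≠ 0 := by norm_cast
        rw [h1, neg_div, neg_mul, mul_assoc 2 (j + 1 : ℂ), ← mul_assoc 2 (j + 1 : ℂ),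
          div_mul_cancel₀ _ (mul_ne_zero (mul_ne_zero two_ne_zero h3) h2)]
      rw [hc]
      module
    -- The trace of a partial sum telescopes to one term with N + 1 traces, which vanishes for N = s
    -- / 2 by rank.
    have hpart : ∀ N, 2 * N ≤ s → trP η (∑ j ∈ Finset.range (N + 1),
        (tracelessCoeff d s j : ℂ) • (pSq η ^ j * (trP η)^[j] (rank s f))) =
        (tracelessCoeff d s N : ℂ) • (pSq η ^ N * (trP η)^[N + 1] (rank s f)) := by
      intro N
      induction N with
      | zero => intro _; simp [tracelessCoeff]
      | succ n ih =>
        intro hn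
        rw [Finset.sum_range_succ, trP_add, ih (by omega), hterm n hn]
        module
    rw [tracelessPart, hpart _ (by omega)]
    have : (trP η)^[s / 2 + 1] (rank s f) = 0 := by
      refine rank_ext fun k => ?_
      rw [rank_trP_iter, rank_rank, if_neg (by omega), trP_iter_zero, rank_zero]
    rw [this, mul_zero, smul_zero]
  · refine ⟨(-1 : ℂ) • ∑ j ∈ Finset.range (s / 2), (tracelessCoeff d s (j + 1) : ℂ) •
      (pSq η ^ j * (trP η)^[j + 1] (rank s f)), ?_⟩
    rw [tracelessPart, Finset.sum_range_succ', mul_smul_comm, Finset.mul_sum]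
    simp only [mul_smul_comm, ← mul_assoc, ← pow_succ']
    simp only [tracelessCoeff, Complex.ofReal_one, one_smul, pow_zero, one_mul,
      Function.iterate_zero, id]
    module

/-! ## The Moyal product -/

theorem symb_sub_zero (f : Symb d) : f - 0 = f := sub_zero f

theorem nablaPow_zero_right (n : ℕ) (f : Symb d) : nablaPow n f 0 = 0 := by
  induction n generalizing f with
  | zero => exact mul_zero f
  | succ n ih => simp [nablaPow, ih]

theorem nablaPow_add_right (n : ℕ) (f g g' : Symb d) :
    nablaPow n f (g + g') = nablaPow n f g + nablaPow n f g' := by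
  induction n generalizing f g g' with
  | zero => exact mul_add f g g'
  | succ n ih =>
    simp only [nablaPow, dP_add, dX_add, ih, ← Finset.sum_add_distrib]
    exact Finset.sum_congr rfl fun i _ => by ring

theorem nablaPow_smul_right (n : ℕ) (c : ℂ) (f g : Symb d) :
    nablaPow n f (c • g) = c • nablaPow n f g := by
  induction n generalizing f g with
  | zero => exact mul_smul_comm c f g
  | succ n ih =>
    simp only [nablaPow, dP_smul, dX_smul, ih, Finset.smul_sum]
    exact Finset.sum_congr rfl fun i _ => by module

/-- Each ∇ is antisymmetric. This transfers right linearity to the left argument, and it supplies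
the sign that makes conjugation reverse the Moyal product. -/
theorem nablaPow_swap (n : ℕ) (f g : Symb d) :
    nablaPow n f g = (-1 : ℂ) ^ n • nablaPow n g f := by
  induction n generalizing f g with
  | zero => simp [nablaPow, mul_comm]
  | succ n ih =>
    simp only [nablaPow, Finset.smul_sum]
    refine Finset.sum_congr rfl fun i _ => ?_
    rw [ih (dX i f), ih (dP i f), pow_succ]
    module

theorem nablaPow_add_left (n : ℕ) (f f' g : Symb d) :
    nablaPow n (f + f') g = nablaPow n f g + nablaPow n f' g := by
  rw [nablaPow_swap, nablaPow_add_right, nablaPow_swap n f, nablaPow_swap n f', smul_add]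

theorem nablaPow_smul_left (n : ℕ) (c : ℂ) (f g : Symb d) :
    nablaPow n (c • f) g = c • nablaPow n f g := by
  rw [nablaPow_swap, nablaPow_smul_right, nablaPow_swap n f, smul_comm]

theorem totalDegree_dX (i : Fin d) (f : Symb d) : (dX i f).totalDegree ≤ f.totalDegree :=
  totalDegree_le_of_rank fun k hk => by rw [rank_dX, rank_eq_zero hk, dX_zero]

theorem totalDegree_dP (i : Fin d) (f : Symb d) : (dP i f).totalDegree ≤ f.totalDegree - 1 :=
  totalDegree_le_of_rank fun k hk => by rw [rank_dP, rank_eq_zero (by omega), dP_zero]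

theorem dP_eq_zero {i : Fin d} {f : Symb d} (h : f.totalDegree = 0) : dP i f = 0 :=
  rank_ext fun k => by rw [rank_dP, rank_eq_zero (by omega), dP_zero, rank_zero]

/-- Every ∇ takes one p-derivative of one of the two factors, so the sum of their degrees drops at
each step. -/
theorem nablaPow_eq_zero {n : ℕ} {f g : Symb d} (h : f.totalDegree + g.totalDegree < n) :
    nablaPow n f g = 0 := by
  induction n generalizing f g with
  | zero => omega
  | succ n ih =>
    refine Finset.sum_eq_zero fun i _ => ?_
    have h1 : nablaPow n (dX i f) (dP i g) = 0 := by
      rcases Nat.eq_zero_or_pos g.totalDegree with hg | hg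
      · rw [dP_eq_zero hg, nablaPow_zero_right]
      · have := totalDegree_dX i f
        have := totalDegree_dP i g
        exact ih (by omega)
    have h2 : nablaPow n (dP i f) (dX i g) = 0 := by
      rcases Nat.eq_zero_or_pos f.totalDegree with hf | hf
      · rw [dP_eq_zero hf, nablaPow_swap, nablaPow_zero_right, smul_zero]
      · have := totalDegree_dX i g
        have := totalDegree_dP i f
        exact ih (by omega)
    rw [h1, h2, symb_sub_zero]

/-- Frees the truncation in the product from the degrees of the factors, which is needed for
bilinearity. -/
theorem moyal_eq (ħ : ℝ) (f g : Symb d) {N : ℕ} (hN : f.totalDegree + g.totalDegree < N) :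
    moyal ħ f g = ∑ n ∈ Finset.range N,
      ((Complex.I * ħ / 2) ^ n / (n.factorial : ℂ)) • nablaPow n f g := by
  refine Finset.sum_subset (fun n hn => by simp at hn ⊢; omega) fun n _ hn => ?_
  rw [nablaPow_eq_zero (by simp at hn; omega), smul_zero]

theorem moyal_add_right (ħ : ℝ) (f g g' : Symb d) :
    moyal ħ f (g + g') = moyal ħ f g + moyal ħ f g' := by
  have h := MvPolynomial.totalDegree_add g g'
  have h1 : g.totalDegree ≤ max g.totalDegree g'.totalDegree := le_max_left _ _
  have h2 : g'.totalDegree ≤ max g.totalDegree g'.totalDegree := le_max_right _ _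
  set M := max g.totalDegree g'.totalDegree
  rw [moyal_eq ħ f (g + g') (N := f.totalDegree + M + 1) (by omega),
    moyal_eq ħ f g (N := f.totalDegree + M + 1) (by omega),
    moyal_eq ħ f g' (N := f.totalDegree + M + 1) (by omega), ← Finset.sum_add_distrib]
  simp only [nablaPow_add_right, smul_add]

theorem moyal_add_left (ħ : ℝ) (f f' g : Symb d) :
    moyal ħ (f + f') g = moyal ħ f g + moyal ħ f' g := by
  have h := MvPolynomial.totalDegree_add f f'
  have h1 : f.totalDegree ≤ max f.totalDegree f'.totalDegree := le_max_left _ _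
  have h2 : f'.totalDegree ≤ max f.totalDegree f'.totalDegree := le_max_right _ _
  set M := max f.totalDegree f'.totalDegree
  rw [moyal_eq ħ (f + f') g (N := M + g.totalDegree + 1) (by omega),
    moyal_eq ħ f g (N := M + g.totalDegree + 1) (by omega),
    moyal_eq ħ f' g (N := M + g.totalDegree + 1) (by omega), ← Finset.sum_add_distrib]
  simp only [nablaPow_add_left, smul_add]

theorem totalDegree_csmul (c : ℂ) (f : Symb d) : (c • f).totalDegree ≤ f.totalDegree :=
  totalDegree_le_of_rank fun k hk => by rw [rank_smul, rank_eq_zero hk, smul_zero]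

theorem moyal_smul_right (ħ : ℝ) (c : ℂ) (f g : Symb d) :
    moyal ħ f (c • g) = c • moyal ħ f g := by
  have h := totalDegree_csmul c g
  rw [moyal_eq ħ f (c • g) (N := f.totalDegree + g.totalDegree + 1) (by omega),
    moyal_eq ħ f g (N := f.totalDegree + g.totalDegree + 1) (by omega), Finset.smul_sum]
  simp only [nablaPow_smul_right]
  exact Finset.sum_congr rfl fun n _ => smul_comm _ _ _

theorem moyal_smul_left (ħ : ℝ) (c : ℂ) (f g : Symb d) :
    moyal ħ (c • f) g = c • moyal ħ f g := by
  have h := totalDegree_csmul c f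
  rw [moyal_eq ħ (c • f) g (N := f.totalDegree + g.totalDegree + 1) (by omega),
    moyal_eq ħ f g (N := f.totalDegree + g.totalDegree + 1) (by omega), Finset.smul_sum]
  simp only [nablaPow_smul_left]
  exact Finset.sum_congr rfl fun n _ => smul_comm _ _ _

theorem gaugeVar_add (ħ : ℝ) (w H H' : Symb d) :
    gaugeVar ħ w (H + H') = gaugeVar ħ w H + gaugeVar ħ w H' := by
  simp only [gaugeVar, moyal_add_right, moyal_add_left]
  ring

theorem gaugeVar_smul (ħ : ℝ) (c : ℂ) (w H : Symb d) :
    gaugeVar ħ w (c • H) = c • gaugeVar ħ w H := by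
  simp only [gaugeVar, moyal_smul_right, moyal_smul_left, smul_add]

/-- Complex conjugation of smooth functions as a ring homomorphism. -/
def conjHom : smoothFn d →+* smoothFn d where
  toFun := conjFn
  map_one' := val_ext fun _ => map_one (starRingEnd ℂ)
  map_mul' _ _ := val_ext fun _ => map_mul (starRingEnd ℂ) _ _
  map_zero' := conjFn_zero
  map_add' _ _ := val_ext fun _ => map_add (starRingEnd ℂ) _ _

theorem dagger_eq_map (f : Symb d) : dagger f = MvPolynomial.map conjHom f := by
  ext1 α
  rw [coeff_dagger, MvPolynomial.coeff_map]
  rfl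

theorem dagger_mul (f g : Symb d) : dagger (f * g) = dagger f * dagger g := by
  simp only [dagger_eq_map, map_mul]

theorem dagger_neg (f : Symb d) : dagger (-f) = -dagger f := by
  simp only [dagger_eq_map, map_neg]

theorem dagger_sub (f g : Symb d) : dagger (f - g) = dagger f - dagger g := by
  rw [sub_eq_add_neg, dagger_add, dagger_neg, ← sub_eq_add_neg]

theorem dagger_dagger (f : Symb d) : dagger (dagger f) = f := by
  ext1 α
  rw [coeff_dagger, coeff_dagger]
  exact val_ext fun x => Complex.conj_conj _

theorem dagger_nablaPow (n : ℕ) (f g : Symb d) :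
    dagger (nablaPow n f g) = nablaPow n (dagger f) (dagger g) := by
  induction n generalizing f g with
  | zero => exact dagger_mul f g
  | succ n ih =>
    simp only [nablaPow, dagger_sum, dagger_sub, ih, (isNice_dX _).dag, (isNice_dP _).dag]

/-- Conjugating (iħ/2)^n gives (-1)^n, the sign by which the n-th term changes when its factors are
exchanged. -/
theorem dagger_moyal (ħ : ℝ) (f g : Symb d) :
    dagger (moyal ħ f g) = moyal ħ (dagger g) (dagger f) := by
  have hf := totalDegree_dagger f
  have hg := totalDegree_dagger g
  rw [moyal_eq ħ f g (N := f.totalDegree + g.totalDegree + 1) (by omega),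
    moyal_eq ħ (dagger g) (dagger f) (N := f.totalDegree + g.totalDegree + 1) (by omega),
    dagger_sum]
  refine Finset.sum_congr rfl fun n _ => ?_
  rw [dagger_smul, dagger_nablaPow, nablaPow_swap, smul_smul]
  congr 1
  simp only [map_div₀, map_pow, map_mul, Complex.conj_I, Complex.conj_ofReal, map_natCast,
    Complex.conj_ofNat]
  rw [div_mul_eq_mul_div, ← mul_pow]
  congr 2
  ring

theorem dagger_gaugeVar (ħ : ℝ) (w : Symb d) {H : Symb d} (hH : dagger H = H) :
    dagger (gaugeVar ħ w H) = gaugeVar ħ w H := by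
  rw [gaugeVar, dagger_add, dagger_moyal, dagger_moyal, dagger_dagger, hH, add_comm]

theorem IsCompSupp.mul_right {f : Symb d} (hf : IsCompSupp f) (g : Symb d) :
    IsCompSupp (f * g) := by
  intro α
  rw [MvPolynomial.coeff_mul]
  have : ∀ t : Finset ((Fin d →₀ ℕ) × (Fin d →₀ ℕ)),
      HasCompactSupport (val (∑ x ∈ t, f.coeff x.1 * g.coeff x.2)) := by
    intro t
    classical
    induction t using Finset.induction_on with
    | empty => exact HasCompactSupport.zero
    | insert a s ha ih =>
      rw [Finset.sum_insert ha]
      exact HasCompactSupport.add ((hf a.1).mul_right (f' := val (g.coeff a.2))) ih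
  exact this _

theorem IsNice.dX_compSupp {f : Symb d} (hf : IsCompSupp f) (i : Fin d) : IsCompSupp (dX i f) :=
  (isNice_dX i).compSupp (dX_zero i) hf

theorem IsNice.dP_compSupp {f : Symb d} (hf : IsCompSupp f) (i : Fin d) : IsCompSupp (dP i f) :=
  (isNice_dP i).compSupp (dP_zero i) hf

theorem IsCompSupp.sub {f g : Symb d} (hf : IsCompSupp f) (hg : IsCompSupp g) :
    IsCompSupp (f - g) := by
  have := hf.add (hg.smul (-1))
  rwa [neg_one_csmul, ← sub_eq_add_neg] at this

theorem IsCompSupp.nablaPow {f : Symb d} (hf : IsCompSupp f) (n : ℕ) (g : Symb d) :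
    IsCompSupp (nablaPow n f g) := by
  induction n generalizing f g with
  | zero => exact hf.mul_right g
  | succ n ih => exact IsCompSupp.sum _ fun i _ =>
      (ih (IsNice.dX_compSupp hf i) _).sub (ih (IsNice.dP_compSupp hf i) _)

theorem IsCompSupp.dagger {f : Symb d} (hf : IsCompSupp f) : IsCompSupp (dagger f) := by
  intro α
  rw [coeff_dagger]
  exact (hf α).comp_left (g := starRingEnd ℂ) (map_zero _)

theorem IsCompSupp.gaugeVar {w : Symb d} (hw : IsCompSupp w) (ħ : ℝ) (H : Symb d) :
    IsCompSupp (gaugeVar ħ w H) := by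
  refine IsCompSupp.add (IsCompSupp.sum _ fun n _ => (hw.dagger.nablaPow n H).smul _)
    (IsCompSupp.sum _ fun n _ => ?_)
  rw [nablaPow_swap]
  exact ((hw.nablaPow n H).smul _).smul _

/-! ### Moyal products with p² and the gauge variation of the vacuum -/

theorem dX_pSq (η : Fin d → ℝ) (i : Fin d) : dX i (pSq η) = 0 := by
  have h : dX i (1 : Symb d) = 0 := by
    have := isNice_dX (d := d) i
    ext1 α
    classical
    rw [coeff_dX, MvPolynomial.coeff_one]
    split_ifs
    · refine val_ext fun x => ?_
      rw [val_pd]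
      have : val (1 : smoothFn d) = fun _ => 1 := rfl
      simp [this]
    · simp
  have := dX_pSq_mul η i 1
  rwa [h, mul_one, mul_zero] at this

theorem dP_one (i : Fin d) : dP i (1 : Symb d) = 0 := MvPolynomial.pderiv_one

theorem dX_X (i j : Fin d) : dX i (MvPolynomial.X j : Symb d) = 0 := by
  classical
  ext1 α
  rw [coeff_dX, MvPolynomial.coeff_X]
  split_ifs
  · refine val_ext fun x => ?_
    rw [val_pd]
    have : val (1 : smoothFn d) = fun _ => 1 := rfl
    simp [this]
  · simp

theorem dP_pSq (η : Fin d → ℝ) (i : Fin d) :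
    dP i (pSq η) = (2 * η i : ℂ) • (MvPolynomial.X i : Symb d) := by
  have := dP_pSq_mul η i 1
  rwa [dP_one, mul_one, mul_one, mul_zero, zero_add] at this

theorem dX_one (i : Fin d) : dX i (1 : Symb d) = 0 := by
  classical
  ext1 α
  rw [coeff_dX, MvPolynomial.coeff_one]
  split_ifs
  · refine val_ext fun x => ?_
    rw [val_pd]
    have : val (1 : smoothFn d) = fun _ => 1 := rfl
    simp [this]
  · simp

theorem nablaPow_succ_one (n : ℕ) (f : Symb d) : nablaPow (n + 1) f 1 = 0 := by
  simp [nablaPow, dP_one, dX_one, nablaPow_zero_right]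

theorem nablaPow_succ_X (n : ℕ) (f : Symb d) (i : Fin d) :
    nablaPow (n + 1) f (MvPolynomial.X i) = nablaPow n (dX i f) 1 := by
  simp only [nablaPow, dX_X, nablaPow_zero_right, symb_sub_zero, dP_X]
  rw [Finset.sum_eq_single i]
  · simp
  · intro j _ hj
    rw [if_neg hj, nablaPow_zero_right]
  · simp

theorem nablaPow_succ_pSq (n : ℕ) (η : Fin d → ℝ) (f : Symb d) : nablaPow (n + 1) f (pSq η) =
    ∑ i, (2 * η i : ℂ) • nablaPow n (dX i f) (MvPolynomial.X i) := by
  simp only [nablaPow, dX_pSq, nablaPow_zero_right, symb_sub_zero, dP_pSq, nablaPow_smul_right]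

/-- Only derivatives of p² with respect to p contribute, and there are at most two, so the
exponential stops after n = 2; the coefficients are 1, iħ/2 · 2 and (iħ/2)²/2 · 2. -/
theorem moyal_pSq (ħ : ℝ) (η : Fin d → ℝ) (f : Symb d) : moyal ħ f (pSq η) =
    pSq η * f + (Complex.I * ħ) • pGrad η f + (-(ħ ^ 2 / 4) : ℂ) • boxX η f := by
  rw [moyal_eq ħ f (pSq η) (N := f.totalDegree + (pSq η).totalDegree + 3) (by omega),
    Finset.sum_range_succ', Finset.sum_range_succ', Finset.sum_range_succ', Finset.sum_eq_zero]
  · simp only [nablaPow_succ_pSq, nablaPow_succ_X]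
    simp only [nablaPow, boxX, pGrad, Finset.smul_sum, smul_smul, mul_one]
    have h1 : ∀ i : Fin d, dX i f * MvPolynomial.X i = MvPolynomial.X i * dX i f :=
      fun i => mul_comm _ _
    simp only [h1]
    rw [zero_add, add_comm, ← add_assoc, mul_comm f, add_right_comm]
    refine congrArg₂ _ (congrArg₂ _ ?_ ?_) ?_
    · simp
    · exact Finset.sum_congr rfl fun i _ => by congr 1; simp; ring
    · refine Finset.sum_congr rfl fun i _ => ?_
      congr 1
      simp only [zero_add, Nat.factorial]
      push_cast
      linear_combination (ħ ^ 2 / 4 * η i : ℂ) * Complex.I_sq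
  · intro n _
    simp only [nablaPow_succ_pSq, nablaPow_succ_X, nablaPow_succ_one, smul_zero,
      Finset.sum_const_zero]

theorem pSq_moyal (ħ : ℝ) (η : Fin d → ℝ) (f : Symb d) : moyal ħ (pSq η) f =
    pSq η * f - (Complex.I * ħ) • pGrad η f + (-(ħ ^ 2 / 4) : ℂ) • boxX η f := by
  have h1 : dagger (pSq η) = pSq η := by
    simp only [pSq, dagger_sum, dagger_smul, Complex.conj_ofReal, dagger_mul]
    refine Finset.sum_congr rfl fun i _ => ?_
    rw [dagger_eq_map, MvPolynomial.map_X]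
  have h2 := dagger_moyal ħ (dagger f) (pSq η)
  rw [dagger_dagger, h1] at h2
  rw [← h2, moyal_pSq, dagger_add, dagger_add, dagger_mul, h1, dagger_smul, dagger_smul,
    (isNice_pGrad η).dag, (isNice_boxX η).dag, dagger_dagger]
  simp only [map_mul, Complex.conj_I, Complex.conj_ofReal, map_neg, map_div₀, map_pow,
    Complex.conj_ofNat]
  module

theorem boxX_add (η : Fin d → ℝ) (f g : Symb d) : boxX η (f + g) = boxX η f + boxX η g := by
  simp only [← boxL_apply, map_add]

theorem boxX_smul (η : Fin d → ℝ) (c : ℂ) (f : Symb d) : boxX η (c • f) = c • boxX η f := by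
  simp only [← boxL_apply, map_smul]

/-- The products of p² from the left and from the right differ in the sign of the gradient. Hence
the real part of ω survives in the even terms p² and □, and its imaginary part in the gradient only.
-/
theorem gaugeVar_vac (ħ : ℝ) (hħ : ħ ≠ 0) (η : Fin d → ℝ) {a ε : Symb d} (ha : dagger a = a)
    (hε : dagger ε = ε) :
    gaugeVar ħ (a + (Complex.I / ħ) • ε) (vac η) = deformedGauge ħ η a ε := by
  have hv : vac η = (-1 : ℂ) • pSq η := (neg_one_csmul _).symm
  have hħ' : (ħ : ℂ) ≠ 0 := by exact_mod_cast hħ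
  rw [hv, gaugeVar_smul, gaugeVar, moyal_pSq, pSq_moyal, dagger_add, dagger_smul, ha, hε]
  simp only [pGrad_add, pGrad_smul, boxX_add, boxX_smul, map_div₀, Complex.conj_I, Complex.conj_ofReal,
    mul_add, mul_smul_comm, smul_add, smul_smul, deformedGauge]
  have e : Complex.I * ħ * (-Complex.I / ħ) = 1 := by
    field_simp
    rw [Complex.I_sq]; ring
  have e' : Complex.I * ħ * (Complex.I / ħ) = -1 := by
    field_simp
    rw [Complex.I_sq]
  rw [e, e']
  module

end

section

variable {d : ℕ}

/-! ## Differential calculus of the invariants -/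

section Kernel

open MvPolynomial (C X pderiv)

/-- The value of `□` at the frequency `κ`. -/
def boxVal (η : Fin d → ℝ) (κ : Fin d → ℂ) : ℂ := ∑ i, (η i : ℂ) * κ i ^ 2

theorem bx_eq (η : Fin d → ℝ) (κ : Fin d → ℂ) : bx η κ = C (boxVal η κ) := rfl

theorem pderiv_qq (η : Fin d → ℝ) (i : Fin d) :
    pderiv (Sum.inl i) (qq η) = C (2 * η i : ℂ) * X (Sum.inl i) := by
  classical
  unfold qq
  rw [map_sum, Finset.sum_eq_single i]
  · rw [MvPolynomial.pderiv_C_mul, MvPolynomial.pderiv_pow, MvPolynomial.pderiv_X_self]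
    simp only [map_mul, map_ofNat]
    push_cast
    ring
  · intro j _ hj
    rw [MvPolynomial.pderiv_C_mul, MvPolynomial.pderiv_pow, MvPolynomial.pderiv_X_of_ne
      (by simpa using hj)]
    ring
  · simp

theorem pderiv_qq2 (η : Fin d → ℝ) (i : Fin d) : pderiv (Sum.inl i) (qq2 η) = 0 := by
  unfold qq2
  rw [map_sum]
  refine Finset.sum_eq_zero fun j _ => ?_
  rw [MvPolynomial.pderiv_C_mul, MvPolynomial.pderiv_pow, MvPolynomial.pderiv_X_of_ne (by simp)]
  ring

theorem pderiv_qd2 (κ : Fin d → ℂ) (i : Fin d) : pderiv (Sum.inl i) (qd2 κ) = 0 := by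
  unfold qd2
  rw [map_sum]
  refine Finset.sum_eq_zero fun j _ => ?_
  rw [MvPolynomial.pderiv_C_mul, MvPolynomial.pderiv_X_of_ne (by simp)]
  ring

theorem pderiv_qd (κ : Fin d → ℂ) (i : Fin d) : pderiv (Sum.inl i) (qd κ) = C (κ i) := by
  unfold qd
  rw [map_sum, Finset.sum_eq_single i]
  · rw [MvPolynomial.pderiv_C_mul, MvPolynomial.pderiv_X_self, mul_one]
  · intro j _ hj
    rw [MvPolynomial.pderiv_C_mul, MvPolynomial.pderiv_X_of_ne (by simpa using hj), mul_zero]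
  · simp

theorem pderiv_qq12 (η : Fin d → ℝ) (i : Fin d) :
    pderiv (Sum.inl i) (qq12 η) = C (η i : ℂ) * X (Sum.inr i) := by
  unfold qq12
  rw [map_sum, Finset.sum_eq_single i]
  · rw [MvPolynomial.pderiv_C_mul, MvPolynomial.pderiv_mul, MvPolynomial.pderiv_X_self,
      MvPolynomial.pderiv_X_of_ne (by simp)]
    ring
  · intro j _ hj
    rw [MvPolynomial.pderiv_C_mul, MvPolynomial.pderiv_mul,
      MvPolynomial.pderiv_X_of_ne (by simpa using hj), MvPolynomial.pderiv_X_of_ne (by simp)]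
    ring
  · simp

/-- The derivative of `ρ²`. -/
def rhoGrad (η : Fin d → ℝ) (κ : Fin d → ℂ) (i : Fin d) : QPoly d :=
  C 2 * (C (boxVal η κ) * C (η i : ℂ) * X (Sum.inl i) - C (κ i) * qd κ)

/-- The derivative of `τ`. -/
def tauGrad (η : Fin d → ℝ) (κ : Fin d → ℂ) (i : Fin d) : QPoly d :=
  C (boxVal η κ) * C (η i : ℂ) * X (Sum.inr i) - C (κ i) * qd2 κ

theorem pderiv_rho (η : Fin d → ℝ) (κ : Fin d → ℂ) (i : Fin d) :
    pderiv (Sum.inl i) (rho η κ) = rhoGrad η κ i := by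
  unfold rho rhoGrad
  rw [map_sub, bx_eq, MvPolynomial.pderiv_C_mul, pderiv_qq, MvPolynomial.pderiv_pow, pderiv_qd]
  simp only [map_mul, map_ofNat]
  push_cast
  ring

theorem pderiv_rho2 (η : Fin d → ℝ) (κ : Fin d → ℂ) (i : Fin d) :
    pderiv (Sum.inl i) (rho2 η κ) = 0 := by
  unfold rho2
  rw [map_sub, bx_eq, MvPolynomial.pderiv_C_mul, pderiv_qq2, MvPolynomial.pderiv_pow, pderiv_qd2]
  ring

theorem pderiv_tau (η : Fin d → ℝ) (κ : Fin d → ℂ) (i : Fin d) :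
    pderiv (Sum.inl i) (tau η κ) = tauGrad η κ i := by
  unfold tau tauGrad
  rw [map_sub, bx_eq, MvPolynomial.pderiv_C_mul, pderiv_qq12, MvPolynomial.pderiv_mul, pderiv_qd,
    pderiv_qd2]
  ring

theorem pderiv_rhoGrad (η : Fin d → ℝ) (κ : Fin d → ℂ) (i : Fin d) :
    pderiv (Sum.inl i) (rhoGrad η κ i) = C (2 * (boxVal η κ * η i - κ i ^ 2)) := by
  unfold rhoGrad
  rw [MvPolynomial.pderiv_C_mul, map_sub, ← map_mul, MvPolynomial.pderiv_C_mul,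
    MvPolynomial.pderiv_C_mul, pderiv_qd, MvPolynomial.pderiv_X_self]
  simp only [map_mul, map_sub, map_pow]
  ring

theorem pderiv_tauGrad (η : Fin d → ℝ) (κ : Fin d → ℂ) (i : Fin d) :
    pderiv (Sum.inl i) (tauGrad η κ i) = 0 := by
  unfold tauGrad
  rw [map_sub, ← map_mul, MvPolynomial.pderiv_C_mul,
    MvPolynomial.pderiv_C_mul, pderiv_qd2, MvPolynomial.pderiv_X_of_ne (by simp)]
  ring

theorem C_eta_sq {η : Fin d → ℝ} (hη : ∀ i, η i = 1 ∨ η i = -1) (i : Fin d) :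
    (C (η i : ℂ) * C (η i : ℂ) : QPoly d) = 1 := by
  rw [← map_mul, eta_sq hη, map_one]

theorem sum_C_kappa (η : Fin d → ℝ) (κ : Fin d → ℂ) :
    ∑ i, (C (η i : ℂ) * C (κ i) ^ 2 : QPoly d) = C (boxVal η κ) := by
  simp only [boxVal, map_sum, map_mul, map_pow]

/-- This and the next two contractions express the inner products of the q-gradients of ρ² and τ
through the invariants themselves; the closure lets the Laplacian act on monomials in ρ², ρ'², τ. -/
theorem sum_rhoGrad_sq {η : Fin d → ℝ} (hη : ∀ i, η i = 1 ∨ η i = -1) (κ : Fin d → ℂ) :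
    ∑ i, C (η i : ℂ) * rhoGrad η κ i ^ 2 = C 4 * C (boxVal η κ) * rho η κ := by
  have h : ∀ i, C (η i : ℂ) * rhoGrad η κ i ^ 2 =
      C 4 * C (boxVal η κ) ^ 2 * (C (η i : ℂ) * X (Sum.inl i) ^ 2) -
      C 4 * (2 * C (boxVal η κ) * qd κ) * (C (κ i) * X (Sum.inl i)) +
      C 4 * qd κ ^ 2 * (C (η i : ℂ) * C (κ i) ^ 2) := by
    intro i
    have h4 : (C 4 : QPoly d) = C 2 * C 2 := by rw [← map_mul]; norm_num
    unfold rhoGrad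
    rw [h4]
    linear_combination (C 2 ^ 2 * (C (boxVal η κ) ^ 2 * C (η i : ℂ) * X (Sum.inl i) ^ 2 -
      2 * C (boxVal η κ) * X (Sum.inl i) * C (κ i) * qd κ)) * C_eta_sq hη i
  simp only [h, Finset.sum_add_distrib, Finset.sum_sub_distrib, ← Finset.mul_sum, sum_C_kappa]
  rw [← qq, ← qd, rho, bx_eq]
  ring

theorem sum_rhoGrad_tauGrad {η : Fin d → ℝ} (hη : ∀ i, η i = 1 ∨ η i = -1) (κ : Fin d → ℂ) :
    ∑ i, C (η i : ℂ) * (rhoGrad η κ i * tauGrad η κ i) = C 2 * C (boxVal η κ) * tau η κ := by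
  have h : ∀ i, C (η i : ℂ) * (rhoGrad η κ i * tauGrad η κ i) =
      C 2 * C (boxVal η κ) ^ 2 * (C (η i : ℂ) * (X (Sum.inl i) * X (Sum.inr i))) -
      C 2 * (C (boxVal η κ) * qd2 κ) * (C (κ i) * X (Sum.inl i)) -
      C 2 * (C (boxVal η κ) * qd κ) * (C (κ i) * X (Sum.inr i)) +
      C 2 * (qd κ * qd2 κ) * (C (η i : ℂ) * C (κ i) ^ 2) := by
    intro i
    unfold rhoGrad tauGrad
    linear_combination (C 2 * (C (boxVal η κ) ^ 2 * C (η i : ℂ) * (X (Sum.inl i) * X (Sum.inr i)) -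
      C (boxVal η κ) * X (Sum.inl i) * C (κ i) * qd2 κ -
      C (boxVal η κ) * X (Sum.inr i) * C (κ i) * qd κ)) * C_eta_sq hη i
  simp only [h, Finset.sum_add_distrib, Finset.sum_sub_distrib, ← Finset.mul_sum, sum_C_kappa]
  rw [← qq12, ← qd, ← qd2, tau, bx_eq]
  ring

theorem sum_tauGrad_sq {η : Fin d → ℝ} (hη : ∀ i, η i = 1 ∨ η i = -1) (κ : Fin d → ℂ) :
    ∑ i, C (η i : ℂ) * tauGrad η κ i ^ 2 = C (boxVal η κ) * rho2 η κ := by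
  have h : ∀ i, C (η i : ℂ) * tauGrad η κ i ^ 2 =
      C (boxVal η κ) ^ 2 * (C (η i : ℂ) * X (Sum.inr i) ^ 2) -
      (2 * C (boxVal η κ) * qd2 κ) * (C (κ i) * X (Sum.inr i)) +
      qd2 κ ^ 2 * (C (η i : ℂ) * C (κ i) ^ 2) := by
    intro i
    unfold tauGrad
    linear_combination (C (boxVal η κ) ^ 2 * C (η i : ℂ) * X (Sum.inr i) ^ 2 -
      2 * C (boxVal η κ) * X (Sum.inr i) * C (κ i) * qd2 κ) * C_eta_sq hη i
  simp only [h, Finset.sum_add_distrib, Finset.sum_sub_distrib, ← Finset.mul_sum, sum_C_kappa]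
  rw [← qq2, ← qd2, rho2, bx_eq]
  ring

theorem sum_pderiv_rhoGrad {η : Fin d → ℝ} (hη : ∀ i, η i = 1 ∨ η i = -1) (κ : Fin d → ℂ) :
    ∑ i, C (η i : ℂ) * pderiv (Sum.inl i) (rhoGrad η κ i) =
      C (2 * (d - 1) : ℂ) * C (boxVal η κ) := by
  simp only [pderiv_rhoGrad, ← map_mul, ← map_sum]
  congr 1
  have h : ∀ i, (η i : ℂ) * (2 * (boxVal η κ * η i - κ i ^ 2)) =
      2 * boxVal η κ - 2 * (η i * κ i ^ 2) := fun i => by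
    linear_combination 2 * boxVal η κ * eta_sq hη i
  simp only [h, Finset.sum_sub_distrib, ← Finset.mul_sum]
  rw [← boxVal]
  simp
  ring

/-- The Laplacian `∂_q²`. -/
def lap (η : Fin d → ℝ) (F : QPoly d) : QPoly d :=
  ∑ i, C (η i : ℂ) * pderiv (Sum.inl i) (pderiv (Sum.inl i) F)

theorem lap_add (η : Fin d → ℝ) (F G : QPoly d) : lap η (F + G) = lap η F + lap η G := by
  simp only [lap, map_add, mul_add, Finset.sum_add_distrib]

theorem lap_C_mul (η : Fin d → ℝ) (c : ℂ) (F : QPoly d) : lap η (C c * F) = C c * lap η F := by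
  simp only [lap, MvPolynomial.pderiv_C_mul, Finset.mul_sum]
  exact Finset.sum_congr rfl fun i _ => by ring

theorem lap_zero (η : Fin d → ℝ) : lap η (0 : QPoly d) = 0 := by simp [lap]

theorem lap_sum {ι : Type*} (η : Fin d → ℝ) (t : Finset ι) (F : ι → QPoly d) :
    lap η (∑ j ∈ t, F j) = ∑ j ∈ t, lap η (F j) :=
  map_sum (⟨⟨lap η, lap_zero η⟩, lap_add η⟩ : QPoly d →+ QPoly d) F t

/-- The monomials `(ρ²)^a (ρ'²)^b τ^c`. -/
def invMon (η : Fin d → ℝ) (κ : Fin d → ℂ) (a b c : ℕ) : QPoly d :=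
  rho η κ ^ a * rho2 η κ ^ b * tau η κ ^ c

theorem cast_mul_pow_pred (n : ℕ) (x : QPoly d) : (n : QPoly d) * (x ^ (n - 1) * x) = n * x ^ n := by
  cases n with
  | zero => simp
  | succ n => simp [pow_succ]

/-- The chain rule gives 4a(a-1) + 4ac + 2a(d-1) for the terms that lose one power of ρ², and d - 1
= 2(ν + 1) makes this 4a(a + c + ν). The truncated exponents a - 1 and c - 2 occur with coefficients
that vanish where truncation matters. -/
theorem lap_invMon {η : Fin d → ℝ} (hη : ∀ i, η i = 1 ∨ η i = -1) (κ : Fin d → ℂ) (a b c : ℕ) :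
    lap η (invMon η κ a b c) =
      C (boxVal η κ) * (C (4 * a * (a + c + nu d) : ℂ) * invMon η κ (a - 1) b c +
        C (c * (c - 1) : ℂ) * invMon η κ a (b + 1) (c - 2)) := by
  set S := boxVal η κ
  set P := rho η κ
  set Q := rho2 η κ
  set T := tau η κ
  have hterm : ∀ i, pderiv (Sum.inl i) (pderiv (Sum.inl i) (invMon η κ a b c)) =
      (a * ((a - 1 : ℕ) : QPoly d)) * P ^ (a - 2) * Q ^ b * T ^ c * rhoGrad η κ i ^ 2 +
      2 * a * c * P ^ (a - 1) * Q ^ b * T ^ (c - 1) * (rhoGrad η κ i * tauGrad η κ i) +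
      (c * ((c - 1 : ℕ) : QPoly d)) * P ^ a * Q ^ b * T ^ (c - 2) * tauGrad η κ i ^ 2 +
      a * P ^ (a - 1) * Q ^ b * T ^ c * pderiv (Sum.inl i) (rhoGrad η κ i) := by
    intro i
    have h1 : pderiv (Sum.inl i) (invMon η κ a b c) =
        a * (P ^ (a - 1) * (Q ^ b * (T ^ c * rhoGrad η κ i))) +
        c * (P ^ a * (Q ^ b * (T ^ (c - 1) * tauGrad η κ i))) := by
      simp only [invMon, MvPolynomial.pderiv_mul, MvPolynomial.pderiv_pow, pderiv_rho, pderiv_rho2,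
        pderiv_tau]
      ring
    have hc : ∀ (n : ℕ) (F : QPoly d), pderiv (Sum.inl i) ((n : QPoly d) * F) = (n : QPoly d) * pderiv (Sum.inl i) F := by
      intro n F
      rw [← map_natCast (C : ℂ →+* QPoly d), MvPolynomial.pderiv_C_mul]
    rw [h1, map_add, hc, hc]
    simp only [MvPolynomial.pderiv_mul, MvPolynomial.pderiv_pow, P, Q, T, pderiv_rho, pderiv_rho2,
      pderiv_tau, pderiv_tauGrad, Nat.sub_sub]
    ring
  have hsum : lap η (invMon η κ a b c) =
      ((a : QPoly d) * ((a - 1 : ℕ) : QPoly d)) * P ^ (a - 2) * Q ^ b * T ^ c * (C 4 * C S * P) +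
      2 * (a : QPoly d) * (c : QPoly d) * P ^ (a - 1) * Q ^ b * T ^ (c - 1) * (C 2 * C S * T) +
      ((c : QPoly d) * ((c - 1 : ℕ) : QPoly d)) * P ^ a * Q ^ b * T ^ (c - 2) * (C S * Q) +
      (a : QPoly d) * P ^ (a - 1) * Q ^ b * T ^ c * (C (2 * (d - 1) : ℂ) * C S) := by
    rw [← sum_rhoGrad_sq hη, ← sum_rhoGrad_tauGrad hη, ← sum_tauGrad_sq hη,
      ← sum_pderiv_rhoGrad hη, lap]
    simp only [Finset.mul_sum, ← Finset.sum_add_distrib]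
    exact Finset.sum_congr rfl fun i _ => by rw [hterm i]; ring
  have e1 := cast_mul_pow_pred (a - 1) P
  have e2 := cast_mul_pow_pred c T
  rw [Nat.sub_sub] at e1
  have e3 : (a : QPoly d) * ((a - 1 : ℕ) : QPoly d) = a * (a - 1) := by
    cases a <;> simp
  have e4 : (c : QPoly d) * ((c - 1 : ℕ) : QPoly d) = c * (c - 1) := by
    cases c <;> simp
  have hν : (C ((nu d : ℝ) : ℂ) : QPoly d) = (C ((d : ℂ) - 1) - 2) * C (1 / 2) := by
    rw [← map_ofNat (C : ℂ →+* QPoly d) 2, ← map_sub, ← map_mul]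
    congr 1
    simp [nu]
    ring
  have h12 : (C (1 / 2 : ℂ) : QPoly d) * 2 = 1 := by
    rw [← map_ofNat (C : ℂ →+* QPoly d) 2, ← map_mul]
    norm_num
  rw [hsum]
  simp only [invMon, map_mul, map_add, map_sub, map_one, map_natCast, map_ofNat, hν]
  change _ = C S * (4 * (a : QPoly d) * ((a : QPoly d) + (c : QPoly d) +
    (((d : QPoly d) - 1) - 2) * C (1 / 2)) *
    (P ^ (a - 1) * Q ^ b * T ^ c) + ((c : QPoly d) * ((c : QPoly d) - 1)) * (P ^ a * Q ^ (b + 1) * T ^ (c - 2)))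
  linear_combination (4 * (a : QPoly d) * Q ^ b * T ^ c * C S) * e1 +
    (4 * (a : QPoly d) * P ^ (a - 1) * Q ^ b * C S) * e2 + (P ^ a * Q ^ b * T ^ (c - 2) * C S * Q) * e4 +
    (4 * C S * P ^ (a - 1) * Q ^ b * T ^ c) * e3 -
    (2 * C S * (a : QPoly d) * P ^ (a - 1) * Q ^ b * T ^ c * ((d : QPoly d) - 1 - 2)) * h12

/-- The derivation `∂^m ∂/∂q^m`. -/
def transv (η : Fin d → ℝ) (κ : Fin d → ℂ) (F : QPoly d) : QPoly d :=
  ∑ i, C ((η i : ℂ) * κ i) * pderiv (Sum.inl i) F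

theorem transv_mul (η : Fin d → ℝ) (κ : Fin d → ℂ) (F G : QPoly d) :
    transv η κ (F * G) = transv η κ F * G + F * transv η κ G := by
  simp only [transv, MvPolynomial.pderiv_mul, Finset.sum_mul, Finset.mul_sum,
    ← Finset.sum_add_distrib]
  exact Finset.sum_congr rfl fun i _ => by ring

theorem transv_pow {η : Fin d → ℝ} {κ : Fin d → ℂ} {F : QPoly d} (h : transv η κ F = 0) (n : ℕ) :
    transv η κ (F ^ n) = 0 := by
  induction n with
  | zero => simp [transv]
  | succ n ih => rw [pow_succ, transv_mul, ih, h]; ring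

theorem transv_C (η : Fin d → ℝ) (κ : Fin d → ℂ) (c : ℂ) : transv η κ (C c) = 0 := by
  simp [transv]

theorem transv_sum {ι : Type*} (η : Fin d → ℝ) (κ : Fin d → ℂ) (t : Finset ι) (F : ι → QPoly d) :
    transv η κ (∑ j ∈ t, F j) = ∑ j ∈ t, transv η κ (F j) := by
  simp only [transv, map_sum, Finset.mul_sum]
  exact Finset.sum_comm

/-- ρ² depends on q only through its part transverse to κ: □ times the square of q minus the square
of its contraction with κ. The same reason applies to τ below. -/
theorem transv_rho {η : Fin d → ℝ} (hη : ∀ i, η i = 1 ∨ η i = -1) (κ : Fin d → ℂ) :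
    transv η κ (rho η κ) = 0 := by
  have h : ∀ i, C ((η i : ℂ) * κ i) * rhoGrad η κ i =
      C 2 * (C (boxVal η κ) * (C (κ i) * X (Sum.inl i)) -
        qd κ * (C (η i : ℂ) * C (κ i) ^ 2)) := by
    intro i
    rw [rhoGrad, map_mul]
    linear_combination (C (κ i) * C 2 * C (boxVal η κ) * X (Sum.inl i)) * C_eta_sq hη i
  simp only [transv, pderiv_rho, h, ← Finset.mul_sum, Finset.sum_sub_distrib, sum_C_kappa]
  rw [← qd]
  ring

theorem transv_rho2 (η : Fin d → ℝ) (κ : Fin d → ℂ) : transv η κ (rho2 η κ) = 0 := by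
  simp [transv, pderiv_rho2]

theorem transv_tau {η : Fin d → ℝ} (hη : ∀ i, η i = 1 ∨ η i = -1) (κ : Fin d → ℂ) :
    transv η κ (tau η κ) = 0 := by
  have h : ∀ i, C ((η i : ℂ) * κ i) * tauGrad η κ i =
      C (boxVal η κ) * (C (κ i) * X (Sum.inr i)) - qd2 κ * (C (η i : ℂ) * C (κ i) ^ 2) := by
    intro i
    rw [tauGrad, map_mul]
    linear_combination (C (κ i) * C (boxVal η κ) * X (Sum.inr i)) * C_eta_sq hη i
  simp only [transv, pderiv_tau, h, ← Finset.mul_sum, Finset.sum_sub_distrib, sum_C_kappa]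
  rw [← qd2]
  ring

theorem transv_invMon {η : Fin d → ℝ} (hη : ∀ i, η i = 1 ∨ η i = -1) (κ : Fin d → ℂ)
    (a b c : ℕ) : transv η κ (invMon η κ a b c) = 0 := by
  rw [invMon, transv_mul, transv_mul, transv_pow (transv_rho hη κ), transv_pow (transv_rho2 η κ),
    transv_pow (transv_tau hη κ)]
  ring

/-! ### The Gegenbauer kernel -/

/-- The recursion that makes the Gegenbauer polynomial solve its differential equation and the
kernel harmonic. The denominators are non-zero because ν ≥ 0 and 2(r + 1) ≤ s, which includes ν = 0.
-/
theorem gegenbauerCoeff_succ {ν : ℝ} (hν : 0 ≤ ν) {s r : ℕ} (h : 2 * (r + 1) ≤ s) :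
    gegenbauerCoeff ν s (r + 1) * (4 * (r + 1) * (s - 1 - r + ν)) =
      -((s - 2 * r) * (s - 2 * r - 1) * gegenbauerCoeff ν s r) := by
  obtain ⟨t, rfl⟩ := Nat.exists_eq_add_of_le' h
  have e1 : t + 2 * (r + 1) - 2 * r = t + 2 := by omega
  have e2 : t + 2 * (r + 1) - 2 * (r + 1) = t := by omega
  have hp : ∀ n, n ≤ r + 1 →
      ∏ j ∈ Finset.range n, (((t + 2 * (r + 1) : ℕ) : ℝ) - 1 - j + ν) ≠ 0 := by
    intro n hn
    refine Finset.prod_ne_zero_iff.mpr fun j hj => ?_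
    have hj' : (j : ℝ) + 1 ≤ r + 1 := by
      exact_mod_cast (Nat.succ_le_of_lt (Finset.mem_range.mp hj)).trans hn
    push_cast
    have : (0 : ℝ) ≤ t := by positivity
    have : (0 : ℝ) ≤ r := by positivity
    apply ne_of_gt
    linarith
  have h1 := hp r (by omega)
  have h2 := hp (r + 1) le_rfl
  unfold gegenbauerCoeff
  rw [e1, e2, Finset.prod_range_succ, Nat.factorial_succ r, Nat.factorial_succ (t + 1),
    Nat.factorial_succ t]
  rw [Finset.prod_range_succ] at h2
  have h3 := right_ne_zero_of_mul h2
  set Q := ∏ j ∈ Finset.range r, (((t + 2 * (r + 1) : ℕ) : ℝ) - 1 - j + ν)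
  have h4 : ((t + 2 * (r + 1) : ℕ) : ℝ) - 1 - r + ν = t + r + 1 + ν := by push_cast; ring
  rw [h4] at h3 ⊢
  push_cast
  field_simp
  ring

theorem gegenbauerCoeff_zero_ne (ν : ℝ) (s : ℕ) : gegenbauerCoeff ν s 0 ≠ 0 := by
  simp [gegenbauerCoeff, Nat.factorial_ne_zero]

/-- The value at `1` of the Gegenbauer polynomial. -/
def gegenbauerSum (ν : ℝ) (s : ℕ) : ℝ := ∑ r ∈ Finset.range (s / 2 + 1), gegenbauerCoeff ν s r

/-- The Gegenbauer polynomial. -/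
def gegenbauerPoly (ν : ℝ) (s : ℕ) : Polynomial ℝ :=
  ∑ r ∈ Finset.range (s / 2 + 1), Polynomial.monomial (s - 2 * r) (gegenbauerCoeff ν s r)

/-- The operator sends t^n to multiples of t^n and t^(n-2), and by the recursion neighbouring terms
cancel. The equation is needed only to control the value at 1. -/
theorem gegenbauerPoly_ode {ν : ℝ} (hν : 0 ≤ ν) (s : ℕ) :
    let y := gegenbauerPoly ν s
    (1 - Polynomial.X ^ 2) * Polynomial.derivative (Polynomial.derivative y) -
      Polynomial.C (2 * ν + 1) * Polynomial.X * Polynomial.derivative y +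
      Polynomial.C (s * (s + 2 * ν)) * y = 0 := by
  intro y
  let L : Polynomial ℝ → Polynomial ℝ := fun y =>
    (1 - Polynomial.X ^ 2) * Polynomial.derivative (Polynomial.derivative y) -
      Polynomial.C (2 * ν + 1) * Polynomial.X * Polynomial.derivative y +
      Polynomial.C (s * (s + 2 * ν)) * y
  have hL : ∀ (n : ℕ) (c : ℝ), L (Polynomial.monomial n c) =
      Polynomial.monomial (n - 2) (n * (n - 1) * c) +
      Polynomial.monomial n ((s - n) * (s + n + 2 * ν) * c) := by
    intro n c
    have key : ∀ (n : ℕ) (c : ℝ), Polynomial.monomial n c = Polynomial.C c * Polynomial.X ^ n :=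
      fun n c => (Polynomial.C_mul_X_pow_eq_monomial).symm
    simp only [L, key, Polynomial.derivative_C_mul_X_pow]
    rcases n with _ | _ | n
    · simp
    · simp
      ring
    · simp only [show n + 1 + 1 - 1 = n + 1 by omega,
        show n + 1 + 1 - 2 = n by omega]
      push_cast
      simp only [map_mul, map_add, map_sub, map_one, map_natCast, map_ofNat]
      ring
  have hLsum : ∀ N, 2 * N ≤ s →
      L (∑ r ∈ Finset.range (N + 1), Polynomial.monomial (s - 2 * r) (gegenbauerCoeff ν s r)) =
      Polynomial.monomial (s - 2 * N - 2)
        ((s - 2 * N) * (s - 2 * N - 1) * gegenbauerCoeff ν s N) := by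
    intro N
    have hadd : ∀ p q, L (p + q) = L p + L q := fun p q => by
      simp only [L, Polynomial.derivative_add]; ring
    induction N with
    | zero =>
      intro _
      rw [zero_add, Finset.sum_range_one, hL]
      simp
    | succ N ih =>
      intro hN
      rw [Finset.sum_range_succ, hadd, ih (by omega), hL]
      have h := gegenbauerCoeff_succ hν hN
      have hc : ((s - 2 * (N + 1) : ℕ) : ℝ) = s - 2 * (N + 1) := by
        rw [Nat.cast_sub hN]; push_cast; ring
      have e : s - 2 * (N + 1) = s - 2 * N - 2 := by omega
      have hz : (s - ((s - 2 * (N + 1) : ℕ) : ℝ)) * (s + ((s - 2 * (N + 1) : ℕ) : ℝ) + 2 * ν) *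
          gegenbauerCoeff ν s (N + 1) = -((s - 2 * N) * (s - 2 * N - 1) * gegenbauerCoeff ν s N) := by
        rw [hc, ← h]; ring
      rw [hz, hc, e, map_neg]
      push_cast
      ring
  have := hLsum (s / 2) (by omega)
  change L (gegenbauerPoly ν s) = 0
  rw [gegenbauerPoly, this]
  -- What remains at the end of the telescoping contains s - 2⌊s/2⌋, which is 0 or 1.
  have h0 : ((s : ℝ) - 2 * (s / 2 : ℕ)) * (s - 2 * (s / 2 : ℕ) - 1) = 0 := by
    rcases Nat.even_or_odd' s with ⟨t, rfl | rfl⟩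
    · rw [show 2 * t / 2 = t by omega]; push_cast; ring
    · rw [show (2 * t + 1) / 2 = t by omega]; push_cast; ring
  rw [h0, zero_mul, map_zero]

/-- At the singular point t = 1 a zero of order k + 1 would have to satisfy the indicial equation (k
+ 1)(2k + 2ν + 1) = 0, impossible for ν ≥ 0; a non-zero polynomial solution therefore does not
vanish there. This number normalizes the wave factors and shows that the kernel is non-zero. -/
theorem gegenbauerSum_ne_zero {ν : ℝ} (hν : 0 ≤ ν) (s : ℕ) : gegenbauerSum ν s ≠ 0 := by
  intro h0
  set y := gegenbauerPoly ν s with hy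
  have hode := gegenbauerPoly_ode hν s
  rw [← hy] at hode
  have hy0 : y ≠ 0 := by
    intro h
    have h1 : y.coeff s = gegenbauerCoeff ν s 0 := by
      rw [hy, gegenbauerPoly, Polynomial.finsetSum_coeff, Finset.sum_eq_single 0]
      · simp
      · intro r hr hr0
        rw [Polynomial.coeff_monomial, if_neg]
        simp at hr
        omega
      · simp
    rw [h, Polynomial.coeff_zero] at h1
    exact gegenbauerCoeff_zero_ne ν s h1.symm
  have hroot : y.IsRoot 1 := by
    rw [Polynomial.IsRoot, hy, gegenbauerPoly, Polynomial.eval_finsetSum]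
    simpa [Polynomial.eval_monomial, gegenbauerSum] using h0
  obtain ⟨z, hz, hnd⟩ := Polynomial.exists_eq_pow_rootMultiplicity_mul_and_not_dvd y hy0 1
  have hm : 0 < y.rootMultiplicity 1 := (Polynomial.rootMultiplicity_pos hy0).mpr hroot
  obtain ⟨k, hk⟩ := Nat.exists_eq_succ_of_ne_zero hm.ne'
  rw [hk, Nat.succ_eq_add_one, pow_succ] at hz
  rw [Polynomial.dvd_iff_isRoot, Polynomial.IsRoot] at hnd
  set X1 : Polynomial ℝ := Polynomial.X - Polynomial.C 1 with hX1
  have hd1 : Polynomial.derivative X1 = 1 := by simp [hX1]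
  have e1 : Polynomial.derivative y = X1 ^ k * (((k : Polynomial ℝ) + 1) * z + X1 * Polynomial.derivative z) := by
    rw [hz, ← pow_succ, Polynomial.derivative_mul, Polynomial.derivative_pow, hd1,
      Nat.add_sub_cancel]
    simp only [map_natCast]
    push_cast
    ring
  have hXX : Polynomial.X = X1 + 1 := by simp [hX1]
  obtain ⟨w, hw⟩ : ∃ w : Polynomial ℝ, (1 - Polynomial.X ^ 2) * Polynomial.derivative (Polynomial.derivative y) =
      X1 ^ k * (-(2 * (k : Polynomial ℝ) * ((k : Polynomial ℝ) + 1)) * z + X1 * w) := by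
    set u := ((k : Polynomial ℝ) + 1) * z + X1 * Polynomial.derivative z with hu
    have hdu : (1 - Polynomial.X ^ 2 : Polynomial ℝ) = -(X1 * (X1 + 2)) := by rw [hXX]; ring
    rw [e1, Polynomial.derivative_mul, Polynomial.derivative_pow, hd1, hdu]
    refine ⟨-(X1 + 2) * Polynomial.derivative u - (k : Polynomial ℝ) * u - 2 * (k : Polynomial ℝ) * Polynomial.derivative z, ?_⟩
    simp only [map_natCast]
    -- The second derivative of y involves the exponent k - 1, which truncates when the zero is
    -- simple.
    rcases k with _ | k
    · simp
      ring
    · rw [Nat.add_sub_cancel, hu]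
      push_cast
      ring
  have h2 : X1 ^ k * (-(2 * (k : Polynomial ℝ) * ((k : Polynomial ℝ) + 1)) * z + X1 * w -
      Polynomial.C (2 * ν + 1) * Polynomial.X * (((k : Polynomial ℝ) + 1) * z + X1 * Polynomial.derivative z) +
      Polynomial.C (s * (s + 2 * ν)) * (X1 * z)) = 0 := by
    rw [← hode, hw, e1]
    conv_rhs => rw [hz]
    ring
  have hX1ne : X1 ^ k ≠ 0 := pow_ne_zero _ (Polynomial.X_sub_C_ne_zero 1)
  have h3 := congrArg (Polynomial.eval 1) ((mul_eq_zero.mp h2).resolve_left hX1ne)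
  simp [hX1] at h3
  have h4 : (k + 1) * (2 * k + 2 * ν + 1) * z.eval 1 = 0 := by linear_combination -h3
  have h5 : ((k : ℝ) + 1) * (2 * k + 2 * ν + 1) ≠ 0 := by positivity
  exact hnd ((mul_eq_zero.mp h4).resolve_left h5)

theorem confKernel_eq (η : Fin d → ℝ) (s : ℕ) (κ : Fin d → ℂ) : confKernel η s κ =
    ∑ r ∈ Finset.range (s / 2 + 1),
      C (gegenbauerCoeff (nu d) s r : ℂ) * invMon η κ r r (s - 2 * r) := by
  unfold confKernel invMon
  exact Finset.sum_congr rfl fun r _ => by ring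

theorem transv_confKernel {η : Fin d → ℝ} (hη : ∀ i, η i = 1 ∨ η i = -1) (s : ℕ)
    (κ : Fin d → ℂ) : transv η κ (confKernel η s κ) = 0 := by
  rw [confKernel_eq, transv_sum]
  refine Finset.sum_eq_zero fun r _ => ?_
  rw [transv_mul, transv_C, transv_invMon hη]
  ring

/-- In 4(n + r)(n + s - r + ν) = 4n(n + s + ν) + 4r(s - r + ν) the first part does not depend on r
and factors out, while the second cancels between neighbouring terms by the Gegenbauer recursion.
The case n = 0 is harmonicity; general n yields the factor of the Bessel recursion. -/
theorem lap_rho_pow_confKernel (hd : 3 ≤ d) {η : Fin d → ℝ} (hη : ∀ i, η i = 1 ∨ η i = -1)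
    (s n : ℕ) (κ : Fin d → ℂ) : lap η (rho η κ ^ n * confKernel η s κ) =
      C (boxVal η κ) * C (4 * n * (n + s + nu d) : ℂ) * (rho η κ ^ (n - 1) * confKernel η s κ) := by
  have hterm : ∀ r, 2 * r ≤ s → lap η (rho η κ ^ n * invMon η κ r r (s - 2 * r)) =
      C (boxVal η κ) * C (4 * n * (n + s + nu d) : ℂ) *
        (rho η κ ^ (n - 1) * invMon η κ r r (s - 2 * r)) +
      C (boxVal η κ) * (C (4 * r * (s - r + nu d) : ℂ) *
          (rho η κ ^ n * invMon η κ (r - 1) r (s - 2 * r)) +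
        C ((s - 2 * r) * (s - 2 * r - 1) : ℂ) *
          (rho η κ ^ n * invMon η κ r (r + 1) (s - 2 * r - 2))) := by
    intro r hr
    have hm : ∀ a b c, rho η κ ^ n * invMon η κ a b c = invMon η κ (n + a) b c := fun a b c => by
      simp only [invMon, pow_add]; ring
    have hc : ((s - 2 * r : ℕ) : ℂ) = s - 2 * r := by rw [Nat.cast_sub hr]; push_cast; ring
    have e1 : C (4 * (n : ℂ) * (n + s + nu d)) *
        (rho η κ ^ (n - 1) * invMon η κ r r (s - 2 * r)) =
        C (4 * (n : ℂ) * (n + s + nu d)) * invMon η κ (n + r - 1) r (s - 2 * r) := by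
      rcases n with _ | n
      · simp
      · rw [show n + 1 + r - 1 = n + r by omega, show n + 1 - 1 = n by omega]
        simp only [invMon, pow_add]
        ring
    have e2 : C (4 * (r : ℂ) * (s - r + nu d)) *
        (rho η κ ^ n * invMon η κ (r - 1) r (s - 2 * r)) =
        C (4 * (r : ℂ) * (s - r + nu d)) * invMon η κ (n + r - 1) r (s - 2 * r) := by
      rcases r with _ | r
      · simp
      · rw [hm, show n + (r + 1) - 1 = n + r by omega, show r + 1 - 1 = r by omega]
    rw [mul_assoc (C (boxVal η κ)), e1, e2, hm, hm, lap_invMon hη, hc]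
    have e3 : (4 * ((n + r : ℕ) : ℂ) * ((n + r : ℕ) + (s - 2 * r) + nu d)) =
        4 * n * (n + s + nu d) + 4 * r * (s - r + nu d) := by push_cast; ring
    rw [e3, map_add C (4 * (n : ℂ) * (n + s + nu d))]
    ring
  have hpart : ∀ N, 2 * N ≤ s → lap η (rho η κ ^ n * ∑ r ∈ Finset.range (N + 1),
        C (gegenbauerCoeff (nu d) s r : ℂ) * invMon η κ r r (s - 2 * r)) =
      C (boxVal η κ) * C (4 * n * (n + s + nu d) : ℂ) * (rho η κ ^ (n - 1) *
        ∑ r ∈ Finset.range (N + 1),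
          C (gegenbauerCoeff (nu d) s r : ℂ) * invMon η κ r r (s - 2 * r)) +
      C (boxVal η κ) * C (gegenbauerCoeff (nu d) s N * ((s - 2 * N) * (s - 2 * N - 1)) : ℂ) *
        (rho η κ ^ n * invMon η κ N (N + 1) (s - 2 * N - 2)) := by
    intro N
    induction N with
    | zero =>
      intro _
      rw [zero_add, Finset.sum_range_one, mul_left_comm, lap_C_mul, hterm 0 (by omega)]
      simp only [map_mul, Nat.cast_zero, mul_zero, zero_mul, map_zero]
      ring
    | succ N ih =>
      intro hN
      have hg := congrArg (fun x : ℝ => (C (x : ℂ) : QPoly d))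
        (gegenbauerCoeff_succ (nu_nonneg hd) hN)
      push_cast at hg
      simp only [map_mul, map_neg] at hg
      rw [Finset.sum_range_succ, mul_add, lap_add, ih (by omega),
        mul_left_comm (rho η κ ^ n) (C (gegenbauerCoeff (nu d) s (N + 1) : ℂ)), lap_C_mul,
        hterm (N + 1) hN, show s - 2 * (N + 1) = s - 2 * N - 2 by omega,
        show N + 1 - 1 = N by omega]
      have e : ((N + 1 : ℕ) : ℂ) = N + 1 := by push_cast; ring
      rw [e, show (s : ℂ) - (N + 1) + nu d = s - 1 - N + nu d by ring]
      simp only [map_mul]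
      linear_combination (C (boxVal η κ) *
        (rho η κ ^ n * invMon η κ N (N + 1) (s - 2 * N - 2))) * hg
  have h0 : ((s : ℂ) - 2 * (s / 2 : ℕ)) * (s - 2 * (s / 2 : ℕ) - 1) = 0 := by
    rcases Nat.even_or_odd' s with ⟨t, h | h⟩
    · rw [show s / 2 = t by omega, h]; push_cast; ring
    · rw [show s / 2 = t by omega, h]; push_cast; ring
  rw [confKernel_eq, hpart (s / 2) (by omega), h0, mul_zero, map_zero]
  ring

theorem lap_confKernel (hd : 3 ≤ d) {η : Fin d → ℝ} (hη : ∀ i, η i = 1 ∨ η i = -1)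
    (s : ℕ) (κ : Fin d → ℂ) : lap η (confKernel η s κ) = 0 := by
  have := lap_rho_pow_confKernel hd hη s 0 κ
  simpa using this

end Kernel

end

section

variable {d : ℕ}

/-! ## The conformal kernel -/

section ConformalKernel

open MvPolynomial (C X pderiv)

/-- The dependence on `κ` is polynomial. -/
def IsPolyDep (E : (Fin d → ℂ) → QPoly d) : Prop :=
  ∃ G : MvPolynomial (Fin d ⊕ Fin d) (MvPolynomial (Fin d) ℂ),
    ∀ κ, E κ = MvPolynomial.map (MvPolynomial.eval κ) G

namespace IsPolyDep

theorem const (p : QPoly d) : IsPolyDep fun _ => p :=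
  ⟨MvPolynomial.map C p, fun κ => by
    rw [MvPolynomial.map_map]
    have : (MvPolynomial.eval κ).comp C = RingHom.id ℂ := by ext; simp
    rw [this, MvPolynomial.map_id]⟩

theorem coeffPoly (p : MvPolynomial (Fin d) ℂ) :
    IsPolyDep (d := d) fun κ => C (MvPolynomial.eval κ p) :=
  ⟨C p, fun κ => by simp⟩

theorem add {E F : (Fin d → ℂ) → QPoly d} (hE : IsPolyDep E) (hF : IsPolyDep F) :
    IsPolyDep fun κ => E κ + F κ := by
  obtain ⟨G, hG⟩ := hE
  obtain ⟨H, hH⟩ := hF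
  exact ⟨G + H, fun κ => by simp only [map_add, hG, hH]⟩

theorem sub {E F : (Fin d → ℂ) → QPoly d} (hE : IsPolyDep E) (hF : IsPolyDep F) :
    IsPolyDep fun κ => E κ - F κ := by
  obtain ⟨G, hG⟩ := hE
  obtain ⟨H, hH⟩ := hF
  exact ⟨G - H, fun κ => by simp only [map_sub, hG, hH]⟩

theorem mul {E F : (Fin d → ℂ) → QPoly d} (hE : IsPolyDep E) (hF : IsPolyDep F) :
    IsPolyDep fun κ => E κ * F κ := by
  obtain ⟨G, hG⟩ := hE
  obtain ⟨H, hH⟩ := hF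
  exact ⟨G * H, fun κ => by simp only [map_mul, hG, hH]⟩

theorem pow {E : (Fin d → ℂ) → QPoly d} (hE : IsPolyDep E) (n : ℕ) :
    IsPolyDep fun κ => E κ ^ n := by
  obtain ⟨G, hG⟩ := hE
  exact ⟨G ^ n, fun κ => by simp only [map_pow, hG]⟩

theorem sum {ι : Type*} (t : Finset ι) {E : ι → (Fin d → ℂ) → QPoly d}
    (hE : ∀ i ∈ t, IsPolyDep (E i)) : IsPolyDep fun κ => ∑ i ∈ t, E i κ := by
  classical
  induction t using Finset.induction_on with
  | empty => simpa using const (d := d) 0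
  | insert a t ha ih =>
    simp only [Finset.sum_insert ha]
    exact (hE a (by simp)).add (ih fun i hi => hE i (by simp [hi]))

theorem coeff {E : (Fin d → ℂ) → QPoly d} (hE : IsPolyDep E) (m : Fin d ⊕ Fin d →₀ ℕ) :
    ∃ p : MvPolynomial (Fin d) ℂ, ∀ κ, (E κ).coeff m = MvPolynomial.eval κ p := by
  obtain ⟨G, hG⟩ := hE
  exact ⟨G.coeff m, fun κ => by rw [hG, MvPolynomial.coeff_map]⟩

theorem qd : IsPolyDep (qd (d := d)) :=
  sum _ fun i _ => by simpa using (coeffPoly (X i)).mul (const (X (Sum.inl i)))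

theorem qd2 : IsPolyDep (qd2 (d := d)) :=
  sum _ fun i _ => by simpa using (coeffPoly (X i)).mul (const (X (Sum.inr i)))

theorem bx (η : Fin d → ℝ) : IsPolyDep (bx η) := by
  convert coeffPoly (∑ i, C (η i : ℂ) * X i ^ 2) using 2 with κ
  simp [ConformalHS.bx]

theorem rho (η : Fin d → ℝ) : IsPolyDep (rho η) :=
  ((bx η).mul (const _)).sub (qd.pow 2)

theorem rho2 (η : Fin d → ℝ) : IsPolyDep (rho2 η) :=
  ((bx η).mul (const _)).sub (qd2.pow 2)

theorem tau (η : Fin d → ℝ) : IsPolyDep (tau η) :=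
  ((bx η).mul (const _)).sub (qd.mul qd2)

theorem confKernel (η : Fin d → ℝ) (s : ℕ) : IsPolyDep (confKernel η s) :=
  sum _ fun _ _ => (((const _).mul ((tau η).pow _)).mul ((rho η).pow _)).mul ((rho2 η).pow _)

end IsPolyDep

/-- The weight that counts the variables `q`. -/
def leftWeight (d : ℕ) : Fin d ⊕ Fin d → ℕ := Sum.elim (fun _ => 1) fun _ => 0

/-- The weight that counts the variables `q'`. -/
def rightWeight (d : ℕ) : Fin d ⊕ Fin d → ℕ := Sum.elim (fun _ => 0) fun _ => 1

/-- Homogeneous of degree `i` in `q` and of degree `j` in `q'`. -/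
def IsBihom (i j : ℕ) (F : QPoly d) : Prop :=
  F.IsWeightedHomogeneous (leftWeight d) i ∧ F.IsWeightedHomogeneous (rightWeight d) j

namespace IsBihom

theorem const (c : ℂ) : IsBihom 0 0 (C c : QPoly d) :=
  ⟨MvPolynomial.isWeightedHomogeneous_C _ c, MvPolynomial.isWeightedHomogeneous_C _ c⟩

theorem inl (i : Fin d) : IsBihom 1 0 (X (Sum.inl i) : QPoly d) :=
  ⟨MvPolynomial.isWeightedHomogeneous_X ℂ (leftWeight d) (Sum.inl i),
    MvPolynomial.isWeightedHomogeneous_X ℂ (rightWeight d) (Sum.inl i)⟩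

theorem inr (i : Fin d) : IsBihom 0 1 (X (Sum.inr i) : QPoly d) :=
  ⟨MvPolynomial.isWeightedHomogeneous_X ℂ (leftWeight d) (Sum.inr i),
    MvPolynomial.isWeightedHomogeneous_X ℂ (rightWeight d) (Sum.inr i)⟩

theorem mul {i j k l : ℕ} {F G : QPoly d} (hF : IsBihom i j F) (hG : IsBihom k l G) :
    IsBihom (i + k) (j + l) (F * G) := ⟨hF.1.mul hG.1, hF.2.mul hG.2⟩

theorem sub {i j : ℕ} {F G : QPoly d} (hF : IsBihom i j F) (hG : IsBihom i j G) :
    IsBihom i j (F - G) := ⟨hF.1.sub hG.1, hF.2.sub hG.2⟩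

theorem pow {i j : ℕ} {F : QPoly d} (hF : IsBihom i j F) (n : ℕ) :
    IsBihom (n * i) (n * j) (F ^ n) := ⟨hF.1.pow n, hF.2.pow n⟩

theorem sum {ι : Type*} (t : Finset ι) {i j : ℕ} {F : ι → QPoly d}
    (hF : ∀ a ∈ t, IsBihom i j (F a)) : IsBihom i j (∑ a ∈ t, F a) :=
  ⟨MvPolynomial.IsWeightedHomogeneous.sum t F i fun a ha => (hF a ha).1,
    MvPolynomial.IsWeightedHomogeneous.sum t F j fun a ha => (hF a ha).2⟩

theorem C_mul {i j : ℕ} {F : QPoly d} (hF : IsBihom i j F) (c : ℂ) : IsBihom i j (C c * F) := by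
  simpa using (const c).mul hF

theorem qd (κ : Fin d → ℂ) : IsBihom 1 0 (qd κ) := sum _ fun i _ => (inl i).C_mul _

theorem qd2 (κ : Fin d → ℂ) : IsBihom 0 1 (qd2 κ) := sum _ fun i _ => (inr i).C_mul _

theorem qq (η : Fin d → ℝ) : IsBihom 2 0 (qq η) := sum _ fun i _ => ((inl i).pow 2).C_mul _

theorem qq2 (η : Fin d → ℝ) : IsBihom 0 2 (qq2 η) := sum _ fun i _ => ((inr i).pow 2).C_mul _

theorem qq12 (η : Fin d → ℝ) : IsBihom 1 1 (qq12 η) :=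
  sum _ fun i _ => ((inl i).mul (inr i)).C_mul _

theorem rho (η : Fin d → ℝ) (κ : Fin d → ℂ) : IsBihom 2 0 (rho η κ) :=
  ((qq η).C_mul _).sub ((qd κ).pow 2)

theorem rho2 (η : Fin d → ℝ) (κ : Fin d → ℂ) : IsBihom 0 2 (rho2 η κ) :=
  ((qq2 η).C_mul _).sub ((qd2 κ).pow 2)

theorem tau (η : Fin d → ℝ) (κ : Fin d → ℂ) : IsBihom 1 1 (tau η κ) :=
  ((qq12 η).C_mul _).sub ((qd κ).mul (qd2 κ))

theorem invMon (η : Fin d → ℝ) (κ : Fin d → ℂ) (a b c : ℕ) :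
    IsBihom (2 * a + c) (2 * b + c) (invMon η κ a b c) := by
  have := (((rho η κ).pow a).mul ((rho2 η κ).pow b)).mul ((tau η κ).pow c)
  convert this using 1 <;> first | omega | rfl

theorem confKernel (η : Fin d → ℝ) (s : ℕ) (κ : Fin d → ℂ) :
    IsBihom s s (confKernel η s κ) := by
  rw [confKernel_eq]
  refine sum _ fun r hr => C_mul ?_ _
  have h : 2 * r + (s - 2 * r) = s := by
    rw [Finset.mem_range] at hr
    omega
  simpa only [h] using invMon η κ r r (s - 2 * r)

/-- The coefficients of other degrees vanish. -/
theorem coeff_eq_zero {i j : ℕ} {F : QPoly d} (hF : IsBihom i j F) (α β : Fin d →₀ ℕ)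
    (h : α.degree ≠ i ∨ β.degree ≠ j) : F.coeff (Finsupp.sumElim α β) = 0 := by
  have hl : Finsupp.weight (leftWeight d) (Finsupp.sumElim α β) = α.degree := by
    simp [Finsupp.weight_apply, Finsupp.sum_fintype, leftWeight, Finsupp.degree_eq_sum]
  have hr : Finsupp.weight (rightWeight d) (Finsupp.sumElim α β) = β.degree := by
    simp [Finsupp.weight_apply, Finsupp.sum_fintype, rightWeight, Finsupp.degree_eq_sum]
  rcases h with h | h
  · exact hF.1.coeff_eq_zero _ (by rwa [hl])
  · exact hF.2.coeff_eq_zero _ (by rwa [hr])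

end IsBihom

/-! ### The exchange of q and q', and rescaling of the frequency -/

theorem rename_qd (κ : Fin d → ℂ) : MvPolynomial.rename Sum.swap (qd κ) = qd2 κ := by
  simp [qd, qd2]

theorem rename_qd2 (κ : Fin d → ℂ) : MvPolynomial.rename Sum.swap (qd2 κ) = qd κ := by
  simp [qd, qd2]

theorem rename_qq (η : Fin d → ℝ) : MvPolynomial.rename Sum.swap (qq η) = qq2 η := by
  simp [qq, qq2]

theorem rename_qq2 (η : Fin d → ℝ) : MvPolynomial.rename Sum.swap (qq2 η) = qq η := by
  simp [qq, qq2]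

theorem rename_qq12 (η : Fin d → ℝ) : MvPolynomial.rename Sum.swap (qq12 η) = qq12 η := by
  simp [qq12, mul_comm]

theorem rename_rho (η : Fin d → ℝ) (κ : Fin d → ℂ) :
    MvPolynomial.rename Sum.swap (rho η κ) = rho2 η κ := by
  simp only [rho, rho2, bx_eq, map_sub, map_mul, map_pow, rename_qq, rename_qd,
    MvPolynomial.rename_C]

theorem rename_rho2 (η : Fin d → ℝ) (κ : Fin d → ℂ) :
    MvPolynomial.rename Sum.swap (rho2 η κ) = rho η κ := by
  simp only [rho, rho2, bx_eq, map_sub, map_mul, map_pow, rename_qq2, rename_qd2,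
    MvPolynomial.rename_C]

theorem rename_tau (η : Fin d → ℝ) (κ : Fin d → ℂ) :
    MvPolynomial.rename Sum.swap (tau η κ) = tau η κ := by
  simp only [tau, bx_eq, map_sub, map_mul, rename_qq12, rename_qd, rename_qd2,
    MvPolynomial.rename_C]
  ring

theorem rename_invMon (η : Fin d → ℝ) (κ : Fin d → ℂ) (a b c : ℕ) :
    MvPolynomial.rename Sum.swap (invMon η κ a b c) = invMon η κ b a c := by
  simp only [invMon, map_mul, map_pow, rename_rho, rename_rho2, rename_tau]
  ring

theorem rename_confKernel (η : Fin d → ℝ) (s : ℕ) (κ : Fin d → ℂ) :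
    MvPolynomial.rename Sum.swap (confKernel η s κ) = confKernel η s κ := by
  simp only [confKernel_eq, map_sum, map_mul, rename_invMon, MvPolynomial.rename_C]

theorem qd_smul (c : ℂ) (κ : Fin d → ℂ) : qd (c • κ) = C c * qd κ := by
  simp only [qd, Finset.mul_sum, Pi.smul_apply, smul_eq_mul, map_mul, mul_assoc]

theorem qd2_smul (c : ℂ) (κ : Fin d → ℂ) : qd2 (c • κ) = C c * qd2 κ := by
  simp only [qd2, Finset.mul_sum, Pi.smul_apply, smul_eq_mul, map_mul, mul_assoc]

theorem boxVal_smul (η : Fin d → ℝ) (c : ℂ) (κ : Fin d → ℂ) :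
    boxVal η (c • κ) = c ^ 2 * boxVal η κ := by
  simp only [boxVal, Finset.mul_sum, Pi.smul_apply, smul_eq_mul]
  exact Finset.sum_congr rfl fun i _ => by ring

theorem rho_smul (η : Fin d → ℝ) (c : ℂ) (κ : Fin d → ℂ) :
    rho η (c • κ) = C (c ^ 2) * rho η κ := by
  simp only [rho, bx_eq, boxVal_smul, qd_smul, map_mul, map_pow]
  ring

theorem rho2_smul (η : Fin d → ℝ) (c : ℂ) (κ : Fin d → ℂ) :
    rho2 η (c • κ) = C (c ^ 2) * rho2 η κ := by
  simp only [rho2, bx_eq, boxVal_smul, qd2_smul, map_mul, map_pow]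
  ring

theorem tau_smul (η : Fin d → ℝ) (c : ℂ) (κ : Fin d → ℂ) :
    tau η (c • κ) = C (c ^ 2) * tau η κ := by
  simp only [tau, bx_eq, boxVal_smul, qd_smul, qd2_smul, map_mul, map_pow]
  ring

theorem invMon_smul (η : Fin d → ℝ) (c : ℂ) (κ : Fin d → ℂ) (a b n : ℕ) :
    invMon η (c • κ) a b n = C (c ^ (2 * (a + b + n))) * invMon η κ a b n := by
  simp only [invMon, rho_smul, rho2_smul, tau_smul, mul_pow, ← map_pow, ← pow_mul,
    mul_add 2, pow_add c, map_mul]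
  ring

theorem confKernel_smul (η : Fin d → ℝ) (s : ℕ) (c : ℂ) (κ : Fin d → ℂ) :
    confKernel η s (c • κ) = c ^ (2 * s) • confKernel η s κ := by
  rw [MvPolynomial.smul_eq_C_mul, confKernel_eq, confKernel_eq, Finset.mul_sum]
  refine Finset.sum_congr rfl fun r hr => ?_
  have h : r + r + (s - 2 * r) = s := by
    rw [Finset.mem_range] at hr
    omega
  rw [invMon_smul, h]
  ring

/-! ### Evaluation -/

/-- The values of the invariants at given momenta. -/
def dotVal (η : Fin d → ℝ) (v w : Fin d → ℂ) : ℂ := ∑ i, (η i : ℂ) * (v i * w i)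

/-- The contraction of a momentum and a frequency. -/
def conVal (κ v : Fin d → ℂ) : ℂ := ∑ i, κ i * v i

/-- The value at the momenta `q = v` and `q' = w`. -/
def evalAt (v w : Fin d → ℂ) : QPoly d →+* ℂ := MvPolynomial.eval (Sum.elim v w)

section

variable (η : Fin d → ℝ) (κ v w : Fin d → ℂ)

theorem evalAt_C (c : ℂ) : evalAt v w (C c) = c := by simp [evalAt]

theorem evalAt_qd : evalAt v w (qd κ) = conVal κ v := by simp [evalAt, qd, conVal]

theorem evalAt_qd2 : evalAt v w (qd2 κ) = conVal κ w := by simp [evalAt, qd2, conVal]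

theorem evalAt_qq : evalAt v w (qq η) = dotVal η v v := by
  simp [evalAt, qq, dotVal, sq]

theorem evalAt_qq2 : evalAt v w (qq2 η) = dotVal η w w := by
  simp [evalAt, qq2, dotVal, sq]

theorem evalAt_qq12 : evalAt v w (qq12 η) = dotVal η v w := by
  simp [evalAt, qq12, dotVal]

theorem evalAt_rho : evalAt v w (rho η κ) = boxVal η κ * dotVal η v v - conVal κ v ^ 2 := by
  rw [rho, bx_eq, map_sub, map_mul, map_pow, evalAt_C, evalAt_qq, evalAt_qd]

theorem evalAt_rho2 : evalAt v w (rho2 η κ) = boxVal η κ * dotVal η w w - conVal κ w ^ 2 := by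
  rw [rho2, bx_eq, map_sub, map_mul, map_pow, evalAt_C, evalAt_qq2, evalAt_qd2]

theorem evalAt_tau :
    evalAt v w (tau η κ) = boxVal η κ * dotVal η v w - conVal κ v * conVal κ w := by
  rw [tau, bx_eq, map_sub, map_mul, map_mul, evalAt_C, evalAt_qq12, evalAt_qd, evalAt_qd2]

theorem evalAt_invMon (a b c : ℕ) : evalAt v w (invMon η κ a b c) =
    (boxVal η κ * dotVal η v v - conVal κ v ^ 2) ^ a *
      (boxVal η κ * dotVal η w w - conVal κ w ^ 2) ^ b *
      (boxVal η κ * dotVal η v w - conVal κ v * conVal κ w) ^ c := by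
  rw [invMon, map_mul, map_mul, map_pow, map_pow, map_pow, evalAt_rho, evalAt_rho2, evalAt_tau]

/-- On the diagonal q = q' the three invariants ρ², ρ'², τ coincide, so only the sum of the
Gegenbauer coefficients is left. -/
theorem evalAt_confKernel_self (s : ℕ) : evalAt v v (confKernel η s κ) =
    gegenbauerSum (nu d) s * (boxVal η κ * dotVal η v v - conVal κ v ^ 2) ^ s := by
  rw [confKernel_eq, map_sum, gegenbauerSum]
  push_cast
  rw [Finset.sum_mul]
  refine Finset.sum_congr rfl fun r hr => ?_
  have h : s = r + r + (s - 2 * r) := by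
    rw [Finset.mem_range] at hr
    omega
  rw [map_mul, evalAt_C, evalAt_invMon]
  generalize s - 2 * r = t at h
  subst h
  ring

end

/-- If the quadratic form ρ² vanished identically, polarization would give □η_{ij} = κ_i κ_j with
both indices down. Two directions already force □ = 0 and then κ = 0. Null and complex frequencies
are included. -/
theorem exists_rho_ne_zero (hd : 2 ≤ d) {η : Fin d → ℝ} (hη : ∀ i, η i = 1 ∨ η i = -1)
    {κ : Fin d → ℂ} (hκ : κ ≠ 0) :
    ∃ v, boxVal η κ * dotVal η v v - conVal κ v ^ 2 ≠ 0 := by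
  classical
  by_contra! h
  have e1 : ∀ i, boxVal η κ * η i = κ i ^ 2 := by
    intro i
    have := h (Pi.single i 1)
    simp only [dotVal, conVal, Pi.single_apply] at this
    simp at this
    linear_combination this
  have e2 : ∀ i j, i ≠ j → κ i * κ j = 0 := by
    intro i j hij
    have := h (Pi.single i 1 + Pi.single j 1)
    have hji := hij.symm
    simp only [dotVal, conVal, Pi.add_apply, Pi.single_apply, mul_add, add_mul,
      Finset.sum_add_distrib] at this
    simp [hij, hji] at this
    linear_combination (-1 / 2) * this + (1 / 2) * e1 i + (1 / 2) * e1 j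
  let i0 : Fin d := ⟨0, by omega⟩
  let i1 : Fin d := ⟨1, by omega⟩
  have h01 : i0 ≠ i1 := by simp [i0, i1]
  have hS : boxVal η κ = 0 := by
    have h1 := e1 i0
    have h2 := e1 i1
    have h3 := e2 i0 i1 h01
    have h4 : boxVal η κ ^ 2 * (η i0 * η i1) = 0 := by
      linear_combination boxVal η κ * η i1 * h1 + κ i0 ^ 2 * h2 + κ i0 * κ i1 * h3
    have h5 : (η i0 : ℂ) * η i1 ≠ 0 := by
      rcases hη i0 with a | a <;> rcases hη i1 with b | b <;> simp [a, b]
    simpa [h5] using h4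
  refine hκ (funext fun i => ?_)
  have := e1 i
  rw [hS, zero_mul] at this
  exact pow_eq_zero_iff two_ne_zero |>.mp this.symm

/-! ### Lorentz invariance -/

section Lorentz

variable {η : Fin d → ℝ} {Λ : Matrix (Fin d) (Fin d) ℝ}

/-- The action of a linear map on the momenta. -/
def lorentzHom (Λ : Matrix (Fin d) (Fin d) ℝ) : QPoly d →ₐ[ℂ] QPoly d :=
  MvPolynomial.aeval (Sum.elim
    (fun i => ∑ j, C (Λ i j : ℂ) * X (Sum.inl j)) fun i => ∑ j, C (Λ i j : ℂ) * X (Sum.inr j))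

theorem lorentz_dot (hΛ : Λ.transpose * Matrix.diagonal η * Λ = Matrix.diagonal η)
    (a b : Fin d → QPoly d) :
    ∑ i, C (η i : ℂ) * ((∑ j, C (Λ i j : ℂ) * a j) * ∑ j, C (Λ i j : ℂ) * b j) =
      ∑ i, C (η i : ℂ) * (a i * b i) := by
  classical
  have h : ∀ j k, ∑ i, (C (η i : ℂ) * C (Λ i j : ℂ) * C (Λ i k : ℂ) : QPoly d) =
      if j = k then C (η j : ℂ) else 0 := by
    intro j k
    have := congrFun (congrFun hΛ j) k
    rw [Matrix.mul_assoc, Matrix.mul_apply] at this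
    simp only [Matrix.diagonal_mul, Matrix.transpose_apply, Matrix.diagonal_apply] at this
    have h2 := congrArg (fun x : ℝ => (C (x : ℂ) : QPoly d)) this
    simp only [Complex.ofReal_sum, map_sum, Complex.ofReal_mul, map_mul] at h2
    rw [apply_ite (fun x : ℝ => (C (x : ℂ) : QPoly d))] at h2
    simp only [Complex.ofReal_zero, map_zero] at h2
    rw [← h2]
    exact Finset.sum_congr rfl fun i _ => by ring
  have h2 : ∀ i, C (η i : ℂ) * ((∑ j, C (Λ i j : ℂ) * a j) * ∑ j, C (Λ i j : ℂ) * b j) =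
      ∑ j, ∑ k, (C (η i : ℂ) * C (Λ i j : ℂ) * C (Λ i k : ℂ)) * (a j * b k) := by
    intro i
    rw [Finset.sum_mul_sum, Finset.mul_sum]
    refine Finset.sum_congr rfl fun j _ => ?_
    rw [Finset.mul_sum]
    exact Finset.sum_congr rfl fun k _ => by ring
  simp only [h2]
  rw [Finset.sum_comm]
  refine Finset.sum_congr rfl fun j _ => ?_
  rw [Finset.sum_comm]
  simp only [← Finset.sum_mul, h, ite_mul, zero_mul, Finset.sum_ite_eq, Finset.mem_univ, if_true]

theorem lorentz_con (κ : Fin d → ℂ) (a : Fin d → QPoly d) :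
    ∑ i, C (κ i) * (∑ j, C (Λ i j : ℂ) * a j) =
      ∑ j, C (∑ i, κ i * (Λ i j : ℂ)) * a j := by
  simp only [Finset.mul_sum, map_sum, Finset.sum_mul, map_mul]
  rw [Finset.sum_comm]
  exact Finset.sum_congr rfl fun j _ => Finset.sum_congr rfl fun k _ => by ring

/-- The frequency transforms with the transpose of Λ, so the identity needed is Λ η Λᵀ = η. It
follows from the hypothesis because a one-sided inverse of a square matrix is two-sided. -/
theorem boxVal_lorentz (hη : ∀ i, η i = 1 ∨ η i = -1)
    (hΛ : Λ.transpose * Matrix.diagonal η * Λ = Matrix.diagonal η) (κ : Fin d → ℂ) :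
    boxVal η (fun j => ∑ i, κ i * (Λ i j : ℂ)) = boxVal η κ := by
  classical
  have hη2 : Matrix.diagonal η * Matrix.diagonal η = (1 : Matrix (Fin d) (Fin d) ℝ) := by
    rw [Matrix.diagonal_mul_diagonal, ← Matrix.diagonal_one]
    congr 1
    funext i
    rcases hη i with h | h <;> simp [h]
  have h1 : (Matrix.diagonal η * Λ.transpose * Matrix.diagonal η) * Λ = 1 := by
    rw [Matrix.mul_assoc, Matrix.mul_assoc, ← Matrix.mul_assoc Λ.transpose, hΛ, hη2]
  have h2 := mul_eq_one_comm.mp h1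
  have h3 : Λ * Matrix.diagonal η * Λ.transpose = Matrix.diagonal η := by
    calc Λ * Matrix.diagonal η * Λ.transpose
        = (Λ * (Matrix.diagonal η * Λ.transpose * Matrix.diagonal η)) * Matrix.diagonal η := by
          simp only [Matrix.mul_assoc, hη2, Matrix.mul_one]
      _ = Matrix.diagonal η := by rw [h2, Matrix.one_mul]
  have h : ∀ j k, ∑ i, ((η i : ℂ) * (Λ j i : ℂ) * (Λ k i : ℂ)) =
      if j = k then (η j : ℂ) else 0 := by
    intro j k
    have := congrFun (congrFun h3 j) k
    rw [Matrix.mul_apply] at this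
    simp only [Matrix.mul_diagonal, Matrix.transpose_apply, Matrix.diagonal_apply] at this
    have h4 := congrArg (fun x : ℝ => (x : ℂ)) this
    simp only [Complex.ofReal_sum, Complex.ofReal_mul] at h4
    rw [apply_ite (fun x : ℝ => (x : ℂ)), Complex.ofReal_zero] at h4
    rw [← h4]
    exact Finset.sum_congr rfl fun i _ => by ring
  have h5 : ∀ i, (η i : ℂ) * (∑ j, κ j * (Λ j i : ℂ)) ^ 2 =
      ∑ j, ∑ k, ((η i : ℂ) * (Λ j i : ℂ) * (Λ k i : ℂ)) * (κ j * κ k) := by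
    intro i
    rw [sq, Finset.sum_mul_sum, Finset.mul_sum]
    refine Finset.sum_congr rfl fun j _ => ?_
    rw [Finset.mul_sum]
    exact Finset.sum_congr rfl fun k _ => by ring
  simp only [boxVal, h5]
  rw [Finset.sum_comm]
  refine Finset.sum_congr rfl fun j _ => ?_
  rw [Finset.sum_comm]
  simp only [← Finset.sum_mul, h, ite_mul, zero_mul, Finset.sum_ite_eq, Finset.mem_univ, if_true]
  ring

theorem confKernel_lorentz (hη : ∀ i, η i = 1 ∨ η i = -1)
    (hΛ : Λ.transpose * Matrix.diagonal η * Λ = Matrix.diagonal η) (s : ℕ) (κ : Fin d → ℂ) :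
    lorentzHom Λ (confKernel η s κ) = confKernel η s fun j => ∑ i, κ i * (Λ i j : ℂ) := by
  have hC : ∀ c : ℂ, lorentzHom Λ (C c) = C c := fun c => by
    rw [lorentzHom, ← MvPolynomial.algebraMap_eq, AlgHom.commutes]
  have hl : ∀ i, lorentzHom Λ (X (Sum.inl i)) = ∑ j, C (Λ i j : ℂ) * X (Sum.inl j) := fun i => by
    simp [lorentzHom]
  have hr : ∀ i, lorentzHom Λ (X (Sum.inr i)) = ∑ j, C (Λ i j : ℂ) * X (Sum.inr j) := fun i => by
    simp [lorentzHom]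
  have h1 : lorentzHom Λ (qq η) = qq η := by
    simp only [qq, sq, map_sum, map_mul, hC, hl, lorentz_dot hΛ]
  have h2 : lorentzHom Λ (qq2 η) = qq2 η := by
    simp only [qq2, sq, map_sum, map_mul, hC, hr, lorentz_dot hΛ]
  have h3 : lorentzHom Λ (qq12 η) = qq12 η := by
    simp only [qq12, map_sum, map_mul, hC, hl, hr, lorentz_dot hΛ]
  have h4 : lorentzHom Λ (qd κ) = qd fun j => ∑ i, κ i * (Λ i j : ℂ) := by
    simp only [qd, map_sum, map_mul, hC, hl, lorentz_con]
  have h5 : lorentzHom Λ (qd2 κ) = qd2 fun j => ∑ i, κ i * (Λ i j : ℂ) := by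
    simp only [qd2, map_sum, map_mul, hC, hr, lorentz_con]
  simp only [confKernel, rho, rho2, tau, bx_eq, map_sum, map_sub, map_mul, map_pow, hC, h1, h2, h3,
    h4, h5, boxVal_lorentz hη hΛ]

end Lorentz

theorem isConformalKernel_confKernel (hd : 3 ≤ d) {η : Fin d → ℝ}
    (hη : ∀ i, η i = 1 ∨ η i = -1) (s : ℕ) : IsConformalKernel η s (confKernel η s) where
  rank_left κ := (IsBihom.confKernel η s κ).1
  rank_right κ := (IsBihom.confKernel η s κ).2
  differential := (IsPolyDep.confKernel η s).coeff
  order c κ := confKernel_smul η s c κ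
  nonzero κ hκ h0 := by
    obtain ⟨v, hv⟩ := exists_rho_ne_zero (by omega) hη hκ
    have h := evalAt_confKernel_self η κ v s
    rw [h0, map_zero] at h
    rcases mul_eq_zero.mp h.symm with h | h
    · exact gegenbauerSum_ne_zero (nu_nonneg hd) s (by exact_mod_cast h)
    · exact pow_ne_zero s hv h
  invariant Λ hΛ κ := confKernel_lorentz hη hΛ s κ
  symm := rename_confKernel η s
  symm_neg κ := by
    have h := confKernel_smul η s (-1) κ
    rw [pow_mul, neg_one_sq, one_pow, one_smul] at h
    rw [rename_confKernel, ← h]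
    congr 1
    funext i
    simp
  traceless := lap_confKernel hd hη s
  transverse := transv_confKernel hη s

end ConformalKernel

end

section

variable {d : ℕ}

/-! ## The pairing of wave operators with pairs of momentum polynomials -/

section Pairing

open MvPolynomial (C X pderiv)

/-- Polynomials in the momenta with constant coefficients: the Fourier transforms of symbols. -/
abbrev PPoly (d : ℕ) := MvPolynomial (Fin d) ℂ

/-- The value `{p(∂_q) q(∂_{q'}) K}` at `q = q' = 0` of a power series `K`. -/
def pairing (K : (Fin d ⊕ Fin d →₀ ℕ) → ℂ) (p q : PPoly d) : ℂ :=
  ∑ α ∈ p.support, ∑ β ∈ q.support,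
    multiFact α * multiFact β * K (Finsupp.sumElim α β) * (p.coeff α * q.coeff β)

theorem pairing_eq_sum (K : (Fin d ⊕ Fin d →₀ ℕ) → ℂ) {p q : PPoly d} {s t : Finset (Fin d →₀ ℕ)}
    (hs : p.support ⊆ s) (ht : q.support ⊆ t) : pairing K p q =
      ∑ α ∈ s, ∑ β ∈ t,
        multiFact α * multiFact β * K (Finsupp.sumElim α β) * (p.coeff α * q.coeff β) := by
  unfold pairing
  rw [Finset.sum_subset hs]
  · refine Finset.sum_congr rfl fun α _ => Finset.sum_subset ht fun β _ hβ => ?_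
    rw [MvPolynomial.notMem_support_iff.mp hβ]
    ring
  · intro α _ hα
    refine Finset.sum_eq_zero fun β _ => ?_
    rw [MvPolynomial.notMem_support_iff.mp hα]
    ring

theorem pairing_add_left (K : (Fin d ⊕ Fin d →₀ ℕ) → ℂ) (p p' q : PPoly d) :
    pairing K (p + p') q = pairing K p q + pairing K p' q := by
  classical
  have h1 : (p + p').support ⊆ p.support ∪ p'.support := MvPolynomial.support_add
  rw [pairing_eq_sum K h1 (Finset.Subset.refl _),
    pairing_eq_sum K (Finset.subset_union_left (s₂ := p'.support)) (Finset.Subset.refl _),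
    pairing_eq_sum K (Finset.subset_union_right (s₁ := p.support)) (Finset.Subset.refl _),
    ← Finset.sum_add_distrib]
  refine Finset.sum_congr rfl fun α _ => ?_
  rw [← Finset.sum_add_distrib]
  refine Finset.sum_congr rfl fun β _ => ?_
  rw [MvPolynomial.coeff_add]
  ring

theorem pairing_swap (K : (Fin d ⊕ Fin d →₀ ℕ) → ℂ) (p q : PPoly d) :
    pairing K p q = pairing (fun m => K (m.mapDomain Sum.swap)) q p := by
  unfold pairing
  rw [Finset.sum_comm]
  refine Finset.sum_congr rfl fun β _ => Finset.sum_congr rfl fun α _ => ?_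
  have : (Finsupp.sumElim β α).mapDomain Sum.swap = Finsupp.sumElim α β := by
    ext x
    rw [← Sum.swap_swap x, Finsupp.mapDomain_apply Sum.swap_leftInverse.injective]
    rcases x with x | x <;> simp
  simp only [this]
  ring

theorem pairing_add_right (K : (Fin d ⊕ Fin d →₀ ℕ) → ℂ) (p q q' : PPoly d) :
    pairing K p (q + q') = pairing K p q + pairing K p q' := by
  rw [pairing_swap, pairing_add_left, ← pairing_swap, ← pairing_swap]

theorem pairing_smul_left (K : (Fin d ⊕ Fin d →₀ ℕ) → ℂ) (c : ℂ) (p q : PPoly d) :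
    pairing K (c • p) q = c * pairing K p q := by
  rw [pairing_eq_sum K MvPolynomial.support_smul (Finset.Subset.refl _), pairing, Finset.mul_sum]
  refine Finset.sum_congr rfl fun α _ => ?_
  rw [Finset.mul_sum]
  refine Finset.sum_congr rfl fun β _ => ?_
  rw [MvPolynomial.coeff_smul, smul_eq_mul]
  ring

theorem pairing_smul_right (K : (Fin d ⊕ Fin d →₀ ℕ) → ℂ) (c : ℂ) (p q : PPoly d) :
    pairing K p (c • q) = c * pairing K p q := by
  rw [pairing_swap, pairing_smul_left, ← pairing_swap]

theorem pairing_zero_left (K : (Fin d ⊕ Fin d →₀ ℕ) → ℂ) (q : PPoly d) : pairing K 0 q = 0 := by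
  simp [pairing]

theorem pairing_zero_right (K : (Fin d ⊕ Fin d →₀ ℕ) → ℂ) (p : PPoly d) : pairing K p 0 = 0 := by
  simp [pairing]

theorem pairing_sum_left {ι : Type*} (K : (Fin d ⊕ Fin d →₀ ℕ) → ℂ) (t : Finset ι)
    (p : ι → PPoly d) (q : PPoly d) : pairing K (∑ a ∈ t, p a) q = ∑ a ∈ t, pairing K (p a) q :=
  map_sum (⟨⟨fun p => pairing K p q, pairing_zero_left K q⟩,
    fun p p' => pairing_add_left K p p' q⟩ : PPoly d →+ ℂ) p t

theorem pairing_sum_right {ι : Type*} (K : (Fin d ⊕ Fin d →₀ ℕ) → ℂ) (t : Finset ι)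
    (p : PPoly d) (q : ι → PPoly d) : pairing K p (∑ a ∈ t, q a) = ∑ a ∈ t, pairing K p (q a) :=
  map_sum (⟨⟨fun q => pairing K p q, pairing_zero_right K p⟩,
    fun q q' => pairing_add_right K p q q'⟩ : PPoly d →+ ℂ) q t

theorem pairing_monomial (K : (Fin d ⊕ Fin d →₀ ℕ) → ℂ) (α β : Fin d →₀ ℕ) (a b : ℂ) :
    pairing K (MvPolynomial.monomial α a) (MvPolynomial.monomial β b) =
      multiFact α * multiFact β * K (Finsupp.sumElim α β) * (a * b) := by
  rw [pairing_eq_sum K MvPolynomial.support_monomial_subset MvPolynomial.support_monomial_subset]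
  simp

/-- The pairing with a polynomial wave operator. -/
def polyPair (K : QPoly d) (p q : PPoly d) : ℂ := pairing (fun m => K.coeff m) p q

theorem polyPair_add (K L : QPoly d) (p q : PPoly d) :
    polyPair (K + L) p q = polyPair K p q + polyPair L p q := by
  simp only [polyPair, pairing, ← Finset.sum_add_distrib, MvPolynomial.coeff_add]
  exact Finset.sum_congr rfl fun α _ => Finset.sum_congr rfl fun β _ => by ring

theorem polyPair_C_mul (c : ℂ) (K : QPoly d) (p q : PPoly d) :
    polyPair (C c * K) p q = c * polyPair K p q := by
  simp only [polyPair, pairing, Finset.mul_sum, MvPolynomial.coeff_C_mul]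
  exact Finset.sum_congr rfl fun α _ => Finset.sum_congr rfl fun β _ => by ring

theorem polyPair_zero (p q : PPoly d) : polyPair (0 : QPoly d) p q = 0 := by
  simp [polyPair, pairing]

theorem polyPair_sum {ι : Type*} (t : Finset ι) (K : ι → QPoly d) (p q : PPoly d) :
    polyPair (∑ a ∈ t, K a) p q = ∑ a ∈ t, polyPair (K a) p q :=
  map_sum (⟨⟨fun K => polyPair K p q, polyPair_zero p q⟩,
    fun K L => polyPair_add K L p q⟩ : QPoly d →+ ℂ) K t

theorem polyPair_sub (K L : QPoly d) (p q : PPoly d) :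
    polyPair (K - L) p q = polyPair K p q - polyPair L p q :=
  map_sub (⟨⟨fun K => polyPair K p q, polyPair_zero p q⟩,
    fun K L => polyPair_add K L p q⟩ : QPoly d →+ ℂ) K L

theorem polyPair_rename_swap (K : QPoly d) (p q : PPoly d) :
    polyPair (MvPolynomial.rename Sum.swap K) p q = polyPair K q p := by
  rw [polyPair, pairing_swap, polyPair]
  congr 1
  funext m
  rw [MvPolynomial.coeff_rename_mapDomain _ Sum.swap_leftInverse.injective]

theorem polyPair_induction {P Q : PPoly d → PPoly d → ℂ}
    (hP : ∀ p p' q, P (p + p') q = P p q + P p' q) (hP' : ∀ p q q', P p (q + q') = P p q + P p q')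
    (hQ : ∀ p p' q, Q (p + p') q = Q p q + Q p' q) (hQ' : ∀ p q q', Q p (q + q') = Q p q + Q p q')
    (h : ∀ α β a b, P (MvPolynomial.monomial α a) (MvPolynomial.monomial β b) =
      Q (MvPolynomial.monomial α a) (MvPolynomial.monomial β b)) (p q : PPoly d) : P p q = Q p q := by
  induction p using MvPolynomial.induction_on' with
  | monomial α a =>
    induction q using MvPolynomial.induction_on' with
    | monomial β b => exact h α β a b
    | add q q' h1 h2 => rw [hP', hQ', h1, h2]
  | add p p' h1 h2 => rw [hP, hQ, h1, h2]

theorem multiFact_add_single (α : Fin d →₀ ℕ) (i : Fin d) :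
    multiFact (α + Finsupp.single i 1) = multiFact α * (α i + 1) := by
  unfold multiFact
  rw [← Finset.mul_prod_erase _ _ (Finset.mem_univ i),
    ← Finset.mul_prod_erase _ (fun j => ((α j).factorial : ℂ)) (Finset.mem_univ i)]
  have h : ∀ j ∈ Finset.univ.erase i, (((α + Finsupp.single i 1 : Fin d →₀ ℕ) j).factorial : ℂ) =
      ((α j).factorial : ℂ) := by
    intro j hj
    have : i ≠ j := (Finset.ne_of_mem_erase hj).symm
    simp [this]
  rw [Finset.prod_congr rfl h]
  simp only [Finsupp.add_apply, Finsupp.single_eq_same, Nat.factorial_succ]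
  push_cast
  ring

theorem multiFact_ne_zero (α : Fin d →₀ ℕ) : multiFact α ≠ 0 :=
  Finset.prod_ne_zero_iff.mpr fun i _ => by exact_mod_cast Nat.factorial_ne_zero _

theorem sumElim_add_single (α β : Fin d →₀ ℕ) (i : Fin d) :
    Finsupp.sumElim (α + Finsupp.single i 1) β =
      Finsupp.sumElim α β + Finsupp.single (Sum.inl i) 1 := by
  ext x
  rcases x with x | x <;> simp [Finsupp.single_apply]

/-- The weights α! β! in the pairing make multiplication of the kernel by q_i adjoint to ∂/∂p_i on
the polynomial, and `polyPair_mul_left` is the converse. Through this duality Bessel factors of the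
kernel become operators on fields, and gauge variations of fields become differential equations for
the kernel. -/
theorem polyPair_X_mul (i : Fin d) (K : QPoly d) (p q : PPoly d) :
    polyPair (X (Sum.inl i) * K) p q = polyPair K (pderiv i p) q := by
  refine polyPair_induction (P := fun p q => polyPair (X (Sum.inl i) * K) p q)
    (Q := fun p q => polyPair K (pderiv i p) q) (fun p p' q => pairing_add_left _ p p' q)
    (fun p q q' => pairing_add_right _ p q q') (fun p p' q => ?_)
    (fun p q q' => pairing_add_right _ _ q q') (fun α β a b => ?_) p q
  · rw [map_add]
    exact pairing_add_left _ _ _ q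
  · rw [MvPolynomial.pderiv_monomial, polyPair, polyPair, pairing_monomial, pairing_monomial,
      MvPolynomial.coeff_X_mul']
    by_cases h : α i = 0
    · rw [if_neg (by simp [h]), h]
      simp
    · have hα : α = α - Finsupp.single i 1 + Finsupp.single i 1 :=
        (tsub_add_cancel_of_le (Finsupp.single_le_iff.mpr (Nat.one_le_iff_ne_zero.mpr h))).symm
      rw [if_pos (by simp [h])]
      generalize α - Finsupp.single i 1 = γ at hα
      subst hα
      rw [sumElim_add_single, add_tsub_cancel_right, multiFact_add_single]
      simp
      ring

theorem polyPair_mul_left (i : Fin d) (K : QPoly d) (p q : PPoly d) :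
    polyPair K (X i * p) q = polyPair (pderiv (Sum.inl i) K) p q := by
  refine polyPair_induction (P := fun p q => polyPair K (X i * p) q)
    (Q := fun p q => polyPair (pderiv (Sum.inl i) K) p q) (fun p p' q => ?_)
    (fun p q q' => pairing_add_right _ _ q q') (fun p p' q => pairing_add_left _ p p' q)
    (fun p q q' => pairing_add_right _ _ q q') (fun α β a b => ?_) p q
  · rw [mul_add]
    exact pairing_add_left _ _ _ q
  · have : (X i * MvPolynomial.monomial α a : PPoly d) =
        MvPolynomial.monomial (α + Finsupp.single i 1) a := by
      rw [mul_comm, MvPolynomial.X, MvPolynomial.monomial_mul, mul_one]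
    rw [this, polyPair, polyPair, pairing_monomial, pairing_monomial, MvPolynomial.coeff_pderiv,
      sumElim_add_single, multiFact_add_single, Finsupp.sumElim_inl]
    ring

/-- The trace of a momentum polynomial. -/
def trHat (η : Fin d → ℝ) (p : PPoly d) : PPoly d := ∑ i, (η i : ℂ) • pderiv i (pderiv i p)

/-- The divergence of a momentum polynomial. -/
def divHat (κ : Fin d → ℂ) (p : PPoly d) : PPoly d := ∑ i, κ i • pderiv i p

/-- The operator `ρ²` on momentum polynomials. -/
def rhoHat (η : Fin d → ℝ) (κ : Fin d → ℂ) (p : PPoly d) : PPoly d :=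
  boxVal η κ • trHat η p + (-1 : ℂ) • divHat κ (divHat κ p)

/-- Multiplication with `p²`. -/
def pSqHat (η : Fin d → ℝ) (p : PPoly d) : PPoly d := ∑ i, (η i : ℂ) • (X i * (X i * p))

/-- Multiplication with `p∂`. -/
def gradHat (η : Fin d → ℝ) (κ : Fin d → ℂ) (p : PPoly d) : PPoly d :=
  ∑ i, ((η i : ℂ) * κ i) • (X i * p)

theorem polyPair_sum_smul_left {ι : Type*} (t : Finset ι) (K : QPoly d) (c : ι → ℂ)
    (p : ι → PPoly d) (q : PPoly d) :
    polyPair K (∑ a ∈ t, c a • p a) q = ∑ a ∈ t, c a * polyPair K (p a) q := by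
  rw [polyPair, pairing_sum_left]
  exact Finset.sum_congr rfl fun a _ => pairing_smul_left _ _ _ _

theorem polyPair_qq_mul (η : Fin d → ℝ) (K : QPoly d) (p q : PPoly d) :
    polyPair (qq η * K) p q = polyPair K (trHat η p) q := by
  rw [qq, trHat, polyPair_sum_smul_left, Finset.sum_mul, polyPair_sum]
  refine Finset.sum_congr rfl fun i _ => ?_
  rw [mul_assoc, polyPair_C_mul, sq, mul_assoc, polyPair_X_mul, polyPair_X_mul]

theorem polyPair_qd_mul (κ : Fin d → ℂ) (K : QPoly d) (p q : PPoly d) :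
    polyPair (qd κ * K) p q = polyPair K (divHat κ p) q := by
  rw [qd, divHat, polyPair_sum_smul_left, Finset.sum_mul, polyPair_sum]
  refine Finset.sum_congr rfl fun i _ => ?_
  rw [mul_assoc, polyPair_C_mul, polyPair_X_mul]

theorem polyPair_rho_mul (η : Fin d → ℝ) (κ : Fin d → ℂ) (K : QPoly d) (p q : PPoly d) :
    polyPair (rho η κ * K) p q = polyPair K (rhoHat η κ p) q := by
  have h : rho η κ * K = C (boxVal η κ) * (qq η * K) - qd κ * (qd κ * K) := by
    rw [rho, bx_eq]
    ring
  rw [h, polyPair_sub, polyPair_C_mul, polyPair_qq_mul, polyPair_qd_mul, polyPair_qd_mul, rhoHat,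
    polyPair, polyPair, polyPair, pairing_add_left, pairing_smul_left, pairing_smul_left]
  ring

theorem polyPair_rho_pow_mul (η : Fin d → ℝ) (κ : Fin d → ℂ) (r : ℕ) (K : QPoly d)
    (p q : PPoly d) : polyPair (rho η κ ^ r * K) p q = polyPair K ((rhoHat η κ)^[r] p) q := by
  induction r generalizing p with
  | zero => simp
  | succ r ih => rw [pow_succ', mul_assoc, polyPair_rho_mul, ih, Function.iterate_succ_apply]

theorem polyPair_rho2_pow_mul (η : Fin d → ℝ) (κ : Fin d → ℂ) (r : ℕ) (K : QPoly d)
    (p q : PPoly d) : polyPair (rho2 η κ ^ r * K) p q = polyPair K p ((rhoHat η κ)^[r] q) := by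
  rw [← polyPair_rename_swap, map_mul, map_pow, rename_rho2, polyPair_rho_pow_mul,
    polyPair_rename_swap]

theorem polyPair_pSqHat (η : Fin d → ℝ) (K : QPoly d) (p q : PPoly d) :
    polyPair K (pSqHat η p) q = polyPair (lap η K) p q := by
  rw [pSqHat, polyPair_sum_smul_left, lap, polyPair_sum]
  refine Finset.sum_congr rfl fun i _ => ?_
  rw [polyPair_C_mul, polyPair_mul_left, polyPair_mul_left]

theorem polyPair_gradHat (η : Fin d → ℝ) (κ : Fin d → ℂ) (K : QPoly d) (p q : PPoly d) :
    polyPair K (gradHat η κ p) q = polyPair (transv η κ K) p q := by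
  rw [gradHat, polyPair_sum_smul_left, transv, polyPair_sum]
  refine Finset.sum_congr rfl fun i _ => ?_
  rw [polyPair_C_mul, polyPair_mul_left]

/-- In a quadratic action the left field is evaluated at the opposite frequency; the dressing
operator is even, so it is the same on both sides. -/
theorem rhoHat_neg (η : Fin d → ℝ) (κ : Fin d → ℂ) : rhoHat η (-κ) = rhoHat η κ := by
  funext p
  have h1 : boxVal η (-κ) = boxVal η κ := by simp [boxVal]
  have h2 : ∀ p, divHat (-κ) p = (-1 : ℂ) • divHat κ p := fun p => by
    rw [divHat, divHat, Finset.smul_sum]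
    exact Finset.sum_congr rfl fun i _ => by rw [Pi.neg_apply, smul_smul, neg_one_mul]
  have h3 : ∀ (c : ℂ) (p : PPoly d), divHat κ (c • p) = c • divHat κ p := fun c p => by
    rw [divHat, divHat, Finset.smul_sum]
    exact Finset.sum_congr rfl fun i _ => by rw [Derivation.map_smul, smul_comm]
  rw [rhoHat, rhoHat, h1, h2, h2, h3, smul_smul (-1 : ℂ) (-1 : ℂ)]
  norm_num

/-- Only the rank `(s, s)` parts of the arguments contribute for a kernel of that degree. -/
theorem polyPair_homogeneousComponent {K : QPoly d} {i j : ℕ} (hK : IsBihom i j K)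
    (p q : PPoly d) : polyPair K p q =
      polyPair K (MvPolynomial.homogeneousComponent i p) (MvPolynomial.homogeneousComponent j q) := by
  refine polyPair_induction (P := fun p q => polyPair K p q) (Q := fun p q => polyPair K
    (MvPolynomial.homogeneousComponent i p) (MvPolynomial.homogeneousComponent j q))
    (fun p p' q => pairing_add_left _ p p' q) (fun p q q' => pairing_add_right _ _ q q')
    (fun p p' q => ?_) (fun p q q' => ?_) (fun α β a b => ?_) p q
  · rw [map_add]
    exact pairing_add_left _ _ _ _
  · rw [map_add]
    exact pairing_add_right _ _ _ _
  · have hc : ∀ (n : ℕ) (γ : Fin d →₀ ℕ) (c : ℂ), MvPolynomial.homogeneousComponent n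
        (MvPolynomial.monomial γ c) = if γ.degree = n then MvPolynomial.monomial γ c else 0 := by
      intro n γ c
      classical
      ext δ
      rw [MvPolynomial.coeff_homogeneousComponent, MvPolynomial.coeff_monomial]
      by_cases h : γ = δ
      · subst h
        by_cases h' : γ.degree = n <;> simp [h']
      · by_cases h' : γ.degree = n <;> simp [h, h']
    rw [hc, hc]
    by_cases h : α.degree = i ∧ β.degree = j
    · rw [if_pos h.1, if_pos h.2]
    · have h0 : polyPair K (MvPolynomial.monomial α a) (MvPolynomial.monomial β b) = 0 := by
        rw [polyPair, pairing_monomial, hK.coeff_eq_zero _ _ (by tauto)]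
        ring
      rw [h0]
      by_cases h1 : α.degree = i
      · have h2 : β.degree ≠ j := by tauto
        rw [if_neg h2]
        exact (pairing_zero_right _ _).symm
      · rw [if_neg h1]
        exact (pairing_zero_left _ _).symm

end Pairing

end

section

variable {d : ℕ}

/-! ## Fourier transforms of symbols -/

section Fourier

open MvPolynomial (C X pderiv)
open scoped SchwartzMap

/-- A smooth function with compact support as a Schwartz function. -/
def schwartz (f : smoothFn d) (hf : HasCompactSupport (val f)) : 𝓢(Pt d, ℂ) :=
  hf.toSchwartzMap f.2

theorem fourier_schwartz (f : smoothFn d) (hf : HasCompactSupport (val f)) :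
    𝓕 (val f) = ⇑(𝓕 (schwartz f hf) : 𝓢(Pt d, ℂ)) := rfl

theorem fourier_val_add (f g : smoothFn d) (hf : HasCompactSupport (val f))
    (hg : HasCompactSupport (val g)) (ξ : Pt d) :
    𝓕 (val (f + g)) ξ = 𝓕 (val f) ξ + 𝓕 (val g) ξ := by
  rw [fourier_schwartz f hf, fourier_schwartz g hg, ← add_apply,
    ← FourierTransform.fourier_add]
  rfl

theorem fourier_val_smul (c : ℂ) (f : smoothFn d) (ξ : Pt d) :
    𝓕 (val (c • f)) ξ = c * 𝓕 (val f) ξ := by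
  rw [Real.fourier_eq, Real.fourier_eq, ← integral_const_mul]
  congr 1
  funext x
  rw [val_smul, Circle.smul_def, Circle.smul_def, smul_eq_mul, smul_eq_mul]
  ring

theorem fourier_val_zero (ξ : Pt d) : 𝓕 (val (0 : smoothFn d)) ξ = 0 := by
  have := fourier_val_smul 0 (0 : smoothFn d) ξ
  rwa [zero_smul, zero_mul] at this

theorem fourier_pd (i : Fin d) (f : smoothFn d) (hf : HasCompactSupport (val f)) (ξ : Pt d) :
    𝓕 (val (pd i f)) ξ = dSym ξ i * 𝓕 (val f) ξ := by
  have h := SchwartzMap.fourier_lineDerivOp_eq (schwartz f hf) (EuclideanSpace.single i 1)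
  have h2 := congrArg (fun F : 𝓢(Pt d, ℂ) => F ξ) h
  have hg : (fun v : Pt d => inner ℝ v (EuclideanSpace.single i (1 : ℝ))).HasTemperateGrowth :=
    ((innerSL ℝ).flip (EuclideanSpace.single i (1 : ℝ))).hasTemperateGrowth
  simp only [smul_apply] at h2
  rw [SchwartzMap.smulLeftCLM_apply_apply hg] at h2
  have h3 : inner ℝ ξ (EuclideanSpace.single i (1 : ℝ)) = ξ i := by
    rw [EuclideanSpace.inner_single_right]
    simp
  rw [h3] at h2
  have h4 : 𝓕 (val (pd i f)) ξ =
      𝓕 (LineDeriv.lineDerivOp (EuclideanSpace.single i (1 : ℝ)) (schwartz f hf)) ξ := rfl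
  rw [h4, h2, dSym, fourier_schwartz f hf]
  simp only [smul_eq_mul, Complex.real_smul]
  ring

/-- The Fourier transform of a symbol. -/
def hat (u : Symb d) (ξ : Pt d) : PPoly d :=
  ∑ α ∈ u.support, MvPolynomial.monomial α (𝓕 (val (u.coeff α)) ξ)

theorem coeff_hat (u : Symb d) (ξ : Pt d) (α : Fin d →₀ ℕ) :
    (hat u ξ).coeff α = 𝓕 (val (u.coeff α)) ξ :=
  coeff_sum_monomial (fun f : smoothFn d => 𝓕 (val f) ξ) (fourier_val_zero ξ) u α

theorem support_hat (u : Symb d) (ξ : Pt d) : (hat u ξ).support ⊆ u.support := by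
  intro α hα
  rw [MvPolynomial.mem_support_iff, coeff_hat] at hα
  rw [MvPolynomial.mem_support_iff]
  intro h
  rw [h, fourier_val_zero] at hα
  exact hα rfl

theorem hat_add {u v : Symb d} (hu : IsCompSupp u) (hv : IsCompSupp v) (ξ : Pt d) :
    hat (u + v) ξ = hat u ξ + hat v ξ := by
  ext α
  rw [MvPolynomial.coeff_add, coeff_hat, coeff_hat, coeff_hat, MvPolynomial.coeff_add,
    fourier_val_add _ _ (hu α) (hv α)]

theorem hat_smul (c : ℂ) (u : Symb d) (ξ : Pt d) : hat (c • u) ξ = c • hat u ξ := by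
  ext α
  rw [MvPolynomial.coeff_smul, coeff_hat, coeff_hat, coeff_csmul, fourier_val_smul, smul_eq_mul]

theorem hat_zero (ξ : Pt d) : hat (0 : Symb d) ξ = 0 := by simp [hat]

theorem hat_sum {ι : Type*} (t : Finset ι) {u : ι → Symb d} (hu : ∀ i ∈ t, IsCompSupp (u i))
    (ξ : Pt d) : hat (∑ i ∈ t, u i) ξ = ∑ i ∈ t, hat (u i) ξ := by
  classical
  induction t using Finset.induction_on with
  | empty => simpa using hat_zero ξ
  | insert a t ha ih =>
    rw [Finset.sum_insert ha, Finset.sum_insert ha, hat_add (hu a (by simp))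
      (IsCompSupp.sum t fun i hi => hu i (by simp [hi])), ih fun i hi => hu i (by simp [hi])]

theorem hat_rank (s : ℕ) (u : Symb d) (ξ : Pt d) :
    hat (rank s u) ξ = MvPolynomial.homogeneousComponent s (hat u ξ) := by
  ext α
  rw [coeff_hat, coeff_rank, MvPolynomial.coeff_homogeneousComponent, coeff_hat]
  split_ifs
  · rfl
  · exact fourier_val_zero ξ

theorem hat_dX (i : Fin d) {u : Symb d} (hu : IsCompSupp u) (ξ : Pt d) :
    hat (dX i u) ξ = dSym ξ i • hat u ξ := by
  ext α
  rw [MvPolynomial.coeff_smul, coeff_hat, coeff_hat, coeff_dX, fourier_pd i _ (hu α), smul_eq_mul]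

theorem hat_dP (i : Fin d) (u : Symb d) (ξ : Pt d) : hat (dP i u) ξ = pderiv i (hat u ξ) := by
  ext α
  rw [coeff_hat, MvPolynomial.coeff_pderiv, coeff_hat, dP, MvPolynomial.coeff_pderiv]
  have : u.coeff (α + Finsupp.single i 1) * ((α i : smoothFn d) + 1) =
      ((α i : ℂ) + 1) • u.coeff (α + Finsupp.single i 1) := by
    rw [Algebra.smul_def, map_add, map_natCast, map_one, mul_comm]
  rw [this, fourier_val_smul, mul_comm]

theorem hat_X_mul (i : Fin d) (u : Symb d) (ξ : Pt d) :
    hat (MvPolynomial.X i * u) ξ = X i * hat u ξ := by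
  classical
  ext α
  rw [coeff_hat, MvPolynomial.coeff_X_mul', MvPolynomial.coeff_X_mul', coeff_hat]
  split_ifs
  · rfl
  · exact fourier_val_zero ξ

/-! ### Composite operators on symbols in frequency space -/

theorem hat_boxX (η : Fin d → ℝ) {u : Symb d} (hu : IsCompSupp u) (ξ : Pt d) :
    hat (boxX η u) ξ = boxVal η (dSym ξ) • hat u ξ := by
  have h : ∀ i, IsCompSupp (dX i u) := fun i => IsNice.dX_compSupp hu i
  rw [boxX, hat_sum _ fun i _ => (IsNice.dX_compSupp (h i) i).smul _, boxVal, Finset.sum_smul]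
  refine Finset.sum_congr rfl fun i _ => ?_
  rw [hat_smul, hat_dX i (h i), hat_dX i hu, smul_smul, smul_smul, sq, mul_assoc]

theorem hat_trP (η : Fin d → ℝ) {u : Symb d} (hu : IsCompSupp u) (ξ : Pt d) :
    hat (trP η u) ξ = trHat η (hat u ξ) := by
  have h : ∀ i, IsCompSupp (dP i u) := fun i => IsNice.dP_compSupp hu i
  rw [trP, hat_sum _ fun i _ => (IsNice.dP_compSupp (h i) i).smul _, trHat]
  refine Finset.sum_congr rfl fun i _ => ?_
  rw [hat_smul, hat_dP, hat_dP]

theorem hat_divP {u : Symb d} (hu : IsCompSupp u) (ξ : Pt d) :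
    hat (divP u) ξ = divHat (dSym ξ) (hat u ξ) := by
  have h : ∀ i, IsCompSupp (dP i u) := fun i => IsNice.dP_compSupp hu i
  rw [divP, hat_sum _ fun i _ => IsNice.dX_compSupp (h i) i, divHat]
  refine Finset.sum_congr rfl fun i _ => ?_
  rw [hat_dX i (h i), hat_dP]

theorem IsCompSupp.boxX {u : Symb d} (hu : IsCompSupp u) (η : Fin d → ℝ) :
    IsCompSupp (boxX η u) :=
  IsCompSupp.sum _ fun i _ => (IsNice.dX_compSupp (IsNice.dX_compSupp hu i) i).smul _

theorem IsCompSupp.trP {u : Symb d} (hu : IsCompSupp u) (η : Fin d → ℝ) :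
    IsCompSupp (trP η u) :=
  IsCompSupp.sum _ fun i _ => (IsNice.dP_compSupp (IsNice.dP_compSupp hu i) i).smul _

theorem IsCompSupp.divP {u : Symb d} (hu : IsCompSupp u) : IsCompSupp (divP u) :=
  IsCompSupp.sum _ fun i _ => IsNice.dX_compSupp (IsNice.dP_compSupp hu i) i

theorem IsCompSupp.rhoSq {u : Symb d} (hu : IsCompSupp u) (η : Fin d → ℝ) :
    IsCompSupp (rhoSq η u) := ((hu.trP η).boxX η).sub hu.divP.divP

theorem IsCompSupp.rhoSq_iter {u : Symb d} (hu : IsCompSupp u) (η : Fin d → ℝ) (r : ℕ) :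
    IsCompSupp ((ConformalHS.rhoSq η)^[r] u) := by
  induction r with
  | zero => exact hu
  | succ r ih =>
    rw [Function.iterate_succ_apply']
    exact ih.rhoSq η

theorem IsCompSupp.X_mul {u : Symb d} (hu : IsCompSupp u) (i : Fin d) :
    IsCompSupp (MvPolynomial.X i * u) := by
  rw [mul_comm]
  exact hu.mul_right _

theorem IsCompSupp.pGrad {u : Symb d} (hu : IsCompSupp u) (η : Fin d → ℝ) :
    IsCompSupp (pGrad η u) :=
  IsCompSupp.sum _ fun i _ => ((IsNice.dX_compSupp hu i).X_mul i).smul _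

theorem IsCompSupp.pSq_mul {u : Symb d} (hu : IsCompSupp u) (η : Fin d → ℝ) :
    IsCompSupp (pSq η * u) := by
  rw [mul_comm]
  exact hu.mul_right _

theorem hat_rhoSq (η : Fin d → ℝ) {u : Symb d} (hu : IsCompSupp u) (ξ : Pt d) :
    hat (rhoSq η u) ξ = rhoHat η (dSym ξ) (hat u ξ) := by
  have e : rhoSq η u = boxX η (trP η u) + (-1 : ℂ) • divP (divP u) := by
    rw [rhoSq]
    module
  rw [e, hat_add ((hu.trP η).boxX η) (hu.divP.divP.smul _), hat_smul, hat_boxX η (hu.trP η),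
    hat_trP η hu, hat_divP hu.divP, hat_divP hu, rhoHat]

theorem hat_rhoSq_iter (η : Fin d → ℝ) {u : Symb d} (hu : IsCompSupp u) (r : ℕ) (ξ : Pt d) :
    hat ((rhoSq η)^[r] u) ξ = (rhoHat η (dSym ξ))^[r] (hat u ξ) := by
  induction r with
  | zero => rfl
  | succ r ih =>
    rw [Function.iterate_succ_apply', Function.iterate_succ_apply', hat_rhoSq η (hu.rhoSq_iter η r),
      ih]

theorem hat_pGrad (η : Fin d → ℝ) {u : Symb d} (hu : IsCompSupp u) (ξ : Pt d) :
    hat (pGrad η u) ξ = gradHat η (dSym ξ) (hat u ξ) := by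
  rw [pGrad, hat_sum _ fun i _ => ((IsNice.dX_compSupp hu i).X_mul i).smul _, gradHat]
  refine Finset.sum_congr rfl fun i _ => ?_
  rw [hat_smul, hat_X_mul, hat_dX i hu, mul_smul_comm, smul_smul]

theorem hat_pSq_mul (η : Fin d → ℝ) {u : Symb d} (hu : IsCompSupp u) (ξ : Pt d) :
    hat (pSq η * u) ξ = pSqHat η (hat u ξ) := by
  have e : pSq η * u = ∑ i, (η i : ℂ) • (MvPolynomial.X i * (MvPolynomial.X i * u)) := by
    rw [pSq, Finset.sum_mul]
    exact Finset.sum_congr rfl fun i _ => by rw [smul_mul_assoc, mul_assoc]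
  rw [e, hat_sum _ fun i _ => ((hu.X_mul i).X_mul i).smul _, pSqHat]
  refine Finset.sum_congr rfl fun i _ => ?_
  rw [hat_smul, hat_X_mul, hat_X_mul]

theorem dSym_neg (ξ : Pt d) : dSym (-ξ) = -dSym ξ := by
  funext i
  simp [dSym]

theorem boxVal_dSym (η : Fin d → ℝ) (ξ : Pt d) : boxVal η (dSym ξ) = boxSym η ξ := by
  rw [boxVal, boxSym]
  push_cast
  rw [Finset.mul_sum, ← Finset.sum_neg_distrib]
  refine Finset.sum_congr rfl fun i _ => ?_
  rw [dSym]
  linear_combination 4 * Real.pi ^ 2 * η i * ξ i ^ 2 * Complex.I_sq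

theorem boxSym_neg (η : Fin d → ℝ) (ξ : Pt d) : boxSym η (-ξ) = boxSym η ξ := by
  simp [boxSym]

/-! ### Fourier multipliers -/

/-- Continuous and decaying faster than any power. -/
def IsRapid (G : Pt d → ℂ) : Prop :=
  Continuous G ∧ ∀ N : ℕ, ∃ B : ℝ, ∀ ξ, (1 + ‖ξ‖) ^ N * ‖G ξ‖ ≤ B

/-- Continuous and of polynomial growth. -/
def IsSlow (G : Pt d → ℂ) : Prop :=
  Continuous G ∧ ∃ N : ℕ, ∃ B : ℝ, ∀ ξ, ‖G ξ‖ ≤ B * (1 + ‖ξ‖) ^ N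

/-- Locally integrable, and at most of polynomial growth in the mean. -/
def IsMultiplier (k : Pt d → ℂ) : Prop := ∃ N : ℕ, Integrable fun ξ => k ξ / ((1 + ‖ξ‖ : ℝ) : ℂ) ^ N

theorem one_add_norm_ne_zero (ξ : Pt d) : ((1 + ‖ξ‖ : ℝ) : ℂ) ≠ 0 := by
  have : (0 : ℝ) < 1 + ‖ξ‖ := by positivity
  exact_mod_cast this.ne'

theorem norm_one_add_norm (ξ : Pt d) : ‖((1 + ‖ξ‖ : ℝ) : ℂ)‖ = 1 + ‖ξ‖ := by
  rw [Complex.norm_real, Real.norm_of_nonneg (by positivity)]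

theorem isRapid_fourier (f : smoothFn d) (hf : HasCompactSupport (val f)) :
    IsRapid (𝓕 (val f)) := by
  rw [fourier_schwartz f hf]
  refine ⟨SchwartzMap.continuous _, fun N => ⟨2 ^ N * (Finset.Iic (N, 0)).sup
    (fun m : ℕ × ℕ => SchwartzMap.seminorm ℂ m.1 m.2) (𝓕 (schwartz f hf) : 𝓢(Pt d, ℂ)),
    fun ξ => ?_⟩⟩
  have := SchwartzMap.one_add_le_sup_seminorm_apply (𝕜 := ℂ) (m := (N, 0)) le_rfl le_rfl
    (𝓕 (schwartz f hf)) ξ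
  rwa [norm_iteratedFDeriv_zero] at this

theorem IsRapid.comp_neg {G : Pt d → ℂ} (hG : IsRapid G) : IsRapid fun ξ => G (-ξ) := by
  refine ⟨hG.1.comp continuous_neg, fun N => ?_⟩
  obtain ⟨B, hB⟩ := hG.2 N
  exact ⟨B, fun ξ => by simpa using hB (-ξ)⟩

theorem IsRapid.mul {G H : Pt d → ℂ} (hG : IsRapid G) (hH : IsRapid H) :
    IsRapid fun ξ => G ξ * H ξ := by
  refine ⟨hG.1.mul hH.1, fun N => ?_⟩
  obtain ⟨B, hB⟩ := hG.2 N
  obtain ⟨B', hB'⟩ := hH.2 0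
  refine ⟨B * B', fun ξ => ?_⟩
  rw [norm_mul, ← mul_assoc]
  have h1 := hB' ξ
  rw [pow_zero, one_mul] at h1
  exact mul_le_mul (hB ξ) h1 (norm_nonneg _) ((by positivity : (0 : ℝ) ≤ _).trans (hB ξ))

theorem continuous_one_add_norm_pow (N : ℕ) :
    Continuous fun ξ : Pt d => ((1 + ‖ξ‖ : ℝ) : ℂ) ^ N := by fun_prop

theorem IsMultiplier.integrable_mul {k G : Pt d → ℂ} (hk : IsMultiplier k) (hG : IsRapid G) :
    Integrable fun ξ => k ξ * G ξ := by
  obtain ⟨N, hN⟩ := hk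
  obtain ⟨B, hB⟩ := hG.2 N
  have h : Integrable fun ξ : Pt d =>
      (k ξ / ((1 + ‖ξ‖ : ℝ) : ℂ) ^ N) * (((1 + ‖ξ‖ : ℝ) : ℂ) ^ N * G ξ) := by
    refine hN.mul_bdd (c := B)
      (((continuous_one_add_norm_pow N).mul hG.1).aestronglyMeasurable)
      (Eventually.of_forall fun ξ => ?_)
    rw [norm_mul, norm_pow, norm_one_add_norm]
    exact hB ξ
  refine h.congr (Eventually.of_forall fun ξ => ?_)
  have := one_add_norm_ne_zero ξ
  simp only
  field_simp

theorem IsMultiplier.mul_slow {k G : Pt d → ℂ} (hk : IsMultiplier k) (hG : IsSlow G) :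
    IsMultiplier fun ξ => k ξ * G ξ := by
  obtain ⟨N, hN⟩ := hk
  obtain ⟨M, B, hB⟩ := hG.2
  refine ⟨N + M, ?_⟩
  have h : Integrable fun ξ : Pt d =>
      (k ξ / ((1 + ‖ξ‖ : ℝ) : ℂ) ^ N) * (G ξ / ((1 + ‖ξ‖ : ℝ) : ℂ) ^ M) := by
    refine hN.mul_bdd (c := B)
      ((hG.1.div (continuous_one_add_norm_pow M)
        fun ξ => pow_ne_zero _ (one_add_norm_ne_zero ξ)).aestronglyMeasurable)
      (Eventually.of_forall fun ξ => ?_)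
    rw [norm_div, norm_pow, norm_one_add_norm, div_le_iff₀ (by positivity)]
    exact hB ξ
  refine h.congr (Eventually.of_forall fun ξ => ?_)
  have := one_add_norm_ne_zero ξ
  simp only
  rw [pow_add]
  field_simp

theorem IsSlow.const (c : ℂ) : IsSlow fun _ : Pt d => c :=
  ⟨continuous_const, 0, ‖c‖, fun ξ => by simp⟩

theorem IsSlow.one_div_pow (M : ℕ) : IsSlow fun ξ : Pt d => 1 / ((1 + ‖ξ‖ : ℝ) : ℂ) ^ M := by
  refine ⟨continuous_const.div (continuous_one_add_norm_pow M)
    fun ξ => pow_ne_zero _ (one_add_norm_ne_zero ξ), 0, 1, fun ξ => ?_⟩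
  rw [norm_div, norm_pow, norm_one_add_norm, norm_one, pow_zero, mul_one]
  rw [div_le_one (by positivity)]
  exact one_le_pow₀ (by linarith [norm_nonneg ξ])

theorem IsSlow.add {G H : Pt d → ℂ} (hG : IsSlow G) (hH : IsSlow H) :
    IsSlow fun ξ => G ξ + H ξ := by
  obtain ⟨hGc, N, B, hB⟩ := hG
  obtain ⟨hHc, M, B', hB'⟩ := hH
  refine ⟨hGc.add hHc, N + M, |B| + |B'|, fun ξ => (norm_add_le _ _).trans ?_⟩
  have h1 : (1 : ℝ) ≤ 1 + ‖ξ‖ := by linarith [norm_nonneg ξ]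
  have h2 := pow_le_pow_right₀ h1 (Nat.le_add_right N M)
  have h3 := pow_le_pow_right₀ h1 (Nat.le_add_left M N)
  rw [add_mul]
  refine add_le_add ((hB ξ).trans ?_) ((hB' ξ).trans ?_)
  · exact mul_le_mul (le_abs_self B) h2 (by positivity) (abs_nonneg _)
  · exact mul_le_mul (le_abs_self B') h3 (by positivity) (abs_nonneg _)

theorem IsSlow.mul {G H : Pt d → ℂ} (hG : IsSlow G) (hH : IsSlow H) :
    IsSlow fun ξ => G ξ * H ξ := by
  obtain ⟨hGc, N, B, hB⟩ := hG
  obtain ⟨hHc, M, B', hB'⟩ := hH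
  refine ⟨hGc.mul hHc, N + M, B * B', fun ξ => ?_⟩
  rw [norm_mul, pow_add]
  calc ‖G ξ‖ * ‖H ξ‖ ≤ (B * (1 + ‖ξ‖) ^ N) * (B' * (1 + ‖ξ‖) ^ M) :=
        mul_le_mul (hB ξ) (hB' ξ) (norm_nonneg _) ((norm_nonneg _).trans (hB ξ))
    _ = _ := by ring

theorem isSlow_dSym (i : Fin d) : IsSlow fun ξ : Pt d => dSym ξ i := by
  refine ⟨by unfold dSym; fun_prop, 1, 2 * Real.pi, fun ξ => ?_⟩
  have h := PiLp.norm_apply_le ξ i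
  simp only [dSym, norm_mul, Complex.norm_real, Complex.norm_I, Complex.norm_ofNat, mul_one, pow_one]
  rw [Real.norm_of_nonneg Real.pi_pos.le]
  have := Real.pi_pos
  gcongr
  linarith

theorem isSlow_eval (p : MvPolynomial (Fin d) ℂ) :
    IsSlow fun ξ : Pt d => MvPolynomial.eval (dSym ξ) p := by
  induction p using MvPolynomial.induction_on with
  | C a => simpa using IsSlow.const a
  | add p q hp hq => simpa using hp.add hq
  | mul_X p i hp => simpa using hp.mul (isSlow_dSym i)

theorem IsMultiplier.const_mul {k : Pt d → ℂ} (hk : IsMultiplier k) (c : ℂ) :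
    IsMultiplier fun ξ => c * k ξ := by
  simpa only [mul_comm c] using hk.mul_slow (IsSlow.const c)

theorem IsMultiplier.zero : IsMultiplier fun _ : Pt d => 0 := ⟨0, by simp⟩

theorem IsMultiplier.add {k l : Pt d → ℂ} (hk : IsMultiplier k) (hl : IsMultiplier l) :
    IsMultiplier fun ξ => k ξ + l ξ := by
  have aux : ∀ {k : Pt d → ℂ} {N : ℕ} (M : ℕ),
      Integrable (fun ξ => k ξ / ((1 + ‖ξ‖ : ℝ) : ℂ) ^ N) →
      Integrable fun ξ => k ξ / ((1 + ‖ξ‖ : ℝ) : ℂ) ^ (N + M) := by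
    intro k N M hN
    have h := hN.mul_bdd (c := 1) (IsSlow.one_div_pow M).1.aestronglyMeasurable
      (Eventually.of_forall fun ξ => by
        rw [norm_div, norm_pow, norm_one_add_norm, norm_one, div_le_one (by positivity)]
        exact one_le_pow₀ (by linarith [norm_nonneg ξ]))
    refine h.congr (Eventually.of_forall fun ξ => ?_)
    have := one_add_norm_ne_zero ξ
    simp only
    rw [pow_add]
    field_simp
  obtain ⟨N, hN⟩ := hk
  obtain ⟨M, hM⟩ := hl
  refine ⟨N + M, ?_⟩
  have h1 := aux M hN
  have h2 := aux N hM
  rw [add_comm M N] at h2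
  refine (h1.add h2).congr (Eventually.of_forall fun ξ => ?_)
  simp only [Pi.add_apply, add_div]

theorem IsMultiplier.sum {ι : Type*} (t : Finset ι) {k : ι → Pt d → ℂ}
    (hk : ∀ i ∈ t, IsMultiplier (k i)) : IsMultiplier fun ξ => ∑ i ∈ t, k i ξ := by
  classical
  induction t using Finset.induction_on with
  | empty => simpa using IsMultiplier.zero
  | insert a t ha ih =>
    simp only [Finset.sum_insert ha]
    exact (hk a (by simp)).add (ih fun i hi => hk i (by simp [hi]))

theorem IsTempered.isMultiplier {η : Fin d → ℝ} {F : ℝ → ℝ} (hF : IsTempered η F) :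
    IsMultiplier fun ξ : Pt d => (F (boxSym η ξ) : ℂ) := by
  obtain ⟨N, hN⟩ := hF
  refine ⟨N, ?_⟩
  have := hN.ofReal (𝕜 := ℂ)
  simpa using this

theorem isTempered_iff {η : Fin d → ℝ} {F : ℝ → ℝ} :
    IsTempered η F ↔ IsMultiplier fun ξ : Pt d => (F (boxSym η ξ) : ℂ) := by
  refine ⟨IsTempered.isMultiplier, fun ⟨N, hN⟩ => ⟨N, ?_⟩⟩
  refine hN.re.congr (Eventually.of_forall fun ξ => ?_)
  change Complex.re _ = _
  rw [← Complex.ofReal_pow, ← Complex.ofReal_div]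
  exact Complex.ofReal_re _

theorem IsMultiplier.mul_coeff {k : Pt d → ℂ} (hk : IsMultiplier k) {E : (Fin d → ℂ) → QPoly d}
    (hE : IsPolyDep E) (m : Fin d ⊕ Fin d →₀ ℕ) :
    IsMultiplier fun ξ => k ξ * (E (dSym ξ)).coeff m := by
  obtain ⟨p, hp⟩ := hE.coeff m
  simp only [hp]
  exact hk.mul_slow (isSlow_eval p)

end Fourier

end

section

variable {d : ℕ}

/-! ## Quadratic actions in frequency space -/

section Action

open MvPolynomial (C X pderiv)
open scoped SchwartzMap

/-- All the coefficients of the wave operator are Fourier multipliers. -/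
def IsMultiplierOp (P : WaveOp d) : Prop :=
  ∀ m, IsMultiplier fun ξ => MvPowerSeries.coeff m (P ξ)

/-- The integrand of a quadratic action in frequency space. -/
def density (P : WaveOp d) (g h : Symb d) (ξ : Pt d) : ℂ :=
  pairing (fun m => MvPowerSeries.coeff m (P ξ)) (hat g (-ξ)) (hat h ξ)

/-- The bilinear form of a quadratic action. -/
def bilin (P : WaveOp d) (g h : Symb d) : ℂ := ∫ ξ, density P g h ξ

theorem density_eq (P : WaveOp d) (g h : Symb d) (ξ : Pt d) : density P g h ξ =
    ∑ α ∈ g.support, ∑ β ∈ h.support, multiFact α * multiFact β *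
      (MvPowerSeries.coeff (Finsupp.sumElim α β) (P ξ) *
        (𝓕 (val (g.coeff α)) (-ξ) * 𝓕 (val (h.coeff β)) ξ)) := by
  rw [density, pairing_eq_sum _ (support_hat g _) (support_hat h _)]
  refine Finset.sum_congr rfl fun α _ => Finset.sum_congr rfl fun β _ => ?_
  rw [coeff_hat, coeff_hat]
  ring

theorem integrable_density_term {P : WaveOp d} (hP : IsMultiplierOp P) {g h : Symb d}
    (hg : IsCompSupp g) (hh : IsCompSupp h) (α β : Fin d →₀ ℕ) :
    Integrable fun ξ => MvPowerSeries.coeff (Finsupp.sumElim α β) (P ξ) *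
      (𝓕 (val (g.coeff α)) (-ξ) * 𝓕 (val (h.coeff β)) ξ) :=
  (hP _).integrable_mul ((isRapid_fourier _ (hg α)).comp_neg.mul (isRapid_fourier _ (hh β)))

theorem integrable_density {P : WaveOp d} (hP : IsMultiplierOp P) {g h : Symb d}
    (hg : IsCompSupp g) (hh : IsCompSupp h) : Integrable (density P g h) := by
  have : density P g h = fun ξ => _ := funext (density_eq P g h)
  rw [this]
  exact integrable_finsetSum _ fun α _ => integrable_finsetSum _ fun β _ =>
    (integrable_density_term hP hg hh α β).const_mul _

/-- `∫ f 𝓕⁻g = ∫ (𝓕f)(-ξ) g(ξ)`. -/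
theorem integral_mul_fourierInv {f g : Pt d → ℂ} (hf : Integrable f) (hg : Integrable g) :
    ∫ x, f x * 𝓕⁻ g x = ∫ ξ, g ξ * 𝓕 f (-ξ) := by
  have h1 : 𝓕⁻ g = 𝓕 fun ξ => g (-ξ) := by
    funext x
    rw [Real.fourierInv_eq_fourier_comp_neg]
  have h2 : ∫ ξ, 𝓕 f ξ • (fun ξ => g (-ξ)) ξ = ∫ x, f x • 𝓕 (fun ξ => g (-ξ)) x := by
    simpa using! VectorFourier.integral_fourierIntegral_smul_eq_flip (L := innerₗ (Pt d))
      (f := f) (g := fun ξ => g (-ξ)) Real.continuous_fourierChar continuous_inner hf hg.comp_neg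
  simp only [smul_eq_mul] at h2
  rw [h1, ← h2, ← integral_neg_eq_self]
  exact integral_congr_ae (Eventually.of_forall fun ξ => by simp [mul_comm])

/-- Parseval's formula, term by term. A multiplier is integrable only against rapidly decaying
functions, which suffices here because the transforms of test functions decay rapidly. -/
theorem quadAction_eq_bilin {P : WaveOp d} (hP : IsMultiplierOp P) {h : Symb d}
    (hh : IsCompSupp h) : quadAction P h = bilin P h h := by
  rw [bilin, funext (density_eq P h h), quadAction, integral_finsetSum]
  · refine Finset.sum_congr rfl fun α _ => ?_
    rw [integral_finsetSum]
    · refine Finset.sum_congr rfl fun β _ => ?_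
      rw [integral_const_mul]
      congr 1
      rw [integral_mul_fourierInv]
      · exact integral_congr_ae (Eventually.of_forall fun ξ => by simp only; ring)
      · exact (schwartz _ (hh α)).integrable
      · exact (hP _).integrable_mul (isRapid_fourier _ (hh β))
    · exact fun β _ => (integrable_density_term hP hh hh α β).const_mul _
  · exact fun α _ => integrable_finsetSum _ fun β _ =>
      (integrable_density_term hP hh hh α β).const_mul _

theorem bilin_add_left {P : WaveOp d} (hP : IsMultiplierOp P) {g g' h : Symb d}
    (hg : IsCompSupp g) (hg' : IsCompSupp g') (hh : IsCompSupp h) :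
    bilin P (g + g') h = bilin P g h + bilin P g' h := by
  rw [bilin, bilin, bilin, ← integral_add (integrable_density hP hg hh)
    (integrable_density hP hg' hh)]
  refine integral_congr_ae (Eventually.of_forall fun ξ => ?_)
  simp only [density, hat_add hg hg', pairing_add_left]

theorem bilin_add_right {P : WaveOp d} (hP : IsMultiplierOp P) {g h h' : Symb d}
    (hg : IsCompSupp g) (hh : IsCompSupp h) (hh' : IsCompSupp h') :
    bilin P g (h + h') = bilin P g h + bilin P g h' := by
  rw [bilin, bilin, bilin, ← integral_add (integrable_density hP hg hh)
    (integrable_density hP hg hh')]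
  refine integral_congr_ae (Eventually.of_forall fun ξ => ?_)
  simp only [density, hat_add hh hh', pairing_add_right]

theorem bilin_smul_left (P : WaveOp d) (c : ℂ) (g h : Symb d) :
    bilin P (c • g) h = c * bilin P g h := by
  rw [bilin, bilin, ← integral_const_mul]
  refine integral_congr_ae (Eventually.of_forall fun ξ => ?_)
  simp only [density, hat_smul, pairing_smul_left]

theorem bilin_smul_right (P : WaveOp d) (c : ℂ) (g h : Symb d) :
    bilin P g (c • h) = c * bilin P g h := by
  rw [bilin, bilin, ← integral_const_mul]
  refine integral_congr_ae (Eventually.of_forall fun ξ => ?_)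
  simp only [density, hat_smul, pairing_smul_right]

/-- The real and imaginary parts of a symbol. -/
theorem exists_real_imag {u : Symb d} (hu : IsCompSupp u) :
    ∃ r i : Symb d, IsRealField r ∧ IsRealField i ∧ u = r + Complex.I • i := by
  have h1 : dagger (dagger u) = u := dagger_dagger u
  refine ⟨(1 / 2 : ℂ) • (u + dagger u), (-Complex.I / 2) • (u + (-1 : ℂ) • dagger u),
    ⟨?_, (hu.add hu.dagger).smul _⟩, ⟨?_, (hu.add (hu.dagger.smul _)).smul _⟩, ?_⟩
  · rw [dagger_smul, dagger_add, h1, add_comm, map_div₀, map_one, map_ofNat]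
  · rw [dagger_smul, dagger_add, dagger_smul, h1]
    have : (starRingEnd ℂ) (-Complex.I / 2) = Complex.I / 2 := by
      rw [map_div₀, map_neg, Complex.conj_I, neg_neg, map_ofNat]
    rw [this, map_neg, map_one]
    module
  · rw [smul_smul, show Complex.I * (-Complex.I / 2) = 1 / 2 by
      linear_combination (-1 / 2) * Complex.I_sq]
    module

/-- A bilinear form that vanishes on real fields vanishes on all compactly supported symbols. -/
theorem bilin_eq_zero_of_real {P : WaveOp d} (hP : IsMultiplierOp P) {T : Symb d → Symb d}
    (hT : ∀ u, IsCompSupp u → IsCompSupp (T u)) (hTadd : ∀ u v, T (u + v) = T u + T v)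
    (hTsmul : ∀ (c : ℂ) u, T (c • u) = c • T u)
    (h : ∀ u v, IsRealField u → IsRealField v → bilin P (T u) v = 0) {u v : Symb d}
    (hu : IsCompSupp u) (hv : IsCompSupp v) : bilin P (T u) v = 0 := by
  obtain ⟨r, i, hr, hi, rfl⟩ := exists_real_imag hu
  obtain ⟨r', i', hr', hi', rfl⟩ := exists_real_imag hv
  rw [hTadd, hTsmul, bilin_add_left hP (hT _ hr.2) ((hT _ hi.2).smul _) hv, bilin_smul_left,
    bilin_add_right hP (hT _ hr.2) hr'.2 (hi'.2.smul _),
    bilin_add_right hP (hT _ hi.2) hr'.2 (hi'.2.smul _), bilin_smul_right, bilin_smul_right,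
    h r r' hr hr', h r i' hr hi', h i r' hi hr', h i i' hi hi']
  ring

/-- A multiplier is determined by its matrix elements between test functions. -/
theorem IsMultiplier.ae_eq_zero {k : Pt d → ℂ} (hk : IsMultiplier k)
    (h : ∀ f g : smoothFn d, HasCompactSupport (val f) → HasCompactSupport (val g) →
      ∫ ξ, k ξ * (𝓕 (val f) (-ξ) * 𝓕 (val g) ξ) = 0) : ∀ᵐ ξ, k ξ = 0 := by
  -- For a fixed `f` the product of `k` with the reflected transform of `f` is integrable. The
  -- hypothesis says that it annihilates all transforms of test functions, so its own Fourier
  -- transform vanishes.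
  have step : ∀ f : smoothFn d, HasCompactSupport (val f) →
      ∀ᵐ ξ, k ξ * 𝓕 (val f) (-ξ) = 0 := by
    intro f hf
    set K : Pt d → ℂ := fun ξ => k ξ * 𝓕 (val f) (-ξ) with hKdef
    have hK : Integrable K := hk.integrable_mul (isRapid_fourier f hf).comp_neg
    have flip : ∀ ψ : Pt d → ℂ, Integrable ψ → ∫ ξ, 𝓕 ψ ξ * K ξ = ∫ x, ψ x * 𝓕 K x := by
      intro ψ hψ
      simpa using! VectorFourier.integral_fourierIntegral_smul_eq_flip (L := innerₗ (Pt d))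
        (f := ψ) (g := K) Real.continuous_fourierChar continuous_inner hψ hK
    have hcont : Continuous (𝓕 K) := VectorFourier.fourierIntegral_continuous
      Real.continuous_fourierChar (by exact continuous_inner) hK
    have hzero : ∀ᵐ x, 𝓕 K x = 0 := by
      refine ae_eq_zero_of_integral_contDiff_smul_eq_zero hcont.locallyIntegrable fun g hg hgs => ?_
      let G : smoothFn d := ⟨fun x => (g x : ℂ), Complex.ofRealCLM.contDiff.comp hg⟩
      have hGs : HasCompactSupport (val G) := hgs.comp_left (g := fun r : ℝ => (r : ℂ)) rfl
      have h1 := h f G hf hGs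
      have h2 := flip (val G) (schwartz G hGs).integrable
      have h3 : ∫ ξ, 𝓕 (val G) ξ * K ξ = 0 := by
        rw [← h1]
        exact integral_congr_ae (Eventually.of_forall fun ξ => by simp only [K]; ring)
      rw [h3] at h2
      rw [h2]
      exact integral_congr_ae (Eventually.of_forall fun x => by
        simp only [Complex.real_smul]; rfl)
    -- Injectivity of the Fourier transform on integrable functions: any test function is the
    -- transform of a Schwartz function ψ, and the integral moves to ψ times the transform of `K`,
    -- which is zero.
    refine ae_eq_zero_of_integral_contDiff_smul_eq_zero hK.locallyIntegrable fun g hg hgs => ?_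
    let G : smoothFn d := ⟨fun x => (g x : ℂ), Complex.ofRealCLM.contDiff.comp hg⟩
    have hGs : HasCompactSupport (val G) := hgs.comp_left (g := fun r : ℝ => (r : ℂ)) rfl
    let ψ : 𝓢(Pt d, ℂ) := 𝓕⁻ (schwartz G hGs)
    have h4 : 𝓕 (ψ : Pt d → ℂ) = val G := by
      have : 𝓕 ψ = schwartz G hGs := FourierTransform.fourier_fourierInv_eq _
      have h5 := congrArg (fun F : 𝓢(Pt d, ℂ) => (F : Pt d → ℂ)) this
      exact h5
    have h6 := flip ψ ψ.integrable
    rw [h4] at h6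
    have h7 : ∫ x, ψ x * 𝓕 K x = 0 := by
      rw [integral_eq_zero_of_ae]
      filter_upwards [hzero] with x hx
      simp [hx]
    rw [h7] at h6
    rw [← h6]
    exact integral_congr_ae (Eventually.of_forall fun x => by
      simp only [Complex.real_smul]; rfl)
  -- To remove the factor depending on `f`, near each ξ₀ a bump function is modulated so that its
  -- transform at -ξ₀ equals the integral of the bump. By continuity the factor is non-zero in a
  -- neighbourhood, and a locally null set is null.
  have hnull : volume {ξ : Pt d | k ξ ≠ 0} = 0 := by
    refine measure_null_of_locally_null _ fun ξ₀ _ => ?_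
    let b : ContDiffBump (0 : Pt d) := ⟨1, 2, by norm_num, by norm_num⟩
    let f : smoothFn d := ⟨fun x => (b x : ℂ) * Complex.exp (((-2 * Real.pi * inner ℝ x ξ₀ : ℝ) : ℂ) * Complex.I),
      ((Complex.ofRealCLM.contDiff.comp b.contDiff).mul
        (Complex.contDiff_exp.comp ((Complex.ofRealCLM.contDiff.comp
          (contDiff_const.mul (contDiff_id.inner ℝ contDiff_const))).mul contDiff_const)))⟩
    have hf : HasCompactSupport (val f) := by
      have : HasCompactSupport fun x => (b x : ℂ) :=
        b.hasCompactSupport.comp_left (g := fun r : ℝ => (r : ℂ)) rfl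
      exact this.mul_right
    have hval : 𝓕 (val f) (-ξ₀) = ((∫ x, b x : ℝ) : ℂ) := by
      have ho : ((∫ x, b x : ℝ) : ℂ) = ∫ x, (b x : ℂ) := integral_ofReal.symm
      rw [Real.fourier_eq', ho]
      refine integral_congr_ae (Eventually.of_forall fun x => ?_)
      simp only [smul_eq_mul, val, f]
      rw [mul_left_comm, ← Complex.exp_add, inner_neg_right]
      push_cast
      rw [show -2 * (Real.pi : ℂ) * -((inner ℝ x ξ₀ : ℝ) : ℂ) * Complex.I +
        -2 * (Real.pi : ℂ) * ((inner ℝ x ξ₀ : ℝ) : ℂ) * Complex.I = 0 by ring]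
      simp
    have hpos : 0 < ∫ x, b x := b.integral_pos
    have hne : 𝓕 (val f) (-ξ₀) ≠ 0 := by
      rw [hval]
      exact_mod_cast hpos.ne'
    have hcont : Continuous fun ξ => 𝓕 (val f) (-ξ) := (isRapid_fourier f hf).comp_neg.1
    have hopen := hcont.continuousAt.eventually_ne hne
    refine ⟨{ξ | k ξ ≠ 0} ∩ {ξ | 𝓕 (val f) (-ξ) ≠ 0},
      inter_mem self_mem_nhdsWithin (mem_nhdsWithin_of_mem_nhds hopen), ?_⟩
    refine measure_mono_null ?_ (step f hf)
    rintro ξ ⟨h1, h2⟩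
    exact mul_ne_zero h1 h2
  exact hnull

/-- The monomial symbol `f(x) p^α`. -/
theorem isCompSupp_monomial {f : smoothFn d} (hf : HasCompactSupport (val f)) (α : Fin d →₀ ℕ) :
    IsCompSupp (MvPolynomial.monomial α f : Symb d) := by
  classical
  intro β
  rw [MvPolynomial.coeff_monomial]
  split_ifs
  · exact hf
  · exact HasCompactSupport.zero

theorem hat_monomial (f : smoothFn d) (α : Fin d →₀ ℕ) (ξ : Pt d) :
    hat (MvPolynomial.monomial α f : Symb d) ξ = MvPolynomial.monomial α (𝓕 (val f) ξ) := by
  classical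
  ext β
  rw [coeff_hat, MvPolynomial.coeff_monomial, MvPolynomial.coeff_monomial]
  split_ifs
  · rfl
  · exact fourier_val_zero ξ

end Action

end

section

variable {d : ℕ}

/-! ## Second variations -/

section Variation

theorem ContDiffAt.eventually_differentiableAt {n : ℕ} {E : (Fin n → ℝ) → ℝ}
    (hE : ContDiffAt ℝ 2 E 0) : ∀ᶠ x in 𝓝 0, DifferentiableAt ℝ E x := by
  have := hE.eventually (by simp)
  exact this.mono fun x hx => hx.differentiableAt (by simp)

theorem differentiableAt_fderiv {n : ℕ} {E : (Fin n → ℝ) → ℝ}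
    (hE : ContDiffAt ℝ 2 E 0) : DifferentiableAt ℝ (fderiv ℝ E) 0 :=
  (hE.fderiv_right (m := 1) (by norm_num)).differentiableAt (by simp)

theorem hasDerivAt_fderiv_line {n : ℕ} {E : (Fin n → ℝ) → ℝ} (hE : ContDiffAt ℝ 2 E 0)
    (v w : Fin n → ℝ) : HasDerivAt (fun t : ℝ => fderiv ℝ E (t • v) w)
      (fderiv ℝ (fderiv ℝ E) 0 v w) 0 := by
  have h1 : HasDerivAt (fun t : ℝ => t • v) v 0 := by
    simpa using (hasDerivAt_id (0 : ℝ)).smul_const v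
  have h2 : HasFDerivAt (fderiv ℝ E) (fderiv ℝ (fderiv ℝ E) 0) ((0 : ℝ) • v) := by
    rw [zero_smul]
    exact (differentiableAt_fderiv hE).hasFDerivAt
  have h3 := h2.comp_hasDerivAt (0 : ℝ) h1
  exact ((ContinuousLinearMap.apply ℝ ℝ w).hasFDerivAt.comp_hasDerivAt (0 : ℝ) h3)

theorem eventually_line {n : ℕ} {p : (Fin n → ℝ) → Prop} (hp : ∀ᶠ x in 𝓝 0, p x)
    (v : Fin n → ℝ) : ∀ᶠ t : ℝ in 𝓝 0, p (t • v) := by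
  have : Tendsto (fun t : ℝ => t • v) (𝓝 0) (𝓝 0) := by
    have h : Continuous fun t : ℝ => t • v := by fun_prop
    simpa using h.tendsto 0
  exact this.eventually hp

theorem iteratedDeriv_two_line {n : ℕ} {E : (Fin n → ℝ) → ℝ} (hE : ContDiffAt ℝ 2 E 0)
    (v : Fin n → ℝ) : iteratedDeriv 2 (fun t : ℝ => E (t • v)) 0 =
      fderiv ℝ (fderiv ℝ E) 0 v v := by
  rw [iteratedDeriv_succ, iteratedDeriv_one]
  have h : deriv (fun t : ℝ => E (t • v)) =ᶠ[𝓝 0] fun t => fderiv ℝ E (t • v) v := by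
    filter_upwards [eventually_line (ContDiffAt.eventually_differentiableAt hE) v] with t ht
    have h1 : HasDerivAt (fun t : ℝ => t • v) v t := by
      simpa using (hasDerivAt_id t).smul_const v
    exact (ht.hasFDerivAt.comp_hasDerivAt t h1).deriv
  rw [h.deriv_eq]
  exact (hasDerivAt_fderiv_line hE v v).deriv

theorem dagger_pSq (η : Fin d → ℝ) : dagger (pSq η) = pSq η := by
  have hX : ∀ i : Fin d, dagger (MvPolynomial.X i : Symb d) = MvPolynomial.X i := by
    intro i
    classical
    refine MvPolynomial.ext _ _ fun α => ?_
    rw [coeff_dagger, MvPolynomial.coeff_X]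
    split_ifs
    · exact val_ext fun x => map_one (starRingEnd ℂ)
    · exact conjFn_zero
  rw [pSq, dagger_sum]
  refine Finset.sum_congr rfl fun i _ => ?_
  rw [dagger_smul, dagger_mul, hX, Complex.conj_ofReal]

theorem dagger_vac (η : Fin d → ℝ) : dagger (vac η) = vac η := by
  rw [vac, dagger_neg, dagger_pSq]

/-- If the derivative in the direction `e₁ + t e₂` at `t e₀` is of second order in `t`, and the
derivative in the direction `e₂` vanishes at the origin, so does the mixed second derivative. -/
theorem mixed_derivative_eq_zero {n : ℕ} {E : (Fin n → ℝ) → ℝ} (hE : ContDiffAt ℝ 2 E 0)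
    (e₀ e₁ e₂ : Fin n → ℝ)
    (hO : (fun t : ℝ => deriv (fun u : ℝ => E (t • e₀ + u • (e₁ + t • e₂))) 0)
      =O[𝓝 0] fun t : ℝ => t ^ 2)
    (h0 : HasDerivAt (fun t : ℝ => E (t • e₂)) 0 0) : fderiv ℝ (fderiv ℝ E) 0 e₀ e₁ = 0 := by
  -- By the chain rule the variation is DE(te₀)e₁ + t DE(te₀)e₂ near t = 0. Its derivative at 0 is
  -- D²E(e₀, e₁) + DE(0)e₂, which vanishes because the variation is O(t²); the vacuum condition
  -- kills the last term.
  have hev : (fun t : ℝ => deriv (fun u : ℝ => E (t • e₀ + u • (e₁ + t • e₂))) 0) =ᶠ[𝓝 0]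
      fun t : ℝ => fderiv ℝ E (t • e₀) e₁ + t * fderiv ℝ E (t • e₀) e₂ := by
    filter_upwards [eventually_line (ContDiffAt.eventually_differentiableAt hE) e₀] with t ht
    have h2 : HasDerivAt (fun u : ℝ => t • e₀ + u • (e₁ + t • e₂)) (e₁ + t • e₂) 0 := by
      simpa using ((hasDerivAt_id (0 : ℝ)).smul_const (e₁ + t • e₂)).const_add (t • e₀)
    have h3 : HasFDerivAt E (fderiv ℝ E (t • e₀)) (t • e₀ + (0 : ℝ) • (e₁ + t • e₂)) := by
      rw [zero_smul, add_zero]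
      exact ht.hasFDerivAt
    have h4 : HasDerivAt (fun u : ℝ => E (t • e₀ + u • (e₁ + t • e₂)))
        (fderiv ℝ E (t • e₀) (e₁ + t • e₂)) 0 := h3.comp_hasDerivAt (0 : ℝ) h2
    rw [h4.deriv, map_add, map_smul, smul_eq_mul]
  have hO2 : (fun t : ℝ => fderiv ℝ E (t • e₀) e₁ + t * fderiv ℝ E (t • e₀) e₂)
      =O[𝓝 0] fun t : ℝ => ‖t - 0‖ ^ 2 := by
    refine (hO.congr' hev EventuallyEq.rfl).trans (IsBigO.of_bound 1 (Eventually.of_forall ?_))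
    intro t
    simp
  have hd0 := (hO2.hasFDerivAt (by norm_num)).hasDerivAt
  have hd1 := (hasDerivAt_fderiv_line hE e₀ e₁).add
    ((hasDerivAt_id (0 : ℝ)).mul (hasDerivAt_fderiv_line hE e₀ e₂))
  have hd2 := hd0.unique hd1
  have hpsi : fderiv ℝ E 0 e₂ = 0 := by
    have h7 : HasDerivAt (fun t : ℝ => t • e₂) e₂ 0 := by
      simpa using (hasDerivAt_id (0 : ℝ)).smul_const e₂
    have h8 : HasFDerivAt E (fderiv ℝ E 0) ((0 : ℝ) • e₂) := by
      rw [zero_smul]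
      exact (hE.differentiableAt (by simp)).hasFDerivAt
    have h9 : HasDerivAt (fun t : ℝ => E (t • e₂)) (fderiv ℝ E 0 e₂) 0 :=
      h8.comp_hasDerivAt (0 : ℝ) h7
    exact h9.unique h0
  simp [hpsi] at hd2
  exact hd2.symm

/-- The linearized gauge transformations are symmetries of the quadratic part of an invariant
action. -/
theorem quadPart_add_gaugeVar {ħ : ℝ} {η : Fin d → ℝ} {A : Symb d → ℝ} (hA : HasExpansion η A)
    (hinv : IsGaugeInvariant ħ η A) (hvac : IsVacuum η A) {w h : Symb d} (hw : IsCompSupp w)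
    (hh : IsRealField h) : quadPart η A (h + gaugeVar ħ w (vac η)) =
      quadPart η A h + quadPart η A (gaugeVar ħ w (vac η)) := by
  have hδ : IsRealField (gaugeVar ħ w (vac η)) :=
    ⟨dagger_gaugeVar ħ _ (dagger_vac η), hw.gaugeVar ħ _⟩
  have hδ' : IsRealField (gaugeVar ħ w h) := ⟨dagger_gaugeVar ħ _ hh.1, hw.gaugeVar ħ _⟩
  -- The gauge variation is linear in `H`, so varying -p² + th moves in the three directions h, δ
  -- and δ', the last with coefficient ut. This places the problem in a three-parameter family, to
  -- which the regularity assumption applies.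
  have hvary : ∀ t u : ℝ, vac η + (t : ℂ) • h + (u : ℂ) • gaugeVar ħ w (vac η + (t : ℂ) • h) =
      vac η + ((t : ℂ) • h + (u : ℂ) • gaugeVar ħ w (vac η) +
        ((u * t : ℝ) : ℂ) • gaugeVar ħ w h) := by
    intro t u
    rw [gaugeVar_add, gaugeVar_smul]
    push_cast
    module
  have hinv2 := hinv w h hw hh 2
  have hvac2 := hvac _ hδ'
  simp only [gaugeVariation, hvary] at hinv2
  clear hvary
  generalize gaugeVar ħ w (vac η) = δ at *
  generalize gaugeVar ħ w h = δ' at *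
  let E : (Fin 3 → ℝ) → ℝ := fun t => A (vac η + ∑ i, (t i : ℂ) • (![h, δ, δ'] : Fin 3 → Symb d) i)
  have hE : ContDiffAt ℝ 2 E 0 := hA 3 ![h, δ, δ'] (by
    intro i
    fin_cases i
    · exact hh
    · exact hδ
    · exact hδ')
  have hEval : ∀ t : Fin 3 → ℝ, E t =
      A (vac η + ((t 0 : ℂ) • h + (t 1 : ℂ) • δ + (t 2 : ℂ) • δ')) := by
    intro t
    simp only [E, Fin.sum_univ_three]
    rfl
  have hquad : ∀ a b : ℝ, quadPart η A ((a : ℂ) • h + (b : ℂ) • δ) =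
      fderiv ℝ (fderiv ℝ E) 0 ![a, b, 0] ![a, b, 0] / 2 := by
    intro a b
    rw [quadPart, ← iteratedDeriv_two_line hE]
    congr 2
    funext t
    have c0 : (t • ![a, b, 0] : Fin 3 → ℝ) 0 = t * a := rfl
    have c1 : (t • ![a, b, 0] : Fin 3 → ℝ) 1 = t * b := rfl
    have c2 : (t • ![a, b, 0] : Fin 3 → ℝ) 2 = 0 := mul_zero t
    rw [hEval, c0, c1, c2]
    congr 2
    push_cast
    module
  have e1 := hquad 1 0
  have e2 := hquad 0 1
  have e3 := hquad 1 1
  rw [Complex.ofReal_one, Complex.ofReal_zero, one_smul, zero_smul, add_zero] at e1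
  rw [Complex.ofReal_one, Complex.ofReal_zero, one_smul, zero_smul, zero_add] at e2
  rw [Complex.ofReal_one, one_smul, one_smul] at e3
  have hv : (![1, 1, 0] : Fin 3 → ℝ) = ![1, 0, 0] + ![0, 1, 0] := by
    funext i
    fin_cases i <;> simp
  have hsymm : fderiv ℝ (fderiv ℝ E) 0 ![0, 1, 0] ![1, 0, 0] =
      fderiv ℝ (fderiv ℝ E) 0 ![1, 0, 0] ![0, 1, 0] := (hE.isSymmSndFDerivAt (by simp)) _ _
  -- Second order in t of the invariance condition is enough; no higher order is used.
  have hcross : fderiv ℝ (fderiv ℝ E) 0 ![1, 0, 0] ![0, 1, 0] = 0 := by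
    refine mixed_derivative_eq_zero hE _ _ ![0, 0, 1] ?_ ?_
    · refine hinv2.congr_left fun t => ?_
      congr 1
      funext u
      have c0 : (t • ![1, 0, 0] + u • (![0, 1, 0] + t • ![0, 0, 1]) : Fin 3 → ℝ) 0 = t := by simp
      have c1 : (t • ![1, 0, 0] + u • (![0, 1, 0] + t • ![0, 0, 1]) : Fin 3 → ℝ) 1 = u := by simp
      have c2 : (t • ![1, 0, 0] + u • (![0, 1, 0] + t • ![0, 0, 1]) : Fin 3 → ℝ) 2 = u * t := by
        simp
      rw [hEval, c0, c1, c2]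
    · convert hvac2 using 2 with t
      have c0 : (t • ![0, 0, 1] : Fin 3 → ℝ) 0 = 0 := by simp
      have c1 : (t • ![0, 0, 1] : Fin 3 → ℝ) 1 = 0 := by simp
      have c2 : (t • ![0, 0, 1] : Fin 3 → ℝ) 2 = t := by simp
      rw [hEval, c0, c1, c2, Complex.ofReal_zero]
      congr 2
      module
  rw [e3, e1, e2, hv]
  simp only [map_add, add_apply, hsymm, hcross]
  ring

end Variation

end

section

variable {d : ℕ}

/-! ## Wave operators by rank -/

section Parts

open MvPolynomial (C X pderiv)

theorem degree_sumElim (α β : Fin d →₀ ℕ) :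
    (Finsupp.sumElim α β).degree = α.degree + β.degree := by
  simp [Finsupp.degree_eq_sum]

/-- One term of the general invariant wave operator. -/
def invTerm (η : Fin d → ℝ) (κ : Fin d → ℂ) (t : Fin 5 → ℕ) : QPoly d :=
  qq η ^ t 0 * qq2 η ^ t 1 * qq12 η ^ t 2 * qd κ ^ t 3 * qd2 κ ^ t 4

theorem IsBihom.invTerm (η : Fin d → ℝ) (κ : Fin d → ℂ) (t : Fin 5 → ℕ) :
    IsBihom (2 * t 0 + t 2 + t 3) (2 * t 1 + t 2 + t 4) (invTerm η κ t) := by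
  have := (((((qq η).pow (t 0)).mul ((qq2 η).pow (t 1))).mul ((qq12 η).pow (t 2))).mul
    ((qd κ).pow (t 3))).mul ((qd2 κ).pow (t 4))
  convert this using 1 <;> first | omega | rfl

theorem IsPolyDep.invTerm (η : Fin d → ℝ) (t : Fin 5 → ℕ) :
    IsPolyDep fun κ => invTerm η κ t :=
  ((((const _).mul (const _)).mul (const _)).mul (qd.pow _)).mul (qd2.pow _)

/-- The terms of the invariant wave operator for the components of rank `i` and `j`. -/
def rankTerms (i j : ℕ) : Finset (Fin 5 → ℕ) :=
  (Fintype.piFinset fun _ : Fin 5 => Finset.range (i + j + 1)).filter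
    fun t => 2 * t 0 + t 2 + t 3 = i ∧ 2 * t 1 + t 2 + t 4 = j

/-- The box of exponents is only there for finiteness: the two rank equations bound every exponent
by i + j. -/
theorem mem_rankTerms {i j : ℕ} {t : Fin 5 → ℕ} : t ∈ rankTerms i j ↔
    2 * t 0 + t 2 + t 3 = i ∧ 2 * t 1 + t 2 + t 4 = j := by
  rw [rankTerms, Finset.mem_filter, Fintype.mem_piFinset]
  refine ⟨fun h => h.2, fun h => ⟨fun k => ?_, h⟩⟩
  rw [Finset.mem_range]
  fin_cases k <;> simp <;> omega

/-- The part of the invariant wave operator of rank `(i, j)`. -/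
def invPart (η : Fin d → ℝ) (W : (Fin 5 → ℕ) → ℝ → ℝ) (i j : ℕ) (ξ : Pt d) : QPoly d :=
  ∑ t ∈ rankTerms i j, C (W t (boxSym η ξ) : ℂ) * invTerm η (dSym ξ) t

theorem IsBihom.invPart (η : Fin d → ℝ) (W : (Fin 5 → ℕ) → ℝ → ℝ) (i j : ℕ) (ξ : Pt d) :
    IsBihom i j (invPart η W i j ξ) := by
  refine sum _ fun t ht => C_mul ?_ _
  have := mem_rankTerms.mp ht
  simpa only [this.1, this.2] using invTerm η (dSym ξ) t

theorem coeff_invariantOp' (η : Fin d → ℝ) (W : (Fin 5 → ℕ) → ℝ → ℝ) (ξ : Pt d)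
    (m : Fin d ⊕ Fin d →₀ ℕ) : MvPowerSeries.coeff m (invariantOp η W ξ) =
      ∑ t ∈ Fintype.piFinset fun _ : Fin 5 => Finset.range (m.degree + 1),
        (W t (boxSym η ξ) : ℂ) * (invTerm η (dSym ξ) t).coeff m := by
  change MvPolynomial.coeff m _ = _
  rw [MvPolynomial.coeff_sum]
  refine Finset.sum_congr rfl fun t _ => ?_
  rw [← MvPolynomial.coeff_C_mul, invTerm]
  congr 1
  ring

/-- A monomial of degree (α, β) only receives terms whose bidegree is (|α|, |β|), so the truncation
by total degree loses nothing and each coefficient can be read off from one homogeneous part. -/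
theorem coeff_invariantOp (η : Fin d → ℝ) (W : (Fin 5 → ℕ) → ℝ → ℝ) (ξ : Pt d)
    (α β : Fin d →₀ ℕ) : MvPowerSeries.coeff (Finsupp.sumElim α β) (invariantOp η W ξ) =
      (invPart η W α.degree β.degree ξ).coeff (Finsupp.sumElim α β) := by
  rw [coeff_invariantOp', invPart, MvPolynomial.coeff_sum, rankTerms, Finset.sum_filter,
    degree_sumElim]
  refine Finset.sum_congr rfl fun t _ => ?_
  split_ifs with h
  · rw [MvPolynomial.coeff_C_mul]
  · rw [(IsBihom.invTerm η (dSym ξ) t).coeff_eq_zero α β (by tauto), mul_zero]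

theorem isMultiplierOp_invariantOp {η : Fin d → ℝ} {W : (Fin 5 → ℕ) → ℝ → ℝ}
    (hW : ∀ t, IsTempered η (W t)) : IsMultiplierOp (invariantOp η W) := by
  intro m
  simp only [coeff_invariantOp']
  exact IsMultiplier.sum _ fun t _ => (hW t).isMultiplier.mul_coeff (IsPolyDep.invTerm η t) m

/-- The coefficient of `h_i` in the undressed field of rank `s`. -/
def dressFactor (d : ℕ) (ħ : ℝ) (s i : ℕ) : ℝ :=
  if s ≤ i ∧ Even (i - s) then
    besselCoeff (s + nu d) ((i - s) / 2) * muRatioSq ħ ^ ((i - s) / 2) else 0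

theorem sum_dressFactor (d : ℕ) (ħ : ℝ) {s i N : ℕ} (h : i ≤ N) :
    ∑ r ∈ Finset.range (N + 1), (if 2 * r + s = i then
      besselCoeff (s + nu d) r * muRatioSq ħ ^ r else 0) = dressFactor d ħ s i := by
  rw [dressFactor]
  split_ifs with hsi
  · obtain ⟨h1, k, hk⟩ := hsi
    rw [Finset.sum_eq_single ((i - s) / 2)]
    · rw [if_pos (by omega)]
    · intro r _ hr
      rw [if_neg (by omega)]
    · intro hr
      rw [Finset.mem_range] at hr
      omega
  · refine Finset.sum_eq_zero fun r _ => if_neg fun hr => hsi ⟨by omega, ⟨r, by omega⟩⟩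

/-- The part of the deformed wave operator of rank `(i, j)`, without the factors of the dressing. -/
def dressedKernel (η : Fin d → ℝ) (s i j : ℕ) (κ : Fin d → ℂ) : QPoly d :=
  rho η κ ^ ((i - s) / 2) * rho2 η κ ^ ((j - s) / 2) * confKernel η s κ

/-- The truncation of the deformed wave operator. -/
def deformedPoly (ħ : ℝ) (η : Fin d → ℝ) (s N : ℕ) (κ : Fin d → ℂ) : QPoly d :=
  ∑ r ∈ Finset.range (N + 1), ∑ r' ∈ Finset.range (N + 1),
    C (((besselCoeff (s + nu d) r * muRatioSq ħ ^ r) *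
      (besselCoeff (s + nu d) r' * muRatioSq ħ ^ r') : ℝ) : ℂ) *
      (rho η κ ^ r * (rho2 η κ ^ r' * confKernel η s κ))

/-- Powers r and r' contribute only in bidegree (2r + s, 2r' + s), so at most one pair is seen by a
given monomial, and any truncation at `N` above its degree contains that pair. -/
theorem coeff_deformedPoly (ħ : ℝ) (η : Fin d → ℝ) (s : ℕ) {N : ℕ} (κ : Fin d → ℂ)
    (α β : Fin d →₀ ℕ) (h : α.degree + β.degree ≤ N) :
    (deformedPoly ħ η s N κ).coeff (Finsupp.sumElim α β) =
      ((dressFactor d ħ s α.degree * dressFactor d ħ s β.degree : ℝ) : ℂ) *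
        (dressedKernel η s α.degree β.degree κ).coeff (Finsupp.sumElim α β) := by
  rw [← sum_dressFactor d ħ (show α.degree ≤ N by omega),
    ← sum_dressFactor d ħ (show β.degree ≤ N by omega), Finset.sum_mul_sum, deformedPoly,
    MvPolynomial.coeff_sum, Complex.ofReal_sum, Finset.sum_mul]
  refine Finset.sum_congr rfl fun r _ => ?_
  rw [MvPolynomial.coeff_sum, Complex.ofReal_sum, Finset.sum_mul]
  refine Finset.sum_congr rfl fun r' _ => ?_
  rw [MvPolynomial.coeff_C_mul]
  by_cases h1 : 2 * r + s = α.degree ∧ 2 * r' + s = β.degree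
  · rw [if_pos h1.1, if_pos h1.2, dressedKernel, ← h1.1, ← h1.2,
      show (2 * r + s - s) / 2 = r by omega, show (2 * r' + s - s) / 2 = r' by omega, mul_assoc (rho η κ ^ r)]
  · have h2 : IsBihom (2 * r + s) (2 * r' + s)
        (rho η κ ^ r * (rho2 η κ ^ r' * confKernel η s κ)) := by
      have := ((IsBihom.rho η κ).pow r).mul
        (((IsBihom.rho2 η κ).pow r').mul (IsBihom.confKernel η s κ))
      convert this using 1 <;> omega
    rw [h2.coeff_eq_zero α β (by
      by_cases h3 : 2 * r + s = α.degree
      · exact Or.inr fun h4 => h1 ⟨h3, h4.symm⟩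
      · exact Or.inl fun h4 => h3 h4.symm)]
    by_cases h3 : 2 * r + s = α.degree
    · have h4 : ¬ 2 * r' + s = β.degree := fun h4 => h1 ⟨h3, h4⟩
      rw [if_neg h4]
      simp
    · rw [if_neg h3]
      simp

theorem exists_sumElim (m : Fin d ⊕ Fin d →₀ ℕ) : ∃ α β, m = Finsupp.sumElim α β :=
  ⟨_, _, ((Finsupp.sumFinsuppEquivProdFinsupp (α := Fin d) (β := Fin d) (γ := ℕ)).symm_apply_apply
    m).symm⟩

theorem coeff_deformedOp_eq (ħ : ℝ) (η : Fin d → ℝ) (s : ℕ) (ξ : Pt d)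
    (m : Fin d ⊕ Fin d →₀ ℕ) : MvPowerSeries.coeff m (deformedOp ħ η s ξ) =
      (deformedPoly ħ η s m.degree (dSym ξ)).coeff m := by
  change MvPolynomial.coeff m _ = _
  congr 1
  rw [deformedPoly, Finset.sum_mul_sum, Finset.sum_mul]
  refine Finset.sum_congr rfl fun r _ => ?_
  rw [Finset.sum_mul]
  refine Finset.sum_congr rfl fun r' _ => ?_
  push_cast
  simp only [map_mul]
  ring

theorem coeff_deformedOp (ħ : ℝ) (η : Fin d → ℝ) (s : ℕ) (ξ : Pt d) (α β : Fin d →₀ ℕ) :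
    MvPowerSeries.coeff (Finsupp.sumElim α β) (deformedOp ħ η s ξ) =
      ((dressFactor d ħ s α.degree * dressFactor d ħ s β.degree : ℝ) : ℂ) *
        (dressedKernel η s α.degree β.degree (dSym ξ)).coeff (Finsupp.sumElim α β) := by
  rw [coeff_deformedOp_eq, coeff_deformedPoly ħ η s _ α β (degree_sumElim α β).ge]

theorem coeff_scaleOp (η : Fin d → ℝ) (f : ℝ → ℝ) (P : WaveOp d) (ξ : Pt d)
    (m : Fin d ⊕ Fin d →₀ ℕ) : MvPowerSeries.coeff m (scaleOp η f P ξ) =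
      (f (boxSym η ξ) : ℂ) * MvPowerSeries.coeff m (P ξ) := by
  rw [scaleOp, map_smul, smul_eq_mul]

theorem coeff_confOp (η : Fin d → ℝ) (s : ℕ) (ξ : Pt d) (m : Fin d ⊕ Fin d →₀ ℕ) :
    MvPowerSeries.coeff m (confOp η s ξ) = (confKernel η s (dSym ξ)).coeff m :=
  MvPolynomial.coeff_coe _ _

theorem IsPolyDep.deformedPoly (ħ : ℝ) (η : Fin d → ℝ) (s N : ℕ) :
    IsPolyDep (deformedPoly ħ η s N) :=
  sum _ fun r _ => sum _ fun r' _ => (const _).mul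
    (((rho η).pow r).mul (((rho2 η).pow r').mul (confKernel η s)))

theorem isMultiplierOp_deformed {η : Fin d → ℝ} {f : ℝ → ℝ} (hf : IsTempered η f) (ħ : ℝ)
    (s : ℕ) : IsMultiplierOp (scaleOp η f (deformedOp ħ η s)) := by
  intro m
  simp only [coeff_scaleOp, coeff_deformedOp_eq]
  exact hf.isMultiplier.mul_coeff (IsPolyDep.deformedPoly ħ η s m.degree) m

theorem isMultiplierOp_conf {η : Fin d → ℝ} {f : ℝ → ℝ} (hf : IsTempered η f) (s : ℕ) :
    IsMultiplierOp (scaleOp η f (confOp η s)) := by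
  intro m
  simp only [coeff_scaleOp, coeff_confOp]
  exact hf.isMultiplier.mul_coeff (IsPolyDep.confKernel η s) m

/-! ### Deformed and conformal actions in frequency space -/

theorem density_conf (η : Fin d → ℝ) (f : ℝ → ℝ) (s : ℕ) (g h : Symb d) (ξ : Pt d) :
    density (scaleOp η f (confOp η s)) g h ξ =
      f (boxSym η ξ) * polyPair (confKernel η s (dSym ξ)) (hat g (-ξ)) (hat h ξ) := by
  rw [← polyPair_C_mul, density, polyPair]
  congr 1
  funext m
  rw [coeff_scaleOp, coeff_confOp, MvPolynomial.coeff_C_mul]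

theorem density_deformed (ħ : ℝ) (η : Fin d → ℝ) (f : ℝ → ℝ) (s : ℕ) {h : Symb d} {N : ℕ}
    (hN : h.totalDegree + h.totalDegree ≤ N) (ξ : Pt d) :
    density (scaleOp η f (deformedOp ħ η s)) h h ξ =
      f (boxSym η ξ) * polyPair (deformedPoly ħ η s N (dSym ξ)) (hat h (-ξ)) (hat h ξ) := by
  rw [← polyPair_C_mul, density, polyPair, pairing, pairing]
  have hdeg : ∀ ζ : Pt d, ∀ α ∈ (hat h ζ).support, α.degree ≤ h.totalDegree := fun ζ α hα => by
    exact MvPolynomial.le_totalDegree (support_hat h ζ hα)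
  refine Finset.sum_congr rfl fun α hα => Finset.sum_congr rfl fun β hβ => ?_
  have h1 := hdeg _ α hα
  have h2 := hdeg _ β hβ
  rw [coeff_scaleOp, coeff_deformedOp, MvPolynomial.coeff_C_mul,
    coeff_deformedPoly ħ η s _ α β (by omega)]

theorem rank_undress (ħ : ℝ) (η : Fin d → ℝ) {h : Symb d} {N : ℕ} (hN : h.totalDegree ≤ N)
    (s : ℕ) : rank s (∑ r ∈ Finset.range (N + 1),
      ((besselCoeff (s + nu d) r * muRatioSq ħ ^ r : ℝ) : ℂ) • (rhoSq η)^[r] h) =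
        rank s (undress ħ η h) := by
  rw [undress_eq, rank_ladder η _ h s N (by omega), rank_sum]
  refine Finset.sum_congr rfl fun r _ => ?_
  rw [rank_smul, rank_rhoSq_iter]
  rfl

/-- By adjointness the Bessel series in ρ² acts on the left field and the one in ρ'² on the right
field. The remaining kernel has bidegree (s, s) and sees only the rank s components, which are those
of the undressed field. -/
theorem density_deformed_eq (ħ : ℝ) (η : Fin d → ℝ) (f : ℝ → ℝ) (s : ℕ) {h : Symb d}
    (hh : IsCompSupp h) (ξ : Pt d) : density (scaleOp η f (deformedOp ħ η s)) h h ξ =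
      density (scaleOp η f (confOp η s)) (rank s (undress ħ η h)) (rank s (undress ħ η h)) ξ := by
  set N := h.totalDegree + h.totalDegree
  rw [density_deformed ħ η f s le_rfl, density_conf]
  congr 1
  have hat_eq : ∀ ζ, ∑ r ∈ Finset.range (N + 1),
      ((besselCoeff (s + nu d) r * muRatioSq ħ ^ r : ℝ) : ℂ) •
        (rhoHat η (dSym ζ))^[r] (hat h ζ) = hat (∑ r ∈ Finset.range (N + 1),
      ((besselCoeff (s + nu d) r * muRatioSq ħ ^ r : ℝ) : ℂ) • (rhoSq η)^[r] h) ζ := by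
    intro ζ
    rw [hat_sum _ fun r _ => (hh.rhoSq_iter η r).smul _]
    exact Finset.sum_congr rfl fun r _ => by rw [hat_smul, hat_rhoSq_iter η hh]
  have hneg : rhoHat η (dSym ξ) = rhoHat η (dSym (-ξ)) := by rw [dSym_neg, rhoHat_neg]
  rw [← rank_undress ħ η (show h.totalDegree ≤ N by omega) s, hat_rank, hat_rank,
    ← polyPair_homogeneousComponent (IsBihom.confKernel η s _), ← hat_eq, ← hat_eq, ← hneg,
    deformedPoly, polyPair_sum, polyPair, pairing_sum_left]
  refine Finset.sum_congr rfl fun r _ => ?_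
  rw [polyPair_sum, pairing_sum_right]
  refine Finset.sum_congr rfl fun r' _ => ?_
  rw [polyPair_C_mul, polyPair_rho_pow_mul, polyPair_rho2_pow_mul, pairing_smul_left,
    pairing_smul_right, ← polyPair]
  push_cast
  ring

theorem confAction_eq_bilin {η : Fin d → ℝ} {f : ℝ → ℝ} (hf : IsTempered η f) (s : ℕ)
    {φ : Symb d} (hφ : IsCompSupp φ) :
    confAction η s f φ = bilin (scaleOp η f (confOp η s)) φ φ :=
  quadAction_eq_bilin (isMultiplierOp_conf hf s) hφ

/-- The deformed actions are the conformal actions of the undressed fields. -/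
theorem deformedAction_eq (ħ : ℝ) {η : Fin d → ℝ} {f : ℝ → ℝ} (hf : IsTempered η f) (s : ℕ)
    {h : Symb d} (hh : IsCompSupp h) (hu : IsCompSupp (rank s (undress ħ η h))) :
    deformedAction ħ η s f h = confAction η s f (rank s (undress ħ η h)) := by
  rw [confAction_eq_bilin hf s hu, deformedAction,
    quadAction_eq_bilin (isMultiplierOp_deformed hf ħ s) hh, bilin, bilin]
  exact integral_congr_ae (Eventually.of_forall fun ξ => density_deformed_eq ħ η f s hh ξ)

theorem confAction_rank {η : Fin d → ℝ} {f : ℝ → ℝ} (hf : IsTempered η f) (s : ℕ) {φ : Symb d}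
    (hφ : IsCompSupp φ) (hr : IsCompSupp (rank s φ)) :
    confAction η s f (rank s φ) = confAction η s f φ := by
  rw [confAction_eq_bilin hf s hφ, confAction_eq_bilin hf s hr, bilin, bilin]
  refine integral_congr_ae (Eventually.of_forall fun ξ => ?_)
  simp only [density_conf, hat_rank]
  rw [← polyPair_homogeneousComponent (IsBihom.confKernel η s _)]

theorem confKernel_neg (η : Fin d → ℝ) (s : ℕ) (κ : Fin d → ℂ) :
    confKernel η s (-κ) = confKernel η s κ := by
  have := confKernel_smul η s (-1) κ
  rwa [pow_mul, neg_one_sq, one_pow, one_smul, neg_one_smul] at this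

theorem density_conf_neg (η : Fin d → ℝ) (f : ℝ → ℝ) (s : ℕ) (g h : Symb d) (ξ : Pt d) :
    density (scaleOp η f (confOp η s)) g h (-ξ) = density (scaleOp η f (confOp η s)) h g ξ := by
  rw [density_conf, density_conf, boxSym_neg, neg_neg, dSym_neg, confKernel_neg,
    ← polyPair_rename_swap, rename_confKernel]

theorem bilin_conf_symm (η : Fin d → ℝ) (f : ℝ → ℝ) (s : ℕ) (g h : Symb d) :
    bilin (scaleOp η f (confOp η s)) g h = bilin (scaleOp η f (confOp η s)) h g := by
  rw [bilin, bilin, ← integral_neg_eq_self]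
  exact integral_congr_ae (Eventually.of_forall fun ξ => density_conf_neg η f s g h ξ)

theorem bilin_conf_pSq (hd : 3 ≤ d) {η : Fin d → ℝ} (hη : ∀ i, η i = 1 ∨ η i = -1)
    (f : ℝ → ℝ) (s : ℕ) {a : Symb d} (ha : IsCompSupp a) (h : Symb d) :
    bilin (scaleOp η f (confOp η s)) (pSq η * a) h = 0 := by
  rw [bilin, integral_eq_zero_of_ae]
  refine Eventually.of_forall fun ξ => ?_
  rw [density_conf, hat_pSq_mul η ha, polyPair_pSqHat, lap_confKernel hd hη, polyPair_zero,
    mul_zero]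
  rfl

theorem bilin_conf_pGrad {η : Fin d → ℝ} (hη : ∀ i, η i = 1 ∨ η i = -1)
    (f : ℝ → ℝ) (s : ℕ) {a : Symb d} (ha : IsCompSupp a) (h : Symb d) :
    bilin (scaleOp η f (confOp η s)) (pGrad η a) h = 0 := by
  rw [bilin, integral_eq_zero_of_ae]
  refine Eventually.of_forall fun ξ => ?_
  have h1 : gradHat η (dSym (-ξ)) (hat a (-ξ)) = (-1 : ℂ) • gradHat η (dSym ξ) (hat a (-ξ)) := by
    rw [dSym_neg, gradHat, gradHat, Finset.smul_sum]
    exact Finset.sum_congr rfl fun i _ => by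
      rw [smul_smul, Pi.neg_apply]
      congr 1
      ring
  rw [density_conf, hat_pGrad η ha, h1, polyPair, pairing_smul_left, ← polyPair, polyPair_gradHat,
    transv_confKernel hη, polyPair_zero, mul_zero, mul_zero]
  rfl

/-- A conformal action does not change if a field in the kernel of its bilinear form is added. -/
theorem confAction_add_of_kernel {η : Fin d → ℝ} {f : ℝ → ℝ} (hf : IsTempered η f) (s : ℕ)
    {φ χ : Symb d} (hφ : IsCompSupp φ) (hχ : IsCompSupp χ)
    (h : ∀ g, IsCompSupp g → bilin (scaleOp η f (confOp η s)) χ g = 0) :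
    confAction η s f (φ + χ) = confAction η s f φ := by
  have hP := isMultiplierOp_conf hf s
  rw [confAction_eq_bilin hf s (hφ.add hχ), confAction_eq_bilin hf s hφ,
    bilin_add_left hP hφ hχ (hφ.add hχ), bilin_add_right hP hφ hφ hχ, h _ (hφ.add hχ),
    bilin_conf_symm _ _ _ φ χ, h _ hφ]
  ring

end Parts

end

section

variable {d : ℕ}

/-! ## Invariant kernels at a fixed frequency -/

section Classification

open MvPolynomial (C X pderiv)

section Bilinear

variable (η : Fin d → ℝ) (κ : Fin d → ℂ)

theorem dotVal_comm (v w : Fin d → ℂ) : dotVal η v w = dotVal η w v := by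
  simp only [dotVal, mul_comm (v _)]

theorem dotVal_add_left (v v' w : Fin d → ℂ) :
    dotVal η (v + v') w = dotVal η v w + dotVal η v' w := by
  simp only [dotVal, Pi.add_apply, add_mul, mul_add, Finset.sum_add_distrib]

theorem dotVal_add_right (v w w' : Fin d → ℂ) :
    dotVal η v (w + w') = dotVal η v w + dotVal η v w' := by
  simp only [dotVal, Pi.add_apply, mul_add, Finset.sum_add_distrib]

theorem dotVal_smul_left (c : ℂ) (v w : Fin d → ℂ) :
    dotVal η (c • v) w = c * dotVal η v w := by
  simp only [dotVal, Pi.smul_apply, smul_eq_mul, Finset.mul_sum]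
  exact Finset.sum_congr rfl fun i _ => by ring

theorem dotVal_smul_right (c : ℂ) (v w : Fin d → ℂ) :
    dotVal η v (c • w) = c * dotVal η v w := by
  rw [dotVal_comm, dotVal_smul_left, dotVal_comm]

theorem conVal_add (v w : Fin d → ℂ) : conVal κ (v + w) = conVal κ v + conVal κ w := by
  simp only [conVal, Pi.add_apply, mul_add, Finset.sum_add_distrib]

theorem conVal_smul (c : ℂ) (v : Fin d → ℂ) : conVal κ (c • v) = c * conVal κ v := by
  simp only [conVal, Pi.smul_apply, smul_eq_mul, Finset.mul_sum]
  exact Finset.sum_congr rfl fun i _ => by ring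

/-- The frequency with its index raised. -/
def sharp : Fin d → ℂ := fun i => (η i : ℂ) * κ i

theorem conVal_sharp : conVal κ (sharp η κ) = boxVal η κ := by
  simp only [conVal, sharp, boxVal]
  exact Finset.sum_congr rfl fun i _ => by ring

variable {η} in
theorem dotVal_sharp (hη : ∀ i, η i = 1 ∨ η i = -1) (v : Fin d → ℂ) :
    dotVal η (sharp η κ) v = conVal κ v := by
  simp only [conVal, sharp, dotVal]
  exact Finset.sum_congr rfl fun i _ => by linear_combination κ i * v i * eta_sq hη i

theorem dotVal_single_left (i : Fin d) (a : ℂ) (w : Fin d → ℂ) :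
    dotVal η (Pi.single i a) w = η i * (a * w i) := by
  classical
  rw [dotVal, Finset.sum_eq_single i]
  · rw [Pi.single_eq_same]
  · intro j _ hj
    rw [Pi.single_eq_of_ne hj]
    ring
  · simp

theorem conVal_single (i : Fin d) (a : ℂ) : conVal κ (Pi.single i a) = κ i * a := by
  classical
  rw [conVal, Finset.sum_eq_single i]
  · rw [Pi.single_eq_same]
  · intro j _ hj
    rw [Pi.single_eq_of_ne hj]
    ring
  · simp

end Bilinear

/-! ### Transverse polynomials -/

theorem transv_add (η : Fin d → ℝ) (κ : Fin d → ℂ) (F G : QPoly d) :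
    transv η κ (F + G) = transv η κ F + transv η κ G := by
  simp only [transv, map_add, mul_add, Finset.sum_add_distrib]

/-- Transverse polynomials are invariant under translations along the frequency. -/
theorem evalAt_translate {η : Fin d → ℝ} {κ : Fin d → ℂ} {F : QPoly d} (hF : transv η κ F = 0)
    (v w : Fin d → ℂ) (c : ℂ) : evalAt (v + c • sharp η κ) w F = evalAt v w F := by
  -- Ψ restricts a polynomial to the line q = v + xκ^♯ with q' = w fixed. The derivative in x is the
  -- restriction of the transverse derivation, so a transverse polynomial is constant along the
  -- line.
  obtain ⟨Ψ, hl, hr, hC⟩ : ∃ Ψ : QPoly d →+* Polynomial ℂ,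
      (∀ i, Ψ (X (Sum.inl i)) =
        Polynomial.C (v i) + Polynomial.C (sharp η κ i) * Polynomial.X) ∧
      (∀ i, Ψ (X (Sum.inr i)) = Polynomial.C (w i)) ∧ ∀ a, Ψ (C a) = Polynomial.C a :=
    ⟨MvPolynomial.eval₂Hom Polynomial.C (Sum.elim
      (fun i => Polynomial.C (v i) + Polynomial.C (sharp η κ i) * Polynomial.X)
      fun i => Polynomial.C (w i)), fun i => by simp, fun i => by simp, fun a => by simp⟩
  have hder : ∀ G, Polynomial.derivative (Ψ G) = Ψ (transv η κ G) := by
    intro G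
    induction G using MvPolynomial.induction_on with
    | C a => rw [transv_C, hC, Polynomial.derivative_C, map_zero]
    | add p q hp hq => rw [transv_add, map_add, map_add, map_add, hp, hq]
    | mul_X p x hp =>
      rw [transv_mul, map_add Ψ, map_mul Ψ, map_mul Ψ, map_mul Ψ, Polynomial.derivative_mul, hp]
      congr 2
      rcases x with i | i
      · have : transv η κ (X (Sum.inl i)) = C (sharp η κ i) := by
          classical
          rw [transv, Finset.sum_eq_single i]
          · rw [MvPolynomial.pderiv_X_self, mul_one, sharp]
          · intro j _ hj
            rw [MvPolynomial.pderiv_X_of_ne (by simpa using hj.symm), mul_zero]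
          · simp
        rw [this, hC, hl]
        simp
      · have : transv η κ (X (Sum.inr i)) = 0 := by
          rw [transv]
          refine Finset.sum_eq_zero fun j _ => ?_
          rw [MvPolynomial.pderiv_X_of_ne (by simp), mul_zero]
        rw [this, hr]
        simp
  have heval : ∀ (a : ℂ) G, Polynomial.eval a (Ψ G) = evalAt (v + a • sharp η κ) w G := by
    intro a G
    induction G using MvPolynomial.induction_on with
    | C b => rw [hC, evalAt_C, Polynomial.eval_C]
    | add p q hp hq => rw [map_add, map_add, Polynomial.eval_add, hp, hq]
    | mul_X p x hp =>
      rw [map_mul, map_mul, Polynomial.eval_mul, hp]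
      congr 1
      rcases x with i | i
      · rw [hl]
        simp [evalAt]
        ring
      · rw [hr]
        simp [evalAt]
  have h0 : Polynomial.derivative (Ψ F) = 0 := by rw [hder, hF, map_zero]
  have h1 := Polynomial.eq_C_of_natDegree_eq_zero
    (Polynomial.derivative_eq_zero.mp h0)
  have h2 := heval c F
  have h3 := heval 0 F
  rw [zero_smul, add_zero] at h3
  rw [← h2, ← h3, h1, Polynomial.eval_C, Polynomial.eval_C]

theorem evalAt_rename (v w : Fin d → ℂ) (F : QPoly d) :
    evalAt v w (MvPolynomial.rename Sum.swap F) = evalAt w v F := by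
  rw [evalAt, MvPolynomial.eval_rename, evalAt]
  congr 2
  funext x
  rcases x with x | x <;> rfl

theorem qpoly_ext {F G : QPoly d} (h : ∀ v w, evalAt v w F = evalAt v w G) : F = G := by
  refine MvPolynomial.funext fun x => ?_
  have := h (x ∘ Sum.inl) (x ∘ Sum.inr)
  rwa [evalAt, Sum.elim_comp_inl_inr] at this

/-- The transverse part of a term of the invariant wave operator. -/
def transvTerm (η : Fin d → ℝ) (κ : Fin d → ℂ) (t : Fin 5 → ℕ) : QPoly d :=
  if t 3 = 0 ∧ t 4 = 0 then
    C ((boxVal η κ)⁻¹ ^ (t 0 + t 1 + t 2)) * invMon η κ (t 0) (t 1) (t 2) else 0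

/-- Transverse invariant polynomials are polynomials in `ρ²`, `ρ'²` and `τ`. -/
theorem eq_sum_transvTerm {η : Fin d → ℝ} (hη : ∀ i, η i = 1 ∨ η i = -1) {κ : Fin d → ℂ}
    (hS : boxVal η κ ≠ 0) (s : Finset (Fin 5 → ℕ)) (V : (Fin 5 → ℕ) → ℂ)
    (hl : transv η κ (∑ t ∈ s, C (V t) * invTerm η κ t) = 0)
    (hr : transv η κ (MvPolynomial.rename Sum.swap (∑ t ∈ s, C (V t) * invTerm η κ t)) = 0) :
    ∑ t ∈ s, C (V t) * invTerm η κ t = ∑ t ∈ s, C (V t) * transvTerm η κ t := by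
  refine qpoly_ext fun v w => ?_
  set S := boxVal η κ
  -- The projections of q and q' to the hyperplane where their contraction with κ vanishes; this is
  -- where □ ≠ 0 is needed. Transversality in both arguments allows evaluation there.
  set v' := v + (-conVal κ v / S) • sharp η κ with hv'
  set w' := w + (-conVal κ w / S) • sharp η κ with hw'
  rw [← evalAt_translate hl v w (-conVal κ v / S), ← hv', ← evalAt_rename,
    ← evalAt_translate hr w v' (-conVal κ w / S), ← hw', evalAt_rename]
  have c1 : conVal κ v' = 0 := by
    rw [hv', conVal_add, conVal_smul, conVal_sharp]
    field_simp
    ring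
  have c2 : conVal κ w' = 0 := by
    rw [hw', conVal_add, conVal_smul, conVal_sharp]
    field_simp
    ring
  -- Scalar products of projected vectors are ρ², ρ'² or τ divided by □, whereas q∂ and q'∂ become
  -- zero; only terms without these factors survive.
  have key : ∀ x y : Fin d → ℂ,
      dotVal η (x + (-conVal κ x / S) • sharp η κ) (y + (-conVal κ y / S) • sharp η κ) =
        S⁻¹ * (S * dotVal η x y - conVal κ x * conVal κ y) := by
    intro x y
    rw [dotVal_add_left, dotVal_add_right, dotVal_add_right, dotVal_smul_right, dotVal_smul_left,
      dotVal_smul_left, dotVal_smul_right, dotVal_comm η x (sharp η κ), dotVal_sharp κ hη,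
      dotVal_sharp κ hη, dotVal_sharp κ hη, conVal_sharp]
    change dotVal η x y + -conVal κ y / S * conVal κ x + (-conVal κ x / S * conVal κ y +
      -conVal κ x / S * (-conVal κ y / S * S)) = _
    field_simp
    ring
  rw [map_sum, map_sum]
  refine Finset.sum_congr rfl fun t _ => ?_
  rw [map_mul, map_mul, evalAt_C, evalAt_C, invTerm, transvTerm]
  simp only [map_mul, map_pow, evalAt_qq, evalAt_qq2, evalAt_qq12, evalAt_qd, evalAt_qd2, c1, c2]
  rw [hv', hw', key, key, key]
  split_ifs with h
  · rw [h.1, h.2, map_mul, map_pow, evalAt_C, evalAt_invMon, pow_zero, mul_one, mul_one,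
      mul_pow, mul_pow, mul_pow, pow_add, pow_add]
    simp only [S]
    ring
  · rw [map_zero]
    by_cases h3 : t 3 = 0
    · have h4 : t 4 ≠ 0 := fun h4 => h ⟨h3, h4⟩
      rw [zero_pow h4]
      ring
    · rw [zero_pow h3]
      ring

/-! ### Radial polynomials -/

/-- Polynomials in `ρ²`, `ρ'²` and `τ` of rank `(j + 2k, j)`. -/
def IsRadial (η : Fin d → ℝ) (κ : Fin d → ℂ) (k j : ℕ) (F : QPoly d) : Prop :=
  ∃ ψ : ℕ → ℂ, F = ∑ b ∈ Finset.range (j / 2 + 1), C (ψ b) * invMon η κ (b + k) b (j - 2 * b)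

namespace IsRadial

variable {η : Fin d → ℝ} {κ : Fin d → ℂ} {k j : ℕ}

theorem zero : IsRadial η κ k j 0 := ⟨0, by simp⟩

theorem add {F G : QPoly d} (hF : IsRadial η κ k j F) (hG : IsRadial η κ k j G) :
    IsRadial η κ k j (F + G) := by
  obtain ⟨φ, rfl⟩ := hF
  obtain ⟨ψ, rfl⟩ := hG
  refine ⟨φ + ψ, ?_⟩
  simp only [Pi.add_apply, map_add, add_mul, Finset.sum_add_distrib]

theorem C_mul {F : QPoly d} (hF : IsRadial η κ k j F) (c : ℂ) : IsRadial η κ k j (C c * F) := by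
  obtain ⟨φ, rfl⟩ := hF
  refine ⟨fun b => c * φ b, ?_⟩
  simp only [map_mul, Finset.mul_sum, mul_assoc]

theorem sub {F G : QPoly d} (hF : IsRadial η κ k j F) (hG : IsRadial η κ k j G) :
    IsRadial η κ k j (F - G) := by
  have := hF.add (hG.C_mul (-1))
  rwa [map_neg, map_one, neg_one_mul, ← sub_eq_add_neg] at this

theorem sum {ι : Type*} (t : Finset ι) {F : ι → QPoly d}
    (hF : ∀ a ∈ t, IsRadial η κ k j (F a)) : IsRadial η κ k j (∑ a ∈ t, F a) := by
  classical
  induction t using Finset.induction_on with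
  | empty => simpa using zero
  | insert a t ha ih =>
    rw [Finset.sum_insert ha]
    exact (hF a (by simp)).add (ih fun i hi => hF i (by simp [hi]))

theorem invMon {b c : ℕ} (h : 2 * b + c = j) : IsRadial η κ k j (invMon η κ (b + k) b c) := by
  classical
  refine ⟨fun n => if n = b then 1 else 0, ?_⟩
  rw [Finset.sum_eq_single b]
  · simp only [if_true]
    rw [map_one, one_mul, show j - 2 * b = c by omega]
  · intro n _ hn
    simp only [if_neg hn]
    rw [map_zero, zero_mul]
  · intro hb
    rw [Finset.mem_range] at hb
    omega

end IsRadial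

/-- The frequency is not null, and the plane transverse to it contains an orthonormal pair. -/
structure IsGeneric (η : Fin d → ℝ) (κ : Fin d → ℂ) (e f : Fin d → ℂ) : Prop where
  box_ne_zero : boxVal η κ ≠ 0
  con_e : conVal κ e = 0
  con_f : conVal κ f = 0
  dot_e : boxVal η κ * dotVal η e e = 1
  dot_f : boxVal η κ * dotVal η f f = 1
  dot_ef : dotVal η e f = 0

theorem exists_sq_eq (z : ℂ) : ∃ y : ℂ, y ^ 2 = z := IsAlgClosed.exists_pow_nat_eq z two_pos

/-- With q' = e and q = e + yf one has ρ'² = τ = 1 and ρ² = 1 + y² arbitrary. For a fixed bidegree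
the power of ρ² determines the other two, so this one-parameter evaluation separates radial
monomials. -/
theorem IsGeneric.exists_evalAt_invMon {η : Fin d → ℝ} {κ e f : Fin d → ℂ}
    (h : IsGeneric η κ e f) (x : ℂ) :
    ∃ v w, ∀ a b c, evalAt v w (invMon η κ a b c) = x ^ a := by
  obtain ⟨y, hy⟩ := exists_sq_eq (x - 1)
  refine ⟨e + y • f, e, fun a b c => ?_⟩
  have h1 : boxVal η κ * dotVal η (e + y • f) (e + y • f) - conVal κ (e + y • f) ^ 2 = x := by
    rw [dotVal_add_left, dotVal_add_right, dotVal_add_right, dotVal_smul_right, dotVal_smul_left,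
      dotVal_smul_left, dotVal_smul_right, dotVal_comm η f e, h.dot_ef, conVal_add, conVal_smul,
      h.con_e, h.con_f]
    linear_combination h.dot_e + y ^ 2 * h.dot_f + hy
  have h2 : boxVal η κ * dotVal η e e - conVal κ e ^ 2 = 1 := by
    rw [h.dot_e, h.con_e]
    ring
  have h3 : boxVal η κ * dotVal η (e + y • f) e - conVal κ (e + y • f) * conVal κ e = 1 := by
    rw [dotVal_add_left, dotVal_smul_left, dotVal_comm η f e, h.dot_ef, h.con_e]
    linear_combination h.dot_e
  rw [evalAt_invMon, h1, h2, h3, one_pow, one_pow, mul_one, mul_one]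

/-- The vector κ^♯ + i□e has square □ - □ = 0, since e is transverse with square 1/□, and its
contraction with κ is □. -/
theorem IsGeneric.exists_null {η : Fin d → ℝ} (hη : ∀ i, η i = 1 ∨ η i = -1)
    {κ e f : Fin d → ℂ} (h : IsGeneric η κ e f) : ∃ n, dotVal η n n = 0 ∧ conVal κ n ≠ 0 := by
  refine ⟨sharp η κ + (Complex.I * boxVal η κ) • e, ?_, ?_⟩
  · rw [dotVal_add_left, dotVal_add_right, dotVal_add_right, dotVal_smul_right, dotVal_smul_left,
      dotVal_smul_left, dotVal_smul_right, dotVal_comm η e (sharp η κ), dotVal_sharp κ hη,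
      dotVal_sharp κ hη, h.con_e, conVal_sharp]
    linear_combination Complex.I ^ 2 * boxVal η κ * h.dot_e + boxVal η κ * Complex.I_sq
  · rw [conVal_add, conVal_smul, h.con_e, conVal_sharp, mul_zero, add_zero]
    exact h.box_ne_zero

/-- A generic frequency has non-zero norm, also when restricted to the first two or three
directions. -/
theorem exists_isGeneric {η : Fin d → ℝ} (hη : ∀ i, η i = 1 ∨ η i = -1) {κ : Fin d → ℂ}
    {i₀ i₁ i₂ : Fin d} (h01 : i₀ ≠ i₁) (h02 : i₀ ≠ i₂) (h12 : i₁ ≠ i₂) (hS : boxVal η κ ≠ 0)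
    (hS2 : η i₀ * κ i₀ ^ 2 + η i₁ * κ i₁ ^ 2 ≠ 0)
    (hS3 : η i₀ * κ i₀ ^ 2 + η i₁ * κ i₁ ^ 2 + η i₂ * κ i₂ ^ 2 ≠ 0) :
    ∃ e f, IsGeneric η κ e f := by
  classical
  set T : ℂ := η i₀ * κ i₀ ^ 2 + η i₁ * κ i₁ ^ 2
  -- Gram–Schmidt in the first three directions: `v` is orthogonal to κ within the first two, and
  -- `w` is orthogonal to both κ and `v`. Their squares are products of T, the three-term sum and
  -- signs, and complex square roots then normalize them. The norm conditions in the hypotheses are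
  -- what keeps these squares, multiplied by □, non-zero.
  set v : Fin d → ℂ := Pi.single i₀ (-κ i₁) + Pi.single i₁ (κ i₀) with hv
  set w : Fin d → ℂ := Pi.single i₀ (-(η i₀ * κ i₀ * κ i₂)) +
    (Pi.single i₁ (-(η i₁ * κ i₁ * κ i₂)) + Pi.single i₂ T) with hw
  have v0 : v i₀ = -κ i₁ := by simp [hv, h01]
  have v1 : v i₁ = κ i₀ := by simp [hv, h01.symm]
  have w0 : w i₀ = -(η i₀ * κ i₀ * κ i₂) := by simp [hw, h01, h02]
  have w1 : w i₁ = -(η i₁ * κ i₁ * κ i₂) := by simp [hw, h01.symm, h12]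
  have w2 : w i₂ = T := by simp [hw, h02.symm, h12.symm]
  have q0 := eta_sq hη i₀
  have q1 := eta_sq hη i₁
  have q2 := eta_sq hη i₂
  have cv : conVal κ v = 0 := by
    rw [hv, conVal_add, conVal_single, conVal_single]
    ring
  have cw : conVal κ w = 0 := by
    rw [hw, conVal_add, conVal_add, conVal_single, conVal_single, conVal_single]
    simp only [T]
    ring
  have dv : ∀ u, dotVal η v u = η i₀ * (-κ i₁ * u i₀) + η i₁ * (κ i₀ * u i₁) := fun u => by
    rw [hv, dotVal_add_left, dotVal_single_left, dotVal_single_left]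
  have dw : ∀ u, dotVal η w u = η i₀ * (-(η i₀ * κ i₀ * κ i₂) * u i₀) +
      (η i₁ * (-(η i₁ * κ i₁ * κ i₂) * u i₁) + η i₂ * (T * u i₂)) := fun u => by
    rw [hw, dotVal_add_left, dotVal_add_left, dotVal_single_left, dotVal_single_left,
      dotVal_single_left]
  have hvv : dotVal η v v = η i₀ * η i₁ * T := by
    rw [dv, v0, v1]
    simp only [T]
    linear_combination (-η i₁ * κ i₀ ^ 2) * q0 - (η i₀ * κ i₁ ^ 2) * q1
  have hvw : dotVal η v w = 0 := by
    rw [dv, w0, w1]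
    linear_combination (κ i₀ * κ i₁ * κ i₂) * (q0 - q1)
  have hww : dotVal η w w = η i₂ * T * (T + η i₂ * κ i₂ ^ 2) := by
    rw [dw, w0, w1, w2]
    simp only [T]
    linear_combination (η i₀ * κ i₀ ^ 2 * κ i₂ ^ 2) * q0 + (η i₁ * κ i₁ ^ 2 * κ i₂ ^ 2) * q1 -
      κ i₂ ^ 2 * (η i₀ * κ i₀ ^ 2 + η i₁ * κ i₁ ^ 2) * q2
  have hne : ∀ i, (η i : ℂ) ≠ 0 := fun i h => by
    have := eta_sq hη i
    rw [h] at this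
    norm_num at this
  have nv : boxVal η κ * dotVal η v v ≠ 0 := by
    rw [hvv]
    exact mul_ne_zero hS (mul_ne_zero (mul_ne_zero (hne _) (hne _)) hS2)
  have nw : boxVal η κ * dotVal η w w ≠ 0 := by
    rw [hww]
    exact mul_ne_zero hS (mul_ne_zero (mul_ne_zero (hne _) hS2) hS3)
  obtain ⟨a, ha⟩ := exists_sq_eq (boxVal η κ * dotVal η v v)⁻¹
  obtain ⟨b, hb⟩ := exists_sq_eq (boxVal η κ * dotVal η w w)⁻¹
  refine ⟨a • v, b • w, hS, ?_, ?_, ?_, ?_, ?_⟩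
  · rw [conVal_smul, cv, mul_zero]
  · rw [conVal_smul, cw, mul_zero]
  · rw [dotVal_smul_left, dotVal_smul_right]
    linear_combination (boxVal η κ * dotVal η v v) * ha + inv_mul_cancel₀ nv
  · rw [dotVal_smul_left, dotVal_smul_right]
    linear_combination (boxVal η κ * dotVal η w w) * hb + inv_mul_cancel₀ nw
  · rw [dotVal_smul_left, dotVal_smul_right, hvw, mul_zero, mul_zero]

/-- Harmonic radial polynomials satisfy the recursion of the Gegenbauer coefficients. -/
theorem radial_recursion {η : Fin d → ℝ} (hη : ∀ i, η i = 1 ∨ η i = -1)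
    {κ e f : Fin d → ℂ} (hgen : IsGeneric η κ e f) (k j : ℕ) (ψ : ℕ → ℂ)
    (h : lap η (∑ b ∈ Finset.range (j / 2 + 1),
      C (ψ b) * invMon η κ (b + k) b (j - 2 * b)) = 0) :
    (ψ 0 * (4 * k * (k + j + nu d)) = 0) ∧ ∀ n, n + 1 ≤ j / 2 →
      ψ (n + 1) * (4 * (n + 1 + k) * (k + j - n - 1 + nu d)) =
        -((j - 2 * n) * (j - 2 * n - 1) * ψ n) := by
  -- α comes from the part of the Laplacian that lowers ρ² and β from the part that lowers τ by two.
  -- The polynomial `p` is x times the evaluated Laplacian divided by □; the extra x removes the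
  -- truncated exponent b + k - 1, and the recursion is read off from the coefficients of `p`.
  let α : ℕ → ℂ := fun b => ψ b * (4 * (b + k) * (k + j - b + nu d))
  let β : ℕ → ℂ := fun b => ψ b * ((j - 2 * b) * (j - 2 * b - 1))
  let p : Polynomial ℂ := ∑ b ∈ Finset.range (j / 2 + 1),
    (Polynomial.monomial (b + k) (α b) + Polynomial.monomial (b + 1 + k) (β b))
  have hp : p = 0 := by
    refine Polynomial.funext fun x => ?_
    obtain ⟨v, w, hvw⟩ := hgen.exists_evalAt_invMon x
    have h1 := congrArg (evalAt v w) h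
    rw [lap_sum, map_sum, map_zero] at h1
    have h2 : boxVal η κ * Polynomial.eval x p = 0 := by
      rw [← mul_zero x, ← h1, Polynomial.eval_finsetSum, Finset.mul_sum, Finset.mul_sum]
      refine Finset.sum_congr rfl fun b hb => ?_
      have hb' : 2 * b ≤ j := by
        rw [Finset.mem_range] at hb
        omega
      have hx : ((b + k : ℕ) : ℂ) * (x * x ^ (b + k - 1)) = ((b + k : ℕ) : ℂ) * x ^ (b + k) := by
        generalize b + k = n
        cases n with
        | zero => simp
        | succ n => rw [Nat.add_sub_cancel, pow_succ]; ring
      have hc : ((j - 2 * b : ℕ) : ℂ) = j - 2 * b := by rw [Nat.cast_sub hb']; push_cast; ring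
      rw [lap_C_mul, lap_invMon hη]
      simp only [map_mul, map_add, evalAt_C, hvw, Polynomial.eval_add, Polynomial.eval_monomial,
        α, β, hc]
      push_cast at hx ⊢
      rw [show b + 1 + k = b + k + 1 by ring, pow_succ]
      linear_combination (-boxVal η κ * ψ b * 4 * (k + j - b + nu d)) * hx
    rw [Polynomial.eval_zero]
    exact (mul_eq_zero.mp h2).resolve_left hgen.box_ne_zero
  have hcoeff : ∀ n, n ≤ j / 2 → α n + (if n = 0 then 0 else β (n - 1)) = 0 := by
    intro n hn
    have h1 := congrArg (fun q : Polynomial ℂ => q.coeff (n + k)) hp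
    simp only [p, Polynomial.finsetSum_coeff, Polynomial.coeff_add, Polynomial.coeff_monomial,
      Polynomial.coeff_zero, Finset.sum_add_distrib, add_left_inj] at h1
    rw [Finset.sum_ite_eq', if_pos (Finset.mem_range.mpr (Nat.lt_succ_of_le hn))] at h1
    refine Eq.trans ?_ h1
    congr 1
    split_ifs with hn0
    · rw [hn0]
      symm
      refine Finset.sum_eq_zero fun b _ => ?_
      rw [if_neg (by omega)]
    · rw [Finset.sum_eq_single (n - 1)]
      · rw [if_pos (by omega)]
      · intro b _ hb
        exact if_neg (by omega)
      · intro hb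
        rw [Finset.mem_range] at hb
        omega
  constructor
  · have := hcoeff 0 (Nat.zero_le _)
    rw [if_pos rfl, add_zero] at this
    simp only [α, Nat.cast_zero] at this
    linear_combination this
  · intro n hn
    have := hcoeff (n + 1) hn
    rw [if_neg (Nat.succ_ne_zero n), Nat.add_sub_cancel] at this
    simp only [α, β] at this
    push_cast at this
    linear_combination this

/-- For k > 0 the lowest equation has the factor k(k + j + ν) ≠ 0 and kills the first coefficient;
the recursion then kills the others. -/
theorem radial_harmonic_eq_zero (hd : 3 ≤ d) {η : Fin d → ℝ} (hη : ∀ i, η i = 1 ∨ η i = -1)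
    {κ e f : Fin d → ℂ} (hgen : IsGeneric η κ e f) {k j : ℕ} (hk : 0 < k) {F : QPoly d}
    (hF : IsRadial η κ k j F) (h : lap η F = 0) : F = 0 := by
  obtain ⟨ψ, rfl⟩ := hF
  obtain ⟨h0, hrec⟩ := radial_recursion hη hgen k j ψ h
  have hν := nu_nonneg hd
  have key : ∀ n, n ≤ j / 2 → ψ n = 0 := by
    intro n
    induction n with
    | zero =>
      intro _
      refine (mul_eq_zero.mp h0).resolve_right ?_
      have : (4 * (k : ℝ) * (k + j + nu d)) ≠ 0 := by positivity
      exact_mod_cast this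
    | succ n ih =>
      intro hn
      have h1 := hrec n hn
      rw [ih (by omega), mul_zero, neg_zero] at h1
      refine (mul_eq_zero.mp h1).resolve_right ?_
      have hj : (n : ℝ) + 1 ≤ j := by exact_mod_cast (by omega : n + 1 ≤ j)
      have hk' : (1 : ℝ) ≤ k := by exact_mod_cast hk
      have h2 : (4 * ((n : ℝ) + 1 + k) * (k + j - n - 1 + nu d)) ≠ 0 :=
        mul_ne_zero (by positivity) (by linarith : (0 : ℝ) < k + j - n - 1 + nu d).ne'
      exact_mod_cast h2
  refine Finset.sum_eq_zero fun b hb => ?_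
  rw [Finset.mem_range] at hb
  rw [key b (by omega), map_zero, zero_mul]

/-- For k = 0 the lowest equation is empty and the recursion is that of the Gegenbauer coefficients,
so one constant remains free. -/
theorem radial_harmonic_eq_confKernel (hd : 3 ≤ d) {η : Fin d → ℝ}
    (hη : ∀ i, η i = 1 ∨ η i = -1) {κ e f : Fin d → ℂ} (hgen : IsGeneric η κ e f) {j : ℕ}
    {F : QPoly d} (hF : IsRadial η κ 0 j F) (h : lap η F = 0) :
    ∃ c : ℂ, F = C c * confKernel η j κ := by
  obtain ⟨ψ, rfl⟩ := hF
  obtain ⟨_, hrec⟩ := radial_recursion hη hgen 0 j ψ h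
  have hν := nu_nonneg hd
  set c : ℂ := ψ 0 / gegenbauerCoeff (nu d) j 0
  have key : ∀ n, n ≤ j / 2 → ψ n = c * gegenbauerCoeff (nu d) j n := by
    intro n
    induction n with
    | zero =>
      intro _
      have : (gegenbauerCoeff (nu d) j 0 : ℂ) ≠ 0 := by
        exact_mod_cast gegenbauerCoeff_zero_ne (nu d) j
      rw [div_mul_cancel₀ _ this]
    | succ n ih =>
      intro hn
      have h1 := hrec n hn
      have h2 := congrArg (fun x : ℝ => (x : ℂ))
        (gegenbauerCoeff_succ hν (show 2 * (n + 1) ≤ j by omega))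
      push_cast at h1 h2
      rw [ih (by omega)] at h1
      have hj : (n : ℝ) + 1 ≤ j := by exact_mod_cast (by omega : n + 1 ≤ j)
      have hj2 : (n : ℝ) + 2 ≤ j := by exact_mod_cast (by omega : n + 2 ≤ j)
      have h3 : (4 * ((n : ℝ) + 1) * (j - 1 - n + nu d)) ≠ 0 :=
        mul_ne_zero (by positivity) (by linarith : (0 : ℝ) < j - 1 - n + nu d).ne'
      have h4 : (4 * ((n : ℂ) + 1) * (j - 1 - n + nu d)) ≠ 0 := by exact_mod_cast h3
      refine mul_right_cancel₀ h4 ?_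
      linear_combination h1 - c * h2
  refine ⟨c, ?_⟩
  rw [confKernel_eq, Finset.mul_sum]
  refine Finset.sum_congr rfl fun b hb => ?_
  rw [Finset.mem_range] at hb
  rw [key b (by omega), map_mul, add_zero, mul_assoc]

end Classification

end

section

variable {d : ℕ}

/-! ## Classification of the invariant kernels at a generic frequency -/

section Classification

open MvPolynomial (C X pderiv)

/-- The exchange of `q` and `q'`. -/
def swapIdx (t : Fin 5 → ℕ) : Fin 5 → ℕ := ![t 1, t 0, t 2, t 4, t 3]

theorem swapIdx_swapIdx (t : Fin 5 → ℕ) : swapIdx (swapIdx t) = t := by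
  funext k
  fin_cases k <;> rfl

theorem swapIdx_mem_rankTerms {i j : ℕ} {t : Fin 5 → ℕ} (h : t ∈ rankTerms i j) :
    swapIdx t ∈ rankTerms j i := by
  rw [mem_rankTerms] at h ⊢
  exact ⟨h.2, h.1⟩

theorem rename_invTerm (η : Fin d → ℝ) (κ : Fin d → ℂ) (t : Fin 5 → ℕ) :
    MvPolynomial.rename Sum.swap (invTerm η κ t) = invTerm η κ (swapIdx t) := by
  simp only [invTerm, map_mul, map_pow, rename_qq, rename_qq2, rename_qq12, rename_qd, rename_qd2]
  simp only [swapIdx, Matrix.cons_val]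
  ring

theorem lap_rho2_pow_mul (η : Fin d → ℝ) (κ : Fin d → ℂ) (n : ℕ) (F : QPoly d) :
    lap η (rho2 η κ ^ n * F) = rho2 η κ ^ n * lap η F := by
  have h : ∀ i, pderiv (Sum.inl i) (rho2 η κ ^ n) = 0 := fun i => by
    rw [MvPolynomial.pderiv_pow, pderiv_rho2, mul_zero]
  simp only [lap, MvPolynomial.pderiv_mul, h, zero_mul, zero_add, Finset.mul_sum]
  exact Finset.sum_congr rfl fun i _ => by ring

theorem rename_dressedKernel (η : Fin d → ℝ) (s i j : ℕ) (κ : Fin d → ℂ) :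
    MvPolynomial.rename Sum.swap (dressedKernel η s i j κ) = dressedKernel η s j i κ := by
  simp only [dressedKernel, map_mul, map_pow, rename_rho, rename_rho2, rename_confKernel]
  ring

theorem dressFactor_of_lt (d : ℕ) (ħ : ℝ) {s i : ℕ} (h : i < s) : dressFactor d ħ s i = 0 :=
  if_neg fun h' => by omega

theorem dressFactor_self_ne_zero (hd : 3 ≤ d) (ħ : ℝ) (s : ℕ) : dressFactor d ħ s s ≠ 0 := by
  rw [dressFactor, if_pos ⟨le_rfl, by simp⟩]
  have hν := nu_nonneg hd
  have hG : Real.Gamma (s + nu d + (0 : ℕ) + 1) ≠ 0 := (Real.Gamma_pos_of_pos (by positivity)).ne'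
  simp only [Nat.sub_self, Nat.zero_div, pow_zero, mul_one, besselCoeff]
  positivity

/-- The part of rank `(i, j)` of a sum of deformed wave operators. -/
def dressedSum (ħ : ℝ) (η : Fin d → ℝ) (f : ℕ → ℂ) (N i j : ℕ) (κ : Fin d → ℂ) : QPoly d :=
  ∑ s ∈ Finset.range N, C (f s * (dressFactor d ħ s i * dressFactor d ħ s j)) *
    dressedKernel η s i j κ

theorem rename_dressedSum (ħ : ℝ) (η : Fin d → ℝ) (f : ℕ → ℂ) (N i j : ℕ) (κ : Fin d → ℂ) :
    MvPolynomial.rename Sum.swap (dressedSum ħ η f N i j κ) = dressedSum ħ η f N j i κ := by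
  rw [dressedSum, map_sum]
  refine Finset.sum_congr rfl fun s _ => ?_
  rw [map_mul, rename_dressedKernel, MvPolynomial.rename_C, mul_comm (dressFactor d ħ s i : ℂ)]

theorem dressedSum_of_odd (ħ : ℝ) (η : Fin d → ℝ) (f : ℕ → ℂ) (N : ℕ) {i j : ℕ} (κ : Fin d → ℂ)
    (h : ¬ Even (i + j)) : dressedSum ħ η f N i j κ = 0 := by
  refine Finset.sum_eq_zero fun s _ => ?_
  have : (dressFactor d ħ s i * dressFactor d ħ s j : ℂ) = 0 := by
    rw [dressFactor, dressFactor]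
    split_ifs with h1 h2
    · exact absurd (by
        obtain ⟨h1, a, ha⟩ := h1
        obtain ⟨h2, b, hb⟩ := h2
        exact ⟨a + b + s, by omega⟩) h
    all_goals simp
  rw [this, mul_zero, map_zero, zero_mul]

theorem IsRadial.dressedSum (ħ : ℝ) (η : Fin d → ℝ) (f : ℕ → ℂ) (N k j : ℕ) (κ : Fin d → ℂ) :
    IsRadial η κ k j (dressedSum ħ η f N (j + 2 * k) j κ) := by
  refine sum _ fun s _ => ?_
  by_cases h : s ≤ j ∧ Even (j - s)
  · obtain ⟨h1, b, hb⟩ := h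
    refine C_mul ?_ _
    rw [dressedKernel, confKernel_eq, Finset.mul_sum]
    refine sum _ fun r hr => ?_
    rw [Finset.mem_range] at hr
    have := (invMon (η := η) (κ := κ) (k := k) (j := j) (b := b + r) (c := s - 2 * r)
      (by omega)).C_mul (gegenbauerCoeff (nu d) s r : ℂ)
    convert this using 1
    rw [ConformalHS.invMon, ConformalHS.invMon, show (j - s) / 2 = b by omega,
      show (j + 2 * k - s) / 2 = b + k by omega]
    ring
  · have : dressFactor d ħ s j = 0 := if_neg h
    rw [this, Complex.ofReal_zero, mul_zero, mul_zero, map_zero, zero_mul]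
    exact zero

/-- Lowering the power of ρ² produces 4(r + 1)(r + 1 + s + ν)□, and the Bessel recursion trades this
factor for -(μ/√□)² times the previous coefficient. Hence the deformed kernels satisfy the equation
imposed by the transformations (p² + μ²)a. -/
theorem lap_dressedSum (hd : 3 ≤ d) {η : Fin d → ℝ} (hη : ∀ i, η i = 1 ∨ η i = -1) (ħ : ℝ)
    (f : ℕ → ℂ) (N i j : ℕ) (κ : Fin d → ℂ) : lap η (dressedSum ħ η f N (i + 2) j κ) =
      C (-(muRatioSq ħ * boxVal η κ)) * dressedSum ħ η f N i j κ := by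
  rw [dressedSum, lap_sum, dressedSum, Finset.mul_sum]
  refine Finset.sum_congr rfl fun s _ => ?_
  have hν := nu_nonneg hd
  rw [lap_C_mul, dressedKernel, mul_comm (rho η κ ^ _), mul_assoc, lap_rho2_pow_mul,
    lap_rho_pow_confKernel hd hη, dressedKernel]
  by_cases h : s ≤ i ∧ Even (i - s)
  · obtain ⟨h1, r, hr⟩ := h
    have hb := congrArg Complex.ofReal (besselCoeff_succ (σ := s + nu d) (by positivity) r)
    have e1 : dressFactor d ħ s (i + 2) = besselCoeff (s + nu d) (r + 1) *
        muRatioSq ħ ^ (r + 1) := by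
      rw [dressFactor, if_pos ⟨by omega, ⟨r + 1, by omega⟩⟩, show (i + 2 - s) / 2 = r + 1 by omega]
    have e2 : dressFactor d ħ s i = besselCoeff (s + nu d) r * muRatioSq ħ ^ r := by
      rw [dressFactor, if_pos ⟨by omega, ⟨r, by omega⟩⟩, show (i - s) / 2 = r by omega]
    rw [e1, e2, show (i + 2 - s) / 2 = r + 1 by omega, show (i - s) / 2 = r by omega,
      Nat.add_sub_cancel]
    push_cast at hb ⊢
    have key : f s * (besselCoeff (s + nu d) (r + 1) * muRatioSq ħ ^ (r + 1) *
        dressFactor d ħ s j) * (boxVal η κ * (4 * (r + 1) * (r + 1 + s + nu d))) =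
        -(muRatioSq ħ * boxVal η κ) * (f s * (besselCoeff (s + nu d) r * muRatioSq ħ ^ r *
          dressFactor d ħ s j)) := by
      linear_combination (f s * muRatioSq ħ ^ (r + 1) * dressFactor d ħ s j * boxVal η κ) * hb
    have key' := congrArg (C : ℂ → QPoly d) key
    rw [map_mul, map_mul C (boxVal η κ), map_mul C (-(_ : ℂ))] at key'
    linear_combination (rho η κ ^ r * rho2 η κ ^ ((j - s) / 2) * confKernel η s κ) * key'
  · have e2 : dressFactor d ħ s i = 0 := if_neg h
    rw [e2]
    by_cases h' : i + 2 = s ∨ i + 1 = s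
    · rw [show (i + 2 - s) / 2 = 0 by omega]
      simp
    · have e1 : dressFactor d ħ s (i + 2) = 0 := if_neg fun hh => h ⟨by omega, by
        obtain ⟨b, hb⟩ := hh.2
        exact ⟨b - 1, by omega⟩⟩
      rw [e1]
      simp

/-- At q = q' = n null all invariants equal -(κ·n)², so every spin contributes a number times the
same power. -/
theorem evalAt_dressedSum_null {η : Fin d → ℝ} (ħ : ℝ) (f : ℕ → ℂ) (N j : ℕ) {κ n : Fin d → ℂ}
    (hn : dotVal η n n = 0) : evalAt n n (dressedSum ħ η f N j j κ) =
      (∑ s ∈ Finset.range N, f s * (dressFactor d ħ s j ^ 2 * gegenbauerSum (nu d) s)) *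
        (-conVal κ n ^ 2) ^ j := by
  rw [dressedSum, map_sum, Finset.sum_mul]
  refine Finset.sum_congr rfl fun s _ => ?_
  rw [map_mul, evalAt_C, dressedKernel, map_mul, map_mul, map_pow, map_pow, evalAt_rho,
    evalAt_rho2, evalAt_confKernel_self, hn, mul_zero, zero_sub]
  by_cases h : s ≤ j ∧ Even (j - s)
  · obtain ⟨h1, b, hb⟩ := h
    rw [show (j - s) / 2 = b by omega, show j = b + b + s by omega, pow_add, pow_add]
    ring
  · have : dressFactor d ħ s j = 0 := if_neg h
    rw [this]
    simp

/-- The sum of the terms of rank `(i, j)` with coefficients `V`. -/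
def invSum (η : Fin d → ℝ) (V : (Fin 5 → ℕ) → ℂ) (i j : ℕ) (κ : Fin d → ℂ) : QPoly d :=
  ∑ t ∈ rankTerms i j, C (V t) * invTerm η κ t

/-- The sign of the symmetrized coefficients depends on t₃ + t₄ only, and t₃ + t₄ has the parity of
i + j because the other exponents enter twice. -/
theorem rename_invSum (η : Fin d → ℝ) {V : (Fin 5 → ℕ) → ℂ}
    (hV : ∀ t, V (swapIdx t) = (-1) ^ (t 3 + t 4) * V t) (i j : ℕ) (κ : Fin d → ℂ) :
    MvPolynomial.rename Sum.swap (invSum η V i j κ) = C ((-1) ^ (i + j)) * invSum η V j i κ := by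
  rw [invSum, invSum, map_sum, Finset.mul_sum]
  refine Finset.sum_bij' (fun t _ => swapIdx t) (fun t _ => swapIdx t)
    (fun t ht => swapIdx_mem_rankTerms ht) (fun t ht => swapIdx_mem_rankTerms ht)
    (fun t _ => swapIdx_swapIdx t) (fun t _ => swapIdx_swapIdx t) fun t ht => ?_
  rw [map_mul, MvPolynomial.rename_C, rename_invTerm, hV, ← mul_assoc, ← map_mul]
  congr 2
  rw [mem_rankTerms] at ht
  rw [← mul_assoc, ← pow_add, Even.neg_one_pow, one_mul]
  exact ⟨t 0 + t 1 + t 2 + t 3 + t 4, by omega⟩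

/-- Any factor q², q'² or qq' vanishes on a null diagonal vector, and the rank then forces the
exponents of q∂ and q'∂ to be j. The free constant of the classification is thereby one of the given
functions of □. -/
theorem evalAt_invSum_null {η : Fin d → ℝ} (V : (Fin 5 → ℕ) → ℂ) (j : ℕ) {κ n : Fin d → ℂ}
    (hn : dotVal η n n = 0) : evalAt n n (invSum η V j j κ) =
      V ![0, 0, 0, j, j] * (conVal κ n ^ 2) ^ j := by
  rw [invSum, map_sum, Finset.sum_eq_single ![0, 0, 0, j, j]]
  · rw [map_mul, evalAt_C, invTerm]
    simp only [map_mul, map_pow, evalAt_qd, evalAt_qd2, Matrix.cons_val, pow_zero, map_one]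
    ring
  · intro t ht hne
    rw [map_mul, evalAt_C, invTerm]
    simp only [map_mul, map_pow, evalAt_qq, evalAt_qq2, evalAt_qq12, hn]
    by_cases h : t 0 = 0 ∧ t 1 = 0 ∧ t 2 = 0
    · refine absurd ?_ hne
      rw [mem_rankTerms] at ht
      funext k
      fin_cases k <;> simp <;> omega
    · have : (0 : ℂ) ^ t 0 * 0 ^ t 1 * 0 ^ t 2 = 0 := by
        rw [← pow_add, ← pow_add]
        exact zero_pow (by omega)
      rw [this]
      ring
  · intro h
    refine absurd (mem_rankTerms.mpr ?_) h
    simp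

/-! ### Rigidity of kernels subject to the gauge conditions -/

section Rigidity

variable {η : Fin d → ℝ} {κ e f : Fin d → ℂ} {V : (Fin 5 → ℕ) → ℂ}

theorem invSum_eq_transvTerm (hη : ∀ i, η i = 1 ∨ η i = -1) (hS : boxVal η κ ≠ 0)
    (hV : ∀ t, V (swapIdx t) = (-1) ^ (t 3 + t 4) * V t)
    (htr : ∀ i j, transv η κ (invSum η V i j κ) = 0) (i j : ℕ) :
    invSum η V i j κ = ∑ t ∈ rankTerms i j, C (V t) * transvTerm η κ t := by
  refine eq_sum_transvTerm hη hS _ V (htr i j) ?_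
  have h := rename_invSum η hV i j κ
  rw [invSum] at h
  rw [h, transv_mul, transv_C, htr]
  ring

/-- Transverse terms contain neither q∂ nor q'∂, so their total degree is even. -/
theorem invSum_of_odd (hη : ∀ i, η i = 1 ∨ η i = -1) (hS : boxVal η κ ≠ 0)
    (hV : ∀ t, V (swapIdx t) = (-1) ^ (t 3 + t 4) * V t)
    (htr : ∀ i j, transv η κ (invSum η V i j κ) = 0) {i j : ℕ} (h : ¬ Even (i + j)) :
    invSum η V i j κ = 0 := by
  rw [invSum_eq_transvTerm hη hS hV htr]
  refine Finset.sum_eq_zero fun t ht => ?_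
  rw [mem_rankTerms] at ht
  rw [transvTerm, if_neg, mul_zero]
  exact fun h' => h ⟨t 0 + t 1 + t 2, by omega⟩

theorem IsRadial.invSum (hη : ∀ i, η i = 1 ∨ η i = -1) (hS : boxVal η κ ≠ 0)
    (hV : ∀ t, V (swapIdx t) = (-1) ^ (t 3 + t 4) * V t)
    (htr : ∀ i j, transv η κ (invSum η V i j κ) = 0) (k j : ℕ) :
    IsRadial η κ k j (invSum η V (j + 2 * k) j κ) := by
  rw [invSum_eq_transvTerm hη hS hV htr]
  refine sum _ fun t ht => C_mul ?_ _
  rw [mem_rankTerms] at ht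
  rw [transvTerm]
  split_ifs with h
  · refine C_mul ?_ _
    rw [show t 0 = t 1 + k by omega]
    exact invMon (by omega)
  · exact zero

/-- An invariant kernel that is invariant under the deformed gauge transformations is a sum of
deformed kernels. -/
theorem invSum_eq_dressedSum (hd : 3 ≤ d) (hη : ∀ i, η i = 1 ∨ η i = -1)
    (hgen : IsGeneric η κ e f) (ħ : ℝ) (hV : ∀ t, V (swapIdx t) = (-1) ^ (t 3 + t 4) * V t)
    (htr : ∀ i j, transv η κ (invSum η V i j κ) = 0)
    (hlap : ∀ i j, lap η (invSum η V (i + 2) j κ) =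
      C (-(muRatioSq ħ * boxVal η κ)) * invSum η V i j κ) (N : ℕ) (g : ℕ → ℂ)
    (hg : ∀ j < N, ∑ s ∈ Finset.range N, g s * (dressFactor d ħ s j ^ 2 * gegenbauerSum (nu d) s) =
      (-1) ^ j * V ![0, 0, 0, j, j]) :
    ∀ n < N, ∀ i j, i + j = n → invSum η V i j κ = dressedSum ħ η g N i j κ := by
  have hS := hgen.box_ne_zero
  intro n
  induction n using Nat.strong_induction_on with
  | _ n ih =>
  intro hn
  -- It is enough to treat left rank at least right rank with even difference; the other cases
  -- follow by exchange of q and q' and by parity.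
  have main : ∀ k j, j + 2 * k + j = n →
      invSum η V (j + 2 * k) j κ = dressedSum ħ η g N (j + 2 * k) j κ := by
    intro k j hkj
    have hrad := (IsRadial.invSum hη hS hV htr k j).sub (IsRadial.dressedSum ħ η g N k j κ)
    rw [← sub_eq_zero]
    set D := invSum η V (j + 2 * k) j κ - dressedSum ħ η g N (j + 2 * k) j κ with hD
    have hstep : ∀ i, i + 2 = j + 2 * k → lap η D = 0 := by
      intro i hi
      have h1 := ih (i + j) (by omega) (by omega) i j rfl
      rw [hD, ← hi, sub_eq_add_neg, ← neg_one_mul, ← map_one C, ← map_neg, lap_add, lap_C_mul,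
        hlap, lap_dressedSum hd hη, h1, map_neg C (1 : ℂ), map_one]
      ring
    -- Both kernels obey the same equation relating the Laplacian to lower rank, where they agree by
    -- induction. When the left rank is below two, so that k = 0 and j ≤ 1, nothing lower exists and
    -- harmonicity is automatic.
    have hharm : lap η D = 0 := by
      by_cases h2 : 2 ≤ j + 2 * k
      · exact hstep (j + 2 * k - 2) (by omega)
      · have hk : k = 0 := by omega
        subst hk
        obtain ⟨ψ, hψ⟩ := hrad
        rw [hψ, show j / 2 + 1 = 1 by omega, Finset.sum_range_one, lap_C_mul, lap_invMon hη]
        have hj : (j : ℂ) * (j - 1) = 0 := by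
          rcases (show j = 0 ∨ j = 1 by omega) with rfl | rfl <;> simp
        simp [hj]
    rcases Nat.eq_zero_or_pos k with rfl | hk
    · obtain ⟨c, hc⟩ := radial_harmonic_eq_confKernel hd hη hgen hrad hharm
      -- The remaining multiple of the Gegenbauer kernel is detected at q = q' null, where the
      -- kernel is non-zero and `hg` makes the two sides equal.
      obtain ⟨m, hm, hκm⟩ := hgen.exists_null hη
      have h1 := congrArg (evalAt m m) hc
      rw [hD, mul_zero, add_zero, map_sub, evalAt_invSum_null V j hm,
        evalAt_dressedSum_null ħ g N j hm, hg j (by omega), map_mul, evalAt_C,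
        evalAt_confKernel_self, hm, mul_zero, zero_sub, neg_pow (conVal κ m ^ 2)] at h1
      have hsq : ((-1 : ℂ) ^ j) * (-1) ^ j = 1 := by
        rw [← mul_pow]
        norm_num
      have hc0 : c * (gegenbauerSum (nu d) j * ((-1) ^ j * (conVal κ m ^ 2) ^ j)) = 0 := by
        linear_combination -h1 - (V ![0, 0, 0, j, j] * (conVal κ m ^ 2) ^ j) * hsq
      have hne : (gegenbauerSum (nu d) j * ((-1) ^ j * (conVal κ m ^ 2) ^ j) : ℂ) ≠ 0 := by
        refine mul_ne_zero ?_ (mul_ne_zero (pow_ne_zero _ (by norm_num))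
          (pow_ne_zero _ (pow_ne_zero _ hκm)))
        exact_mod_cast gegenbauerSum_ne_zero (nu_nonneg hd) j
      rw [hc, (mul_eq_zero.mp hc0).resolve_right hne, map_zero, zero_mul]
    · exact radial_harmonic_eq_zero hd hη hgen hk hrad hharm
  intro i j hij
  by_cases hpar : Even (i + j)
  · rcases le_total j i with h | h
    · obtain ⟨k, hk⟩ : ∃ k, i = j + 2 * k := by
        obtain ⟨a, ha⟩ := hpar
        exact ⟨a - j, by omega⟩
      subst hk
      exact main k j hij
    · obtain ⟨k, hk⟩ : ∃ k, j = i + 2 * k := by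
        obtain ⟨a, ha⟩ := hpar
        exact ⟨a - i, by omega⟩
      subst hk
      have h1 := main k i (by omega)
      refine MvPolynomial.rename_injective Sum.swap Sum.swap_leftInverse.injective ?_
      rw [rename_invSum η hV, rename_dressedSum, hpar.neg_one_pow, map_one, one_mul, h1]
  · rw [invSum_of_odd hη hS hV htr hpar, dressedSum_of_odd ħ η g N κ hpar]

end Rigidity

end Classification

end

section

variable {d : ℕ}

/-! ## The wave operator of a gauge invariant quadratic part -/

section GaugeKernel

open MvPolynomial (C X pderiv)

theorem qpoly_ext_sumElim {F G : QPoly d}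
    (h : ∀ α β, F.coeff (Finsupp.sumElim α β) = G.coeff (Finsupp.sumElim α β)) : F = G := by
  ext m
  obtain ⟨α, β, rfl⟩ := exists_sumElim m
  exact h α β

/-- The coefficients are Fourier multipliers. -/
def IsMultiplierPoly (F : Pt d → QPoly d) : Prop := ∀ m, IsMultiplier fun ξ => (F ξ).coeff m

namespace IsMultiplierPoly

variable {F G : Pt d → QPoly d}

theorem add (hF : IsMultiplierPoly F) (hG : IsMultiplierPoly G) :
    IsMultiplierPoly fun ξ => F ξ + G ξ := fun m => by
  simpa only [MvPolynomial.coeff_add] using (hF m).add (hG m)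

theorem sum {ι : Type*} (t : Finset ι) {F : ι → Pt d → QPoly d}
    (hF : ∀ i ∈ t, IsMultiplierPoly (F i)) : IsMultiplierPoly fun ξ => ∑ i ∈ t, F i ξ := fun m => by
  simpa only [MvPolynomial.coeff_sum] using IsMultiplier.sum t fun i hi => hF i hi m

theorem slow_mul (hF : IsMultiplierPoly F) {G : Pt d → ℂ} (hG : IsSlow G) :
    IsMultiplierPoly fun ξ => C (G ξ) * F ξ := fun m => by
  simpa only [MvPolynomial.coeff_C_mul, mul_comm (G _)] using (hF m).mul_slow hG

theorem pderiv (hF : IsMultiplierPoly F) (k : Fin d ⊕ Fin d) :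
    IsMultiplierPoly fun ξ => MvPolynomial.pderiv k (F ξ) := fun m => by
  simpa only [MvPolynomial.coeff_pderiv] using (hF _).mul_slow (IsSlow.const _)

theorem lap (hF : IsMultiplierPoly F) (η : Fin d → ℝ) :
    IsMultiplierPoly fun ξ => lap η (F ξ) :=
  sum _ fun _ _ => ((hF.pderiv _).pderiv _).slow_mul (IsSlow.const _)

theorem transv (hF : IsMultiplierPoly F) (η : Fin d → ℝ) :
    IsMultiplierPoly fun ξ => transv η (dSym ξ) (F ξ) :=
  sum _ fun i _ => (hF.pderiv _).slow_mul ((IsSlow.const _).mul (isSlow_dSym i))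

end IsMultiplierPoly

theorem isMultiplierPoly_invPart {η : Fin d → ℝ} {W : (Fin 5 → ℕ) → ℝ → ℝ}
    (hW : ∀ t, IsTempered η (W t)) (i j : ℕ) : IsMultiplierPoly (invPart η W i j) := fun m => by
  simp only [invPart, MvPolynomial.coeff_sum, MvPolynomial.coeff_C_mul]
  exact IsMultiplier.sum _ fun t _ => (hW t).isMultiplier.mul_coeff (IsPolyDep.invTerm η t) m

theorem isSlow_boxVal (η : Fin d → ℝ) : IsSlow fun ξ : Pt d => boxVal η (dSym ξ) := by
  have := isSlow_eval (d := d) (∑ i, C (η i : ℂ) * X i ^ 2)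
  simpa [boxVal] using this

theorem add_single_inl (α β : Fin d →₀ ℕ) (k : Fin d) :
    Finsupp.sumElim α β + Finsupp.single (Sum.inl k) 1 =
      Finsupp.sumElim (α + Finsupp.single k 1) β := by
  classical
  ext x
  rcases x with x | x <;> simp [Finsupp.single_apply]

theorem IsBihom.coeff_pderiv_eq_zero {i j : ℕ} {F : QPoly d} (hF : IsBihom i j F) (k : Fin d)
    (α β : Fin d →₀ ℕ) (h : α.degree + 1 ≠ i ∨ β.degree ≠ j) :
    (pderiv (Sum.inl k) F).coeff (Finsupp.sumElim α β) = 0 := by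
  rw [MvPolynomial.coeff_pderiv, add_single_inl, hF.coeff_eq_zero _ _ (by simpa using h), zero_mul]

theorem IsBihom.coeff_lap_eq_zero {i j : ℕ} {F : QPoly d} (hF : IsBihom i j F) (η : Fin d → ℝ)
    (α β : Fin d →₀ ℕ) (h : α.degree + 2 ≠ i ∨ β.degree ≠ j) :
    (lap η F).coeff (Finsupp.sumElim α β) = 0 := by
  rw [lap, MvPolynomial.coeff_sum]
  refine Finset.sum_eq_zero fun k _ => ?_
  rw [MvPolynomial.coeff_C_mul, MvPolynomial.coeff_pderiv, add_single_inl,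
    hF.coeff_pderiv_eq_zero k _ _ (by simpa [add_assoc] using h), zero_mul, mul_zero]

theorem IsBihom.coeff_transv_eq_zero {i j : ℕ} {F : QPoly d} (hF : IsBihom i j F)
    (η : Fin d → ℝ) (κ : Fin d → ℂ) (α β : Fin d →₀ ℕ) (h : α.degree + 1 ≠ i ∨ β.degree ≠ j) :
    (transv η κ F).coeff (Finsupp.sumElim α β) = 0 := by
  rw [transv, MvPolynomial.coeff_sum]
  refine Finset.sum_eq_zero fun k _ => ?_
  rw [MvPolynomial.coeff_C_mul, hF.coeff_pderiv_eq_zero k _ _ h, mul_zero]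

/-! ### Symmetrization -/

/-- The coefficients of the transposed wave operator. -/
def swapW (W : (Fin 5 → ℕ) → ℝ → ℝ) : (Fin 5 → ℕ) → ℝ → ℝ := fun t b =>
  (-1) ^ (t 3 + t 4) * W (swapIdx t) b

/-- The coefficients of the symmetric part of the wave operator. -/
def symW (W : (Fin 5 → ℕ) → ℝ → ℝ) : (Fin 5 → ℕ) → ℝ → ℝ := fun t b =>
  1 / 2 * (W t b + swapW W t b)

theorem symW_swapIdx (W : (Fin 5 → ℕ) → ℝ → ℝ) (t : Fin 5 → ℕ) (b : ℝ) :
    symW W (swapIdx t) b = (-1) ^ (t 3 + t 4) * symW W t b := by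
  have h1 : swapIdx t 3 + swapIdx t 4 = t 3 + t 4 := add_comm (t 4) (t 3)
  have h2 : ((-1 : ℝ) ^ (t 3 + t 4)) * (-1) ^ (t 3 + t 4) = 1 := by
    rw [← mul_pow]
    norm_num
  rw [symW, symW, swapW, swapW, swapIdx_swapIdx, h1]
  linear_combination (-1 / 2 * W (swapIdx t) b) * h2

theorem invTerm_neg (η : Fin d → ℝ) (κ : Fin d → ℂ) (t : Fin 5 → ℕ) :
    invTerm η (-κ) t = C ((-1) ^ (t 3 + t 4)) * invTerm η κ t := by
  have h1 := qd_smul (-1) κ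
  have h2 := qd2_smul (-1) κ
  rw [neg_one_smul] at h1 h2
  rw [invTerm, invTerm, h1, h2, map_pow, pow_add, mul_pow, mul_pow]
  ring

theorem rename_invPart_neg (η : Fin d → ℝ) (W : (Fin 5 → ℕ) → ℝ → ℝ) (i j : ℕ) (ξ : Pt d) :
    MvPolynomial.rename Sum.swap (invPart η W j i (-ξ)) = invPart η (swapW W) i j ξ := by
  rw [invPart, invPart, map_sum]
  refine Finset.sum_bij' (fun t _ => swapIdx t) (fun t _ => swapIdx t)
    (fun t ht => swapIdx_mem_rankTerms ht) (fun t ht => swapIdx_mem_rankTerms ht)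
    (fun t _ => swapIdx_swapIdx t) (fun t _ => swapIdx_swapIdx t) fun t _ => ?_
  have h1 : swapIdx t 3 + swapIdx t 4 = t 3 + t 4 := add_comm (t 4) (t 3)
  rw [map_mul, MvPolynomial.rename_C, dSym_neg, invTerm_neg, map_mul, MvPolynomial.rename_C,
    rename_invTerm, boxSym_neg, swapW, swapIdx_swapIdx, h1]
  push_cast
  rw [map_mul C ((-1) ^ _)]
  ring

theorem mapDomain_swap_sumElim (α β : Fin d →₀ ℕ) :
    (Finsupp.sumElim α β).mapDomain Sum.swap = Finsupp.sumElim β α := by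
  ext x
  have h := Finsupp.mapDomain_apply (f := (Sum.swap : Fin d ⊕ Fin d → Fin d ⊕ Fin d))
    Sum.swap_leftInverse.injective (Finsupp.sumElim α β) x.swap
  rw [Sum.swap_swap] at h
  rw [h]
  rcases x with x | x <;> rfl

theorem coeff_invariantOp_neg (η : Fin d → ℝ) (W : (Fin 5 → ℕ) → ℝ → ℝ) (ξ : Pt d)
    (m : Fin d ⊕ Fin d →₀ ℕ) :
    MvPowerSeries.coeff (m.mapDomain Sum.swap) (invariantOp η W (-ξ)) =
      MvPowerSeries.coeff m (invariantOp η (swapW W) ξ) := by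
  obtain ⟨α, β, rfl⟩ := exists_sumElim m
  rw [mapDomain_swap_sumElim, coeff_invariantOp, coeff_invariantOp, ← rename_invPart_neg,
    ← mapDomain_swap_sumElim β α,
    MvPolynomial.coeff_rename_mapDomain _ Sum.swap_leftInverse.injective]

theorem density_invariantOp_neg (η : Fin d → ℝ) (W : (Fin 5 → ℕ) → ℝ → ℝ) (g h : Symb d)
    (ξ : Pt d) :
    density (invariantOp η W) h g (-ξ) = density (invariantOp η (swapW W)) g h ξ := by
  rw [density, pairing_swap, neg_neg, density]
  simp only [coeff_invariantOp_neg]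

theorem density_symW (η : Fin d → ℝ) (W : (Fin 5 → ℕ) → ℝ → ℝ) (g h : Symb d) (ξ : Pt d) :
    density (invariantOp η (symW W)) g h ξ =
      1 / 2 * (density (invariantOp η W) g h ξ + density (invariantOp η W) h g (-ξ)) := by
  rw [density_invariantOp_neg, density_eq, density_eq, density_eq]
  simp only [← Finset.sum_add_distrib, Finset.mul_sum]
  refine Finset.sum_congr rfl fun α _ => Finset.sum_congr rfl fun β _ => ?_
  have h1 : MvPowerSeries.coeff (Finsupp.sumElim α β) (invariantOp η (symW W) ξ) =
      1 / 2 * (MvPowerSeries.coeff (Finsupp.sumElim α β) (invariantOp η W ξ) +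
        MvPowerSeries.coeff (Finsupp.sumElim α β) (invariantOp η (swapW W) ξ)) := by
    rw [coeff_invariantOp', coeff_invariantOp', coeff_invariantOp', ← Finset.sum_add_distrib,
      Finset.mul_sum]
    refine Finset.sum_congr rfl fun t _ => ?_
    rw [symW]
    push_cast
    ring
  rw [h1]
  ring

/-- The functions of `□` that are Fourier multipliers. -/
def temperedSubmodule (η : Fin d → ℝ) : Submodule ℝ (ℝ → ℝ) where
  carrier := {F | IsTempered η F}
  add_mem' := fun {F G} hF hG => isTempered_iff.mpr <| by
    simpa only [Pi.add_apply, Complex.ofReal_add] using hF.isMultiplier.add hG.isMultiplier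
  zero_mem' := isTempered_iff.mpr <| by
    simpa only [Pi.zero_apply, Complex.ofReal_zero] using IsMultiplier.zero (d := d)
  smul_mem' := fun c F hF => isTempered_iff.mpr <| by
    simpa only [Pi.smul_apply, smul_eq_mul, Complex.ofReal_mul] using hF.isMultiplier.const_mul c

theorem symW_mem {p : Submodule ℝ (ℝ → ℝ)} {W : (Fin 5 → ℕ) → ℝ → ℝ} (hW : ∀ t, W t ∈ p)
    (t : Fin 5 → ℕ) : symW W t ∈ p := by
  have : symW W t = (1 / 2 : ℝ) • (W t + ((-1 : ℝ) ^ (t 3 + t 4)) • W (swapIdx t)) := rfl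
  rw [this]
  exact p.smul_mem _ (p.add_mem (hW t) (p.smul_mem _ (hW _)))

theorem isTempered_symW {η : Fin d → ℝ} {W : (Fin 5 → ℕ) → ℝ → ℝ} (hW : ∀ t, IsTempered η (W t))
    (t : Fin 5 → ℕ) : IsTempered η (symW W t) := symW_mem (p := temperedSubmodule η) hW t

/-- Replacing ξ by -ξ in the integral transposes the kernel, with a sign for each factor of q∂ or
q'∂. -/
theorem bilin_symW {η : Fin d → ℝ} {W : (Fin 5 → ℕ) → ℝ → ℝ} (hW : ∀ t, IsTempered η (W t))
    {g h : Symb d} (hg : IsCompSupp g) (hh : IsCompSupp h) :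
    bilin (invariantOp η (symW W)) g h =
      1 / 2 * (bilin (invariantOp η W) g h + bilin (invariantOp η W) h g) := by
  have hP := isMultiplierOp_invariantOp hW
  have h1 : bilin (invariantOp η W) h g = ∫ ξ, density (invariantOp η W) h g (-ξ) := by
    rw [bilin, ← integral_neg_eq_self]
  rw [h1, bilin, bilin, ← integral_add (integrable_density hP hg hh)
    (integrable_density hP hh hg).comp_neg, ← integral_const_mul]
  exact integral_congr_ae (Eventually.of_forall fun ξ => density_symW η W g h ξ)

theorem pairing_invariantOp (η : Fin d → ℝ) (W : (Fin 5 → ℕ) → ℝ → ℝ) (ξ : Pt d) {i j : ℕ}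
    {p q : PPoly d} (hp : p.IsHomogeneous i) (hq : q.IsHomogeneous j) :
    pairing (fun m => MvPowerSeries.coeff m (invariantOp η W ξ)) p q =
      polyPair (invPart η W i j ξ) p q := by
  rw [polyPair, pairing, pairing]
  refine Finset.sum_congr rfl fun α hα => Finset.sum_congr rfl fun β hβ => ?_
  rw [MvPolynomial.mem_support_iff] at hα hβ
  have h1 : α.degree = i := by_contra fun h => hα (hp.coeff_eq_zero h)
  have h2 : β.degree = j := by_contra fun h => hβ (hq.coeff_eq_zero h)
  rw [coeff_invariantOp, h1, h2]

end GaugeKernel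

end

section

variable {d : ℕ}

/-! ### Decoupling of the linearized gauge variations -/

section GaugeConditions

open MvPolynomial (C X pderiv)

/-- Polarization: additivity of the quadratic part on h + δ says that the sum of the two cross terms
vanishes, and that sum is twice the symmetrized form. -/
theorem bilin_symW_gaugeVar {ħ : ℝ} {η : Fin d → ℝ} {A : Symb d → ℝ} (hA : HasExpansion η A)
    (hinv : IsGaugeInvariant ħ η A) (hvac : IsVacuum η A) {W : (Fin 5 → ℕ) → ℝ → ℝ}
    (hW : ∀ t, IsTempered η (W t))
    (hquad : ∀ h, IsRealField h → (quadPart η A h : ℂ) = quadAction (invariantOp η W) h)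
    {w h : Symb d} (hw : IsCompSupp w) (hh : IsRealField h) :
    bilin (invariantOp η (symW W)) (gaugeVar ħ w (vac η)) h = 0 := by
  have hδ : IsRealField (gaugeVar ħ w (vac η)) :=
    ⟨dagger_gaugeVar ħ _ (dagger_vac η), hw.gaugeVar ħ _⟩
  have hP := isMultiplierOp_invariantOp hW
  have h1 := congrArg Complex.ofReal (quadPart_add_gaugeVar hA hinv hvac hw hh)
  rw [Complex.ofReal_add, hquad _ (hh.add hδ), hquad _ hh, hquad _ hδ,
    quadAction_eq_bilin hP (hh.add hδ).2, quadAction_eq_bilin hP hh.2,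
    quadAction_eq_bilin hP hδ.2, bilin_add_left hP hh.2 hδ.2 (hh.add hδ).2,
    bilin_add_right hP hh.2 hh.2 hδ.2, bilin_add_right hP hδ.2 hh.2 hδ.2] at h1
  rw [bilin_symW hW hδ.2 hh.2]
  linear_combination (1 / 2 : ℂ) * h1

theorem isRealField_zero : IsRealField (0 : Symb d) := ⟨dagger_zero, IsCompSupp.zero⟩

/-- The operator `p² + μ²`. -/
def massShell (ħ : ℝ) (η : Fin d → ℝ) (u : Symb d) : Symb d :=
  pSq η * u + (muRatioSq ħ : ℂ) • boxX η u

theorem IsCompSupp.massShell {u : Symb d} (hu : IsCompSupp u) (ħ : ℝ) (η : Fin d → ℝ) :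
    IsCompSupp (massShell ħ η u) := (hu.pSq_mul η).add ((hu.boxX η).smul _)

section

variable {ħ : ℝ} {η : Fin d → ℝ} {A : Symb d → ℝ} {W : (Fin 5 → ℕ) → ℝ → ℝ}

/-- Obtained from a real ω, that is ε = 0, and extended to complex symbols by linearity, since
monomial test symbols with complex coefficients are used below. The gradient counterpart takes ω =
(i/ħ)u. -/
theorem bilin_symW_massShell (hħ : ħ ≠ 0) (hA : HasExpansion η A)
    (hinv : IsGaugeInvariant ħ η A) (hvac : IsVacuum η A) (hW : ∀ t, IsTempered η (W t))
    (hquad : ∀ h, IsRealField h → (quadPart η A h : ℂ) = quadAction (invariantOp η W) h)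
    {u v : Symb d} (hu : IsCompSupp u) (hv : IsCompSupp v) :
    bilin (invariantOp η (symW W)) (massShell ħ η u) v = 0 := by
  refine bilin_eq_zero_of_real (isMultiplierOp_invariantOp (isTempered_symW hW))
    (fun u hu => hu.massShell ħ η) (fun u v => ?_) (fun c u => ?_) (fun u v hu hv => ?_) hu hv
  · simp only [massShell, mul_add, boxX_add, smul_add]
    exact add_add_add_comm _ _ _ _
  · rw [massShell, massShell, boxX_smul, smul_add, mul_smul_comm, smul_comm]
  · have h1 := bilin_symW_gaugeVar hA hinv hvac hW hquad hu.2 hv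
    have h2 := gaugeVar_vac ħ hħ η hu.1 (isRealField_zero (d := d)).1
    rw [smul_zero, add_zero] at h2
    have h3 : deformedGauge ħ η u 0 = (-2 : ℂ) • massShell ħ η u := by
      have h4 : pGrad η (0 : Symb d) = 0 := by
        have := pGrad_smul η 0 (0 : Symb d)
        rwa [zero_smul, zero_smul] at this
      have h5 : (muRatioSq ħ : ℂ) = -(ħ ^ 2 / 4) := by
        rw [muRatioSq]
        push_cast
        ring
      rw [deformedGauge, massShell, h4, h5, smul_zero]
      module
    rw [h2, h3, bilin_smul_left] at h1
    exact (mul_eq_zero.mp h1).resolve_left (by norm_num)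

theorem bilin_symW_pGrad (hħ : ħ ≠ 0) (hA : HasExpansion η A)
    (hinv : IsGaugeInvariant ħ η A) (hvac : IsVacuum η A) (hW : ∀ t, IsTempered η (W t))
    (hquad : ∀ h, IsRealField h → (quadPart η A h : ℂ) = quadAction (invariantOp η W) h)
    {u v : Symb d} (hu : IsCompSupp u) (hv : IsCompSupp v) :
    bilin (invariantOp η (symW W)) (pGrad η u) v = 0 := by
  refine bilin_eq_zero_of_real (isMultiplierOp_invariantOp (isTempered_symW hW))
    (fun u hu => hu.pGrad η) (pGrad_add η) (pGrad_smul η) (fun u v hu hv => ?_) hu hv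
  have h1 := bilin_symW_gaugeVar hA hinv hvac hW hquad (hu.2.smul (Complex.I / ħ)) hv
  have h2 := gaugeVar_vac ħ hħ η (isRealField_zero (d := d)).1 hu.1
  rw [zero_add] at h2
  have h3 : deformedGauge ħ η 0 u = (-2 : ℂ) • pGrad η u := by
    have h4 : boxX η (0 : Symb d) = 0 := by
      have := boxX_smul η 0 (0 : Symb d)
      rwa [zero_smul, zero_smul] at this
    rw [deformedGauge, h4, mul_zero, smul_zero, add_zero, smul_zero]
    module
  rw [h2, h3, bilin_smul_left] at h1
  exact (mul_eq_zero.mp h1).resolve_left (by norm_num)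

end

/-! ### The conditions on the kernel -/

theorem isHomogeneous_monomial (α : Fin d →₀ ℕ) (a : ℂ) :
    (MvPolynomial.monomial α a : PPoly d).IsHomogeneous α.degree :=
  MvPolynomial.isHomogeneous_monomial a rfl

theorem IsHomogeneous.smul' {p : PPoly d} {n : ℕ} (hp : p.IsHomogeneous n) (c : ℂ) :
    (c • p).IsHomogeneous n := by
  rw [MvPolynomial.smul_eq_C_mul]
  simpa using (MvPolynomial.isHomogeneous_C (Fin d) c).mul hp

theorem isHomogeneous_pSqHat (η : Fin d → ℝ) {p : PPoly d} {n : ℕ} (hp : p.IsHomogeneous n) :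
    (pSqHat η p).IsHomogeneous (n + 2) := by
  refine MvPolynomial.IsHomogeneous.sum _ _ _ fun i _ => IsHomogeneous.smul' ?_ _
  have := (MvPolynomial.isHomogeneous_X ℂ i).mul ((MvPolynomial.isHomogeneous_X ℂ i).mul hp)
  rwa [show 1 + (1 + n) = n + 2 by ring] at this

theorem isHomogeneous_gradHat (η : Fin d → ℝ) (κ : Fin d → ℂ) {p : PPoly d} {n : ℕ}
    (hp : p.IsHomogeneous n) : (gradHat η κ p).IsHomogeneous (n + 1) := by
  refine MvPolynomial.IsHomogeneous.sum _ _ _ fun i _ => IsHomogeneous.smul' ?_ _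
  have := (MvPolynomial.isHomogeneous_X ℂ i).mul hp
  rwa [add_comm] at this

theorem gradHat_neg (η : Fin d → ℝ) (κ : Fin d → ℂ) (p : PPoly d) :
    gradHat η (-κ) p = (-1 : ℂ) • gradHat η κ p := by
  rw [gradHat, gradHat, Finset.smul_sum]
  exact Finset.sum_congr rfl fun i _ => by
    rw [smul_smul, Pi.neg_apply]
    congr 1
    ring

theorem multiFact_mul_ne_zero (α β : Fin d →₀ ℕ) : multiFact α * multiFact β ≠ 0 :=
  mul_ne_zero (multiFact_ne_zero α) (multiFact_ne_zero β)

section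

variable {ħ : ℝ} {η : Fin d → ℝ} {V : (Fin 5 → ℕ) → ℝ → ℝ}

/-- The combination of kernels that vanishes if `(p² + μ²) a` decouples. -/
def shellPart (ħ : ℝ) (η : Fin d → ℝ) (V : (Fin 5 → ℕ) → ℝ → ℝ) (i j : ℕ) (ξ : Pt d) : QPoly d :=
  lap η (invPart η V (i + 2) j ξ) +
    C ((muRatioSq ħ : ℂ) * boxVal η (dSym ξ)) * invPart η V i j ξ

theorem density_massShell (f g : smoothFn d) (hf : HasCompactSupport (val f)) (α β : Fin d →₀ ℕ)
    (ξ : Pt d) :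
    density (invariantOp η V) (massShell ħ η (MvPolynomial.monomial α f))
        (MvPolynomial.monomial β g) ξ = (multiFact α * multiFact β) *
      ((shellPart ħ η V α.degree β.degree ξ).coeff (Finsupp.sumElim α β) *
        (𝓕 (val f) (-ξ) * 𝓕 (val g) ξ)) := by
  have hs := isCompSupp_monomial hf α
  have hα := isHomogeneous_monomial α (𝓕 (val f) (-ξ))
  have hβ := isHomogeneous_monomial β (𝓕 (val g) ξ)
  have hbox : boxVal η (dSym (-ξ)) = boxVal η (dSym ξ) := by
    rw [boxVal_dSym, boxVal_dSym, boxSym_neg]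
  rw [density, massShell, hat_add (hs.pSq_mul η) ((hs.boxX η).smul _), hat_pSq_mul η hs, hat_smul,
    hat_boxX η hs, hat_monomial, hat_monomial, pairing_add_left, pairing_smul_left,
    pairing_smul_left, pairing_invariantOp η V ξ (isHomogeneous_pSqHat η hα) hβ,
    pairing_invariantOp η V ξ hα hβ, polyPair_pSqHat, hbox, ← mul_assoc, ← polyPair_C_mul,
    ← polyPair_add, polyPair, pairing_monomial, shellPart]
  ring

theorem density_pGrad (f g : smoothFn d) (hf : HasCompactSupport (val f)) (α β : Fin d →₀ ℕ)
    (ξ : Pt d) :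
    density (invariantOp η V) (pGrad η (MvPolynomial.monomial α f))
        (MvPolynomial.monomial β g) ξ = -(multiFact α * multiFact β) *
      ((transv η (dSym ξ) (invPart η V (α.degree + 1) β.degree ξ)).coeff (Finsupp.sumElim α β) *
        (𝓕 (val f) (-ξ) * 𝓕 (val g) ξ)) := by
  have hs := isCompSupp_monomial hf α
  have hα := isHomogeneous_monomial α (𝓕 (val f) (-ξ))
  have hβ := isHomogeneous_monomial β (𝓕 (val g) ξ)
  rw [density, hat_pGrad η hs, dSym_neg, gradHat_neg, hat_monomial, hat_monomial,
    pairing_smul_left, pairing_invariantOp η V ξ (isHomogeneous_gradHat η _ hα) hβ,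
    polyPair_gradHat, polyPair, pairing_monomial]
  ring

/-- Test symbols f(x)p^α and g(x)p^β isolate a single coefficient of the combination, which is a
multiplier and therefore zero almost everywhere. There are countably many pairs (α, β), so one null
set serves for all; coefficients of other degrees vanish by homogeneity. -/
theorem ae_shellPart_eq_zero (hV : ∀ t, IsTempered η (V t))
    (h : ∀ u v, IsCompSupp u → IsCompSupp v →
      bilin (invariantOp η V) (massShell ħ η u) v = 0) :
    ∀ᵐ ξ, ∀ i j, shellPart ħ η V i j ξ = 0 := by
  have key : ∀ᵐ ξ, ∀ α β : Fin d →₀ ℕ,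
      (shellPart ħ η V α.degree β.degree ξ).coeff (Finsupp.sumElim α β) = 0 := by
    rw [ae_all_iff]
    intro α
    rw [ae_all_iff]
    intro β
    have hk : IsMultiplierPoly (shellPart ħ η V α.degree β.degree) :=
      ((isMultiplierPoly_invPart hV _ _).lap η).add
        ((isMultiplierPoly_invPart hV _ _).slow_mul ((IsSlow.const _).mul (isSlow_boxVal η)))
    refine (hk _).ae_eq_zero fun f g hf hg => ?_
    have h1 := h _ _ (isCompSupp_monomial hf α) (isCompSupp_monomial hg β)
    rw [bilin, funext (density_massShell f g hf α β), integral_const_mul] at h1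
    exact (mul_eq_zero.mp h1).resolve_left (multiFact_mul_ne_zero α β)
  filter_upwards [key] with ξ hξ i j
  refine qpoly_ext_sumElim fun α β => ?_
  rw [MvPolynomial.coeff_zero]
  by_cases hij : α.degree = i ∧ β.degree = j
  · rw [← hij.1, ← hij.2, hξ]
  · rw [shellPart, MvPolynomial.coeff_add, MvPolynomial.coeff_C_mul,
      (IsBihom.invPart η V (i + 2) j ξ).coeff_lap_eq_zero η α β (by
        rw [ne_eq, ne_eq, add_left_inj]
        tauto),
      (IsBihom.invPart η V i j ξ).coeff_eq_zero α β (by tauto)]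
    ring

theorem ae_transv_eq_zero (hV : ∀ t, IsTempered η (V t))
    (h : ∀ u v, IsCompSupp u → IsCompSupp v →
      bilin (invariantOp η V) (pGrad η u) v = 0) :
    ∀ᵐ ξ, ∀ i j, transv η (dSym ξ) (invPart η V i j ξ) = 0 := by
  have key : ∀ᵐ ξ, ∀ α β : Fin d →₀ ℕ,
      (transv η (dSym ξ) (invPart η V (α.degree + 1) β.degree ξ)).coeff
        (Finsupp.sumElim α β) = 0 := by
    rw [ae_all_iff]
    intro α
    rw [ae_all_iff]
    intro β
    have hk := (isMultiplierPoly_invPart hV (α.degree + 1) β.degree).transv η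
    refine (hk _).ae_eq_zero fun f g hf hg => ?_
    have h1 := h _ _ (isCompSupp_monomial hf α) (isCompSupp_monomial hg β)
    rw [bilin, funext (density_pGrad f g hf α β), integral_const_mul] at h1
    exact (mul_eq_zero.mp h1).resolve_left (neg_ne_zero.mpr (multiFact_mul_ne_zero α β))
  filter_upwards [key] with ξ hξ i j
  refine qpoly_ext_sumElim fun α β => ?_
  rw [MvPolynomial.coeff_zero]
  by_cases hij : α.degree + 1 = i ∧ β.degree = j
  · rw [← hij.1, ← hij.2, hξ]
  · exact (IsBihom.invPart η V i j ξ).coeff_transv_eq_zero η _ α β (by tauto)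

end

/-! ### Generic frequencies -/

/-- By Fubini it suffices to look at lines in the direction `i`. There the form is a polynomial
whose coefficient in degree 2 is `c i`, so it has finitely many zeros. -/
theorem ae_sum_mul_sq_ne_zero (c : Fin d → ℝ) {i : Fin d} (hc : c i ≠ 0) :
    ∀ᵐ ξ : Pt d, ∑ k, c k * ξ k ^ 2 ≠ 0 := by
  classical
  let L : ℝ →ₗ[ℝ] Pt d := LinearMap.toSpanSingleton ℝ (Pt d) (EuclideanSpace.single i 1)
  have hcont : Continuous fun ξ : Pt d => ∑ k, c k * ξ k ^ 2 := by fun_prop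
  refine ae_mem_of_ae_add_linearMap_mem L volume volume
    (s := {ξ : Pt d | ∑ k, c k * ξ k ^ 2 ≠ 0})
    (hcont.measurable (measurableSet_singleton 0).compl) fun y => ?_
  let p : Polynomial ℝ := ∑ k, Polynomial.C (c k) *
    (Polynomial.C (y k) + Polynomial.C (if k = i then 1 else 0) * Polynomial.X) ^ 2
  have heval : ∀ x, p.eval x = ∑ k, c k * (y + L x) k ^ 2 := fun x => by
    rw [Polynomial.eval_finsetSum]
    refine Finset.sum_congr rfl fun k _ => ?_
    by_cases hk : k = i <;> simp [L, hk]
  have hp : p ≠ 0 := by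
    intro h0
    have h1 : p.coeff 2 = c i := by
      rw [Polynomial.finsetSum_coeff, Finset.sum_eq_single i]
      · have e : (Polynomial.C (y i) + Polynomial.C 1 * Polynomial.X) ^ 2 =
            Polynomial.X ^ 2 + Polynomial.C (2 * y i) * Polynomial.X + Polynomial.C (y i ^ 2) := by
          rw [map_mul, map_pow, map_one, Polynomial.C_ofNat]
          ring
        rw [if_pos rfl, Polynomial.coeff_C_mul, e, Polynomial.coeff_add, Polynomial.coeff_add,
          Polynomial.coeff_C_mul, Polynomial.coeff_X_pow, Polynomial.coeff_X, Polynomial.coeff_C]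
        norm_num
      · intro k _ hk
        rw [if_neg hk, map_zero, zero_mul, add_zero, ← map_pow, ← map_mul, Polynomial.coeff_C]
        simp
      · simp
    rw [h0, Polynomial.coeff_zero] at h1
    exact hc h1.symm
  have hfin : {x | p.eval x = 0}.Finite := by
    refine (p.roots.toFinset.finite_toSet).subset fun x hx => ?_
    simpa [hp] using hx
  rw [ae_iff]
  refine measure_mono_null (fun x hx => ?_) (hfin.measure_zero volume)
  simp only [Set.mem_ofPred_eq, not_not] at hx ⊢
  rw [heval, hx]

theorem sum_mul_dSym_sq (c : Fin d → ℝ) (ξ : Pt d) : ∑ k, (c k : ℂ) * dSym ξ k ^ 2 =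
    ((-(4 * Real.pi ^ 2) * ∑ k, c k * ξ k ^ 2 : ℝ) : ℂ) := by
  push_cast
  rw [Finset.mul_sum]
  refine Finset.sum_congr rfl fun k _ => ?_
  rw [dSym]
  linear_combination (c k * (4 * Real.pi ^ 2 * ξ k ^ 2) : ℂ) * Complex.I_sq

theorem ae_sum_mul_dSym_sq_ne_zero (c : Fin d → ℝ) {i : Fin d} (hc : c i ≠ 0) :
    ∀ᵐ ξ : Pt d, ∑ k, (c k : ℂ) * dSym ξ k ^ 2 ≠ 0 := by
  filter_upwards [ae_sum_mul_sq_ne_zero c hc] with ξ hξ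
  rw [sum_mul_dSym_sq]
  have := Real.pi_pos
  exact_mod_cast mul_ne_zero (neg_ne_zero.mpr (by positivity)) hξ

/-- Three quadrics have to be avoided, given by □ and by its restrictions to the first two and the
first three coordinates; each of them is a null set. -/
theorem ae_exists_isGeneric (hd : 3 ≤ d) {η : Fin d → ℝ} (hη : ∀ i, η i = 1 ∨ η i = -1) :
    ∀ᵐ ξ : Pt d, ∃ e f, IsGeneric η (dSym ξ) e f := by
  classical
  have hne : ∀ i, η i ≠ 0 := fun i => by rcases hη i with h | h <;> rw [h] <;> norm_num
  let i₀ : Fin d := ⟨0, by omega⟩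
  let i₁ : Fin d := ⟨1, by omega⟩
  let i₂ : Fin d := ⟨2, by omega⟩
  have h01 : i₀ ≠ i₁ := by simp [i₀, i₁]
  have h02 : i₀ ≠ i₂ := by simp [i₀, i₂]
  have h12 : i₁ ≠ i₂ := by simp [i₁, i₂]
  have hS := ae_sum_mul_dSym_sq_ne_zero η (hne i₀)
  have hS2 := ae_sum_mul_dSym_sq_ne_zero (fun k => if k ∈ ({i₀, i₁} : Finset (Fin d)) then η k else 0)
    (i := i₀) (by simpa using hne i₀)
  have hS3 := ae_sum_mul_dSym_sq_ne_zero
    (fun k => if k ∈ ({i₀, i₁, i₂} : Finset (Fin d)) then η k else 0)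
    (i := i₀) (by simpa using hne i₀)
  filter_upwards [hS, hS2, hS3] with ξ g1 g2 g3
  have hif : ∀ (t : Finset (Fin d)), ∑ k, ((if k ∈ t then η k else 0 : ℝ) : ℂ) * dSym ξ k ^ 2 =
      ∑ k ∈ t, (η k : ℂ) * dSym ξ k ^ 2 := fun t => by
    rw [← Finset.sum_subset (Finset.subset_univ t)]
    · exact Finset.sum_congr rfl fun k hk => by rw [if_pos hk]
    · intro k _ hk
      rw [if_neg hk]
      simp
  rw [hif, Finset.sum_pair h01] at g2
  rw [hif, Finset.sum_insert (by simp [h01, h02]), Finset.sum_pair h12, ← add_assoc] at g3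
  exact exists_isGeneric hη h01 h02 h12 g1 g2 g3

end GaugeConditions

end

section

variable {d : ℕ}

/-! ## The decomposition of the quadratic part -/

section Decomposition

open MvPolynomial (C X pderiv)

/-- The solution of a triangular system of linear equations. -/
def triangularSolution (c : ℕ → ℕ → ℝ) (V : ℕ → ℝ → ℝ) : ℕ → ℝ → ℝ
  | j => (c j j)⁻¹ • (V j - ∑ s : Fin j, c s j • triangularSolution c V s)
  decreasing_by exact s.2

theorem sum_triangularSolution (c : ℕ → ℕ → ℝ) (V : ℕ → ℝ → ℝ) {j : ℕ} (h : c j j ≠ 0) :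
    ∑ s ∈ Finset.range (j + 1), c s j • triangularSolution c V s = V j := by
  rw [Finset.sum_range_succ, ← Fin.sum_univ_eq_sum_range (fun s => c s j • triangularSolution c V s),
    triangularSolution.eq_1 c V j, smul_smul, mul_inv_cancel₀ h, one_smul]
  exact add_sub_cancel _ _

/-- The matrix of the system is constant, so the solution stays in any real subspace that contains
the right-hand sides. The tempered functions and the polynomials are the two cases needed. -/
theorem triangularSolution_mem (c : ℕ → ℕ → ℝ) {V : ℕ → ℝ → ℝ} {p : Submodule ℝ (ℝ → ℝ)}
    (hV : ∀ j, V j ∈ p) (j : ℕ) : triangularSolution c V j ∈ p := by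
  induction j using Nat.strong_induction_on with
  | _ j ih =>
    rw [triangularSolution]
    exact p.smul_mem _ (p.sub_mem (hV j) (p.sum_mem fun s _ => p.smul_mem _ (ih s s.2)))

/-- The factor `f_s(□)` of the wave operator of spin `s` in the quadratic part. -/
def waveFactor (d : ℕ) (ħ : ℝ) (W : (Fin 5 → ℕ) → ℝ → ℝ) : ℕ → ℝ → ℝ :=
  triangularSolution (fun s j => dressFactor d ħ s j ^ 2 * gegenbauerSum (nu d) s)
    fun j => ((-1 : ℝ) ^ j) • symW W ![0, 0, 0, j, j]

theorem waveFactor_mem {p : Submodule ℝ (ℝ → ℝ)} (ħ : ℝ) {W : (Fin 5 → ℕ) → ℝ → ℝ}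
    (hW : ∀ t, W t ∈ p) (s : ℕ) : waveFactor d ħ W s ∈ p :=
  triangularSolution_mem _ (fun _ => p.smul_mem _ (symW_mem hW _)) s

theorem isTempered_waveFactor {η : Fin d → ℝ} (ħ : ℝ) {W : (Fin 5 → ℕ) → ℝ → ℝ}
    (hW : ∀ t, IsTempered η (W t)) (s : ℕ) : IsTempered η (waveFactor d ħ W s) :=
  waveFactor_mem (p := temperedSubmodule η) ħ hW s

theorem exists_polynomial_waveFactor (d : ℕ) (ħ : ℝ) {W : (Fin 5 → ℕ) → ℝ → ℝ}
    (hW : ∀ t, ∃ p : Polynomial ℝ, ∀ b, W t b = p.eval b) (s : ℕ) :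
    ∃ p : Polynomial ℝ, ∀ b, waveFactor d ħ W s b = p.eval b := by
  -- Polynomial functions form the range of a linear map, a subspace to which `waveFactor_mem`
  -- applies.
  let L : Polynomial ℝ →ₗ[ℝ] (ℝ → ℝ) := LinearMap.pi fun b => Polynomial.leval b
  have h := waveFactor_mem (d := d) (p := LinearMap.range L) ħ (W := W) (fun t => by
    obtain ⟨p, hp⟩ := hW t
    exact ⟨p, funext fun b => (hp b).symm⟩) s
  obtain ⟨p, hp⟩ := h
  exact ⟨p, fun b => (congrFun hp b).symm⟩

/-- The dressing factor vanishes for s > j, so the sum up to `N` is the j-th row of the triangular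
system; the diagonal is non-zero by the Bessel and Gegenbauer normalizations. -/
theorem sum_waveFactor (hd : 3 ≤ d) (ħ : ℝ) (W : (Fin 5 → ℕ) → ℝ → ℝ) (b : ℝ) {j N : ℕ}
    (hj : j < N) : ∑ s ∈ Finset.range N, (waveFactor d ħ W s b : ℂ) *
      (dressFactor d ħ s j ^ 2 * gegenbauerSum (nu d) s) =
        (-1) ^ j * (symW W ![0, 0, 0, j, j] b : ℂ) := by
  have hc : dressFactor d ħ j j ^ 2 * gegenbauerSum (nu d) j ≠ 0 :=
    mul_ne_zero (pow_ne_zero _ (dressFactor_self_ne_zero hd ħ j))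
      (gegenbauerSum_ne_zero (nu_nonneg hd) j)
  have h := congrFun (sum_triangularSolution
    (fun s j => dressFactor d ħ s j ^ 2 * gegenbauerSum (nu d) s)
    (fun j => ((-1 : ℝ) ^ j) • symW W ![0, 0, 0, j, j]) hc) b
  rw [Finset.sum_apply] at h
  have h' := congrArg Complex.ofReal h
  simp only [Pi.smul_apply, smul_eq_mul] at h'
  push_cast at h'
  rw [← h', ← Finset.sum_subset (Finset.range_subset_range.mpr (show j + 1 ≤ N by omega))]
  · refine Finset.sum_congr rfl fun s _ => ?_
    rw [waveFactor]
    ring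
  · intro s _ hs
    rw [Finset.mem_range] at hs
    rw [dressFactor_of_lt d ħ (show j < s by omega)]
    simp

section

variable {ħ : ℝ} {η : Fin d → ℝ} {W : (Fin 5 → ℕ) → ℝ → ℝ}

/-- A gauge invariant invariant wave operator is a sum of deformed wave operators. -/
theorem ae_invPart_eq_dressedSum (hd : 3 ≤ d) (hη : ∀ i, η i = 1 ∨ η i = -1)
    (hW : ∀ t, IsTempered η (W t))
    (hshell : ∀ u v, IsCompSupp u → IsCompSupp v →
      bilin (invariantOp η (symW W)) (massShell ħ η u) v = 0)
    (hgrad : ∀ u v, IsCompSupp u → IsCompSupp v →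
      bilin (invariantOp η (symW W)) (pGrad η u) v = 0) :
    ∀ᵐ ξ : Pt d, ∀ N i j, i + j < N → invPart η (symW W) i j ξ =
      dressedSum ħ η (fun s => (waveFactor d ħ W s (boxSym η ξ) : ℂ)) N i j (dSym ξ) := by
  filter_upwards [ae_exists_isGeneric hd hη, ae_shellPart_eq_zero (isTempered_symW hW) hshell,
    ae_transv_eq_zero (isTempered_symW hW) hgrad] with ξ hgen h1 h2 N i j hN
  obtain ⟨e, f, hgen⟩ := hgen
  refine invSum_eq_dressedSum (V := fun t => (symW W t (boxSym η ξ) : ℂ)) hd hη hgen ħ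
    (fun t => ?_) h2 (fun i j => ?_) N _ (fun j hj => sum_waveFactor hd ħ W _ hj) (i + j) hN i j rfl
  · rw [symW_swapIdx]
    push_cast
    rfl
  · have h3 := h1 i j
    rw [shellPart] at h3
    change lap η (invPart η (symW W) (i + 2) j ξ) = _ * invPart η (symW W) i j ξ
    rw [map_neg]
    linear_combination h3

theorem ae_density_eq_sum (hd : 3 ≤ d) (hη : ∀ i, η i = 1 ∨ η i = -1)
    (hW : ∀ t, IsTempered η (W t))
    (hshell : ∀ u v, IsCompSupp u → IsCompSupp v →
      bilin (invariantOp η (symW W)) (massShell ħ η u) v = 0)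
    (hgrad : ∀ u v, IsCompSupp u → IsCompSupp v →
      bilin (invariantOp η (symW W)) (pGrad η u) v = 0) (h : Symb d) :
    ∀ᵐ ξ : Pt d, density (invariantOp η (symW W)) h h ξ =
      ∑ s ∈ Finset.range (h.totalDegree + 1),
        density (scaleOp η (waveFactor d ħ W s) (deformedOp ħ η s)) h h ξ := by
  filter_upwards [ae_invPart_eq_dressedSum hd hη hW hshell hgrad] with ξ hξ
  simp only [density_eq]
  symm
  rw [Finset.sum_comm]
  refine Finset.sum_congr rfl fun α hα => ?_
  rw [Finset.sum_comm]
  refine Finset.sum_congr rfl fun β hβ => ?_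
  have hα' : α.degree ≤ h.totalDegree := MvPolynomial.le_totalDegree hα
  have hβ' : β.degree ≤ h.totalDegree := MvPolynomial.le_totalDegree hβ
  rw [← Finset.mul_sum, ← Finset.sum_mul]
  congr 2
  symm
  -- The kernel identity is used up to total degree twice that of `h`. The spins above the degree of
  -- `h` drop out because their dressing factors vanish on every rank occurring in `h`.
  rw [coeff_invariantOp, hξ (h.totalDegree + h.totalDegree + 1) _ _ (by omega), dressedSum,
    MvPolynomial.coeff_sum, ← Finset.sum_subset (Finset.range_subset_range.mpr
      (show h.totalDegree + 1 ≤ h.totalDegree + h.totalDegree + 1 by omega))]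
  · refine Finset.sum_congr rfl fun s _ => ?_
    rw [MvPolynomial.coeff_C_mul, coeff_scaleOp, coeff_deformedOp]
    push_cast
    ring
  · intro s _ hs
    rw [Finset.mem_range] at hs
    rw [dressFactor_of_lt d ħ (show α.degree < s by omega)]
    simp

theorem quadAction_eq_sum_deformedAction (hd : 3 ≤ d) (hη : ∀ i, η i = 1 ∨ η i = -1)
    (hW : ∀ t, IsTempered η (W t))
    (hshell : ∀ u v, IsCompSupp u → IsCompSupp v →
      bilin (invariantOp η (symW W)) (massShell ħ η u) v = 0)
    (hgrad : ∀ u v, IsCompSupp u → IsCompSupp v →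
      bilin (invariantOp η (symW W)) (pGrad η u) v = 0) {h : Symb d} (hh : IsCompSupp h) :
    quadAction (invariantOp η W) h =
      ∑ s ∈ Finset.range (h.totalDegree + 1), deformedAction ħ η s (waveFactor d ħ W s) h := by
  have hf := isTempered_waveFactor (d := d) ħ hW
  have h1 : bilin (invariantOp η (symW W)) h h = bilin (invariantOp η W) h h := by
    rw [bilin_symW hW hh hh]
    ring
  rw [quadAction_eq_bilin (isMultiplierOp_invariantOp hW) hh, ← h1, bilin,
    integral_congr_ae (ae_density_eq_sum hd hη hW hshell hgrad h), integral_finsetSum]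
  · refine Finset.sum_congr rfl fun s _ => ?_
    rw [deformedAction, quadAction_eq_bilin (isMultiplierOp_deformed (hf s) ħ s) hh, bilin]
  · exact fun s _ => integrable_density (isMultiplierOp_deformed (hf s) ħ s) hh hh

end

/-! ### Gauge invariance of the deformed and of the conformal actions -/

theorem IsCompSupp.rank {f : Symb d} (hf : IsCompSupp f) (s : ℕ) : IsCompSupp (rank s f) :=
  (isNice_rank s).compSupp (rank_zero s) hf

theorem undress_add (ħ : ℝ) (η : Fin d → ℝ) (f g : Symb d) :
    undress ħ η (f + g) = undress ħ η f + undress ħ η g := by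
  rw [undress_eq, undress_eq, undress_eq, ladder_add]

theorem IsRealField.undress {f : Symb d} (hf : IsRealField f) (ħ : ℝ) (η : Fin d → ℝ) :
    IsRealField (undress ħ η f) := by
  rw [undress_eq]
  exact hf.ladder _ _

theorem IsRealField.reconstruct {f : Symb d} (hf : IsRealField f) (ħ : ℝ) (η : Fin d → ℝ) :
    IsRealField (reconstruct ħ η f) := by
  rw [reconstruct_eq]
  exact hf.ladder _ _

theorem isLocal_undress (ħ : ℝ) (η : Fin d → ℝ) : IsLocal (undress (d := d) ħ η) := by
  rw [funext (undress_eq ħ η)]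
  exact (isNice_ladder η _).isLocal

theorem isLocal_reconstruct (ħ : ℝ) (η : Fin d → ℝ) : IsLocal (reconstruct (d := d) ħ η) := by
  rw [funext (reconstruct_eq ħ η)]
  exact (isNice_ladder η _).isLocal

theorem IsRealField.deformedGauge {a ε : Symb d} (ha : IsRealField a) (hε : IsRealField ε) (ħ : ℝ)
    (hħ : ħ ≠ 0) (η : Fin d → ℝ) : IsRealField (deformedGauge ħ η a ε) := by
  rw [← gaugeVar_vac ħ hħ η ha.1 hε.1]
  exact ⟨dagger_gaugeVar ħ _ (dagger_vac η), (ha.2.add (hε.2.smul _)).gaugeVar ħ _⟩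

theorem bilin_conf_plainGauge (hd : 3 ≤ d) {η : Fin d → ℝ} (hη : ∀ i, η i = 1 ∨ η i = -1)
    {f : ℝ → ℝ} (hf : IsTempered η f) (s : ℕ) {a ε g : Symb d} (ha : IsCompSupp a)
    (hε : IsCompSupp ε) (hg : IsCompSupp g) :
    bilin (scaleOp η f (confOp η s)) (plainGauge η a ε) g = 0 := by
  have e : plainGauge η a ε = (-2 : ℂ) • (pSq η * a) + (-2 : ℂ) • pGrad η ε := by
    rw [plainGauge]
    module
  rw [e, bilin_add_left (isMultiplierOp_conf hf s) ((ha.pSq_mul η).smul _) ((hε.pGrad η).smul _) hg,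
    bilin_smul_left, bilin_smul_left, bilin_conf_pSq hd hη f s ha, bilin_conf_pGrad hη f s hε]
  ring

theorem IsCompSupp.plainGauge {a ε : Symb d} (ha : IsCompSupp a) (hε : IsCompSupp ε)
    (η : Fin d → ℝ) : IsCompSupp (plainGauge η a ε) :=
  ((ha.pSq_mul η).smul _).sub ((hε.pGrad η).smul _)

/-- The deformed actions are invariant under the deformed gauge transformations. -/
theorem deformedAction_add_deformedGauge (hd : 3 ≤ d) {η : Fin d → ℝ}
    (hη : ∀ i, η i = 1 ∨ η i = -1) {ħ : ℝ} (hħ : ħ ≠ 0) {f : ℝ → ℝ} (hf : IsTempered η f) (s : ℕ)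
    {h a ε : Symb d} (hh : IsRealField h) (ha : IsRealField a) (hε : IsRealField ε) :
    deformedAction ħ η s f (h + deformedGauge ħ η a ε) = deformedAction ħ η s f h := by
  have hδ := ha.deformedGauge hε ħ hħ η
  have hu := hh.undress ħ η
  have hu' := (hh.add hδ).undress ħ η
  have ha' : IsCompSupp (ladder η (besselLadder (nu d + 2) (muRatioSq ħ)) a) := (ha.ladder η _).2
  have hε' := (ha.undressedVector hε ħ η).2
  rw [deformedAction_eq ħ hf s (hh.add hδ).2 (hu'.2.rank s),
    deformedAction_eq ħ hf s hh.2 (hu.2.rank s), confAction_rank hf s hu'.2 (hu'.2.rank s),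
    confAction_rank hf s hu.2 (hu.2.rank s), undress_add, undress_deformedGauge hd hη]
  exact confAction_add_of_kernel hf s hu.2 (ha'.plainGauge hε' η) fun g hg =>
    bilin_conf_plainGauge hd hη hf s ha' hε' hg

/-- The value of the coefficients of a symbol at a point. -/
def atPoint (x : Pt d) : smoothFn d →+* ℂ :=
  (Pi.evalRingHom (fun _ : Pt d => ℂ) x).comp (smoothFn d).val.toRingHom

theorem atPoint_apply (x : Pt d) (f : smoothFn d) : atPoint x f = val f x := rfl

theorem map_pSq_ne_zero (hd : 0 < d) {η : Fin d → ℝ} (hη : ∀ i, η i = 1 ∨ η i = -1) (x : Pt d) :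
    MvPolynomial.map (atPoint x) (pSq η) ≠ 0 := by
  classical
  intro h
  let i : Fin d := ⟨0, hd⟩
  have h1 := congrArg (MvPolynomial.eval (Pi.single i 1)) h
  have hC : ∀ c : ℂ, atPoint x (algebraMap ℂ (smoothFn d) c) = c := fun c => rfl
  rw [pSq, map_sum, map_sum, map_zero, Finset.sum_eq_single i] at h1
  · rw [Algebra.smul_def, MvPolynomial.algebraMap_apply, map_mul, map_mul, MvPolynomial.map_C, hC,
      map_mul (MvPolynomial.map (atPoint x)), MvPolynomial.map_X, MvPolynomial.eval_C, map_mul,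
      MvPolynomial.eval_X, Pi.single_eq_same, mul_one, mul_one] at h1
    rcases hη i with h2 | h2 <;> rw [h2] at h1 <;> norm_num at h1
  · intro j _ hj
    rw [Algebra.smul_def, map_mul, map_mul, map_mul (MvPolynomial.map (atPoint x)),
      MvPolynomial.map_X, map_mul,      MvPolynomial.eval_X, Pi.single_eq_of_ne hj, mul_zero, mul_zero]
  · simp

/-- At each point the coefficients give polynomials over a field, where p² is not a zero divisor; so
χ vanishes wherever p²χ does. This is needed because the definition of a traceless part puts no
support condition on χ. -/
theorem IsCompSupp.of_pSq_mul (hd : 0 < d) {η : Fin d → ℝ} (hη : ∀ i, η i = 1 ∨ η i = -1)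
    {χ : Symb d} (h : IsCompSupp (pSq η * χ)) : IsCompSupp χ := by
  intro α
  refine HasCompactSupport.intro
    (K := ⋃ β ∈ (pSq η * χ).support, tsupport (val ((pSq η * χ).coeff β)))
    ((pSq η * χ).support.isCompact_biUnion fun β _ => h β) fun x hx => ?_
  have h1 : MvPolynomial.map (atPoint x) (pSq η * χ) = 0 := by
    ext β
    rw [MvPolynomial.coeff_map, MvPolynomial.coeff_zero, atPoint_apply]
    by_cases hβ : β ∈ (pSq η * χ).support
    · refine image_eq_zero_of_notMem_tsupport fun hmem => hx ?_
      exact Set.mem_biUnion hβ hmem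
    · rw [MvPolynomial.notMem_support_iff.mp hβ]
      rfl
  rw [map_mul] at h1
  have h2 := (mul_eq_zero.mp h1).resolve_left (map_pSq_ne_zero hd hη x)
  have h3 := congrArg (MvPolynomial.coeff α) h2
  rwa [MvPolynomial.coeff_map, MvPolynomial.coeff_zero, atPoint_apply] at h3

theorem confAction_eq_of_isTracelessPart (hd : 3 ≤ d) {η : Fin d → ℝ}
    (hη : ∀ i, η i = 1 ∨ η i = -1) {f : ℝ → ℝ} (hf : IsTempered η f) (s : ℕ) {φ g : Symb d}
    (hφ : IsCompSupp φ) (hg : IsCompSupp g) (h : IsTracelessPart η φ g) :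
    confAction η s f φ = confAction η s f g := by
  obtain ⟨-, χ, hχ⟩ := h
  have h1 : IsCompSupp (pSq η * χ) := by
    have h2 : pSq η * χ = φ + (-1 : ℂ) • g := by
      rw [hχ]
      module
    rw [h2]
    exact hφ.add (hg.smul _)
  have h3 := h1.of_pSq_mul (by omega) hη
  rw [hχ]
  exact confAction_add_of_kernel hf s hg h1 fun g _ => bilin_conf_pSq hd hη f s h3 g

theorem isConformalTheory_confAction (hd : 3 ≤ d) {η : Fin d → ℝ}
    (hη : ∀ i, η i = 1 ∨ η i = -1) {f : ℝ → ℝ} (hf : IsTempered η f) (s : ℕ) :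
    IsConformalTheory η s (confAction η s f) where
  action := ⟨confKernel η s, f, isConformalKernel_confKernel hd hη s, hf, rfl⟩
  traceless φ g hφ hg _ _ h := confAction_eq_of_isTracelessPart hd hη hf s hφ.2 hg.2 h
  gauge _ φ ε g hφ hε hg _ _ _ _ h := by
    obtain ⟨-, χ, hχ⟩ := h
    have h1 : IsCompSupp (pSq η * χ) := by
      have h2 : pSq η * χ = pGrad η ε + (-1 : ℂ) • g := by
        rw [hχ]
        module
      rw [h2]
      exact (hε.2.pGrad η).add (hg.2.smul _)
    have h3 := h1.of_pSq_mul (by omega) hη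
    have hP := isMultiplierOp_conf hf s
    -- The gradient and the trace part p²χ both lie in the kernel of the bilinear form, hence so
    -- does their difference, the traceless part of the gradient.
    refine confAction_add_of_kernel hf s hφ.2 hg.2 fun k hk => ?_
    have h4 := bilin_conf_pGrad hη f s hε.2 k
    rwa [hχ, bilin_add_left hP hg.2 h1 hk, bilin_conf_pSq hd hη f s h3, add_zero] at h4

theorem tracelessPart_isHomogeneous (η : Fin d → ℝ) (s : ℕ) (f : Symb d) :
    (tracelessPart η s f).IsHomogeneous s := by
  rw [← rank_tracelessPart]
  exact rank_isHomogeneous s _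

theorem IsRealField.tracelessPart {f : Symb d} (hf : IsRealField f) (η : Fin d → ℝ) (s : ℕ) :
    IsRealField (tracelessPart η s f) :=
  (isNice_tracelessPart η s).realField (by
    have h : ∀ j, (trP η)^[j] (0 : Symb d) = 0 := fun j =>
      Function.iterate_fixed (by simp [trP, dP]) j
    simp [ConformalHS.tracelessPart, h]) hf

end Decomposition

end

end ConformalHS

end

/-! ### The quadratic part as a sum of conformal higher-spin theories -/

theorem mainTheorem2 {d : ℕ} (hd : 3 ≤ d) (η : Fin d → ℝ) (hη : ∀ i, η i = 1 ∨ η i = -1)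
    (ħ : ℝ) (hħ : ħ ≠ 0) (A : Symb d → ℝ) (hA : HasExpansion η A)
    (hinv : IsGaugeInvariant ħ η A) (hvac : IsVacuum η A)
    (W : (Fin 5 → ℕ) → ℝ → ℝ) (hW : ∀ t, IsTempered η (W t))
    (hquad : ∀ h, IsRealField h → (quadPart η A h : ℂ) = quadAction (invariantOp η W) h) :
    -- the linearized gauge transformations are those of the deformed theories
    (∀ a ε : Symb d, dagger a = a → dagger ε = ε →
      gaugeVar ħ (a + (Complex.I / ħ) • ε) (vac η) = deformedGauge ħ η a ε) ∧
    -- the undressing and reconstruction maps are local, preserve fields, and are mutually inverse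
    IsLocal (undress (d := d) ħ η) ∧ IsLocal (reconstruct (d := d) ħ η) ∧
    (∀ h : Symb d, IsRealField h → IsRealField (undress ħ η h)) ∧
    (∀ φ : Symb d, IsRealField φ → IsRealField (reconstruct ħ η φ)) ∧
    (∀ h : Symb d, reconstruct ħ η (undress ħ η h) = h) ∧
    (∀ φ : Symb d, undress ħ η (reconstruct ħ η φ) = φ) ∧
    -- they exchange the deformed and the undeformed gauge transformations
    (∀ a ε : Symb d, IsRealField a → IsRealField ε → ∃ a' ε', IsRealField a' ∧ IsRealField ε' ∧
      undress ħ η (deformedGauge ħ η a ε) = plainGauge η a' ε') ∧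
    (∀ a' ε' : Symb d, IsRealField a' → IsRealField ε' → ∃ a ε, IsRealField a ∧ IsRealField ε ∧
      reconstruct ħ η (plainGauge η a' ε') = deformedGauge ħ η a ε) ∧
    ∃ f : ℕ → ℝ → ℝ, (∀ s, IsTempered η (f s)) ∧
      -- if the quadratic part is a local functional, the factors are polynomials in the wave
      -- operator
      ((∀ t, ∃ p : Polynomial ℝ, ∀ b, W t b = p.eval b) →
        ∀ s, ∃ p : Polynomial ℝ, ∀ b, f s b = p.eval b) ∧
      -- the quadratic part is a sum of deformed theories
      (∀ s h a ε, IsRealField h → IsRealField a → IsRealField ε →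
        deformedAction ħ η s (f s) (h + deformedGauge ħ η a ε) = deformedAction ħ η s (f s) h) ∧
      (∀ h, IsRealField h → (quadPart η A h : ℂ) =
        ∑ s ∈ Finset.range (h.totalDegree + 1), deformedAction ħ η s (f s) h) ∧
      -- undressing turns each of them into a conformal higher spin theory
      (∀ s, IsConformalKernel η s (confKernel η s)) ∧
      (∀ s, IsConformalTheory η s (confAction η s (f s))) ∧
      (∀ s h, IsRealField h →
        deformedAction ħ η s (f s) h = confAction η s (f s) (rank s (undress ħ η h))) ∧
      -- so that the quadratic part is a sum of conformal theories of the traceless undressed fields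
      (∀ h, IsRealField h → ∃ φ : ℕ → Symb d,
        (∀ s, IsRealField (φ s) ∧ (φ s).IsHomogeneous s ∧
          IsTracelessPart η (rank s (undress ħ η h)) (φ s)) ∧
        (quadPart η A h : ℂ) =
          ∑ s ∈ Finset.range (h.totalDegree + 1), confAction η s (f s) (φ s)) := by
  have hf := isTempered_waveFactor (d := d) (η := η) ħ hW
  have hsum : ∀ h, IsRealField h → (quadPart η A h : ℂ) =
      ∑ s ∈ Finset.range (h.totalDegree + 1), deformedAction ħ η s (waveFactor d ħ W s) h :=
    fun h hh => by
      rw [hquad h hh]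
      exact quadAction_eq_sum_deformedAction hd hη hW
        (fun u v hu hv => bilin_symW_massShell hħ hA hinv hvac hW hquad hu hv)
        (fun u v hu hv => bilin_symW_pGrad hħ hA hinv hvac hW hquad hu hv) hh.2
  have hundress : ∀ s h, IsRealField h → deformedAction ħ η s (waveFactor d ħ W s) h =
      confAction η s (waveFactor d ħ W s) (rank s (undress ħ η h)) := fun s h hh =>
    deformedAction_eq ħ (hf s) s hh.2 ((hh.undress ħ η).2.rank s)
  refine ⟨fun a ε ha hε => gaugeVar_vac ħ hħ η ha hε, isLocal_undress ħ η, isLocal_reconstruct ħ η,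
    fun h hh => hh.undress ħ η, fun φ hφ => hφ.reconstruct ħ η, reconstruct_undress hd ħ η,
    undress_reconstruct hd ħ η,
    fun a ε ha hε => ⟨_, _, ha.ladder _ _, ha.undressedVector hε ħ η,
      undress_deformedGauge hd hη ħ a ε⟩,
    fun a' ε' ha hε => exists_reconstruct_plainGauge hd hη ħ ha hε,
    waveFactor d ħ W, hf, fun hp s => exists_polynomial_waveFactor d ħ hp s,
    fun s h a ε hh ha hε => deformedAction_add_deformedGauge hd hη hħ (hf s) s hh ha hε, hsum,
    isConformalKernel_confKernel hd hη, fun s => isConformalTheory_confAction hd hη (hf s) s,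
    hundress, fun h hh => ⟨fun s => tracelessPart η s (undress ħ η h), fun s => ⟨?_, ?_, ?_⟩, ?_⟩⟩
  · exact (hh.undress ħ η).tracelessPart η s
  · exact tracelessPart_isHomogeneous η s _
  · exact isTracelessPart_tracelessPart hd hη s _
  · rw [hsum h hh]
    refine Finset.sum_congr rfl fun s _ => ?_
    rw [hundress s h hh]
    exact confAction_eq_of_isTracelessPart hd hη (hf s) s ((hh.undress ħ η).2.rank s)
      ((hh.undress ħ η).tracelessPart η s).2 (isTracelessPart_tracelessPart hd hη s _)
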